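/- Let $\Omega=(0,1)^3$ and $p\in[\frac53,2)$. Let $\mathcal D u=\frac12(\nabla u+(\nabla u)^T)$, with the Frobenius norm on tensors; all norms $\|\cdot\|_q$ are over $\Omega$. For $q\ge1$ let $J^{1,q}(\Omega)$ be the closure, in the norm of $W^{1,q}(\Omega)$, of the smooth divergence-free vector fields $\mathbb R^3\to\mathbb R^3$ that have period $1$ in each coordinate and zero mean over $\Omega$. The system considered is the space-periodic $p$-Navier–Stokes system $$v_t+\operatorname{div}(v\otimes v)-\operatorname{div}\big(|\mathcal D v|^{p-2}\mathcal D v\big)+\nabla\pi=f,\qquad \operatorname{div}v=0 .$$ A field $v$ is called a solution on $(0,T)$ with force $f$ and initial datum $v_0$ if (i) $v\in C([0,T];J^{1,2}(\Omega))$, $\nabla^2v\in L^2(0,T;L^{4/(4-p)}(\Omega))$ (where $\nabla^2 v$ is the weak second gradient of the space-periodic field $v$), and $v_t\in L^2((0,T)\times\Omega)$; (ii) for a.e. $t\in(0,T)$ and all $\omega\in J^{1,p}(\Omega)$, $$(v_t,\omega)+(v\cdot\nabla v,\omega)+\big(|\mathcal D v|^{p-2}\mathcal D v,\mathcal D\omega\big)=(f,\omega),$$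 where $(\cdot,\cdot)$ is integration of the pointwise scalar product over $\Omega$ and $|A|^{p-2}A:=0$ for $A=0$; (iii) $\lim_{t\to0^+}\|v(t)-v_0\|_2=0$. Theorem. For each such $p$ there is a constant $C_S>0$, depending only on $p$ (and on $\Omega$), with the following property. Let $C_K>0$ be any constant for Korn's inequality $\|\nabla u\|_{4/(4-p)}\le C_K\|\mathcal D u\|_{4/(4-p)}$ on smooth space-periodic vector fields $u$, and let $\Lambda$, $K$ be real numbers with $$\Lambda<\min\Big\{\Big(\frac{p}{8C_S}\Big)^{\frac2{3-p}},\ \Big(\frac{3^{\frac{2-p}2}C_SC_K}{2}\Big)^{-\frac2{3-p}},\ \big(C_S^{-1}C_K^{-1}3^{\frac{p-2}2}(p-1)\big)^{\frac2{3-p}}\Big\},\qquad C_SK^22^{2-p}\le\frac{p(p-1)}8\Lambda^{p-1}.$$ If $f\in L^\infty(0,\infty;L^{4/p}(\Omega))$ satisfies $\operatorname{ess\,sup}_{t>0}\|f(t)\|_{4/p}\le K$ and $v_0\in J^{1,2}(\Omega)$ satisfies $\|\nabla v_0\|_2^2<\Lambda$, then there is a field $v$ on $(0,\infty)\times\Omega$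 which, for every $T>0$, is a solution on $(0,T)$ with force $f$ and initial datum $v_0$ and satisfies $$\sup_{t\in[0,T]}\|\nabla v(t)\|_2^2\le\Lambda .$$ -/

import Mathlib

open MeasureTheory Set Filter Topology
open scoped ENNReal ContDiff

namespace PNavierStokes

noncomputable section

/-- Points of space and values of vector fields. -/
abbrev E3 := EuclideanSpace ℝ (Fin 3)

/-- Second order tensors `A i j`, with the Frobenius norm and inner product. -/
abbrev Mat3 := EuclideanSpace ℝ (Fin 3 × Fin 3)

/-- Third order tensors `A i j k`, with the Euclidean norm. -/
abbrev Ten3 := EuclideanSpace ℝ (Fin 3 × Fin 3 × Fin 3)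

/-- The cube `Ω = (0,1)³`. -/
def cube : Set E3 := {x | ∀ i, x i ∈ Ioo (0 : ℝ) 1}

/-- Lebesgue measure on the cube. -/
abbrev volΩ : Measure E3 := volume.restrict cube

/-- The Lebesgue space `L^q(Ω; F)`. -/
abbrev LΩ (F : Type) [NormedAddCommGroup F] (q : ℝ≥0∞) := Lp F q volΩ

/-- The exponent `p`, where `5/3 ≤ p < 2`. -/
def expP (p : Ico (5 / 3 : ℝ) 2) : ℝ≥0∞ := ENNReal.ofReal (p : ℝ)

/-- The exponent `4/p`. -/
def expForce (p : Ico (5 / 3 : ℝ) 2) : ℝ≥0∞ := ENNReal.ofReal (4 / (p : ℝ))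

/-- The exponent `4/(4-p)`. -/
def expHess (p : Ico (5 / 3 : ℝ) 2) : ℝ≥0∞ := ENNReal.ofReal (4 / (4 - (p : ℝ)))

instance (p : Ico (5 / 3 : ℝ) 2) : Fact (1 ≤ expP p) :=
  ⟨by
    have h := p.2.1
    rw [expP, ENNReal.one_le_ofReal]
    linarith⟩

instance (p : Ico (5 / 3 : ℝ) 2) : Fact (1 ≤ expForce p) :=
  ⟨by
    have h := p.2.1
    have h' := p.2.2
    rw [expForce, ENNReal.one_le_ofReal, le_div_iff₀ (by linarith)]
    linarith⟩

instance (p : Ico (5 / 3 : ℝ) 2) : Fact (1 ≤ expHess p) :=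
  ⟨by
    have h := p.2.1
    have h' := p.2.2
    rw [expHess, ENNReal.one_le_ofReal, le_div_iff₀ (by linarith)]
    linarith⟩

/-- Periodicity with period `1` in each coordinate direction. -/
def IsPeriodic {F : Type} (φ : E3 → F) : Prop :=
  ∀ (i : Fin 3) (x : E3), φ (x + EuclideanSpace.single i 1) = φ x

/-- The classical partial derivative `∂ⱼ φ` of a scalar function. -/
def pderiv (j : Fin 3) (φ : E3 → ℝ) (x : E3) : ℝ :=
  fderiv ℝ φ x (EuclideanSpace.single j 1)

/-- The classical gradient of a vector field, `(∇φ) (i, j) = ∂ⱼ φᵢ`. -/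
def grad (φ : E3 → E3) (x : E3) : Mat3 :=
  WithLp.toLp 2 fun ij => pderiv ij.2 (fun y => φ y ij.1) x

/-- The smooth periodic divergence-free vector fields with zero mean. -/
structure IsSolenoidalTest (φ : E3 → E3) : Prop where
  smooth : ContDiff ℝ ∞ φ
  periodic : IsPeriodic φ
  mean_zero : ∫ x in cube, φ x = 0
  div_free : ∀ x, ∑ i, grad φ x (i, i) = 0

/-- The space `J^{1,q}(Ω)`, the closure of the smooth periodic divergence-free zero-mean fields in
the `W^{1,q}` norm. An element is recorded as the pair `(u, ∇u)` of the field and its weak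
gradient; the pair is determined by `u`. -/
def J1 (q : ℝ≥0∞) [Fact (1 ≤ q)] : Set (LΩ E3 q × LΩ Mat3 q) :=
  closure {U | ∃ φ : E3 → E3, IsSolenoidalTest φ ∧ U.1 =ᵐ[volΩ] φ ∧ U.2 =ᵐ[volΩ] grad φ}

/-- The symmetric part of a second order tensor; `𝒟v` is `sym (∇v)`. -/
def sym (A : Mat3) : Mat3 :=
  WithLp.toLp 2 fun ij => (A (ij.1, ij.2) + A (ij.2, ij.1)) / 2

/-- The stress `S(A) = |A|^{p-2} A`, with `S(0) = 0`. -/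
def stress (p : ℝ) (A : Mat3) : Mat3 := ‖A‖ ^ (p - 2) • A

/-- The convective term: for `G = ∇u`, the vector `u · ∇u` with components `∑ⱼ uⱼ ∂ⱼ uᵢ`. -/
def convect (u : E3) (G : Mat3) : E3 :=
  WithLp.toLp 2 fun i => ∑ j, u j * G (i, j)

/-- `H` is the weak (distributional, on periodic functions) gradient of the tensor field `G`:
`H (i, j, k) = ∂ₖ G (i, j)`. With `G = ∇v` this says `H = ∇²v`. -/
def IsWeakGradOfTensor (G : E3 → Mat3) (H : E3 → Ten3) : Prop :=
  ∀ φ : E3 → ℝ, ContDiff ℝ ∞ φ → IsPeriodic φ → ∀ i j k : Fin 3,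
    ∫ x in cube, G x (i, j) * pderiv k φ x = -∫ x in cube, H x (i, j, k) * φ x

/-- `w` is the weak time derivative of `v` on `(0,T)`, as functions with values in `L²(Ω)`. -/
def IsWeakTimeDeriv (T : ℝ) (v w : ℝ → LΩ E3 2) : Prop :=
  ∀ η : ℝ → ℝ, ContDiff ℝ ∞ η → HasCompactSupport η → tsupport η ⊆ Ioo 0 T →
    ∫ t in Ioo 0 T, deriv η t • v t = -∫ t in Ioo 0 T, η t • w t

/-- `v = (v(t), ∇v(t))` is a regular solution on `(0,T)` of the space-periodic `p`-Navier–Stokes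
system with force `f` and initial datum `v₀`. -/
structure IsRegularSolution (p : Ico (5 / 3 : ℝ) 2) (T : ℝ) (f : ℝ → LΩ E3 (expForce p))
    (v₀ : LΩ E3 2) (v : ℝ → LΩ E3 2 × LΩ Mat3 2) : Prop where
  /-- `v ∈ C([0,T]; J^{1,2}(Ω))` -/
  mem : ∀ t ∈ Icc 0 T, v t ∈ J1 2
  cont : ContinuousOn v (Icc 0 T)
  /-- `∇²v ∈ L²(0,T; L^{4/(4-p)}(Ω))` -/
  hess : ∃ H : ℝ → LΩ Ten3 (expHess p), MemLp H 2 (volume.restrict (Ioo 0 T)) ∧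
    ∀ᵐ t ∂volume.restrict (Ioo 0 T), IsWeakGradOfTensor (v t).2 (H t)
  /-- `v_t ∈ L²((0,T) × Ω)`, and the weak form of the system -/
  weak_form : ∃ vt : ℝ → LΩ E3 2, MemLp vt 2 (volume.restrict (Ioo 0 T)) ∧
    IsWeakTimeDeriv T (fun t => (v t).1) vt ∧
    ∀ᵐ t ∂volume.restrict (Ioo 0 T), ∀ W ∈ J1 (expP p),
      (∫ x in cube, inner ℝ (vt t x) (W.1 x)) +
        (∫ x in cube, inner ℝ (convect ((v t).1 x) ((v t).2 x)) (W.1 x)) +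
        (∫ x in cube, inner ℝ (stress p (sym ((v t).2 x))) (sym (W.2 x))) =
      ∫ x in cube, inner ℝ (f t x) (W.1 x)
  /-- the initial condition -/
  initial : Tendsto (fun t => ‖(v t).1 - v₀‖) (𝓝[>] 0) (𝓝 0)

/-- `C` is a constant for Korn's inequality `‖∇u‖_q ≤ C ‖𝒟u‖_q` on periodic fields. -/
def IsKornConstant (q : ℝ≥0∞) (C : ℝ) : Prop :=
  0 < C ∧ ∀ u : E3 → E3, ContDiff ℝ ∞ u → IsPeriodic u →
    eLpNorm (grad u) q volΩ ≤ ENNReal.ofReal C * eLpNorm (fun x => sym (grad u x)) q volΩ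

end

end PNavierStokes

open MeasureTheory Set Filter Topology
open scoped ENNReal ContDiff

namespace PNavierStokes

noncomputable section

set_option linter.unusedSectionVars false
set_option linter.style.haveILetI false

/-- Lebesgue measure on `(0,T)`. -/
local notation "vol[" T "]" => Measure.restrict (volume : Measure ℝ) (Ioo (0 : ℝ) T)

section Periodic

/-- The box `∏ (aᵢ, aᵢ + 1]`. -/
def boxAt (a : E3) : Set E3 := {x | ∀ i, x i ∈ Ioc (a i) (a i + 1)}

theorem isOpen_cube : IsOpen cube := by
  have : cube = ⋂ i, (fun x : E3 => x i) ⁻¹' Ioo 0 1 := by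
    ext x; simp [cube]
  rw [this]
  exact isOpen_iInter_of_finite fun i =>
    isOpen_Ioo.preimage (EuclideanSpace.proj (𝕜 := ℝ) i).continuous

theorem measurableSet_cube : MeasurableSet cube := isOpen_cube.measurableSet

theorem boxAt_ae_eq_cube : boxAt 0 =ᵐ[volume] cube := by
  have h := (EuclideanSpace.volume_preserving_symm_measurableEquiv_toLp (Fin 3))
  have h1 : boxAt 0 = (MeasurableEquiv.toLp 2 (Fin 3 → ℝ)).symm ⁻¹' (Set.pi univ fun _ => Ioc (0:ℝ) 1) := by
    ext x; simp [boxAt, Set.mem_pi]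
  have h2 : cube = (MeasurableEquiv.toLp 2 (Fin 3 → ℝ)).symm ⁻¹' (Set.pi univ fun _ => Ioo (0:ℝ) 1) := by
    ext x; simp [cube, Set.mem_pi]
  rw [h1, h2]
  apply h.quasiMeasurePreserving.preimage_ae_eq
  exact (Measure.univ_pi_Ioc_ae_eq_Icc).trans (Measure.univ_pi_Ioo_ae_eq_Icc).symm

instance : IsProbabilityMeasure volΩ := by
  constructor
  have h := (EuclideanSpace.volume_preserving_symm_measurableEquiv_toLp (Fin 3))
  have h2 : cube = (MeasurableEquiv.toLp 2 (Fin 3 → ℝ)).symm ⁻¹' (Set.pi univ fun _ => Ioo (0:ℝ) 1) := by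
    ext x; simp [cube, Set.mem_pi]
  rw [Measure.restrict_apply_univ, h2, h.measure_preimage_equiv, volume_pi_pi]
  simp

theorem IsPeriodic.add_int {F : Type} {f : E3 → F} (hf : IsPeriodic f) (z : Fin 3 → ℤ) (x : E3) :
    f (x + WithLp.toLp 2 fun i => (z i : ℝ)) = f x := by
  have hp : ∀ i, Function.Periodic f (z i • EuclideanSpace.single i (1:ℝ)) := fun i =>
    Function.Periodic.zsmul (fun y => hf i y) (z i)
  have : (WithLp.toLp 2 fun i => (z i : ℝ)) =
      z 0 • EuclideanSpace.single (0 : Fin 3) (1:ℝ) + z 1 • EuclideanSpace.single (1 : Fin 3) (1:ℝ)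
        + z 2 • EuclideanSpace.single (2 : Fin 3) (1:ℝ) := by
    ext i; fin_cases i <;> simp
  rw [this]
  exact ((hp 0).add_period (hp 1)).add_period (hp 2) x

/-- The representative in `[0,1)³` modulo `ℤ³`. -/
def fractPt (x : E3) : E3 := WithLp.toLp 2 fun i => Int.fract (x i)

theorem IsPeriodic.fractPt {F : Type} {f : E3 → F} (hf : IsPeriodic f) (x : E3) : f (fractPt x) = f x := by
  rw [← hf.add_int (fun i => ⌊x i⌋) (PNavierStokes.fractPt x)]
  congr 1
  ext i; simp [PNavierStokes.fractPt, Int.fract_add_floor]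

theorem measurable_fractPt : Measurable fractPt := by
  apply (MeasurableEquiv.toLp 2 (Fin 3 → ℝ)).measurable.comp
  refine measurable_pi_lambda _ fun i => ?_
  exact measurable_fract.comp (EuclideanSpace.proj (𝕜 := ℝ) i).continuous.measurable

theorem isPeriodic_comp_fractPt {F : Type} (f : E3 → F) : IsPeriodic fun x => f (fractPt x) := by
  intro i x
  show f (fractPt _) = f (fractPt x)
  congr 1
  ext j
  rcases eq_or_ne j i with rfl | h
  · simp [fractPt]
  · simp [fractPt, h]

theorem IsPeriodic.comp_add {F : Type} {f : E3 → F} (hf : IsPeriodic f) (y : E3) : IsPeriodic fun x => f (x + y) := by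
  intro i x
  show f _ = f _
  rw [add_right_comm, hf]

theorem lintegral_boxAt {f : E3 → ℝ≥0∞} (hf : IsPeriodic f) (a b : E3) :
    ∫⁻ x in boxAt a, f x = ∫⁻ x in boxAt b, f x := by
  let g : UnitAddTorus (Fin 3) → ℝ≥0∞ := fun t =>
    f (WithLp.toLp 2 fun i => (AddCircle.equivIco (1:ℝ) 0 (t i) : ℝ))
  have hg : ∀ x : E3, g (fun i => (x i : UnitAddCircle)) = f x := by
    intro x
    rw [← hf.fractPt x]
    show f _ = f _
    congr 1
    ext i
    simp only [fractPt]
    rw [AddCircle.coe_equivIco_mk_apply]; simp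
  have key : ∀ c : E3, ∫⁻ x in boxAt c, f x = ∫⁻ (x : Fin 3 → ℝ) in {x : Fin 3 → ℝ | ∀ i, x i ∈ Ioc (c i) (c i + 1)},
        g (fun i => x i) := by
    intro c
    have h := (EuclideanSpace.volume_preserving_symm_measurableEquiv_toLp (Fin 3))
    have := h.setLIntegral_comp_preimage_emb (MeasurableEquiv.measurableEmbedding _)
      (fun x : Fin 3 → ℝ => g (fun i => x i)) {x : Fin 3 → ℝ | ∀ i, x i ∈ Ioc (c i) (c i + 1)}
    rw [← this]
    refine lintegral_congr fun x => (hg x).symm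
  rw [key a, key b, ← UnitAddTorus.lintegral_preimage g a, ← UnitAddTorus.lintegral_preimage g b]

theorem lintegral_boxAt_eq_cube {f : E3 → ℝ≥0∞} (hf : IsPeriodic f) (a : E3) :
    ∫⁻ x in boxAt a, f x = ∫⁻ x in cube, f x := by
  rw [lintegral_boxAt hf a 0, setLIntegral_congr boxAt_ae_eq_cube]

theorem lintegral_cube_comp_add {f : E3 → ℝ≥0∞} (hf : IsPeriodic f) (y : E3) :
    ∫⁻ x in cube, f (x + y) = ∫⁻ x in cube, f x := by
  rw [← lintegral_boxAt_eq_cube (hf.comp_add y) 0, ← lintegral_boxAt_eq_cube hf y]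
  have h : MeasurePreserving (fun x : E3 => x + y) volume volume := measurePreserving_add_right _ y
  have := h.setLIntegral_comp_preimage_emb (measurableEmbedding_addRight y) f (boxAt y)
  rw [← this]
  congr 2
  ext x
  simp only [boxAt, mem_preimage, PiLp.add_apply, mem_ofPred_eq, mem_Ioc, PiLp.zero_apply]
  refine forall_congr' fun i => ?_
  constructor <;> rintro ⟨h1, h2⟩ <;> constructor <;> linarith

/-- Translation by `y` on the cube modulo `ℤ³`. -/
def shift (y x : E3) : E3 := fractPt (x + y)

theorem IsPeriodic.shift {F : Type} {f : E3 → F} (hf : IsPeriodic f) (y x : E3) :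
    f (shift y x) = f (x + y) := hf.fractPt _

theorem fractPt_ae_eq : ∀ᵐ x ∂volΩ, fractPt x = x := by
  filter_upwards [ae_restrict_mem measurableSet_cube] with x hx
  ext i
  exact Int.fract_eq_self.2 ⟨(hx i).1.le, (hx i).2⟩

theorem measurePreserving_shift (y : E3) : MeasurePreserving (shift y) volΩ volΩ := by
  have hm : Measurable (shift y) := measurable_fractPt.comp (measurable_id.add_const y)
  refine ⟨hm, ?_⟩
  ext s hs
  rw [Measure.map_apply hm hs, ← lintegral_indicator_one hs, ← lintegral_indicator_one (hm hs)]
  have hp := isPeriodic_comp_fractPt (s.indicator (1 : E3 → ℝ≥0∞))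
  calc ∫⁻ x in cube, (shift y ⁻¹' s).indicator (1 : E3 → ℝ≥0∞) x
      = ∫⁻ x in cube, s.indicator (1 : E3 → ℝ≥0∞) (fractPt (x + y)) := by
        exact lintegral_congr fun x => rfl
    _ = ∫⁻ x in cube, s.indicator (1 : E3 → ℝ≥0∞) (fractPt x) := lintegral_cube_comp_add hp y
    _ = _ := by
        refine lintegral_congr_ae ?_
        filter_upwards [fractPt_ae_eq] with x hx
        rw [hx]

variable {F : Type} [NormedAddCommGroup F]

theorem eLpNorm_comp_add {g : E3 → F} (hg : IsPeriodic g) (hm : AEStronglyMeasurable g volΩ)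
    (q : ℝ≥0∞) (y : E3) : eLpNorm (fun x => g (x + y)) q volΩ = eLpNorm g q volΩ := by
  rw [← eLpNorm_comp_measurePreserving hm (measurePreserving_shift y)]
  congr 1
  ext x
  exact (hg.shift y x).symm

theorem integral_comp_add [NormedSpace ℝ F] {g : E3 → F} (hg : IsPeriodic g)
    (hm : AEStronglyMeasurable g volΩ) (y : E3) :
    ∫ x in cube, g (x + y) = ∫ x in cube, g x := by
  have h := measurePreserving_shift y
  have := integral_map h.measurable.aemeasurable (f := g) (by rwa [h.map_eq])
  rw [h.map_eq] at this
  rw [this]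
  exact integral_congr_ae (ae_of_all _ fun x => (hg.shift y x).symm)

end Periodic

section Smooth

variable {F : Type} [NormedAddCommGroup F] [NormedSpace ℝ F]

/-- Smooth periodic functions. -/
structure SP (g : E3 → F) : Prop where
  smooth : ContDiff ℝ ∞ g
  periodic : IsPeriodic g

/-- The partial derivative in the direction `k`. -/
def dd (k : Fin 3) (g : E3 → F) (x : E3) : F := fderiv ℝ g x (EuclideanSpace.single k 1)

theorem cube_subset_closedBall : cube ⊆ Metric.closedBall (0 : E3) 2 := by
  intro x hx
  rw [mem_closedBall_zero_iff, EuclideanSpace.norm_eq]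
  refine Real.sqrt_le_iff.2 ⟨by norm_num, ?_⟩
  have : ∀ i, ‖x i‖ ^ 2 ≤ 1 := fun i => by
    rw [Real.norm_eq_abs, sq_abs]; have := hx i; nlinarith [this.1, this.2]
  rw [Fin.sum_univ_three]; linarith [this 0, this 1, this 2]

omit [NormedSpace ℝ F] in
theorem memLp_of_continuous {g : E3 → F} (hg : Continuous g) (q : ℝ≥0∞) : MemLp g q volΩ := by
  obtain ⟨C, hC⟩ := (isCompact_closedBall (0 : E3) 2).exists_bound_of_continuousOn hg.continuousOn
  have hm : AEStronglyMeasurable g volΩ := hg.aestronglyMeasurable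
  refine (MemLp.of_bound hm C ?_ : MemLp g q volΩ)
  filter_upwards [ae_restrict_mem measurableSet_cube] with x hx
  exact hC x (cube_subset_closedBall hx)

theorem integrable_of_continuous {g : E3 → F} (hg : Continuous g) : Integrable g volΩ :=
  memLp_one_iff_integrable.1 (memLp_of_continuous hg 1)

namespace SP

variable {g h : E3 → F}

theorem continuous (hg : SP g) : Continuous g := hg.smooth.continuous

theorem differentiable (hg : SP g) : Differentiable ℝ g := hg.smooth.differentiable (by simp)

theorem memLp (hg : SP g) (q : ℝ≥0∞) : MemLp g q volΩ := memLp_of_continuous hg.continuous q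

theorem integrable (hg : SP g) : Integrable g volΩ := integrable_of_continuous hg.continuous

theorem comp {G : Type} [NormedAddCommGroup G] [NormedSpace ℝ G] {φ : F → G} (hφ : ContDiff ℝ ∞ φ)
    (hg : SP g) : SP fun x => φ (g x) :=
  ⟨hφ.comp hg.smooth, fun i x => congrArg φ (hg.periodic i x)⟩

theorem add (hg : SP g) (hh : SP h) : SP fun x => g x + h x :=
  ⟨hg.smooth.add hh.smooth, fun i x => by rw [hg.periodic, hh.periodic]⟩

theorem sub (hg : SP g) (hh : SP h) : SP fun x => g x - h x :=
  ⟨hg.smooth.sub hh.smooth, fun i x => by rw [hg.periodic, hh.periodic]⟩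

theorem const (c : F) : SP fun _ => c := ⟨contDiff_const, fun _ _ => rfl⟩

theorem const_smul (c : ℝ) (hg : SP g) : SP fun x => c • g x :=
  ⟨hg.smooth.const_smul c, fun i x => by rw [hg.periodic]⟩

theorem sum {ι : Type*} {s : Finset ι} {g : ι → E3 → F} (hg : ∀ i ∈ s, SP (g i)) : SP fun x => ∑ i ∈ s, g i x :=
  ⟨ContDiff.sum fun i hi => (hg i hi).smooth, fun k x => Finset.sum_congr rfl fun i hi => (hg i hi).periodic k x⟩

theorem smul {a : E3 → ℝ} (ha : SP a) (hg : SP g) : SP fun x => a x • g x :=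
  ⟨ha.smooth.smul hg.smooth, fun i x => by rw [ha.periodic, hg.periodic]⟩

theorem comp_add (hg : SP g) (y : E3) : SP fun x => g (x + y) :=
  ⟨hg.smooth.comp (contDiff_id.add contDiff_const), hg.periodic.comp_add y⟩

theorem fderiv (hg : SP g) : SP (fderiv ℝ g) := by
  refine ⟨hg.smooth.fderiv_right (by simp), fun i x => ?_⟩
  have : g = fun y => g (y + EuclideanSpace.single i 1) := funext fun y => (hg.periodic i y).symm
  conv_rhs => rw [this]
  rw [fderiv_comp_add_right]

theorem fderiv_apply (hg : SP g) (y : E3) : SP fun x => _root_.fderiv ℝ g x y :=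
  hg.fderiv.comp (φ := fun L : E3 →L[ℝ] F => L y) (ContinuousLinearMap.apply ℝ F y).contDiff

theorem dd (hg : SP g) (k : Fin 3) : SP (dd k g) := hg.fderiv_apply _

end SP

theorem fderiv_eq_sum_dd (g : E3 → F) (x y : E3) : fderiv ℝ g x y = ∑ k, y k • dd k g x := by
  conv_lhs => rw [← (EuclideanSpace.basisFun (Fin 3) ℝ).sum_repr y, map_sum]
  simp [dd]

theorem eLpNorm_le_of_forall_param {S : Type} [TopologicalSpace S] [MeasurableSpace S]
    [OpensMeasurableSpace S] [SecondCountableTopology S] {ν : Measure S} [IsProbabilityMeasure ν]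
    {K : E3 → S → F} (hK : Continuous (Function.uncurry K)) {h : E3 → F}
    (hh : ∀ x, ‖h x‖ₑ ≤ ∫⁻ s, ‖K x s‖ₑ ∂ν) {q : ℝ≥0∞} (hq : 1 ≤ q) (hq' : q ≠ ⊤) {B : ℝ≥0∞}
    (hB : ∀ᵐ s ∂ν, eLpNorm (fun x => K x s) q volΩ ≤ B) : eLpNorm h q volΩ ≤ B := by
  have hq0 : q ≠ 0 := (zero_lt_one.trans_le hq).ne'
  have hqr : 0 < q.toReal := ENNReal.toReal_pos hq0 hq'
  rw [eLpNorm_eq_lintegral_rpow_enorm_toReal hq0 hq', one_div, ENNReal.rpow_inv_le_iff hqr]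
  have hKx : ∀ x, Continuous (K x) := fun x => hK.comp (f := fun s => (x, s)) (by fun_prop)
  have hm : Measurable fun z : E3 × S => ‖K z.1 z.2‖ₑ ^ q.toReal := (hK.enorm.measurable).pow_const _
  calc ∫⁻ x in cube, ‖h x‖ₑ ^ q.toReal
      ≤ ∫⁻ x in cube, ∫⁻ s, ‖K x s‖ₑ ^ q.toReal ∂ν := by
        refine lintegral_mono fun x => ?_
        have h1 : ∫⁻ s, ‖K x s‖ₑ ∂ν ≤ eLpNorm (K x) q ν := by
          rw [← eLpNorm_one_eq_lintegral_enorm]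
          exact eLpNorm_le_eLpNorm_of_exponent_le hq (hKx x).aestronglyMeasurable
        rw [eLpNorm_eq_lintegral_rpow_enorm_toReal hq0 hq'] at h1
        calc ‖h x‖ₑ ^ q.toReal ≤ ((∫⁻ s, ‖K x s‖ₑ ^ q.toReal ∂ν) ^ (1 / q.toReal)) ^ q.toReal :=
              ENNReal.rpow_le_rpow ((hh x).trans h1) hqr.le
          _ = _ := by rw [one_div, ENNReal.rpow_inv_rpow hqr.ne']
    _ = ∫⁻ s, (∫⁻ x in cube, ‖K x s‖ₑ ^ q.toReal) ∂ν := lintegral_lintegral_swap hm.aemeasurable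
    _ ≤ ∫⁻ s, B ^ q.toReal ∂ν := by
        refine lintegral_mono_ae ?_
        filter_upwards [hB] with s hs
        rwa [eLpNorm_eq_lintegral_rpow_enorm_toReal hq0 hq', one_div, ENNReal.rpow_inv_le_iff hqr] at hs
    _ = B ^ q.toReal := by simp

theorem eLpNorm_sub_comp_add_le [CompleteSpace F] {g : E3 → F} (hg : SP g) (y : E3) {q : ℝ≥0∞} (hq : 1 ≤ q)
    (hq' : q ≠ ⊤) :
    eLpNorm (fun x => g (x + y) - g x) q volΩ ≤ eLpNorm (fun x => fderiv ℝ g x y) q volΩ := by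
  have hc := (hg.fderiv_apply y).continuous
  haveI : IsProbabilityMeasure (volume.restrict (Ioc (0:ℝ) 1)) := ⟨by simp⟩
  refine eLpNorm_le_of_forall_param (ν := volume.restrict (Ioc (0:ℝ) 1))
    (K := fun x s => fderiv ℝ g (x + s • y) y) ?_ ?_ hq hq' ?_
  · exact hc.comp (f := fun z : E3 × ℝ => z.1 + z.2 • y) (by fun_prop)
  · intro x
    have hd : ∀ s ∈ uIcc (0:ℝ) 1, HasDerivAt (fun s : ℝ => g (x + s • y)) (fderiv ℝ g (x + s • y) y) s := by
      intro s _
      have h1 : HasDerivAt (fun s : ℝ => x + s • y) y s := by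
        simpa using ((hasDerivAt_id s).smul_const y).const_add x
      exact (hg.differentiable _).hasFDerivAt.comp_hasDerivAt s h1
    have hi : Continuous fun s : ℝ => fderiv ℝ g (x + s • y) y := hc.comp (f := fun s : ℝ => x + s • y) (by fun_prop)
    have := intervalIntegral.integral_eq_sub_of_hasDerivAt hd (hi.intervalIntegrable 0 1)
    rw [intervalIntegral.integral_of_le zero_le_one] at this
    simp only [one_smul, zero_smul, add_zero] at this
    rw [← this]
    exact enorm_integral_le_lintegral_enorm _
  · refine ae_of_all _ fun s => ?_
    exact (eLpNorm_comp_add (hg.fderiv_apply y).periodic hc.aestronglyMeasurable q (s • y)).le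

theorem eLpNorm_le_two_mul_fderiv {u : E3 → F} [CompleteSpace F] (hu : SP u)
    (h0 : ∫ x in cube, u x = 0) {q : ℝ≥0∞} (hq : 1 ≤ q) (hq' : q ≠ ⊤) :
    eLpNorm u q volΩ ≤ 2 * eLpNorm (fderiv ℝ u) q volΩ := by
  have hc := hu.continuous
  refine eLpNorm_le_of_forall_param (ν := volΩ) (K := fun x y => u (x + y) - u x) ?_ ?_ hq hq' ?_
  · exact (hc.comp (f := fun z : E3 × E3 => z.1 + z.2) (by fun_prop)).sub
      (hc.comp (f := fun z : E3 × E3 => z.1) (by fun_prop))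
  · intro x
    have h1 : ∫ y in cube, (u (x + y) - u x) = - u x := by
      rw [integral_sub, integral_const]
      · have : ∫ y in cube, u (x + y) = 0 := by
          simp_rw [add_comm x]
          rw [integral_comp_add hu.periodic hc.aestronglyMeasurable, h0]
        rw [this]; simp
      · exact integrable_of_continuous (hc.comp (f := fun y => x + y) (by fun_prop))
      · exact integrable_const _
    rw [← enorm_neg, ← h1]
    exact enorm_integral_le_lintegral_enorm _
  · filter_upwards [ae_restrict_mem measurableSet_cube] with y hy
    refine (eLpNorm_sub_comp_add_le hu y hq hq').trans ?_
    have hy2 : ‖y‖ ≤ 2 := by simpa using cube_subset_closedBall hy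
    refine (eLpNorm_mono_ae (g := fun x => (2:ℝ) • ‖fderiv ℝ u x‖) (ae_of_all _ fun x => ?_)).trans ?_
    · refine (ContinuousLinearMap.le_opNorm _ _).trans ?_
      rw [norm_smul, Real.norm_eq_abs, abs_two, norm_norm, mul_comm]
      gcongr
    · refine (eLpNorm_const_smul_le (c := (2:ℝ)) (f := fun x => ‖fderiv ℝ u x‖)).trans ?_
      rw [eLpNorm_norm]
      simp [enorm]

theorem integral_dd_eq_zero [CompleteSpace F] {g : E3 → F} (hg : SP g) (k : Fin 3) : ∫ x in cube, dd k g x = 0 := by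
  set e : E3 := EuclideanSpace.single k 1
  have hc := (hg.dd k).continuous
  have hd : ∀ x, ∫ s in Ioc (0:ℝ) 1, dd k g (x + s • e) = 0 := by
    intro x
    have hd : ∀ s ∈ uIcc (0:ℝ) 1, HasDerivAt (fun s : ℝ => g (x + s • e)) (dd k g (x + s • e)) s := by
      intro s _
      have h1 : HasDerivAt (fun s : ℝ => x + s • e) e s := by
        simpa using ((hasDerivAt_id s).smul_const e).const_add x
      exact (hg.differentiable _).hasFDerivAt.comp_hasDerivAt s h1
    have hi : Continuous fun s : ℝ => dd k g (x + s • e) := hc.comp (f := fun s : ℝ => x + s • e) (by fun_prop)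
    have := intervalIntegral.integral_eq_sub_of_hasDerivAt hd (hi.intervalIntegrable 0 1)
    rw [intervalIntegral.integral_of_le zero_le_one] at this
    rw [this]
    simp [e, hg.periodic k x]
  have h1 : ∫ x in cube, ∫ s in Ioc (0:ℝ) 1, dd k g (x + s • e) = 0 := by simp [hd]
  haveI : IsProbabilityMeasure (volume.restrict (Ioc (0:ℝ) 1)) := ⟨by simp⟩
  rw [integral_integral_swap] at h1
  · have h2 : ∀ s : ℝ, ∫ x in cube, dd k g (x + s • e) = ∫ x in cube, dd k g x := fun s =>
      integral_comp_add (hg.dd k).periodic hc.aestronglyMeasurable _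
    simp_rw [h2] at h1
    simpa using h1
  · obtain ⟨C, hC⟩ := (isCompact_closedBall (0 : E3) 3).exists_bound_of_continuousOn hc.continuousOn
    refine Integrable.of_bound (C := C) ?_ ?_
    · exact (hc.comp (f := fun z : E3 × ℝ => z.1 + z.2 • e) (by fun_prop)).aestronglyMeasurable
    · rw [Measure.prod_restrict]
      filter_upwards [ae_restrict_mem (measurableSet_cube.prod measurableSet_Ioc)] with z hz
      refine hC _ ?_
      rw [mem_closedBall_zero_iff]
      have h1 : ‖z.1‖ ≤ 2 := by simpa using cube_subset_closedBall hz.1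
      have h2 : ‖z.2 • e‖ ≤ 1 := by
        simp only [e, norm_smul, PiLp.norm_single, norm_one, mul_one, Real.norm_eq_abs]
        rw [abs_of_pos hz.2.1]; exact hz.2.2
      exact (norm_add_le _ _).trans (by linarith)

theorem dd_inner {F : Type} [NormedAddCommGroup F] [InnerProductSpace ℝ F] {g h : E3 → F}
    (hg : SP g) (hh : SP h) (k : Fin 3) (x : E3) :
    dd k (fun x => inner ℝ (g x) (h x)) x = inner ℝ (g x) (dd k h x) + inner ℝ (dd k g x) (h x) := by
  exact fderiv_inner_apply ℝ (hg.differentiable x) (hh.differentiable x) _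

theorem SP.inner {F : Type} [NormedAddCommGroup F] [InnerProductSpace ℝ F] {g h : E3 → F}
    (hg : SP g) (hh : SP h) : SP fun x => inner ℝ (g x) (h x) :=
  ⟨hg.smooth.inner ℝ hh.smooth, fun i x => by rw [hg.periodic, hh.periodic]⟩

/-- Integration by parts on the torus. -/
theorem integral_inner_dd {F : Type} [NormedAddCommGroup F] [InnerProductSpace ℝ F] {g h : E3 → F}
    (hg : SP g) (hh : SP h) (k : Fin 3) :
    ∫ x in cube, inner ℝ (dd k g x) (h x) = -∫ x in cube, inner ℝ (g x) (dd k h x) := by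
  have := integral_dd_eq_zero (hg.inner hh) k
  simp_rw [dd_inner hg hh] at this
  rw [integral_add (hg.inner (hh.dd k)).integrable ((hg.dd k).inner hh).integrable] at this
  linarith

/-- The cube `∏ (-1, 2]` is covered by 27 unit boxes. -/
theorem lintegral_ball_le {f : E3 → ℝ≥0∞} (hf : IsPeriodic f) {s : Set E3} (hs : s ⊆ {x | ∀ i, x i ∈ Ioo (-1 : ℝ) 2}) :
    ∫⁻ x in s, f x ≤ 27 * ∫⁻ x in cube, f x := by
  let a : (Fin 3 → Fin 3) → E3 := fun z => WithLp.toLp 2 fun i => ((z i : ℕ) : ℝ) - 1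
  have hsub : s ⊆ ⋃ z, boxAt (a z) := by
    intro x hx
    have hx := hs hx
    have : ∀ i, ∃ j : Fin 3, x i ∈ Ioc (((j : ℕ) : ℝ) - 1) (((j : ℕ) : ℝ) - 1 + 1) := by
      intro i
      have h := hx i
      by_cases h0 : x i ≤ 0
      · exact ⟨0, by constructor <;> norm_num; exacts [h.1, h0]⟩
      by_cases h1 : x i ≤ 1
      · exact ⟨1, by constructor <;> norm_num; exacts [not_le.1 h0, h1]⟩
      · exact ⟨2, by constructor <;> norm_num <;> linarith [h.2, not_le.1 h1]⟩
    choose z hz using this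
    exact mem_iUnion.2 ⟨z, hz⟩
  calc ∫⁻ x in s, f x ≤ ∫⁻ x in ⋃ z, boxAt (a z), f x := lintegral_mono_set hsub
    _ ≤ ∑' z, ∫⁻ x in boxAt (a z), f x := lintegral_iUnion_le _ _
    _ = 27 * ∫⁻ x in cube, f x := by
      simp_rw [lintegral_boxAt_eq_cube hf]
      rw [tsum_fintype]
      simp

theorem eLpNorm_restrict_le {g : E3 → F} (hg : IsPeriodic g) {s : Set E3}
    (hs : s ⊆ {x | ∀ i, x i ∈ Ioo (-1 : ℝ) 2}) {q : ℝ≥0∞} (hq : 1 ≤ q) (hq' : q ≠ ⊤) :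
    eLpNorm g q (volume.restrict s) ≤ 27 * eLpNorm g q volΩ := by
  have hq0 : q ≠ 0 := (zero_lt_one.trans_le hq).ne'
  have hqr : 0 < q.toReal := ENNReal.toReal_pos hq0 hq'
  have hqr1 : 1 ≤ q.toReal := by
    rw [← ENNReal.toReal_one]; exact ENNReal.toReal_mono hq' hq
  rw [eLpNorm_eq_lintegral_rpow_enorm_toReal hq0 hq', eLpNorm_eq_lintegral_rpow_enorm_toReal hq0 hq']
  calc (∫⁻ x in s, ‖g x‖ₑ ^ q.toReal) ^ (1 / q.toReal)
      ≤ (27 * ∫⁻ x in cube, ‖g x‖ₑ ^ q.toReal) ^ (1 / q.toReal) := by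
        gcongr
        exact lintegral_ball_le (fun i x => by simp only [hg i x]) hs
    _ = 27 ^ (1 / q.toReal) * (∫⁻ x in cube, ‖g x‖ₑ ^ q.toReal) ^ (1 / q.toReal) :=
        ENNReal.mul_rpow_of_nonneg _ _ (by positivity)
    _ ≤ 27 * (∫⁻ x in cube, ‖g x‖ₑ ^ q.toReal) ^ (1 / q.toReal) := by
        gcongr
        conv_rhs => rw [← ENNReal.rpow_one 27]
        exact ENNReal.rpow_le_rpow_of_exponent_le (by norm_num)
          (by rw [div_le_one hqr]; exact hqr1)

/-- The Sobolev inequality for periodic functions of mean zero. -/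
theorem exists_sobolev (F : Type) [NormedAddCommGroup F] [NormedSpace ℝ F] [FiniteDimensional ℝ F]
    (s r : NNReal) (hs : 1 ≤ s) (hr : (r : ℝ)⁻¹ = (s : ℝ)⁻¹ - 3⁻¹) :
    ∃ C : NNReal, ∀ u : E3 → F, SP u → ∫ x in cube, u x = 0 → eLpNorm u r volΩ ≤ C * eLpNorm (fderiv ℝ u) s volΩ := by
  haveI : CompleteSpace F := FiniteDimensional.complete ℝ F
  set c : E3 := WithLp.toLp 2 fun _ => (1/2 : ℝ)
  let χ : ContDiffBump c := ⟨9/10, 7/5, by norm_num, by norm_num⟩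
  have hχ : ContDiff ℝ ∞ χ := χ.contDiff
  have hχcs : HasCompactSupport χ := χ.hasCompactSupport
  have hdc : Continuous (fderiv ℝ (χ : E3 → ℝ)) := hχ.continuous_fderiv (by simp)
  obtain ⟨M, hM⟩ := hdc.bounded_above_of_compact_support (hχcs.fderiv (𝕜 := ℝ))
  have hM0 : 0 ≤ M := (norm_nonneg _).trans (hM 0)
  set Q : Set E3 := Metric.closedBall c (7/5)
  have hQ : Q ⊆ {x | ∀ i, x i ∈ Ioo (-1 : ℝ) 2} := by
    intro x hx i
    have h1 : ‖x - c‖ ≤ 7/5 := by simpa [Q, dist_eq_norm] using hx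
    have h2 : |x i - 1/2| ≤ ‖x - c‖ := by simpa [c] using PiLp.norm_apply_le (x - c) i
    have := abs_le.1 (h2.trans h1)
    constructor <;> linarith [this.1, this.2]
  have hcube : ∀ x ∈ cube, χ x = 1 := by
    intro x hx
    apply χ.one_of_mem_closedBall
    rw [mem_closedBall_iff_norm, EuclideanSpace.norm_eq]
    refine Real.sqrt_le_iff.2 ⟨by norm_num [χ], ?_⟩
    have : ∀ i, ‖(x - c) i‖ ^ 2 ≤ 1/4 := fun i => by
      rw [Real.norm_eq_abs, sq_abs]
      have := hx i
      simp only [c, PiLp.sub_apply]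
      nlinarith [this.1, this.2]
    rw [Fin.sum_univ_three]
    have h0 := this 0; have h1 := this 1; have h2 := this 2
    norm_num [χ] at *; linarith
  have hs' : (1 : ℝ≥0∞) ≤ s := by exact_mod_cast hs
  set C₀ := SNormLESNormFDerivOfEqConst F (volume : Measure E3) s
  refine ⟨C₀ * (27 * (1 + 2 * M.toNNReal)), fun u hu h0 => ?_⟩
  have hw : ContDiff ℝ 1 fun x => χ x • u x := (hχ.smul hu.smooth).of_le (by simp)
  have hwc : HasCompactSupport fun x => χ x • u x := hχcs.smul_right
  have h3 : Module.finrank ℝ E3 = 3 := by simp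
  have key := eLpNorm_le_eLpNorm_fderiv_of_eq (volume : Measure E3) hw hwc hs (by simp)
    (p' := r) (by rw [hr, h3]; norm_num)
  have hfd : ∀ x, fderiv ℝ (fun x => χ x • u x) x = χ x • fderiv ℝ u x + (fderiv ℝ χ x).smulRight (u x) := fun x =>
    fderiv_fun_smul ((hχ.differentiable (by simp)) x) (hu.differentiable x)
  have hpt : ∀ x, ‖fderiv ℝ (fun x => χ x • u x) x‖ ≤ ‖Q.indicator (fun x => ‖fderiv ℝ u x‖ + M * ‖u x‖) x‖ := by
    intro x
    by_cases hx : x ∈ Q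
    · rw [indicator_of_mem hx, Real.norm_of_nonneg (by positivity), hfd]
      refine (norm_add_le _ _).trans (add_le_add ?_ ?_)
      · rw [norm_smul, Real.norm_of_nonneg χ.nonneg]
        exact mul_le_of_le_one_left (norm_nonneg _) χ.le_one
      · rw [ContinuousLinearMap.norm_smulRight_apply]
        gcongr
        exact hM x
    · have hx' : x ∉ tsupport (fun x => χ x • u x) := by
        intro h
        have : x ∈ tsupport (χ : E3 → ℝ) := closure_mono (Function.support_smul_subset_left _ _) h
        rw [χ.tsupport_eq] at this
        exact hx this
      rw [fderiv_of_notMem_tsupport (𝕜 := ℝ) hx']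
      simp
  have hsum : eLpNorm (fun x => ‖fderiv ℝ u x‖ + M * ‖u x‖) s volΩ ≤
      (1 + 2 * M.toNNReal) * eLpNorm (fderiv ℝ u) s volΩ := by
    refine (eLpNorm_add_le hu.fderiv.continuous.norm.aestronglyMeasurable
      (continuous_const.mul hu.continuous.norm).aestronglyMeasurable hs').trans ?_
    rw [eLpNorm_norm, add_mul, one_mul]
    gcongr
    refine (eLpNorm_const_smul_le (c := M) (f := fun x => ‖u x‖)).trans ?_
    rw [eLpNorm_norm]
    have hMe : ‖M‖ₑ = M.toNNReal := by
      rw [Real.enorm_of_nonneg hM0]; rfl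
    rw [hMe, mul_comm (2:ℝ≥0∞), mul_assoc]
    gcongr
    exact eLpNorm_le_two_mul_fderiv hu h0 hs' ENNReal.coe_ne_top
  calc eLpNorm u r volΩ = eLpNorm (fun x => χ x • u x) r volΩ := by
        refine eLpNorm_congr_ae ?_
        filter_upwards [ae_restrict_mem measurableSet_cube] with x hx
        rw [hcube x hx, one_smul]
    _ ≤ eLpNorm (fun x => χ x • u x) r volume := eLpNorm_mono_measure _ Measure.restrict_le_self
    _ ≤ C₀ * eLpNorm (fderiv ℝ (fun x => χ x • u x)) s volume := key
    _ ≤ C₀ * eLpNorm (fun x => ‖fderiv ℝ u x‖ + M * ‖u x‖) s (volume.restrict Q) := by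
        gcongr
        rw [← eLpNorm_indicator_eq_eLpNorm_restrict measurableSet_closedBall]
        exact eLpNorm_mono hpt
    _ ≤ C₀ * (27 * ((1 + 2 * M.toNNReal) * eLpNorm (fderiv ℝ u) s volΩ)) := by
        gcongr
        refine (eLpNorm_restrict_le (fun i x => ?_) hQ hs' ENNReal.coe_ne_top).trans ?_
        · simp only [hu.fderiv.periodic i x, hu.periodic i x]
        · gcongr
    _ = _ := by push_cast; ring

end Smooth

section Calculus

variable {F : Type} [NormedAddCommGroup F] [NormedSpace ℝ F]

theorem dd_clm_comp {G : Type} [NormedAddCommGroup G] [NormedSpace ℝ G] (L : F →L[ℝ] G)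
    {g : E3 → F} (hg : SP g) (k : Fin 3) (x : E3) : dd k (fun y => L (g y)) x = L (dd k g x) := by
  unfold dd
  have := (L.hasFDerivAt.comp x (hg.differentiable x).hasFDerivAt).fderiv
  simp only [Function.comp_def] at this
  rw [this]; rfl

theorem dd_apply {ι : Type} [Fintype ι] {g : E3 → EuclideanSpace ℝ ι} (hg : SP g) (k : Fin 3)
    (i : ι) (x : E3) : dd k (fun y => g y i) x = dd k g x i :=
  dd_clm_comp (EuclideanSpace.proj (𝕜 := ℝ) i) hg k x

theorem SP.apply {ι : Type} [Fintype ι] {g : E3 → EuclideanSpace ℝ ι} (hg : SP g) (i : ι) : SP fun x => g x i :=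
  SP.comp (φ := fun y : EuclideanSpace ℝ ι => y i) (EuclideanSpace.proj (𝕜 := ℝ) i).contDiff hg

theorem SP.of_apply {ι : Type} [Fintype ι] {g : E3 → EuclideanSpace ℝ ι} (hg : ∀ i, SP fun x => g x i) : SP g :=
  ⟨contDiff_euclidean.2 fun i => (hg i).smooth, fun k x => by ext i; exact (hg i).periodic k x⟩

theorem dd_comm {g : E3 → F} (hg : SP g) (j k : Fin 3) : dd j (dd k g) = dd k (dd j g) := by
  have h : ∀ (a b : Fin 3) x, dd a (dd b g) x =
      fderiv ℝ (fderiv ℝ g) x (EuclideanSpace.single a 1) (EuclideanSpace.single b 1) := by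
    intro a b x
    exact dd_clm_comp (ContinuousLinearMap.apply ℝ F (EuclideanSpace.single b (1:ℝ))) hg.fderiv a x
  ext x
  rw [h, h]
  have : ContDiffAt ℝ ∞ g x := hg.smooth.contDiffAt
  exact (this.isSymmSndFDerivAt (by
    simp only [minSmoothness_of_isRCLikeNormedField]
    exact WithTop.coe_le_coe.2 (le_top : (2 : ℕ∞) ≤ ⊤))).eq _ _

theorem dd_add {g h : E3 → F} (hg : SP g) (hh : SP h) (k : Fin 3) (x : E3) :
    dd k (fun x => g x + h x) x = dd k g x + dd k h x := by
  unfold dd; rw [fderiv_fun_add (hg.differentiable x) (hh.differentiable x)]; rfl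

theorem dd_sub {g h : E3 → F} (hg : SP g) (hh : SP h) (k : Fin 3) (x : E3) :
    dd k (fun x => g x - h x) x = dd k g x - dd k h x := by
  unfold dd; rw [fderiv_fun_sub (hg.differentiable x) (hh.differentiable x)]; rfl

theorem dd_const_smul {g : E3 → F} (hg : SP g) (c : ℝ) (k : Fin 3) (x : E3) :
    dd k (fun x => c • g x) x = c • dd k g x := by
  unfold dd; rw [fderiv_fun_const_smul (hg.differentiable x)]; rfl

theorem dd_sum {ι : Type*} {s : Finset ι} {g : ι → E3 → F} (hg : ∀ i ∈ s, SP (g i)) (k : Fin 3)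
    (x : E3) : dd k (fun x => ∑ i ∈ s, g i x) x = ∑ i ∈ s, dd k (g i) x := by
  unfold dd; rw [fderiv_fun_sum fun i hi => (hg i hi).differentiable x]; simp

theorem dd_comp_add (g : E3 → F) (y : E3) (k : Fin 3) (x : E3) : dd k (fun x => g (x + y)) x = dd k g (x + y) := by
  unfold dd; rw [fderiv_comp_add_right]

theorem integral_apply_cube {ι : Type} [Fintype ι] {g : E3 → EuclideanSpace ℝ ι} (hg : SP g) (i : ι) :
    (∫ x in cube, g x) i = ∫ x in cube, g x i :=
  ((EuclideanSpace.proj (𝕜 := ℝ) i).integral_comp_comm hg.integrable).symm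

theorem IsSolenoidalTest.sp {φ : E3 → E3} (h : IsSolenoidalTest φ) : SP φ := ⟨h.smooth, h.periodic⟩

theorem grad_apply {φ : E3 → E3} (hφ : SP φ) (x : E3) (i j : Fin 3) : grad φ x (i, j) = dd j φ x i := dd_apply hφ j i x

theorem SP.grad {φ : E3 → E3} (hφ : SP φ) : SP (grad φ) := by
  refine SP.of_apply fun ij => ?_
  have : (fun x => PNavierStokes.grad φ x ij) = fun x => PNavierStokes.dd ij.2 φ x ij.1 :=
    funext fun x => grad_apply hφ x ij.1 ij.2
  rw [this]
  exact (hφ.dd ij.2).apply ij.1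

theorem grad_dd {φ : E3 → E3} (hφ : SP φ) (k : Fin 3) (x : E3) : grad (dd k φ) x = dd k (grad φ) x := by
  ext ⟨i, j⟩
  rw [grad_apply (hφ.dd k), ← dd_apply hφ.grad]
  have : (fun y => grad φ y (i, j)) = fun y => dd j φ y i := funext fun y => grad_apply hφ y i j
  rw [this, dd_apply (hφ.dd j), dd_comm hφ]

theorem norm_grad_sq {φ : E3 → E3} (hφ : SP φ) (x : E3) : ‖grad φ x‖ ^ 2 = ∑ k, ‖dd k φ x‖ ^ 2 := by
  simp only [EuclideanSpace.norm_sq_eq, Fintype.sum_prod_type, grad_apply hφ]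
  exact Finset.sum_comm

theorem SP.eq_zero_of_integral {g : E3 → F} (hg : SP g) (h : ∫ x in cube, ‖g x‖ ^ 2 = 0) (x : E3) : g x = 0 := by
  let c : E3 := WithLp.toLp 2 fun _ => (1/2 : ℝ)
  have hc : c ∈ cube := fun i => by constructor <;> norm_num [c]
  have hk := hg.comp_add (x - c)
  have hcont : Continuous fun y => ‖g (y + (x - c))‖ ^ 2 := hk.continuous.norm.pow 2
  have h1 : ∫ y in cube, ‖g (y + (x - c))‖ ^ 2 = 0 := by
    rw [integral_comp_add (g := fun y => ‖g y‖ ^ 2) (fun i y => by simp only [hg.periodic i y])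
      (hg.continuous.norm.pow 2).aestronglyMeasurable, h]
  rw [integral_eq_zero_iff_of_nonneg (fun y => by positivity) (integrable_of_continuous hcont)] at h1
  have := Measure.eqOn_open_of_ae_eq h1 isOpen_cube hcont.continuousOn continuousOn_const hc
  simpa using this

end Calculus

section Fourier

open scoped ComplexConjugate

attribute [local instance] instMeasureSpaceUnitAddCircle instIsProbabilityMeasureUnitAddCircleVolume

/-- The character `x ↦ exp (2πi k·x)`. -/
def char (k : Fin 3 → ℤ) (x : E3) : ℂ := Complex.exp (2 * Real.pi * Complex.I * ∑ i, (k i : ℂ) * x i)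

theorem char_add_index (k l : Fin 3 → ℤ) (x : E3) : char (k + l) x = char k x * char l x := by
  rw [char, char, char, ← Complex.exp_add]
  congr 1
  simp only [Pi.add_apply, Fin.sum_univ_three]; push_cast; ring

theorem char_add (k : Fin 3 → ℤ) (x y : E3) : char k (x + y) = char k x * char k y := by
  rw [char, char, char, ← Complex.exp_add]
  congr 1
  simp only [PiLp.add_apply, Fin.sum_univ_three]; push_cast; ring

theorem char_zero (x : E3) : char 0 x = 1 := by simp [char]

theorem char_neg (k : Fin 3 → ℤ) (x : E3) : char (-k) x = conj (char k x) := by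
  rw [char, char, ← Complex.exp_conj]
  congr 1
  simp [Fin.sum_univ_three, Complex.conj_ofNat]
  ring

theorem sum_mul_single (k : Fin 3 → ℤ) (j : Fin 3) :
    ∑ i, (k i : ℂ) * (((EuclideanSpace.single j 1 : E3) i : ℝ) : ℂ) = k j := by
  fin_cases j <;> simp [Fin.sum_univ_three]

theorem hasFDerivAt_char (k : Fin 3 → ℤ) (x : E3) :
    HasFDerivAt (char k) (char k x • (((2 * Real.pi * Complex.I : ℂ)) • ∑ i, (k i : ℂ) •
      Complex.ofRealCLM.comp (EuclideanSpace.proj (𝕜 := ℝ) i : E3 →L[ℝ] ℝ))) x := by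
  have h : HasFDerivAt (fun x : E3 => ∑ i, (k i : ℂ) * (x i : ℂ)) (∑ i, (k i : ℂ) •
      Complex.ofRealCLM.comp (EuclideanSpace.proj (𝕜 := ℝ) i : E3 →L[ℝ] ℝ)) x := by
    refine HasFDerivAt.fun_sum fun i _ => ?_
    exact (Complex.ofRealCLM.comp (EuclideanSpace.proj (𝕜 := ℝ) i : E3 →L[ℝ] ℝ)).hasFDerivAt.const_mul _
  exact (h.const_mul _).cexp

theorem contDiff_char (k : Fin 3 → ℤ) : ContDiff ℝ ∞ (char k) := by
  refine ContDiff.cexp (contDiff_const.mul (ContDiff.sum fun i _ => contDiff_const.mul ?_))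
  exact (Complex.ofRealCLM.comp (EuclideanSpace.proj (𝕜 := ℝ) i : E3 →L[ℝ] ℝ)).contDiff

theorem SP.char (k : Fin 3 → ℤ) : SP (char k) := by
  refine ⟨contDiff_char k, fun i x => ?_⟩
  rw [char_add]
  have : PNavierStokes.char k (EuclideanSpace.single i 1) = 1 := by
    rw [PNavierStokes.char, Complex.exp_eq_one_iff]
    refine ⟨k i, ?_⟩
    rw [sum_mul_single]; ring
  rw [this, mul_one]

theorem dd_char (j : Fin 3) (k : Fin 3 → ℤ) (x : E3) : dd j (char k) x = 2 * Real.pi * Complex.I * k j * char k x := by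
  rw [dd, (hasFDerivAt_char k x).fderiv]
  rw [← sum_mul_single k j]
  simp; ring

/-- Fourier coefficients of a function on the cube. -/
def fc (g : E3 → ℂ) (k : Fin 3 → ℤ) : ℂ := ∫ x in cube, char (-k) x * g x

theorem char_eq_mFourier (k : Fin 3 → ℤ) (x : E3) :
    char k x = UnitAddTorus.mFourier k (fun i => (x i : UnitAddCircle)) := by
  simp only [UnitAddTorus.mFourier, ContinuousMap.coe_mk, fourier_coe_apply, char, ← Complex.exp_sum]
  congr 1
  rw [Finset.mul_sum]
  refine Finset.sum_congr rfl fun i _ => ?_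
  push_cast; ring

/-- Parseval's identity on the cube. -/
theorem hasSum_conj_fc_mul_fc {f g : E3 → ℂ} (hf : Continuous f) (hfp : IsPeriodic f)
    (hg : Continuous g) (hgp : IsPeriodic g) :
    HasSum (fun k => conj (fc f k) * fc g k) (∫ x in cube, conj (f x) * g x) := by
  let lift : (E3 → ℂ) → UnitAddTorus (Fin 3) → ℂ := fun f t =>
    f (WithLp.toLp 2 fun i => (AddCircle.equivIco (1:ℝ) 0 (t i) : ℝ))
  have hl : ∀ {f : E3 → ℂ}, IsPeriodic f → ∀ x : E3, lift f (fun i => (x i : UnitAddCircle)) = f x := by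
    intro f hf x
    rw [← hf.fractPt x]
    show f _ = f _
    congr 1
    ext i
    simp only [fractPt]
    rw [AddCircle.coe_equivIco_mk_apply]; simp
  have hm : ∀ {f : E3 → ℂ}, Continuous f → MemLp (lift f) 2 volume := by
    intro f hf
    obtain ⟨C, hC⟩ := (isCompact_closedBall (0 : E3) 2).exists_bound_of_continuousOn hf.continuousOn
    have hmeas : Measurable fun t : UnitAddTorus (Fin 3) =>
        (WithLp.toLp 2 fun i => (AddCircle.equivIco (1:ℝ) 0 (t i) : ℝ) : E3) := by
      apply (MeasurableEquiv.toLp 2 (Fin 3 → ℝ)).measurable.comp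
      refine measurable_pi_lambda _ fun i => ?_
      exact measurable_subtype_coe.comp ((AddCircle.measurableEquivIco (1:ℝ) 0).measurable.comp (measurable_pi_apply i))
    refine MemLp.of_bound (hf.measurable.comp hmeas).aestronglyMeasurable C (ae_of_all _ fun t => ?_)
    refine hC _ ?_
    rw [mem_closedBall_zero_iff, EuclideanSpace.norm_eq]
    refine Real.sqrt_le_iff.2 ⟨by norm_num, ?_⟩
    have : ∀ i, ‖(AddCircle.equivIco (1:ℝ) 0 (t i) : ℝ)‖ ^ 2 ≤ 1 := fun i => by
      have := (AddCircle.equivIco (1:ℝ) 0 (t i)).2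
      rw [Real.norm_eq_abs, sq_abs]; nlinarith [this.1, this.2]
    rw [Fin.sum_univ_three]
    have h0 := this 0; have h1 := this 1; have h2 := this 2
    simp only at h0 h1 h2 ⊢; linarith
  have hint : ∀ G : UnitAddTorus (Fin 3) → ℂ, ∫ t, G t = ∫ x in cube, G (fun i => (x i : UnitAddCircle)) := by
    intro G
    rw [UnitAddTorus.integral_preimage G 0, ← setIntegral_congr_set boxAt_ae_eq_cube]
    have h := (EuclideanSpace.volume_preserving_symm_measurableEquiv_toLp (Fin 3))
    have := h.setIntegral_preimage_emb (MeasurableEquiv.measurableEmbedding _)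
      (fun x : Fin 3 → ℝ => G (fun i => x i)) {x : Fin 3 → ℝ | ∀ i, x i ∈ Ioc (0:ℝ) (0 + 1)}
    exact this.symm
  have hcoef : ∀ {f : E3 → ℂ} (hf : Continuous f), IsPeriodic f → ∀ k,
      UnitAddTorus.mFourierCoeff ((hm hf).toLp (lift f)) k = fc f k := by
    intro f hf hfp k
    rw [UnitAddTorus.mFourierCoeff]
    have : ∫ t, UnitAddTorus.mFourier (-k) t • ((hm hf).toLp (lift f)) t =
        ∫ t, UnitAddTorus.mFourier (-k) t • lift f t := by
      refine integral_congr_ae ?_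
      filter_upwards [(hm hf).coeFn_toLp] with t ht
      rw [ht]
    rw [this, hint]
    simp only [hl hfp, ← char_eq_mFourier, smul_eq_mul, fc]
  have key := UnitAddTorus.hasSum_prod_mFourierCoeff ((hm hf).toLp (lift f)) ((hm hg).toLp (lift g))
  simp only [hcoef hf hfp, hcoef hg hgp] at key
  convert! key using 1
  have : ∫ t, conj ((hm hf).toLp (lift f) t) * ((hm hg).toLp (lift g)) t = ∫ t, conj (lift f t) * lift g t := by
    refine integral_congr_ae ?_
    filter_upwards [(hm hf).coeFn_toLp, (hm hg).coeFn_toLp] with t ht ht'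
    rw [ht, ht']
  rw [this, hint]
  simp only [hl hfp, hl hgp]

theorem fc_dd {g : E3 → ℂ} (hg : SP g) (j : Fin 3) (k : Fin 3 → ℤ) :
    fc (dd j g) k = 2 * Real.pi * Complex.I * k j * fc g k := by
  have hc := SP.char (-k)
  have hprod : SP fun x => char (-k) x * g x := ⟨hc.smooth.mul hg.smooth, fun i x => by rw [hc.periodic, hg.periodic]⟩
  have h := integral_dd_eq_zero hprod j
  have hd : ∀ x, dd j (fun x => char (-k) x * g x) x =
      char (-k) x * dd j g x - 2 * Real.pi * Complex.I * k j * (char (-k) x * g x) := by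
    intro x
    rw [dd, fderiv_fun_mul (hc.differentiable x) (hg.differentiable x)]
    have := dd_char j (-k) x
    unfold dd at this ⊢
    simp only [add_apply, smul_apply, smul_eq_mul, this]
    simp only [Pi.neg_apply]; push_cast; ring
  simp_rw [hd] at h
  rw [integral_sub, integral_const_mul, sub_eq_zero] at h
  · exact h
  · exact integrable_of_continuous (hc.continuous.mul (hg.dd j).continuous)
  · exact integrable_of_continuous (continuous_const.mul hprod.continuous)

theorem integral_char (k : Fin 3 → ℤ) : ∫ x in cube, char k x = if k = 0 then 1 else 0 := by
  split_ifs with h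
  · subst h; simp [char_zero]
  · obtain ⟨j, hj⟩ := Function.ne_iff.1 h
    have := integral_dd_eq_zero (SP.char k) j
    simp_rw [dd_char] at this
    rw [integral_const_mul] at this
    refine (mul_eq_zero.1 this).resolve_left ?_
    have hj' : (k j : ℂ) ≠ 0 := by exact_mod_cast hj
    simp [hj', Real.pi_ne_zero]

theorem fc_char (l k : Fin 3 → ℤ) : fc (char l) k = if k = l then 1 else 0 := by
  unfold fc
  simp_rw [← char_add_index]
  rw [integral_char]
  congr 1
  rw [neg_add_eq_zero]

theorem fc_comp_add {g : E3 → ℂ} (hg : SP g) (y : E3) (k : Fin 3 → ℤ) :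
    fc (fun x => g (x + y)) k = char k y * fc g k := by
  have hc := SP.char (-k)
  have hprod : SP fun x => char (-k) x * g x := ⟨hc.smooth.mul hg.smooth, fun i x => by rw [hc.periodic, hg.periodic]⟩
  have h := integral_comp_add hprod.periodic hprod.continuous.aestronglyMeasurable y
  unfold fc
  rw [← h, ← integral_const_mul]
  refine integral_congr_ae (ae_of_all _ fun x => ?_)
  have h1 : char k y * char (-k) y = 1 := by rw [← char_add_index, add_neg_cancel, char_zero]
  simp only [char_add]
  linear_combination (- char (-k) x * g (x + y)) * h1

/-- Fourier coefficients of a real function. -/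
def fcR (g : E3 → ℝ) (k : Fin 3 → ℤ) : ℂ := fc (fun x => (g x : ℂ)) k

theorem SP.ofReal {g : E3 → ℝ} (hg : SP g) : SP fun x => (g x : ℂ) :=
  SP.comp Complex.ofRealCLM.contDiff hg

theorem fcR_dd {g : E3 → ℝ} (hg : SP g) (j : Fin 3) (k : Fin 3 → ℤ) :
    fcR (dd j g) k = 2 * Real.pi * Complex.I * k j * fcR g k := by
  rw [fcR, fcR, ← fc_dd hg.ofReal]
  congr 1
  ext x
  exact (dd_clm_comp Complex.ofRealCLM hg j x).symm

theorem fcR_neg (g : E3 → ℝ) (k : Fin 3 → ℤ) : fcR g (-k) = conj (fcR g k) := by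
  unfold fcR fc
  rw [← integral_conj]
  refine integral_congr_ae (ae_of_all _ fun x => ?_)
  simp [char_neg]

theorem hasSum_fcR {f g : E3 → ℝ} (hf : SP f) (hg : SP g) :
    HasSum (fun k => (conj (fcR f k) * fcR g k).re) (∫ x in cube, f x * g x) := by
  have h := Complex.hasSum_re (hasSum_conj_fc_mul_fc hf.ofReal.continuous hf.ofReal.periodic
    hg.ofReal.continuous hg.ofReal.periodic)
  convert! h using 1
  rw [← Complex.ofReal_re (∫ x in cube, f x * g x), ← integral_complex_ofReal]
  simp

theorem hasSum_normSq_fcR {f : E3 → ℝ} (hf : SP f) : HasSum (fun k => ‖fcR f k‖ ^ 2) (∫ x in cube, f x ^ 2) := by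
  have h := hasSum_fcR hf hf
  convert! h using 1
  · ext k
    rw [Complex.conj_mul']
    norm_cast
  · simp_rw [pow_two]

theorem fcR_add {f g : E3 → ℝ} (hf : SP f) (hg : SP g) (k : Fin 3 → ℤ) :
    fcR (fun x => f x + g x) k = fcR f k + fcR g k := by
  have hc := (SP.char (-k)).continuous
  unfold fcR fc
  have h1 : Integrable (fun x => char (-k) x * (f x : ℂ)) volΩ := integrable_of_continuous (hc.mul hf.ofReal.continuous)
  have h2 : Integrable (fun x => char (-k) x * (g x : ℂ)) volΩ := integrable_of_continuous (hc.mul hg.ofReal.continuous)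
  rw [← integral_add h1 h2]
  refine integral_congr_ae (ae_of_all _ fun x => ?_)
  simp only; push_cast; ring

theorem fcR_const_mul (c : ℝ) (f : E3 → ℝ) (k : Fin 3 → ℤ) : fcR (fun x => c * f x) k = c * fcR f k := by
  unfold fcR fc
  rw [← integral_const_mul]
  refine integral_congr_ae (ae_of_all _ fun x => ?_)
  simp only; push_cast; ring

theorem fcR_sub {f g : E3 → ℝ} (hf : SP f) (hg : SP g) (k : Fin 3 → ℤ) :
    fcR (fun x => f x - g x) k = fcR f k - fcR g k := by
  have h := fcR_add hf (hg.const_smul (-1)) k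
  simp only [smul_eq_mul] at h
  rw [fcR_const_mul] at h
  simpa [sub_eq_add_neg] using h

/-- The frequencies `k` with `|kᵢ| ≤ n`. -/
def box (n : ℕ) : Finset (Fin 3 → ℤ) := Fintype.piFinset fun _ => Finset.Icc (-(n : ℤ)) n

theorem mem_box {n : ℕ} {k : Fin 3 → ℤ} : k ∈ box n ↔ ∀ i, |k i| ≤ n := by
  simp [box, abs_le]

theorem box_mono {m n : ℕ} (h : m ≤ n) : box m ⊆ box n := fun k hk =>
  mem_box.2 fun i => (mem_box.1 hk i).trans (by exact_mod_cast h)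

/-- The scalar truncation of the Fourier series. -/
def truncR (n : ℕ) (g : E3 → ℝ) (x : E3) : ℝ := (∑ k ∈ box n, fcR g k * char k x).re

theorem ofReal_truncR (n : ℕ) (g : E3 → ℝ) (x : E3) : (truncR n g x : ℂ) = ∑ k ∈ box n, fcR g k * char k x := by
  apply Complex.conj_eq_iff_re.1
  rw [map_sum]
  refine Finset.sum_equiv (Equiv.neg _) (fun k => ?_) fun k _ => ?_
  · simp [mem_box]
  · simp [char_neg, fcR_neg]

theorem SP.truncC (n : ℕ) (g : E3 → ℝ) : SP fun x => ∑ k ∈ box n, fcR g k * PNavierStokes.char k x :=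
  SP.sum fun k _ => ⟨contDiff_const.mul (SP.char k).smooth, fun i x => by rw [(SP.char k).periodic]⟩

theorem SP.truncR (n : ℕ) (g : E3 → ℝ) : SP (truncR n g) :=
  SP.comp (φ := fun z : ℂ => z.re) Complex.reCLM.contDiff (SP.truncC n g)

theorem fcR_truncR (n : ℕ) (g : E3 → ℝ) (k : Fin 3 → ℤ) : fcR (truncR n g) k = if k ∈ box n then fcR g k else 0 := by
  have : fcR (truncR n g) k = ∑ l ∈ box n, fcR g l * fc (char l) k := by
    unfold fcR fc
    simp_rw [ofReal_truncR, Finset.mul_sum]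
    rw [integral_finsetSum]
    · refine Finset.sum_congr rfl fun l _ => ?_
      rw [← integral_const_mul]
      refine integral_congr_ae (ae_of_all _ fun x => ?_)
      simp only [fcR, fc]; ring
    · intro l _
      exact integrable_of_continuous ((SP.char _).continuous.mul (continuous_const.mul (SP.char _).continuous))
  rw [this]
  simp_rw [fc_char]
  simp

theorem dd_truncR (n : ℕ) {g : E3 → ℝ} (hg : SP g) (j : Fin 3) : dd j (truncR n g) = truncR n (dd j g) := by
  ext x
  apply Complex.ofReal_injective
  have h1 : ((dd j (truncR n g) x : ℝ) : ℂ) = dd j (fun x => (truncR n g x : ℂ)) x :=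
    (dd_clm_comp Complex.ofRealCLM (SP.truncR n g) j x).symm
  rw [h1, ofReal_truncR]
  simp_rw [ofReal_truncR]
  have hs : ∀ k ∈ box n, SP fun x => fcR g k * char k x := fun k _ =>
    ⟨contDiff_const.mul (SP.char k).smooth, fun i x => by rw [(SP.char k).periodic]⟩
  rw [dd_sum hs]
  refine Finset.sum_congr rfl fun k _ => ?_
  rw [fcR_dd hg]
  have : dd j (fun x => fcR g k * char k x) x = fcR g k * dd j (char k) x := by
    unfold dd
    rw [fderiv_const_mul ((SP.char k).differentiable x)]
    rfl
  rw [this, dd_char]; ring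

/-- The remainder of the truncation gains a derivative. -/
theorem integral_sq_sub_truncR_le {n : ℕ} (hn : 1 ≤ n) {g : E3 → ℝ} (hg : SP g) :
    ∫ x in cube, (g x - truncR n g x) ^ 2 ≤ ((n : ℝ) ^ 2)⁻¹ * ∑ j, ∫ x in cube, dd j g x ^ 2 := by
  have h1 := hasSum_normSq_fcR (hg.sub (SP.truncR n g))
  have h2 := (hasSum_sum (s := Finset.univ) fun (j : Fin 3) _ => hasSum_normSq_fcR (hg.dd j)).mul_left (((n : ℝ) ^ 2)⁻¹)
  refine hasSum_le (fun k => ?_) h1 h2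
  rw [fcR_sub hg (SP.truncR n g), fcR_truncR]
  split_ifs with hk
  · rw [sub_self, norm_zero, zero_pow two_ne_zero]; positivity
  · rw [sub_zero]
    rw [mem_box] at hk
    push Not at hk
    obtain ⟨i, hi⟩ := hk
    have hn0 : (0 : ℝ) < n := by exact_mod_cast hn
    rw [inv_mul_eq_div, le_div_iff₀ (by positivity)]
    have hki : (n : ℝ) ≤ |(k i : ℝ)| := by exact_mod_cast hi.le
    calc ‖fcR g k‖ ^ 2 * (n : ℝ) ^ 2 ≤ ‖fcR (dd i g) k‖ ^ 2 := by
          rw [fcR_dd hg, ← mul_pow]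
          refine pow_le_pow_left₀ (by positivity) ?_ 2
          simp only [norm_mul, Complex.norm_I, mul_one, Complex.norm_real, Complex.norm_intCast,
            Real.norm_eq_abs, abs_of_pos Real.pi_pos, Complex.norm_ofNat]
          have h6 : 1 ≤ 2 * Real.pi := by linarith [Real.pi_gt_three]
          calc ‖fcR g k‖ * n ≤ 1 * |(k i : ℝ)| * ‖fcR g k‖ := by
                rw [one_mul, mul_comm]; gcongr
            _ ≤ _ := by gcongr
      _ ≤ _ := Finset.single_le_sum (f := fun j => ‖fcR (dd j g) k‖ ^ 2) (fun j _ => by positivity) (Finset.mem_univ i)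

theorem integral_sq_truncR_le (n : ℕ) {g : E3 → ℝ} (hg : SP g) :
    ∫ x in cube, truncR n g x ^ 2 ≤ ∫ x in cube, g x ^ 2 := by
  refine hasSum_le (fun k => ?_) (hasSum_normSq_fcR (SP.truncR n g)) (hasSum_normSq_fcR hg)
  rw [fcR_truncR]
  split_ifs
  · rfl
  · rw [norm_zero, zero_pow two_ne_zero]; positivity

theorem integral_sub_truncR_mul {n : ℕ} {g h : E3 → ℝ} (hg : SP g) (hh : SP h)
    (h0 : ∀ k ∉ box n, fcR h k = 0) : ∫ x in cube, (g x - truncR n g x) * h x = 0 := by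
  have := hasSum_fcR (hg.sub (SP.truncR n g)) hh
  refine this.unique ?_
  convert! hasSum_zero using 1
  ext k
  rw [fcR_sub hg (SP.truncR n g), fcR_truncR]
  split_ifs with hk
  · simp
  · simp [h0 k hk]

theorem IsSolenoidalTest.div_dd {φ : E3 → E3} (h : IsSolenoidalTest φ) (x : E3) : ∑ i, dd i φ x i = 0 := by
  simpa only [grad_apply h.sp] using h.div_free x

theorem isSolenoidalTest_iff {φ : E3 → E3} : IsSolenoidalTest φ ↔
    SP φ ∧ ∫ x in cube, φ x = 0 ∧ ∀ x, ∑ i, dd i φ x i = 0 :=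
  ⟨fun h => ⟨h.sp, h.mean_zero, h.div_dd⟩, fun h => ⟨h.1.smooth, h.1.periodic, h.2.1, fun x => by
    simpa only [grad_apply h.1] using h.2.2 x⟩⟩

/-- The divergence-free trigonometric polynomials of degree `n` without constant term. -/
def X (n : ℕ) : Submodule ℝ (E3 → E3) where
  carrier := {φ | IsSolenoidalTest φ ∧ ∀ k ∉ box n, ∀ i, fcR (fun x => φ x i) k = 0}
  add_mem' := by
    rintro φ ψ ⟨hφ, hφk⟩ ⟨hψ, hψk⟩
    refine ⟨isSolenoidalTest_iff.2 ⟨hφ.sp.add hψ.sp, ?_, fun x => ?_⟩, fun k hk i => ?_⟩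
    · simp only [Pi.add_apply]
      rw [integral_add hφ.sp.integrable hψ.sp.integrable, hφ.mean_zero, hψ.mean_zero, add_zero]
    · have : ∀ i, dd i (φ + ψ) x i = dd i φ x i + dd i ψ x i := fun i =>
        congrArg (fun v : E3 => v i) (dd_add hφ.sp hψ.sp i x)
      simp_rw [this, Finset.sum_add_distrib, hφ.div_dd, hψ.div_dd, add_zero]
    · have := fcR_add (hφ.sp.apply i) (hψ.sp.apply i) k
      simp only [Pi.add_apply, PiLp.add_apply]
      rw [this, hφk k hk, hψk k hk, add_zero]
  zero_mem' := by
    refine ⟨isSolenoidalTest_iff.2 ⟨SP.const 0, by simp, fun x => ?_⟩, fun k hk i => ?_⟩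
    · have : ∀ i, dd i (0 : E3 → E3) x = 0 := fun i => by simp [dd]
      simp [this]
    · simp [fcR, fc]
  smul_mem' := by
    rintro c φ ⟨hφ, hφk⟩
    refine ⟨isSolenoidalTest_iff.2 ⟨hφ.sp.const_smul c, ?_, fun x => ?_⟩, fun k hk i => ?_⟩
    · simp only [Pi.smul_apply]
      rw [integral_smul, hφ.mean_zero, smul_zero]
    · have : ∀ i, dd i (c • φ) x i = c * dd i φ x i := fun i =>
        congrArg (fun v : E3 => v i) (dd_const_smul hφ.sp c i x)
      simp_rw [this, ← Finset.mul_sum, hφ.div_dd, mul_zero]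
    · have := fcR_const_mul c (fun x => φ x i) k
      simp only [Pi.smul_apply, PiLp.smul_apply, smul_eq_mul]
      rw [this, hφk k hk, mul_zero]

theorem X_mono {m n : ℕ} (h : m ≤ n) : X m ≤ X n := fun _ hφ =>
  ⟨hφ.1, fun k hk => hφ.2 k fun hk' => hk (box_mono h hk')⟩

theorem dd_mem_X {n : ℕ} {φ : E3 → E3} (hφ : φ ∈ X n) (j : Fin 3) : dd j φ ∈ X n := by
  refine ⟨isSolenoidalTest_iff.2 ⟨hφ.1.sp.dd j, integral_dd_eq_zero hφ.1.sp j, fun x => ?_⟩, fun k hk i => ?_⟩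
  · have h1 : ∀ i, dd i (dd j φ) x i = dd j (fun y => dd i φ y i) x := fun i => by
      rw [dd_comm hφ.1.sp, dd_apply (hφ.1.sp.dd i)]
    simp_rw [h1]
    rw [← dd_sum fun i _ => (hφ.1.sp.dd i).apply i]
    rw [show (fun x => ∑ i, dd i φ x i) = fun _ => 0 from funext hφ.1.div_dd]
    simp [dd]
  · have : (fun x => dd j φ x i) = dd j fun x => φ x i := funext fun x => (dd_apply hφ.1.sp j i x).symm
    rw [this, fcR_dd (hφ.1.sp.apply i), hφ.2 k hk i, mul_zero]

theorem comp_add_mem_X {n : ℕ} {φ : E3 → E3} (hφ : φ ∈ X n) (y : E3) : (fun x => φ (x + y)) ∈ X n := by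
  refine ⟨isSolenoidalTest_iff.2 ⟨hφ.1.sp.comp_add y, ?_, fun x => ?_⟩, fun k hk i => ?_⟩
  · rw [integral_comp_add hφ.1.periodic hφ.1.sp.continuous.aestronglyMeasurable, hφ.1.mean_zero]
  · simp_rw [dd_comp_add, hφ.1.div_dd]
  · have := fc_comp_add (hφ.1.sp.apply i).ofReal y k
    unfold fcR at *
    rw [this]
    have h2 := hφ.2 k hk i
    unfold fcR at h2
    rw [h2, mul_zero]

theorem integral_inner_eq_sum {ι : Type} [Fintype ι] {f g : E3 → EuclideanSpace ℝ ι} (hf : SP f)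
    (hg : SP g) : ∫ x in cube, inner ℝ (f x) (g x) = ∑ i, ∫ x in cube, f x i * g x i := by
  simp_rw [PiLp.inner_apply]
  rw [integral_finsetSum]
  · refine Finset.sum_congr rfl fun i _ => integral_congr_ae (ae_of_all _ fun x => ?_)
    simp [mul_comm]
  · intro i _
    exact ((hf.apply i).inner (hg.apply i)).integrable

theorem integral_norm_sq_eq_sum {ι : Type} [Fintype ι] {f : E3 → EuclideanSpace ℝ ι} (hf : SP f) :
    ∫ x in cube, ‖f x‖ ^ 2 = ∑ i, ∫ x in cube, f x i ^ 2 := by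
  have := integral_inner_eq_sum hf hf
  simp only [real_inner_self_eq_norm_sq] at this
  rw [this]
  simp_rw [pow_two]

theorem SP.norm_sq {F : Type} [NormedAddCommGroup F] [InnerProductSpace ℝ F] {g : E3 → F}
    (hg : SP g) : SP fun x => ‖g x‖ ^ 2 := by
  have := hg.inner hg
  simpa only [real_inner_self_eq_norm_sq] using this

theorem integral_norm_grad_sq {φ : E3 → E3} (hφ : SP φ) :
    ∫ x in cube, ‖grad φ x‖ ^ 2 = ∑ j, ∫ x in cube, ‖dd j φ x‖ ^ 2 := by
  simp_rw [norm_grad_sq hφ]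
  exact integral_finsetSum _ fun j _ => (hφ.dd j).norm_sq.integrable

/-- `L²`-orthogonal projection of a test field to `X n`. -/
theorem exists_projection {n : ℕ} (hn : 1 ≤ n) {φ : E3 → E3} (hφ : IsSolenoidalTest φ) :
    ∃ ψ ∈ X n, (∀ χ ∈ X n, ∫ x in cube, inner ℝ (φ x - ψ x) (χ x) = 0) ∧
      (∫ x in cube, ‖φ x - ψ x‖ ^ 2 ≤ ((n : ℝ) ^ 2)⁻¹ * ∫ x in cube, ‖grad φ x‖ ^ 2) ∧
      (∫ x in cube, ‖grad ψ x‖ ^ 2 ≤ ∫ x in cube, ‖grad φ x‖ ^ 2) ∧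
      (∫ x in cube, ‖grad φ x - grad ψ x‖ ^ 2 ≤ ((n : ℝ) ^ 2)⁻¹ * ∑ j, ∫ x in cube, ‖grad (dd j φ) x‖ ^ 2) := by
  let ψ : E3 → E3 := fun x => WithLp.toLp 2 fun i => truncR n (fun y => φ y i) x
  have hψ : SP ψ := SP.of_apply fun i => SP.truncR n _
  have hφs := hφ.sp
  have hddψ : ∀ j x i, dd j ψ x i = truncR n (fun y => dd j φ y i) x := by
    intro j x i
    rw [← dd_apply hψ]
    show dd j (truncR n fun y => φ y i) x = _
    rw [dd_truncR n (hφs.apply i)]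
    congr 1
    ext y; exact dd_apply hφs j i y
  have step : ∀ {f : E3 → E3} (hf : SP f) {g : E3 → E3} (hg : SP g) (_ : ∀ x i, g x i = truncR n (fun y => f y i) x),
      ∫ x in cube, ‖f x - g x‖ ^ 2 ≤ ((n : ℝ) ^ 2)⁻¹ * ∫ x in cube, ‖grad f x‖ ^ 2 := by
    intro f hf g hg h
    rw [integral_norm_sq_eq_sum (hf.sub hg), integral_norm_grad_sq hf]
    simp_rw [integral_norm_sq_eq_sum (hf.dd _), PiLp.sub_apply, h]
    rw [Finset.sum_comm, Finset.mul_sum]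
    refine Finset.sum_le_sum fun i _ => ?_
    refine (integral_sq_sub_truncR_le hn (hf.apply i)).trans_eq ?_
    simp_rw [dd_apply hf]
  refine ⟨ψ, ⟨isSolenoidalTest_iff.2 ⟨hψ, ?_, fun x => ?_⟩, fun k hk i => ?_⟩, fun χ hχ => ?_,
    step hφs hψ fun x i => rfl, ?_, ?_⟩
  · ext i
    rw [integral_apply_cube hψ, PiLp.zero_apply]
    have h0 : fcR (truncR n fun y => φ y i) 0 = 0 := by
      rw [fcR_truncR, if_pos (by simp [mem_box])]
      simp only [fcR, fc, neg_zero, char_zero, one_mul]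
      rw [integral_complex_ofReal, ← integral_apply_cube hφs, hφ.mean_zero]; simp
    simp only [fcR, fc, neg_zero, char_zero, one_mul] at h0
    rw [integral_complex_ofReal] at h0
    exact_mod_cast h0
  · apply Complex.ofReal_injective
    simp_rw [hddψ]
    push_cast
    simp_rw [ofReal_truncR]
    rw [Finset.sum_comm]
    refine Finset.sum_eq_zero fun k _ => ?_
    rw [← Finset.sum_mul]
    have h1 : ∑ i, fcR (fun y => dd i φ y i) k = fcR (fun y => ∑ i, dd i φ y i) k := by
      simp only [Fin.sum_univ_three]
      rw [fcR_add (((hφs.dd _).apply _).add ((hφs.dd _).apply _)) ((hφs.dd _).apply _),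
        fcR_add ((hφs.dd _).apply _) ((hφs.dd _).apply _)]
    rw [h1]
    simp [hφ.div_dd, fcR, fc]
  · show fcR (truncR n fun y => φ y i) k = 0
    rw [fcR_truncR, if_neg hk]
  · rw [integral_inner_eq_sum (hφs.sub hψ) hχ.1.sp]
    refine Finset.sum_eq_zero fun i _ => ?_
    exact integral_sub_truncR_mul (hφs.apply i) (hχ.1.sp.apply i) fun k hk => hχ.2 k hk i
  · rw [integral_norm_grad_sq hψ, integral_norm_grad_sq hφs]
    refine Finset.sum_le_sum fun j _ => ?_
    rw [integral_norm_sq_eq_sum (hψ.dd j), integral_norm_sq_eq_sum (hφs.dd j)]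
    refine Finset.sum_le_sum fun i _ => ?_
    simp_rw [hddψ]
    exact integral_sq_truncR_le n ((hφs.dd j).apply i)
  · have h1 : ∀ x, ‖grad φ x - grad ψ x‖ ^ 2 = ∑ j, ‖dd j φ x - dd j ψ x‖ ^ 2 := by
      intro x
      simp only [EuclideanSpace.norm_sq_eq, Fintype.sum_prod_type, PiLp.sub_apply, grad_apply hφs, grad_apply hψ]
      exact Finset.sum_comm
    simp_rw [h1]
    rw [integral_finsetSum _ fun j _ => ((hφs.dd j).sub (hψ.dd j)).norm_sq.integrable, Finset.mul_sum]
    exact Finset.sum_le_sum fun j _ => step (hφs.dd j) (hψ.dd j) fun x i => hddψ j x i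

instance finiteDimensional_X (n : ℕ) : FiniteDimensional ℝ (X n) := by
  let L : X n →ₗ[ℝ] (box n → Fin 3 → ℂ) :=
    { toFun := fun φ k i => fcR (fun x => φ.1 x i) k
      map_add' := fun φ ψ => by
        ext k i
        exact fcR_add (φ.2.1.sp.apply i) (ψ.2.1.sp.apply i) k
      map_smul' := fun c φ => by
        ext k i
        simpa using fcR_const_mul c (fun x => φ.1 x i) k }
  refine FiniteDimensional.of_injective L ((injective_iff_map_eq_zero L).2 fun φ h => ?_)
  have h0 : ∀ i, ∫ x in cube, φ.1 x i ^ 2 = 0 := by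
    intro i
    refine (hasSum_normSq_fcR (φ.2.1.sp.apply i)).unique ?_
    convert! hasSum_zero using 1
    ext k
    by_cases hk : k ∈ box n
    · have := congrFun (congrFun h ⟨k, hk⟩) i
      have : fcR (fun x => φ.1 x i) k = 0 := this
      rw [this]; simp
    · rw [φ.2.2 k hk i]; simp
  ext x i
  exact (φ.2.1.sp.apply i).eq_zero_of_integral (by simpa using h0 i) x

end Fourier

section Stress

variable {E : Type} [NormedAddCommGroup E] [InnerProductSpace ℝ E]

/-- The regularised weight `(μ + |A|²)^((r-2)/2)`. -/
def wt (μ r : ℝ) (A : E) : ℝ := (μ + ‖A‖ ^ 2) ^ ((r - 2) / 2)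

/-- The regularised stress `(μ + |A|²)^((r-2)/2) A`. -/
def Sm (μ r : ℝ) (A : E) : E := wt μ r A • A

/-- The stress `|A|^(r-2) A` in an arbitrary inner product space. -/
def St (r : ℝ) (A : E) : E := ‖A‖ ^ (r - 2) • A

variable {μ r : ℝ}

theorem wt_nonneg (hμ : 0 ≤ μ) (A : E) : 0 ≤ wt μ r A := by unfold wt; positivity

theorem wt_pos (hμ : 0 < μ) (A : E) : 0 < wt μ r A := by unfold wt; positivity

theorem contDiff_wt (hμ : 0 < μ) : ContDiff ℝ ∞ (wt μ r : E → ℝ) := by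
  refine ContDiff.rpow_const_of_ne (contDiff_const.add (contDiff_norm_sq ℝ)) fun x => ?_
  positivity

theorem contDiff_Sm (hμ : 0 < μ) : ContDiff ℝ ∞ (Sm μ r : E → E) :=
  (contDiff_wt hμ).smul contDiff_id

theorem hasFDerivAt_rpow (hμ : 0 < μ) (s : ℝ) (A : E) : HasFDerivAt (fun A : E => (μ + ‖A‖ ^ 2) ^ s)
      ((2 * s * (μ + ‖A‖ ^ 2) ^ (s - 1)) • innerSL ℝ A) A := by
  have h1 : HasFDerivAt (fun A : E => μ + ‖A‖ ^ 2) (2 • innerSL ℝ A) A :=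
    (hasStrictFDerivAt_norm_sq A).hasFDerivAt.const_add μ
  have h2 := h1.rpow_const (p := s) (Or.inl (by positivity))
  convert! h2 using 1
  ext H
  simp; ring

theorem hasFDerivAt_Sm (hμ : 0 < μ) (A : E) : HasFDerivAt (Sm μ r) (wt μ r A • ContinuousLinearMap.id ℝ E +
      (((r - 2) * (μ + ‖A‖ ^ 2) ^ ((r - 2) / 2 - 1)) • innerSL ℝ A).smulRight A) A := by
  have h := (hasFDerivAt_rpow hμ ((r - 2) / 2) A).smul (hasFDerivAt_id A)
  convert! h using 1
  ext H
  simp only [add_apply, smul_apply, ContinuousLinearMap.smulRight_apply, id]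
  congr 3
  ring

theorem fderiv_Sm_apply (hμ : 0 < μ) (A H : E) : fderiv ℝ (Sm μ r) A H =
    wt μ r A • (H + ((r - 2) / (μ + ‖A‖ ^ 2) * inner ℝ A H) • A) := by
  have hpos : 0 < μ + ‖A‖ ^ 2 := by positivity
  rw [(hasFDerivAt_Sm hμ A).fderiv]
  simp only [add_apply, smul_apply, ContinuousLinearMap.smulRight_apply, ContinuousLinearMap.id_apply,
    innerSL_apply_apply, smul_add, smul_smul]
  congr 2
  rw [Real.rpow_sub_one hpos.ne', wt, smul_eq_mul]
  ring

theorem le_inner_fderiv_Sm (hμ : 0 < μ) (hr2 : r ≤ 2) (A H : E) :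
    (r - 1) * (wt μ r A * ‖H‖ ^ 2) ≤ inner ℝ (fderiv ℝ (Sm μ r) A H) H := by
  have hpos : 0 < μ + ‖A‖ ^ 2 := by positivity
  have hw := wt_pos (r := r) hμ A
  rw [fderiv_Sm_apply hμ, inner_smul_left, inner_add_left, inner_smul_left, real_inner_self_eq_norm_sq]
  simp only [conj_trivial]
  have hcs : inner ℝ A H ^ 2 ≤ (μ + ‖A‖ ^ 2) * ‖H‖ ^ 2 := by
    have := abs_real_inner_le_norm A H
    have h2 : inner ℝ A H ^ 2 ≤ (‖A‖ * ‖H‖) ^ 2 := by rw [← sq_abs]; gcongr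
    nlinarith [sq_nonneg ‖H‖]
  have h3 : (r - 2) * ‖H‖ ^ 2 ≤ (r - 2) / (μ + ‖A‖ ^ 2) * inner ℝ A H * inner ℝ A H := by
    rw [div_mul_eq_mul_div, div_mul_eq_mul_div, le_div_iff₀ hpos]
    nlinarith
  nlinarith

theorem norm_fderiv_Sm_apply_le (hμ : 0 < μ) (hr1 : 1 ≤ r) (hr2 : r ≤ 2) (A H : E) :
    ‖fderiv ℝ (Sm μ r) A H‖ ≤ wt μ r A * ‖H‖ := by
  have hpos : 0 < μ + ‖A‖ ^ 2 := by positivity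
  rw [fderiv_Sm_apply hμ, norm_smul, Real.norm_of_nonneg (wt_nonneg hμ.le A)]
  refine mul_le_mul_of_nonneg_left ?_ (wt_nonneg hμ.le A)
  refine abs_le_of_sq_le_sq' ?_ (norm_nonneg _) |>.2
  set c := (r - 2) / (μ + ‖A‖ ^ 2)
  have hc0 : c ≤ 0 := div_nonpos_of_nonpos_of_nonneg (by linarith) hpos.le
  have hc1 : -1 ≤ c * ‖A‖ ^ 2 := by
    rw [div_mul_eq_mul_div, le_div_iff₀ hpos]
    nlinarith [sq_nonneg ‖A‖]
  have : ‖H + (c * inner ℝ A H) • A‖ ^ 2 = ‖H‖ ^ 2 + c * (inner ℝ A H ^ 2 * (2 + c * ‖A‖ ^ 2)) := by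
    rw [norm_add_sq_real, inner_smul_right, norm_smul, real_inner_comm, mul_pow, Real.norm_eq_abs, sq_abs]
    ring
  rw [this]
  have : 0 ≤ inner ℝ A H ^ 2 * (2 + c * ‖A‖ ^ 2) := mul_nonneg (sq_nonneg _) (by linarith)
  nlinarith

theorem wt_le (hμ : 0 < μ) (hr2 : r ≤ 2) (A : E) : wt μ r A ≤ μ ^ ((r - 2) / 2) := by
  refine Real.rpow_le_rpow_of_nonpos (by positivity) ?_ (by linarith)
  linarith [sq_nonneg ‖A‖]

theorem Sm_monotone (hμ : 0 < μ) (hr1 : 1 ≤ r) (hr2 : r ≤ 2) (A B : E) :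
    (r - 1) * ((μ + (‖A‖ + ‖B‖) ^ 2) ^ ((r - 2) / 2) * ‖A - B‖ ^ 2) ≤ inner ℝ (Sm μ r A - Sm μ r B) (A - B) := by
  set H := A - B
  have hd : ∀ s : ℝ, HasDerivAt (fun s : ℝ => inner ℝ (Sm μ r (B + s • H)) H)
      (inner ℝ (fderiv ℝ (Sm μ r) (B + s • H) H) H) s := by
    intro s
    have h1 : HasDerivAt (fun s : ℝ => B + s • H) H s := by
      simpa using ((hasDerivAt_id s).smul_const H).const_add B
    have h2 := (((contDiff_Sm (E := E) (r := r) hμ).differentiable (by simp))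
      (B + s • H)).hasFDerivAt.comp_hasDerivAt s h1
    simpa using h2.inner ℝ (hasDerivAt_const s H)
  obtain ⟨s, hs, he⟩ := exists_hasDerivAt_eq_slope _ _ zero_lt_one
    (fun s _ => (hd s).continuousAt.continuousWithinAt) fun s _ => hd s
  have hAB : B + (1 : ℝ) • H = A := by simp [H]
  rw [hAB, zero_smul, add_zero, sub_zero, div_one, ← inner_sub_left] at he
  rw [← he]
  refine le_trans ?_ (le_inner_fderiv_Sm hμ hr2 _ _)
  have hn : ‖B + s • H‖ ≤ ‖A‖ + ‖B‖ := by
    have : B + s • H = s • A + (1 - s) • B := by simp only [H]; module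
    rw [this]
    refine (norm_add_le _ _).trans ?_
    rw [norm_smul, norm_smul, Real.norm_of_nonneg hs.1.le, Real.norm_of_nonneg (by linarith [hs.2])]
    nlinarith [norm_nonneg A, norm_nonneg B, hs.1, hs.2]
  refine mul_le_mul_of_nonneg_left (mul_le_mul_of_nonneg_right ?_ (sq_nonneg _)) (by linarith)
  refine Real.rpow_le_rpow_of_nonpos (by positivity) ?_ (by linarith)
  gcongr

theorem norm_Sm_sub_le (hμ : 0 < μ) (hr1 : 1 ≤ r) (hr2 : r ≤ 2) (A B : E) :
    ‖Sm μ r A - Sm μ r B‖ ≤ μ ^ ((r - 2) / 2) * ‖A - B‖ := by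
  refine convex_univ.norm_image_sub_le_of_norm_fderiv_le (𝕜 := ℝ) (fun x _ =>
    ((contDiff_Sm (E := E) (r := r) hμ).differentiable (by simp)) x) (fun x _ => ?_)
    (mem_univ B) (mem_univ A)
  refine ContinuousLinearMap.opNorm_le_bound _ (by positivity) fun H => ?_
  refine (norm_fderiv_Sm_apply_le hμ hr1 hr2 x H).trans ?_
  gcongr
  exact wt_le hμ hr2 x

theorem norm_St (hr1 : 1 < r) (A : E) : ‖St r A‖ = ‖A‖ ^ (r - 1) := by
  rw [St, norm_smul, Real.norm_of_nonneg (by positivity)]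
  rcases eq_or_ne A 0 with rfl | h
  · simp [Real.zero_rpow (by linarith : r - 1 ≠ 0)]
  · have : 0 < ‖A‖ := norm_pos_iff.2 h
    rw [← Real.rpow_add_one this.ne']; congr 1; ring

theorem norm_Sm_sub_St_le (hμ : 0 < μ) (hr1 : 1 < r) (hr2 : r ≤ 2) (A : E) :
    ‖Sm μ r A - St r A‖ ≤ μ ^ ((r - 1) / 2) := by
  rcases eq_or_ne A 0 with rfl | h
  · simp [Sm, St]; positivity
  have ha : 0 < ‖A‖ := norm_pos_iff.2 h
  set a := ‖A‖
  have e1 : a ^ (r - 2) = (a ^ 2) ^ ((r - 2) / 2) := by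
    rw [← Real.rpow_natCast, ← Real.rpow_mul ha.le]; congr 1; push_cast; ring
  have hle : wt μ r A ≤ a ^ (r - 2) := by
    rw [e1]
    exact Real.rpow_le_rpow_of_nonpos (by positivity) (by simp [a, hμ.le]) (by linarith)
  have h1 : ‖Sm μ r A - St r A‖ = (a ^ (r - 2) - wt μ r A) * a := by
    rw [Sm, St, ← sub_smul, norm_smul, Real.norm_eq_abs, abs_of_nonpos (by linarith)]; ring
  have hp : 0 < μ + a ^ 2 := by positivity
  have h2 : (μ + a ^ 2) ^ ((r - 1) / 2) = √(μ + a ^ 2) * wt μ r A := by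
    rw [Real.sqrt_eq_rpow, wt, ← Real.rpow_add hp]; congr 1; ring
  have h3 : √μ * wt μ r A ≤ μ ^ ((r - 1) / 2) := by
    refine (mul_le_mul_of_nonneg_left (wt_le hμ hr2 A) (Real.sqrt_nonneg μ)).trans_eq ?_
    rw [Real.sqrt_eq_rpow, ← Real.rpow_add hμ]; congr 1; ring
  have h4 : a ^ (r - 2) * a ≤ (μ + a ^ 2) ^ ((r - 1) / 2) := by
    calc a ^ (r - 2) * a = (a ^ 2) ^ ((r - 1) / 2) := by
          rw [← Real.rpow_add_one ha.ne', ← Real.rpow_natCast a 2, ← Real.rpow_mul ha.le]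
          congr 1; push_cast; ring
      _ ≤ _ := Real.rpow_le_rpow (by positivity) (by linarith) (by linarith)
  have h5 : √(μ + a ^ 2) ≤ √μ + a := Real.sqrt_le_iff.2 ⟨by positivity, by
    have := mul_nonneg (Real.sqrt_nonneg μ) ha.le
    rw [add_sq, Real.sq_sqrt hμ.le]; linarith⟩
  have h6 := mul_le_mul_of_nonneg_right h5 (wt_nonneg (r := r) hμ.le A)
  linarith

theorem norm_St_sub_le (hr1 : 1 < r) (hr2 : r ≤ 2) (A B : E) : ‖St r A - St r B‖ ≤ 3 * ‖A - B‖ ^ (r - 1) := by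
  rcases eq_or_ne A B with rfl | h
  · simp [Real.zero_rpow (by linarith : r - 1 ≠ 0)]
  have hd : 0 < ‖A - B‖ := norm_pos_iff.2 (sub_ne_zero.2 h)
  set d := ‖A - B‖
  have hd2 : 0 < d ^ 2 := by positivity
  have e1 : (d ^ 2) ^ ((r - 1) / 2) = d ^ (r - 1) := by
    rw [← Real.rpow_natCast, ← Real.rpow_mul hd.le]; congr 1; push_cast; ring
  have e2 : (d ^ 2) ^ ((r - 2) / 2) * d = d ^ (r - 1) := by
    rw [← Real.rpow_natCast, ← Real.rpow_mul hd.le, ← Real.rpow_add_one hd.ne']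
    congr 1; push_cast; ring
  have h1 := norm_Sm_sub_St_le hd2 hr1 hr2 A
  have h2 := norm_Sm_sub_St_le hd2 hr1 hr2 B
  have h3 := norm_Sm_sub_le hd2 hr1.le hr2 A B
  rw [e1] at h1 h2
  rw [e2] at h3
  have : St r A - St r B = -(Sm (d ^ 2) r A - St r A) + (Sm (d ^ 2) r A - Sm (d ^ 2) r B) +
      (Sm (d ^ 2) r B - St r B) := by abel
  rw [this]
  refine (norm_add₃_le).trans ?_
  rw [norm_neg]
  linarith

theorem tendsto_Sm (hr1 : 1 < r) (hr2 : r ≤ 2) (A : E) : Tendsto (fun μ => Sm μ r A) (𝓝[>] 0) (𝓝 (St r A)) := by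
  rw [tendsto_iff_norm_sub_tendsto_zero]
  have h0 : Tendsto (fun μ : ℝ => μ ^ ((r - 1) / 2)) (𝓝[>] 0) (𝓝 0) := by
    have := (Real.continuousAt_rpow_const 0 ((r - 1) / 2) (Or.inr (by linarith))).tendsto
    rw [Real.zero_rpow (by linarith)] at this
    exact this.mono_left nhdsWithin_le_nhds
  refine squeeze_zero' (Eventually.of_forall fun _ => norm_nonneg _) ?_ h0
  filter_upwards [self_mem_nhdsWithin] with μ hμ
  exact norm_Sm_sub_St_le hμ hr1 hr2 A

theorem St_monotone (hr1 : 1 < r) (hr2 : r ≤ 2) (A B : E) :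
    (r - 1) * ((‖A‖ + ‖B‖) ^ (r - 2) * ‖A - B‖ ^ 2) ≤ inner ℝ (St r A - St r B) (A - B) := by
  rcases eq_or_ne A B with rfl | h
  · simp
  have hx : 0 < ‖A‖ + ‖B‖ := by
    rcases eq_or_ne A 0 with rfl | hA
    · have := norm_pos_iff.2 h.symm; simpa using h.symm
    · have := norm_pos_iff.2 hA; positivity
  set x := ‖A‖ + ‖B‖
  have e1 : x ^ (r - 2) = (0 + x ^ 2) ^ ((r - 2) / 2) := by
    rw [zero_add, ← Real.rpow_natCast, ← Real.rpow_mul hx.le]; congr 1; push_cast; ring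
  rw [e1]
  have hl : Tendsto (fun μ : ℝ => (r - 1) * ((μ + x ^ 2) ^ ((r - 2) / 2) * ‖A - B‖ ^ 2)) (𝓝[>] 0)
      (𝓝 ((r - 1) * ((0 + x ^ 2) ^ ((r - 2) / 2) * ‖A - B‖ ^ 2))) := by
    refine Tendsto.mono_left ?_ (nhdsWithin_le_nhds (s := Ioi 0))
    have : ContinuousAt (fun μ : ℝ => (μ + x ^ 2) ^ ((r - 2) / 2)) 0 :=
      (continuousAt_id.add continuousAt_const).rpow_const (Or.inl (by simp; positivity))
    exact (this.tendsto.mul_const _).const_mul _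
  refine le_of_tendsto_of_tendsto hl (((tendsto_Sm hr1 hr2 A).sub (tendsto_Sm hr1 hr2 B)).inner tendsto_const_nhds) ?_
  filter_upwards [self_mem_nhdsWithin] with μ hμ
  exact Sm_monotone hμ hr1.le hr2 A B

theorem norm_St_sub_le_weight_aux (hr1 : 1 < r) (hr2 : r ≤ 2) {A B : E} (hBA : ‖B‖ ≤ ‖A‖) :
    ‖St r A - St r B‖ ≤ 8 * ((‖A‖ + ‖B‖) ^ (r - 2) * ‖A - B‖) := by
  rcases eq_or_ne A 0 with rfl | hA
  · have : B = 0 := by simpa using hBA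
    simp [this]
  have ha : 0 < ‖A‖ := norm_pos_iff.2 hA
  have two_rpow : (2 : ℝ) ^ (2 - r) ≤ 2 := by
    conv_rhs => rw [← Real.rpow_one 2]
    exact Real.rpow_le_rpow_of_exponent_le (by norm_num) (by linarith)
  have h1 : ‖A‖ ^ (r - 2) ≤ 2 * (‖A‖ + ‖B‖) ^ (r - 2) := by
    calc ‖A‖ ^ (r - 2) ≤ ((‖A‖ + ‖B‖) / 2) ^ (r - 2) :=
          Real.rpow_le_rpow_of_nonpos (by positivity) (by linarith) (by linarith)
      _ = 2 ^ (2 - r) * (‖A‖ + ‖B‖) ^ (r - 2) := by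
          rw [Real.div_rpow (by positivity) (by norm_num), div_eq_mul_inv, ← Real.rpow_neg (by norm_num), neg_sub, mul_comm]
      _ ≤ _ := by gcongr
  have h2 : ‖(‖A‖ ^ (r - 2) - ‖B‖ ^ (r - 2)) • B‖ ≤ ‖A‖ ^ (r - 2) * ‖A - B‖ := by
    rcases eq_or_ne B 0 with rfl | hB
    · rw [smul_zero, norm_zero]; positivity
    have hb : 0 < ‖B‖ := norm_pos_iff.2 hB
    have h3 := Real.rpow_le_rpow_of_nonpos hb hBA (by linarith : r - 2 ≤ 0)
    have h4 : ‖B‖ ^ (r - 2) * ‖B‖ ≤ ‖A‖ ^ (r - 2) * ‖A‖ := by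
      rw [← Real.rpow_add_one hb.ne', ← Real.rpow_add_one ha.ne']
      exact Real.rpow_le_rpow hb.le hBA (by linarith)
    rw [norm_smul, Real.norm_of_nonpos (by linarith)]
    have h5 := mul_le_mul_of_nonneg_left (norm_sub_norm_le A B) (by positivity : 0 ≤ ‖A‖ ^ (r - 2))
    linarith
  have e : St r A - St r B = ‖A‖ ^ (r - 2) • (A - B) + (‖A‖ ^ (r - 2) - ‖B‖ ^ (r - 2)) • B := by
    rw [St, St]; module
  rw [e]
  refine (norm_add_le _ _).trans ?_
  rw [norm_smul, Real.norm_of_nonneg (by positivity)]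
  have h3 := mul_le_mul_of_nonneg_right h1 (norm_nonneg (A - B))
  have h4 : 0 ≤ (‖A‖ + ‖B‖) ^ (r - 2) * ‖A - B‖ := by positivity
  linarith

theorem norm_St_sub_le_weight (hr1 : 1 < r) (hr2 : r ≤ 2) (A B : E) :
    ‖St r A - St r B‖ ≤ 8 * ((‖A‖ + ‖B‖) ^ (r - 2) * ‖A - B‖) := by
  rcases le_total ‖B‖ ‖A‖ with h | h
  · exact norm_St_sub_le_weight_aux hr1 hr2 h
  · rw [norm_sub_rev, norm_sub_rev A, add_comm]
    exact norm_St_sub_le_weight_aux hr1 hr2 h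

/-- Comparison of the stress `|A|^(r-2) A` with `V(A) = |A|^((r-2)/2) A`. -/
theorem inner_St_sub_le (hr1 : 1 < r) (hr2 : r ≤ 2) (A B : E) :
    inner ℝ (St r A - St r B) (A - B) ≤ 32 * ‖St ((r + 2) / 2) A - St ((r + 2) / 2) B‖ ^ 2 := by
  rcases eq_or_ne A B with rfl | h
  · simp
  have hx : 0 < ‖A‖ + ‖B‖ := by
    rcases eq_or_ne A 0 with rfl | hA
    · simpa using h.symm
    · have := norm_pos_iff.2 hA; positivity
  have hd : 0 < ‖A - B‖ := norm_pos_iff.2 (sub_ne_zero.2 h)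
  set x := ‖A‖ + ‖B‖
  set d := ‖A - B‖
  set V := ‖St ((r + 2) / 2) A - St ((r + 2) / 2) B‖
  have h1 : inner ℝ (St r A - St r B) (A - B) ≤ 8 * (x ^ (r - 2) * d) * d := (real_inner_le_norm _ _).trans
      (mul_le_mul_of_nonneg_right (norm_St_sub_le_weight hr1 hr2 A B) hd.le)
  have h2 := St_monotone (r := (r + 2) / 2) (by linarith) (by linarith) A B
  have h3 := h2.trans (real_inner_le_norm _ _)
  set y := x ^ ((r + 2) / 2 - 2)
  have hy : 0 < y := Real.rpow_pos_of_pos hx _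
  have hyy : y ^ 2 = x ^ (r - 2) := by
    rw [← Real.rpow_natCast, ← Real.rpow_mul hx.le]; congr 1; push_cast; ring
  have h4 : (1/2) * (y * d) ≤ V := by
    have : ((r + 2) / 2 - 1) * (y * d ^ 2) ≤ V * d := h3
    have h5 : (1/2) * (y * d ^ 2) ≤ V * d := by nlinarith [mul_pos hy (pow_pos hd 2)]
    have : (1/2) * (y * d) * d ≤ V * d := by linarith
    exact le_of_mul_le_mul_right this hd
  have h5 : ((1/2) * (y * d)) ^ 2 ≤ V ^ 2 := by gcongr
  rw [← hyy] at h1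
  nlinarith

/-- The inverse square root of the weight is Hölder continuous. -/
theorem abs_rpow_weight_sub_le {α : ℝ} (hα0 : 0 < α) (hα1 : α ≤ 1) (hμ : 0 ≤ μ) (A B : E) :
    |(μ + ‖A‖ ^ 2) ^ (α / 2) - ‖B‖ ^ α| ≤ μ ^ (α / 2) + ‖A - B‖ ^ α := by
  have key : ∀ x y : ℝ, 0 ≤ x → 0 ≤ y → (x + y) ^ α ≤ x ^ α + y ^ α := fun x y hx hy =>
    Real.rpow_add_le_add_rpow hx hy hα0.le hα1
  have e : ∀ x : ℝ, 0 ≤ x → (x ^ 2) ^ (α / 2) = x ^ α := fun x hx => by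
    rw [← Real.rpow_natCast, ← Real.rpow_mul hx]; congr 1; push_cast; ring
  have h1 : (μ + ‖A‖ ^ 2) ^ (α / 2) ≤ μ ^ (α / 2) + ‖A‖ ^ α := by
    rw [← e _ (norm_nonneg A)]
    exact Real.rpow_add_le_add_rpow hμ (sq_nonneg _) (by linarith) (by linarith)
  have h2 : ‖A‖ ^ α ≤ (μ + ‖A‖ ^ 2) ^ (α / 2) := by
    rw [← e _ (norm_nonneg A)]
    exact Real.rpow_le_rpow (by positivity) (by linarith) (by linarith)
  have h3 : ‖A‖ ^ α ≤ ‖B‖ ^ α + ‖A - B‖ ^ α := by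
    refine le_trans (Real.rpow_le_rpow (norm_nonneg _) ?_ hα0.le) (key _ _ (norm_nonneg _) (norm_nonneg _))
    have := norm_add_le B (A - B); simpa using this
  have h4 : ‖B‖ ^ α ≤ ‖A‖ ^ α + ‖A - B‖ ^ α := by
    refine le_trans (Real.rpow_le_rpow (norm_nonneg _) ?_ hα0.le) (key _ _ (norm_nonneg _) (norm_nonneg _))
    have := norm_sub_le A (A - B); simpa using this
  have h5 : 0 ≤ μ ^ (α / 2) := by positivity
  rw [abs_le]; constructor <;> linarith

end Stress

section Norms

variable {F G : Type} [NormedAddCommGroup F] [NormedAddCommGroup G]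

/-- The `L^q(Ω)` norm as a real number. -/
def nm (q : ℝ≥0∞) (g : E3 → F) : ℝ := (eLpNorm g q volΩ).toReal

theorem nm_nonneg (q : ℝ≥0∞) (g : E3 → F) : 0 ≤ nm q g := ENNReal.toReal_nonneg

theorem norm_eq_nm {q : ℝ≥0∞} (u : LΩ F q) : ‖u‖ = nm q u := rfl

theorem nm_congr {q : ℝ≥0∞} {f g : E3 → F} (h : f =ᵐ[volΩ] g) : nm q f = nm q g := by
  rw [nm, nm, eLpNorm_congr_ae h]

theorem norm_toLp_eq_nm {q : ℝ≥0∞} {g : E3 → F} (hg : MemLp g q volΩ) : ‖hg.toLp g‖ = nm q g :=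
  Lp.norm_toLp g hg

theorem nm_mono {q : ℝ≥0∞} {f : E3 → F} {g : E3 → G} (hg : MemLp g q volΩ)
    (h : ∀ᵐ x ∂volΩ, ‖f x‖ ≤ ‖g x‖) : nm q f ≤ nm q g :=
  ENNReal.toReal_mono hg.2.ne (eLpNorm_mono_ae h)

theorem nm_le_mul {q : ℝ≥0∞} {f : E3 → F} {g : E3 → G} (hg : MemLp g q volΩ) {c : ℝ} (hc : 0 ≤ c)
    (h : ∀ᵐ x ∂volΩ, ‖f x‖ ≤ c * ‖g x‖) : nm q f ≤ c * nm q g := by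
  have h1 := eLpNorm_le_mul_eLpNorm_of_ae_le_mul h q
  have h2 := ENNReal.toReal_mono (ENNReal.mul_ne_top ENNReal.ofReal_ne_top hg.2.ne) h1
  rwa [ENNReal.toReal_mul, ENNReal.toReal_ofReal hc] at h2

theorem nm_exponent_le {a b : ℝ≥0∞} (hab : a ≤ b) {g : E3 → F} (hg : MemLp g b volΩ) : nm a g ≤ nm b g :=
  ENNReal.toReal_mono hg.2.ne (eLpNorm_le_eLpNorm_of_exponent_le hab hg.1)

theorem nm_norm (q : ℝ≥0∞) (g : E3 → F) : nm q (fun x => ‖g x‖) = nm q g := by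
  rw [nm, nm, eLpNorm_norm]

theorem nm_add_le {q : ℝ≥0∞} (hq : 1 ≤ q) {f g : E3 → F} (hf : MemLp f q volΩ)
    (hg : MemLp g q volΩ) : nm q (fun x => f x + g x) ≤ nm q f + nm q g := by
  rw [nm, nm, nm, ← ENNReal.toReal_add hf.2.ne hg.2.ne]
  exact ENNReal.toReal_mono (ENNReal.add_ne_top.2 ⟨hf.2.ne, hg.2.ne⟩) (eLpNorm_add_le hf.1 hg.1 hq)

theorem nm_sub_le {q : ℝ≥0∞} (hq : 1 ≤ q) {f g : E3 → F} (hf : MemLp f q volΩ)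
    (hg : MemLp g q volΩ) : nm q (fun x => f x - g x) ≤ nm q f + nm q g := by
  rw [nm, nm, nm, ← ENNReal.toReal_add hf.2.ne hg.2.ne]
  exact ENNReal.toReal_mono (ENNReal.add_ne_top.2 ⟨hf.2.ne, hg.2.ne⟩) (eLpNorm_sub_le hf.1 hg.1 hq)

theorem nm_const (q : ℝ≥0∞) (hq : q ≠ 0) (c : F) : nm q (fun _ => c) = ‖c‖ := by
  rw [nm, eLpNorm_const c hq (IsProbabilityMeasure.ne_zero _)]
  simp

theorem nm_two_sq {g : E3 → F} (hg : MemLp g 2 volΩ) : nm 2 g ^ 2 = ∫ x in cube, ‖g x‖ ^ 2 := by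
  have h := hg.eLpNorm_eq_integral_rpow_norm (by norm_num) (by norm_num)
  rw [nm, h, ENNReal.toReal_ofReal (by positivity)]
  simp only [ENNReal.toReal_ofNat]
  have h2 : ∀ x, ‖g x‖ ^ (2:ℝ) = ‖g x‖ ^ 2 := fun x => Real.rpow_two _
  simp_rw [h2]
  rw [← Real.rpow_natCast, ← Real.rpow_mul (integral_nonneg fun x => by positivity)]
  norm_num

theorem eLpNorm_mul_norm_le {a b c : ℝ≥0∞} [ENNReal.HolderTriple a b c] {f : E3 → F} {g : E3 → G}
    (hf : AEStronglyMeasurable f volΩ) (hg : AEStronglyMeasurable g volΩ) :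
    eLpNorm (fun x => ‖f x‖ * ‖g x‖) c volΩ ≤ eLpNorm f a volΩ * eLpNorm g b volΩ := by
  have := eLpNorm_smul_le_mul_eLpNorm (p := a) (q := b) (r := c) hg.norm hf.norm
  rwa [eLpNorm_norm, eLpNorm_norm] at this

theorem memLp_mul_norm {a b c : ℝ≥0∞} [ENNReal.HolderTriple a b c] {f : E3 → F} {g : E3 → G}
    (hf : MemLp f a volΩ) (hg : MemLp g b volΩ) : MemLp (fun x => ‖f x‖ * ‖g x‖) c volΩ :=
  ⟨hf.1.norm.mul hg.1.norm, (eLpNorm_mul_norm_le hf.1 hg.1).trans_lt (ENNReal.mul_lt_top hf.2 hg.2)⟩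

theorem nm_mul_norm_le {a b c : ℝ≥0∞} [ENNReal.HolderTriple a b c] {f : E3 → F} {g : E3 → G}
    (hf : MemLp f a volΩ) (hg : MemLp g b volΩ) :
    nm c (fun x => ‖f x‖ * ‖g x‖) ≤ nm a f * nm b g := by
  rw [nm, nm, nm, ← ENNReal.toReal_mul]
  exact ENNReal.toReal_mono (ENNReal.mul_ne_top hf.2.ne hg.2.ne) (eLpNorm_mul_norm_le hf.1 hg.1)

theorem nm_one_eq_integral {g : E3 → F} (hg : AEStronglyMeasurable g volΩ) : nm 1 g = ∫ x in cube, ‖g x‖ := by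
  rw [nm, eLpNorm_one_eq_lintegral_enorm, integral_norm_eq_lintegral_enorm hg]

theorem integral_mul_norm_le {a b : ℝ≥0∞} [ENNReal.HolderConjugate a b] {f : E3 → F} {g : E3 → G}
    (hf : MemLp f a volΩ) (hg : MemLp g b volΩ) :
    ∫ x in cube, ‖f x‖ * ‖g x‖ ≤ nm a f * nm b g := by
  have h := nm_mul_norm_le (c := 1) hf hg
  have hm : AEStronglyMeasurable (fun x => ‖f x‖ * ‖g x‖) volΩ := hf.1.norm.mul hg.1.norm
  rw [nm_one_eq_integral hm] at h
  simpa using h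

theorem integrable_mul_norm {a b : ℝ≥0∞} [ENNReal.HolderConjugate a b] {f : E3 → F} {g : E3 → G}
    (hf : MemLp f a volΩ) (hg : MemLp g b volΩ) : Integrable (fun x => ‖f x‖ * ‖g x‖) volΩ :=
  memLp_one_iff_integrable.1 (memLp_mul_norm hf hg)

theorem integrable_inner {F : Type} [NormedAddCommGroup F] [InnerProductSpace ℝ F] {a b : ℝ≥0∞}
    [ENNReal.HolderConjugate a b] {f g : E3 → F} (hf : MemLp f a volΩ) (hg : MemLp g b volΩ) :
    Integrable (fun x => (inner ℝ (f x) (g x) : ℝ)) volΩ :=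
  (integrable_mul_norm hf hg).mono (hf.1.inner (𝕜 := ℝ) hg.1) (ae_of_all _ fun x => by
      rw [Real.norm_of_nonneg (by positivity : 0 ≤ ‖f x‖ * ‖g x‖)]; exact norm_inner_le_norm _ _)

theorem abs_integral_inner_le {F : Type} [NormedAddCommGroup F] [InnerProductSpace ℝ F] {a b : ℝ≥0∞}
    [ENNReal.HolderConjugate a b] {f g : E3 → F} (hf : MemLp f a volΩ) (hg : MemLp g b volΩ) :
    |∫ x in cube, inner ℝ (f x) (g x)| ≤ nm a f * nm b g := by
  rw [← Real.norm_eq_abs]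
  refine (norm_integral_le_integral_norm _).trans ((integral_mono ?_ ?_ fun x => ?_).trans (integral_mul_norm_le hf hg))
  · exact (integrable_inner hf hg).norm
  · exact integrable_mul_norm hf hg
  · exact norm_inner_le_norm _ _

instance : ENNReal.HolderTriple 4 4 2 := ⟨by
  rw [← ENNReal.toReal_eq_toReal_iff' (by simp) (by simp), ENNReal.toReal_add (by simp) (by simp)]
  norm_num⟩

instance : ENNReal.HolderTriple 6 3 2 := ⟨by
  rw [← ENNReal.toReal_eq_toReal_iff' (by simp) (by simp), ENNReal.toReal_add (by simp) (by simp)]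
  norm_num⟩

/-- Hölder's inequality for three factors. -/
theorem integral_mul_mul_norm_le {H : Type} [NormedAddCommGroup H] {a b : ℝ≥0∞}
    [ENNReal.HolderTriple a b 2] {f : E3 → F} {g : E3 → G} {h : E3 → H} (hf : MemLp f a volΩ)
    (hg : MemLp g 2 volΩ) (hh : MemLp h b volΩ) :
    ∫ x in cube, ‖f x‖ * ‖g x‖ * ‖h x‖ ≤ nm a f * nm 2 g * nm b h := by
  have h1 := memLp_mul_norm (c := 2) hf hh
  have h2 := integral_mul_norm_le h1 hg
  have h3 := nm_mul_norm_le (c := 2) hf hh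
  calc ∫ x in cube, ‖f x‖ * ‖g x‖ * ‖h x‖ = ∫ x in cube, ‖‖f x‖ * ‖h x‖‖ * ‖g x‖ := by
        refine integral_congr_ae (ae_of_all _ fun x => ?_)
        simp only [norm_mul, norm_norm]; ring
    _ ≤ _ := h2
    _ ≤ nm a f * nm b h * nm 2 g := mul_le_mul_of_nonneg_right h3 (nm_nonneg _ _)
    _ = _ := by ring

theorem integrable_mul_mul_norm {H : Type} [NormedAddCommGroup H] {a b : ℝ≥0∞}
    [ENNReal.HolderTriple a b 2] {f : E3 → F} {g : E3 → G} {h : E3 → H} (hf : MemLp f a volΩ)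
    (hg : MemLp g 2 volΩ) (hh : MemLp h b volΩ) :
    Integrable (fun x => ‖f x‖ * ‖g x‖ * ‖h x‖) volΩ := by
  have h1 := integrable_mul_norm (memLp_mul_norm (c := 2) hf hh) hg
  refine h1.congr (ae_of_all _ fun x => ?_)
  simp only [norm_mul, norm_norm]; ring

theorem memLp_of_le {a b : ℝ≥0∞} (hab : a ≤ b) {g : E3 → F} (hg : MemLp g b volΩ) : MemLp g a volΩ :=
  hg.mono_exponent hab

end Norms

section Weighted

variable {F : Type} [NormedAddCommGroup F]

/-- The exponent `4/(2-p)`. -/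
def expAmp (p : Ico (5 / 3 : ℝ) 2) : ℝ≥0∞ := ENNReal.ofReal (4 / (2 - (p : ℝ)))

instance (p : Ico (5 / 3 : ℝ) 2) : Fact (1 ≤ expAmp p) := ⟨by
    have h := p.2.1
    have h' := p.2.2
    rw [expAmp, ENNReal.one_le_ofReal, le_div_iff₀ (by linarith)]
    linarith⟩

instance (p : Ico (5 / 3 : ℝ) 2) : ENNReal.HolderTriple (expAmp p) 2 (expHess p) := ⟨by
  have hp1 := p.2.1
  have hp2 := p.2.2
  have hr : 0 < 4 / (2 - (p : ℝ)) := by apply div_pos <;> linarith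
  rw [expHess, expAmp, ← ENNReal.ofReal_inv_of_pos hr, ← ENNReal.ofReal_inv_of_pos (by
    apply div_pos <;> linarith), show (2:ℝ≥0∞)⁻¹ = ENNReal.ofReal (2⁻¹) by
      rw [ENNReal.ofReal_inv_of_pos (by norm_num)]; simp,
    ← ENNReal.ofReal_add (by positivity) (by norm_num)]
  congr 1
  field_simp; ring⟩

/-- Hölder's inequality that turns the weighted dissipation into an `L^{4/(4-p)}` norm. -/
theorem nm_sq_le_weighted (p : Ico (5 / 3 : ℝ) 2) {g : E3 → F} (hg : Continuous g) {ρ : E3 → ℝ}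
    (hρ : Continuous ρ) (hpos : ∀ x, 0 < ρ x) :
    nm (expHess p) g ^ 2 ≤ (∫ x in cube, ρ x ^ (((p : ℝ) - 2) / 2) * ‖g x‖ ^ 2) *
      (∫ x in cube, ρ x) ^ ((2 - (p : ℝ)) / 2) := by
  have hp1 := p.2.1
  have hp2 := p.2.2
  have hr : 0 < 4 / (2 - (p : ℝ)) := by apply div_pos <;> linarith
  set a : E3 → ℝ := fun x => ρ x ^ ((2 - (p : ℝ)) / 4)
  set b : E3 → ℝ := fun x => ρ x ^ (((p : ℝ) - 2) / 4) * ‖g x‖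
  have hac : Continuous a := hρ.rpow_const fun x => Or.inl (hpos x).ne'
  have hbc : Continuous b := (hρ.rpow_const fun x => Or.inl (hpos x).ne').mul hg.norm
  have h1 := nm_mul_norm_le (c := expHess p) (memLp_of_continuous hac (expAmp p)) (memLp_of_continuous hbc 2)
  have h2 : nm (expHess p) g = nm (expHess p) fun x => ‖a x‖ * ‖b x‖ := by
    rw [← nm_norm]
    congr 1
    ext x
    have h0 := hpos x
    simp only [a, b, norm_mul, norm_norm, Real.norm_of_nonneg (Real.rpow_nonneg h0.le _)]
    rw [← mul_assoc, ← Real.rpow_add h0]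
    rw [show (2 - (p : ℝ)) / 4 + ((p : ℝ) - 2) / 4 = 0 by ring, Real.rpow_zero, one_mul]
  have ha : nm (expAmp p) a ^ 2 = (∫ x in cube, ρ x) ^ ((2 - (p : ℝ)) / 2) := by
    have h := (memLp_of_continuous hac (expAmp p)).eLpNorm_eq_integral_rpow_norm
      (by simpa [expAmp] using hr) (by simp [expAmp])
    rw [nm, h, expAmp, ENNReal.toReal_ofReal (by positivity), ENNReal.toReal_ofReal hr.le]
    have : ∀ x, ‖a x‖ ^ (4 / (2 - (p : ℝ))) = ρ x := fun x => by
      simp only [a, Real.norm_of_nonneg (Real.rpow_nonneg (hpos x).le _)]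
      rw [← Real.rpow_mul (hpos x).le]
      have : (2 - (p : ℝ)) / 4 * (4 / (2 - (p : ℝ))) = 1 := by
        have : 2 - (p : ℝ) ≠ 0 := by linarith
        field_simp
      rw [this, Real.rpow_one]
    simp_rw [this]
    rw [← Real.rpow_natCast, ← Real.rpow_mul (integral_nonneg fun x => (hpos x).le)]
    congr 1
    push_cast; field_simp; norm_num
  have hb : nm 2 b ^ 2 = ∫ x in cube, ρ x ^ (((p : ℝ) - 2) / 2) * ‖g x‖ ^ 2 := by
    rw [nm_two_sq (memLp_of_continuous hbc 2)]
    refine integral_congr_ae (ae_of_all _ fun x => ?_)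
    simp only [b, norm_mul, norm_norm, mul_pow, Real.norm_of_nonneg (Real.rpow_nonneg (hpos x).le _)]
    congr 1
    rw [← Real.rpow_natCast, ← Real.rpow_mul (hpos x).le]; congr 1; push_cast; ring
  rw [h2, ← ha, ← hb, mul_comm, ← mul_pow]
  exact pow_le_pow_left₀ (nm_nonneg _ _) h1 2

end Weighted

section Tensors

/-- `sym` as a continuous linear map. -/
def symL : Mat3 →L[ℝ] Mat3 := LinearMap.toContinuousLinearMap
  { toFun := sym
    map_add' := fun A B => by ext ij; simp [sym]; ring
    map_smul' := fun c A => by ext ij; simp [sym]; ring }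

@[simp] theorem symL_apply (A : Mat3) : symL A = sym A := rfl

theorem inner_sym_left (A B : Mat3) : inner ℝ (sym A) B = inner ℝ A (sym B) := by
  simp only [PiLp.inner_apply, Fintype.sum_prod_type, Fin.sum_univ_three, sym]
  simp
  ring

theorem sym_sym (A : Mat3) : sym (sym A) = sym A := by
  ext ij; simp [sym]; ring

theorem norm_sym_le (A : Mat3) : ‖sym A‖ ≤ ‖A‖ := by
  have h : ‖sym A‖ ^ 2 ≤ ‖sym A‖ * ‖A‖ := by
    rw [← real_inner_self_eq_norm_sq, ← inner_sym_left, sym_sym]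
    exact real_inner_le_norm _ _
  rcases (norm_nonneg (sym A)).eq_or_lt with h0 | h0
  · rw [← h0]; positivity
  · nlinarith

/-- The symmetric gradient. -/
def sg (φ : E3 → E3) (x : E3) : Mat3 := sym (grad φ x)

theorem SP.sg {φ : E3 → E3} (hφ : SP φ) : SP (sg φ) :=
  SP.comp (φ := fun A => symL A) symL.contDiff hφ.grad

theorem dd_sg {φ : E3 → E3} (hφ : SP φ) (k : Fin 3) (x : E3) : dd k (sg φ) x = sg (dd k φ) x := by
  rw [sg, grad_dd hφ]
  exact dd_clm_comp symL hφ.grad k x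

theorem norm_sg_le (φ : E3 → E3) (x : E3) : ‖sg φ x‖ ≤ ‖grad φ x‖ := norm_sym_le _

theorem nm_sg_le {φ : E3 → E3} (hφ : SP φ) (q : ℝ≥0∞) : nm q (sg φ) ≤ nm q (grad φ) :=
  nm_mono (hφ.grad.memLp q) (ae_of_all _ fun x => norm_sg_le φ x)

theorem grad_sub {φ ψ : E3 → E3} (hφ : SP φ) (hψ : SP ψ) (x : E3) :
    grad (fun x => φ x - ψ x) x = grad φ x - grad ψ x := by
  ext ⟨i, j⟩
  rw [PiLp.sub_apply, grad_apply (hφ.sub hψ), grad_apply hφ, grad_apply hψ, dd_sub hφ hψ]; rfl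

theorem sg_sub {φ ψ : E3 → E3} (hφ : SP φ) (hψ : SP ψ) (x : E3) : sg (fun x => φ x - ψ x) x = sg φ x - sg ψ x := by
  rw [sg, grad_sub hφ hψ]; exact map_sub symL _ _

/-- The gradient of a second order tensor field. -/
def tgrad (A : E3 → Mat3) (x : E3) : Ten3 := WithLp.toLp 2 fun t => dd t.2.2 A x (t.1, t.2.1)

theorem SP.tgrad {A : E3 → Mat3} (hA : SP A) : SP (tgrad A) :=
  SP.of_apply fun t => (hA.dd t.2.2).apply _

theorem norm_tgrad_sq (A : E3 → Mat3) (x : E3) : ‖tgrad A x‖ ^ 2 = ∑ k, ‖dd k A x‖ ^ 2 := by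
  simp only [EuclideanSpace.norm_sq_eq, Fintype.sum_prod_type, tgrad, Fin.sum_univ_three]
  ring

/-- Permutation of the indices of a third order tensor. -/
def permT (e : Fin 3 × Fin 3 × Fin 3 ≃ Fin 3 × Fin 3 × Fin 3) (T : Ten3) : Ten3 :=
  WithLp.toLp 2 fun t => T (e t)

theorem norm_permT (e : Fin 3 × Fin 3 × Fin 3 ≃ Fin 3 × Fin 3 × Fin 3) (T : Ten3) : ‖permT e T‖ = ‖T‖ := by
  rw [EuclideanSpace.norm_eq, EuclideanSpace.norm_eq]
  congr 1
  exact Equiv.sum_comp e fun t => ‖T t‖ ^ 2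

/-- `(i, j, k) ↦ (i, k, j)`. -/
def swapT : Fin 3 × Fin 3 × Fin 3 ≃ Fin 3 × Fin 3 × Fin 3 where
  toFun t := (t.1, t.2.2, t.2.1)
  invFun t := (t.1, t.2.2, t.2.1)
  left_inv _ := rfl
  right_inv _ := rfl

/-- `(i, j, k) ↦ (j, k, i)`. -/
def cycT : Fin 3 × Fin 3 × Fin 3 ≃ Fin 3 × Fin 3 × Fin 3 where
  toFun t := (t.2.1, t.2.2, t.1)
  invFun t := (t.2.2, t.1, t.2.1)
  left_inv _ := rfl
  right_inv _ := rfl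

/-- Recovers the second gradient `∇²v` from `∇𝒟v`. -/
def hessT (T : Ten3) : Ten3 := T + permT swapT T - permT cycT T

/-- `hessT` as a continuous linear map. -/
def hessL : Ten3 →L[ℝ] Ten3 := LinearMap.toContinuousLinearMap
  { toFun := hessT
    map_add' := fun A B => by ext t; simp [hessT, permT]; ring
    map_smul' := fun c A => by ext t; simp [hessT, permT]; ring }

@[simp] theorem hessL_apply (T : Ten3) : hessL T = hessT T := rfl

theorem norm_hessT_le (T : Ten3) : ‖hessT T‖ ≤ 3 * ‖T‖ := by
  refine (norm_sub_le _ _).trans ?_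
  have := norm_add_le T (permT swapT T)
  rw [norm_permT] at *
  linarith

theorem tgrad_grad_eq {φ : E3 → E3} (hφ : SP φ) (x : E3) : tgrad (grad φ) x = hessT (tgrad (sg φ) x) := by
  have h1 : ∀ i j k, tgrad (grad φ) x (i, j, k) = dd k (dd j φ) x i := by
    intro i j k
    show dd k (grad φ) x (i, j) = _
    rw [← grad_dd hφ, grad_apply (hφ.dd k), dd_comm hφ]
  have h2 : ∀ i j k, tgrad (sg φ) x (i, j, k) = (dd k (dd j φ) x i + dd k (dd i φ) x j) / 2 := by
    intro i j k
    show dd k (sg φ) x (i, j) = _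
    rw [dd_sg hφ]
    show (grad (dd k φ) x (i, j) + grad (dd k φ) x (j, i)) / 2 = _
    rw [grad_apply (hφ.dd k), grad_apply (hφ.dd k), dd_comm hφ, dd_comm hφ i]
  ext ⟨i, j, k⟩
  show _ = tgrad (sg φ) x (i, j, k) + tgrad (sg φ) x (i, k, j) - tgrad (sg φ) x (j, k, i)
  rw [h1, h2, h2, h2, dd_comm hφ j k, dd_comm hφ i k, dd_comm hφ i j]
  ring

theorem norm_fderiv_sq_le {F : Type} [NormedAddCommGroup F] [NormedSpace ℝ F] (g : E3 → F) (x : E3) :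
    ‖fderiv ℝ g x‖ ^ 2 ≤ ∑ k, ‖dd k g x‖ ^ 2 := by
  have h : ‖fderiv ℝ g x‖ ≤ √(∑ k, ‖dd k g x‖ ^ 2) := by
    refine ContinuousLinearMap.opNorm_le_bound _ (Real.sqrt_nonneg _) fun y => ?_
    rw [fderiv_eq_sum_dd]
    refine (norm_sum_le _ _).trans ?_
    simp_rw [norm_smul]
    rw [EuclideanSpace.norm_eq, mul_comm]
    exact Real.sum_mul_le_sqrt_mul_sqrt _ _ _
  calc ‖fderiv ℝ g x‖ ^ 2 ≤ √(∑ k, ‖dd k g x‖ ^ 2) ^ 2 := by gcongr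
    _ = _ := Real.sq_sqrt (by positivity)

theorem norm_fderiv_le_grad {φ : E3 → E3} (hφ : SP φ) (x : E3) : ‖fderiv ℝ φ x‖ ≤ ‖grad φ x‖ :=
  (sq_le_sq₀ (norm_nonneg _) (norm_nonneg _)).1 (by rw [norm_grad_sq hφ]; exact norm_fderiv_sq_le φ x)

theorem norm_fderiv_le_tgrad (A : E3 → Mat3) (x : E3) : ‖fderiv ℝ A x‖ ≤ ‖tgrad A x‖ :=
  (sq_le_sq₀ (norm_nonneg _) (norm_nonneg _)).1 (by rw [norm_tgrad_sq]; exact norm_fderiv_sq_le A x)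

theorem integral_grad_eq_zero {φ : E3 → E3} (hφ : SP φ) : ∫ x in cube, grad φ x = 0 := by
  ext ⟨i, j⟩
  rw [integral_apply_cube hφ.grad, PiLp.zero_apply]
  have : ∀ x, grad φ x (i, j) = dd j (fun y => φ y i) x := fun x => rfl
  simp_rw [this]
  exact integral_dd_eq_zero (hφ.apply i) j

end Tensors

section Convection

theorem convect_eq {u : E3} {ψ : E3 → E3} (hψ : SP ψ) (x : E3) : convect u (grad ψ x) = ∑ j, u j • dd j ψ x := by
  ext i
  simp [convect, grad_apply hψ]

theorem norm_convect_le (u : E3) (A : Mat3) : ‖convect u A‖ ≤ ‖u‖ * ‖A‖ := by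
  refine (sq_le_sq₀ (norm_nonneg _) (by positivity)).1 ?_
  rw [mul_pow, EuclideanSpace.norm_sq_eq, EuclideanSpace.norm_sq_eq u, EuclideanSpace.norm_sq_eq A,
    Fintype.sum_prod_type, Finset.mul_sum]
  refine Finset.sum_le_sum fun i _ => ?_
  simp only [convect, Real.norm_eq_abs, sq_abs]
  exact Finset.sum_mul_sq_le_sq_mul_sq _ _ _

theorem convect_sub_left (u v : E3) (A : Mat3) : convect (u - v) A = convect u A - convect v A := by
  ext i; simp [convect, Finset.sum_sub_distrib, sub_mul]

theorem convect_sub_right (u : E3) (A B : Mat3) : convect u (A - B) = convect u A - convect u B := by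
  ext i; simp [convect, Finset.sum_sub_distrib, mul_sub]

theorem contDiff_convect : ContDiff ℝ ∞ fun z : E3 × Mat3 => convect z.1 z.2 := by
  rw [contDiff_euclidean]
  intro i
  show ContDiff ℝ ∞ fun z : E3 × Mat3 => ∑ j, z.1 j * z.2 (i, j)
  refine ContDiff.sum fun j _ => ?_
  have h1 : ContDiff ℝ ∞ fun z : E3 × Mat3 => z.1 j := ((EuclideanSpace.proj (𝕜 := ℝ) j).contDiff).comp contDiff_fst
  have h2 : ContDiff ℝ ∞ fun z : E3 × Mat3 => z.2 (i, j) :=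
    ((EuclideanSpace.proj (𝕜 := ℝ) (i, j)).contDiff).comp contDiff_snd
  exact h1.mul h2

theorem SP.convect {φ : E3 → E3} {A : E3 → Mat3} (hφ : SP φ) (hA : SP A) : SP fun x => convect (φ x) (A x) :=
  ⟨contDiff_convect.comp (hφ.smooth.prodMk hA.smooth), fun i x => by
    rw [hφ.periodic, hA.periodic]⟩

theorem dd_smul {F : Type} [NormedAddCommGroup F] [NormedSpace ℝ F] {a : E3 → ℝ} {g : E3 → F}
    (ha : SP a) (hg : SP g) (k : Fin 3) (x : E3) :
    dd k (fun x => a x • g x) x = a x • dd k g x + dd k a x • g x := by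
  unfold dd
  rw [fderiv_fun_smul (ha.differentiable x) (hg.differentiable x)]
  simp

theorem dd_convect {φ ψ : E3 → E3} (hφ : SP φ) (hψ : SP ψ) (k : Fin 3) (x : E3) :
    dd k (fun x => convect (φ x) (grad ψ x)) x = convect (dd k φ x) (grad ψ x) + convect (φ x) (grad (dd k ψ) x) := by
  have h1 : (fun x => convect (φ x) (grad ψ x)) = fun x => ∑ j, φ x j • dd j ψ x := funext fun x => convect_eq hψ x
  rw [h1, dd_sum fun j _ => (hφ.apply j).smul (hψ.dd j), convect_eq hψ, convect_eq (hψ.dd k), ← Finset.sum_add_distrib]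
  refine Finset.sum_congr rfl fun j _ => ?_
  rw [dd_comm hψ j k, ← dd_apply hφ, dd_smul (hφ.apply j) (hψ.dd j), add_comm]

/-- The convective term is skew-symmetric. -/
theorem integral_convect_skew {φ ψ χ : E3 → E3} (hφ : IsSolenoidalTest φ) (hψ : SP ψ) (hχ : SP χ) :
    ∫ x in cube, inner ℝ (convect (φ x) (grad ψ x)) (χ x) = -∫ x in cube, inner ℝ (convect (φ x) (grad χ x)) (ψ x) := by
  have hφs := hφ.sp
  have hsm : ∀ j, SP fun x => φ x j • χ x := fun j => (hφs.apply j).smul hχ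
  have h1 : ∫ x in cube, inner ℝ (convect (φ x) (grad ψ x)) (χ x) =
      ∑ j, ∫ x in cube, inner ℝ (dd j ψ x) (φ x j • χ x) := by
    rw [← integral_finsetSum _ fun j _ => ((hψ.dd j).inner (hsm j)).integrable]
    refine integral_congr_ae (ae_of_all _ fun x => ?_)
    simp only [convect_eq hψ, sum_inner, inner_smul_left, inner_smul_right]
    rfl
  rw [h1]
  simp_rw [integral_inner_dd hψ (hsm _)]
  rw [Finset.sum_neg_distrib, neg_inj, ← integral_finsetSum _ fun j _ => (hψ.inner ((hsm j).dd j)).integrable]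
  refine integral_congr_ae (ae_of_all _ fun x => ?_)
  have h2 : ∀ j, dd j (fun x => φ x j • χ x) x = φ x j • dd j χ x + dd j φ x j • χ x := fun j => by
    rw [← dd_apply hφs, dd_smul (hφs.apply j) hχ]
  simp only [h2, convect_eq hχ, inner_add_right, Finset.sum_add_distrib, inner_smul_right, sum_inner, inner_smul_left]
  rw [← Finset.sum_mul, hφ.div_dd, zero_mul, add_zero]
  simp only [conj_trivial]
  exact Finset.sum_congr rfl fun j _ => by rw [real_inner_comm]

theorem integral_convect_self {φ ψ : E3 → E3} (hφ : IsSolenoidalTest φ) (hψ : SP ψ) :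
    ∫ x in cube, inner ℝ (convect (φ x) (grad ψ x)) (ψ x) = 0 := by
  linarith [integral_convect_skew hφ hψ hψ]

/-- The Laplacian. -/
def lap (φ : E3 → E3) (x : E3) : E3 := ∑ k, dd k (dd k φ) x

theorem SP.lap {φ : E3 → E3} (hφ : SP φ) : SP (lap φ) := SP.sum fun k _ => (hφ.dd k).dd k

theorem integral_convect_lap {φ : E3 → E3} (hφ : IsSolenoidalTest φ) :
    |∫ x in cube, inner ℝ (convect (φ x) (grad φ x)) (lap φ x)| ≤
      nm 2 (grad φ) * nm 4 (grad φ) ^ 2 := by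
  have hφs := hφ.sp
  have hc := hφs.convect hφs.grad
  have h1 : ∫ x in cube, inner ℝ (convect (φ x) (grad φ x)) (lap φ x) =
      ∑ k, ∫ x in cube, inner ℝ (convect (φ x) (grad φ x)) (dd k (dd k φ) x) := by
    rw [← integral_finsetSum _ fun k _ => (hc.inner ((hφs.dd k).dd k)).integrable]
    simp_rw [lap, inner_sum]
  have h2 : ∀ k, ∫ x in cube, inner ℝ (convect (φ x) (grad φ x)) (dd k (dd k φ) x) =
      -∫ x in cube, inner ℝ (convect (dd k φ x) (grad φ x)) (dd k φ x) := by
    intro k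
    have := integral_inner_dd hc (hφs.dd k) k
    rw [eq_comm, neg_eq_iff_eq_neg] at this
    rw [this, neg_inj]
    simp_rw [dd_convect hφs hφs, inner_add_left]
    rw [integral_add (((hφs.dd k).convect hφs.grad).inner (hφs.dd k)).integrable
      ((hφs.convect (hφs.dd k).grad).inner (hφs.dd k)).integrable,
      integral_convect_self hφ (hφs.dd k), add_zero]
  rw [h1]
  simp_rw [h2]
  rw [Finset.sum_neg_distrib, abs_neg, ← integral_finsetSum _ fun k _ =>
    (((hφs.dd k).convect hφs.grad).inner (hφs.dd k)).integrable]
  have hG := hφs.grad.memLp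
  have h5 : nm 4 (grad φ) * nm 2 (grad φ) * nm 4 (grad φ) = nm 2 (grad φ) * nm 4 (grad φ) ^ 2 := by
    ring
  rw [← h5, ← Real.norm_eq_abs]
  refine ((norm_integral_le_integral_norm _).trans (integral_mono ?_ ?_ fun x => ?_)).trans
    (integral_mul_mul_norm_le (hG 4) (hG 2) (hG 4))
  · exact (SP.sum fun k _ => ((hφs.dd k).convect hφs.grad).inner (hφs.dd k)).integrable.norm
  · exact integrable_mul_mul_norm (hG 4) (hG 2) (hG 4)
  · refine (norm_sum_le _ _).trans ?_
    have h3 : ∀ k, ‖(inner ℝ (convect (dd k φ x) (grad φ x)) (dd k φ x) : ℝ)‖ ≤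
        ‖dd k φ x‖ ^ 2 * ‖grad φ x‖ := fun k => by
      refine (norm_inner_le_norm _ _).trans ?_
      nlinarith [norm_convect_le (dd k φ x) (grad φ x), norm_nonneg (dd k φ x)]
    refine (Finset.sum_le_sum fun k _ => h3 k).trans ?_
    rw [← Finset.sum_mul, ← norm_grad_sq hφs]
    simp only [pow_two]
    exact le_of_eq (by ring)

end Convection

section Dissipation

/-- The regularised stress with an additional small viscosity. -/
def Sv (μ p : ℝ) (A : Mat3) : Mat3 := Sm μ p A + μ • A

theorem contDiff_Sv {μ p : ℝ} (hμ : 0 < μ) : ContDiff ℝ ∞ (Sv μ p) :=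
  (contDiff_Sm hμ).add (contDiff_id.const_smul μ)

theorem fderiv_Sv_apply {μ p : ℝ} (hμ : 0 < μ) (A H : Mat3) :
    fderiv ℝ (Sv μ p) A H = fderiv ℝ (Sm μ p) A H + μ • H := by
  have h1 := ((contDiff_Sm (E := Mat3) (r := p) hμ).differentiable (by simp)) A
  have : HasFDerivAt (Sv μ p) (fderiv ℝ (Sm μ p) A + μ • ContinuousLinearMap.id ℝ Mat3) A :=
    h1.hasFDerivAt.add ((hasFDerivAt_id A).const_smul μ)
  rw [this.fderiv]; rfl

/-- Testing the stress with `-Δφ`. -/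
theorem dissipation_le {μ p : ℝ} (hμ : 0 < μ) (hp2 : p ≤ 2) {φ : E3 → E3} (hφ : SP φ) :
    (p - 1) * (∫ x in cube, wt μ p (sg φ x) * ‖tgrad (sg φ) x‖ ^ 2) + μ * (∫ x in cube, ‖tgrad (sg φ) x‖ ^ 2) ≤
    -∫ x in cube, inner ℝ (Sv μ p (sg φ x)) (sg (lap φ) x) := by
  have hA := hφ.sg
  have hS : SP fun x => Sv μ p (sg φ x) := SP.comp (contDiff_Sv hμ) hA
  have hw : SP fun x => wt μ p (sg φ x) := SP.comp (contDiff_wt hμ) hA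
  have hlap : ∀ x, sg (lap φ) x = ∑ k, dd k (dd k (sg φ)) x := by
    intro x
    have h1 : grad (lap φ) x = ∑ k, grad (dd k (dd k φ)) x := by
      ext ⟨i, j⟩
      rw [grad_apply hφ.lap]
      unfold lap
      rw [dd_sum fun k _ => (hφ.dd k).dd k]
      simp [grad_apply ((hφ.dd _).dd _)]
    have h2 : ∀ k, dd k (dd k (sg φ)) x = sg (dd k (dd k φ)) x := fun k => by
      rw [show dd k (sg φ) = sg (dd k φ) from funext fun y => dd_sg hφ k y, dd_sg (hφ.dd k)]
    simp_rw [h2, sg, h1]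
    exact map_sum symL _ _
  have h1 : -∫ x in cube, inner ℝ (Sv μ p (sg φ x)) (sg (lap φ) x) =
      ∑ k, ∫ x in cube, inner ℝ (dd k (fun x => Sv μ p (sg φ x)) x) (dd k (sg φ) x) := by
    simp_rw [hlap, inner_sum]
    rw [integral_finsetSum _ fun k _ => (hS.inner ((hA.dd k).dd k)).integrable, ← Finset.sum_neg_distrib]
    exact Finset.sum_congr rfl fun k _ => (integral_inner_dd hS (hA.dd k) k).symm
  have hcd : ∀ k x, dd k (fun x => Sv μ p (sg φ x)) x = fderiv ℝ (Sv μ p) (sg φ x) (dd k (sg φ) x) := by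
    intro k x
    have := (((contDiff_Sv (p := p) hμ).differentiable (by simp)) (sg φ x)).hasFDerivAt.comp x
      (hA.differentiable x).hasFDerivAt
    unfold dd
    simp only [Function.comp_def] at this
    rw [this.fderiv]; rfl
  rw [h1, ← integral_finsetSum _ fun k _ => ((hS.dd k).inner (hA.dd k)).integrable,
    ← integral_const_mul, ← integral_const_mul, ← integral_add]
  · refine integral_mono ?_ ?_ fun x => ?_
    · exact integrable_of_continuous (by
        have := hw.continuous; have := hA.tgrad.continuous; fun_prop)
    · exact (SP.sum fun k _ => (hS.dd k).inner (hA.dd k)).integrable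
    · simp only
      rw [norm_tgrad_sq, Finset.mul_sum, Finset.mul_sum, Finset.mul_sum, ← Finset.sum_add_distrib]
      refine Finset.sum_le_sum fun k _ => ?_
      rw [hcd, fderiv_Sv_apply hμ, inner_add_left, inner_smul_left, real_inner_self_eq_norm_sq]
      have := le_inner_fderiv_Sm (r := p) hμ hp2 (sg φ x) (dd k (sg φ) x)
      simpa using this
  · exact integrable_of_continuous (by
      have := hw.continuous; have := hA.tgrad.continuous; fun_prop)
  · exact integrable_of_continuous (by have := hA.tgrad.continuous; fun_prop)

end Dissipation

section Classes

variable {F : Type} [NormedAddCommGroup F] {q : ℝ≥0∞}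

open Classical in
/-- The class of `g` in `L^q(Ω)`. -/
def toL (q : ℝ≥0∞) (g : E3 → F) : LΩ F q := if h : MemLp g q volΩ then h.toLp g else 0

theorem toL_eq {g : E3 → F} (h : MemLp g q volΩ) : toL q g = h.toLp g := dif_pos h

theorem coeFn_toL {g : E3 → F} (h : MemLp g q volΩ) : toL q g =ᵐ[volΩ] g := by
  rw [toL_eq h]; exact h.coeFn_toLp

theorem toL_eq_of_ae {g : E3 → F} {u : LΩ F q} (h : u =ᵐ[volΩ] g) : toL q g = u := by
  have hg : MemLp g q volΩ := (memLp_congr_ae h).1 (Lp.memLp u)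
  exact Lp.ext ((coeFn_toL hg).trans h.symm)

theorem norm_toL {g : E3 → F} (h : MemLp g q volΩ) : ‖toL q g‖ = nm q g := by
  rw [toL_eq h, norm_toLp_eq_nm]

theorem toL_sub {f g : E3 → F} (hf : MemLp f q volΩ) (hg : MemLp g q volΩ) :
    toL q (fun x => f x - g x) = toL q f - toL q g := by
  rw [toL_eq hf, toL_eq hg, ← MemLp.toLp_sub]; exact toL_eq (hf.sub hg)

theorem norm_toL_sub {f g : E3 → F} (hf : MemLp f q volΩ) (hg : MemLp g q volΩ) :
    ‖toL q f - toL q g‖ = nm q fun x => f x - g x := by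
  rw [← toL_sub hf hg]; exact norm_toL (hf.sub hg)

theorem norm_sub_toL {g : E3 → F} (u : LΩ F q) (hg : MemLp g q volΩ) : ‖u - toL q g‖ = nm q fun x => u x - g x := by
  rw [norm_eq_nm]
  refine nm_congr ((Lp.coeFn_sub _ _).trans ?_)
  filter_upwards [coeFn_toL hg] with x hx
  simp [hx]

theorem norm_sub_eq_nm (u v : LΩ F q) : ‖u - v‖ = nm q fun x => u x - v x :=
  (norm_eq_nm _).trans (nm_congr (Lp.coeFn_sub u v))

theorem toL_sum_smul [NormedSpace ℝ F] {ι : Type*} (s : Finset ι) (c : ι → ℝ) {E : ι → E3 → F}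
    (hE : ∀ i, MemLp (E i) q volΩ) :
    toL q (fun x => ∑ i ∈ s, c i • E i x) = ∑ i ∈ s, c i • toL q (E i) := by
  refine toL_eq_of_ae ?_
  refine (Lp.coeFn_finsetSum s fun i => c i • toL q (E i)).trans ?_
  have h : ∀ i, ∀ᵐ x ∂volΩ, (c i • toL q (E i)) x = c i • E i x := fun i => by
    filter_upwards [Lp.coeFn_smul (c i) (toL q (E i)), coeFn_toL (hE i)] with x h1 h2
    rw [h1, Pi.smul_apply, h2]
  have h' : ∀ᵐ x ∂volΩ, ∀ i ∈ s, (c i • toL q (E i)) x = c i • E i x := (ae_ball_iff s.countable_toSet).2 fun i _ => h i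
  filter_upwards [h'] with x hx
  rw [Finset.sum_apply]
  exact Finset.sum_congr rfl hx

theorem inner_toL {F : Type} [NormedAddCommGroup F] [InnerProductSpace ℝ F] {f g : E3 → F}
    (hf : MemLp f 2 volΩ) (hg : MemLp g 2 volΩ) :
    (inner ℝ (toL 2 f) (toL 2 g) : ℝ) = ∫ x in cube, inner ℝ (f x) (g x) := by
  rw [L2.inner_def]
  refine integral_congr_ae ?_
  filter_upwards [coeFn_toL hf, coeFn_toL hg] with x h1 h2
  rw [h1, h2]

theorem inner_toL_right {F : Type} [NormedAddCommGroup F] [InnerProductSpace ℝ F] (u : LΩ F 2)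
    {g : E3 → F} (hg : MemLp g 2 volΩ) :
    (inner ℝ u (toL 2 g) : ℝ) = ∫ x in cube, inner ℝ (u x) (g x) := by
  rw [L2.inner_def]
  refine integral_congr_ae ?_
  filter_upwards [coeFn_toL hg] with x h2
  rw [h2]

theorem continuous_toL {Y : Type} [TopologicalSpace Y] (hq : q ≠ 0) [Fact (1 ≤ q)] {Φ : Y → E3 → F}
    (h : Continuous fun z : Y × E3 => Φ z.1 z.2) : Continuous fun y => toL q (Φ y) := by
  have hc : ∀ y, Continuous (Φ y) := fun y => h.comp (by fun_prop : Continuous fun x => (y, x))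
  rw [continuous_iff_continuousAt]
  intro y
  rw [ContinuousAt, tendsto_iff_norm_sub_tendsto_zero]
  rw [Metric.tendsto_nhds]
  intro ε hε
  have ho : IsOpen {z : Y × E3 | dist (Φ y z.2) (Φ z.1 z.2) < ε / 2} :=
    isOpen_lt (((hc y).comp continuous_snd).dist h) continuous_const
  obtain ⟨U, V, hU, -, hyU, hKV, hUV⟩ := generalized_tube_lemma (isCompact_singleton (x := y))
    (isCompact_closedBall (0 : E3) 2) ho (by
      rintro ⟨z, x⟩ ⟨hz, -⟩
      rw [mem_singleton_iff] at hz
      simp only at hz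
      subst hz
      simpa using hε)
  filter_upwards [hU.mem_nhds (hyU rfl)] with z hzU
  have hz : ∀ x ∈ Metric.closedBall (0 : E3) 2, dist (Φ y x) (Φ z x) < ε / 2 := fun x hx =>
    hUV (mk_mem_prod hzU (hKV hx))
  rw [dist_zero_right, norm_norm, norm_toL_sub (memLp_of_continuous (hc z) q) (memLp_of_continuous (hc y) q)]
  have h1 : nm q (fun x => Φ z x - Φ y x) ≤ nm q fun _ : E3 => ε / 2 := by
    refine nm_mono (memLp_const _) ((ae_restrict_mem measurableSet_cube).mono fun x hx => ?_)
    have := hz x (cube_subset_closedBall hx)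
    rw [dist_comm, dist_eq_norm] at this
    rw [Real.norm_of_nonneg (by positivity)]
    exact this.le
  rw [nm_const q hq, Real.norm_of_nonneg (by positivity)] at h1
  linarith

end Classes

section Curves

/-- A `C¹` curve in the Galerkin space `X n`, given by coordinates. -/
structure Curve (n : ℕ) (T : ℝ) where
  N : ℕ
  e : Fin N → E3 → E3
  mem : ∀ i, e i ∈ X n
  c : ℝ → Fin N → ℝ
  c' : ℝ → Fin N → ℝ
  cont : Continuous c
  cont' : Continuous c'
  deriv : ∀ t ∈ Icc 0 T, HasDerivAt c (c' t) t

namespace Curve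

variable {n : ℕ} {T : ℝ} (γ : Curve n T)

/-- The velocity field of a curve. -/
def v (t : ℝ) (x : E3) : E3 := ∑ i, γ.c t i • γ.e i x

/-- The time derivative of the velocity field. -/
def v' (t : ℝ) (x : E3) : E3 := ∑ i, γ.c' t i • γ.e i x

theorem sum_mem_X (a : Fin γ.N → ℝ) : (fun x => ∑ i, a i • γ.e i x) ∈ X n := by
  have : (fun x => ∑ i, a i • γ.e i x) = ∑ i, a i • γ.e i := by ext1 x; simp
  rw [this]
  exact Submodule.sum_mem _ fun i _ => Submodule.smul_mem _ _ (γ.mem i)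

theorem v_mem (t : ℝ) : γ.v t ∈ X n := γ.sum_mem_X _
theorem v'_mem (t : ℝ) : γ.v' t ∈ X n := γ.sum_mem_X _
theorem test (t : ℝ) : IsSolenoidalTest (γ.v t) := (γ.v_mem t).1
theorem test' (t : ℝ) : IsSolenoidalTest (γ.v' t) := (γ.v'_mem t).1
theorem sp (t : ℝ) : SP (γ.v t) := (γ.test t).sp
theorem sp' (t : ℝ) : SP (γ.v' t) := (γ.test' t).sp
theorem sp_e (i : Fin γ.N) : SP (γ.e i) := (γ.mem i).1.sp

variable {F : Type} [NormedAddCommGroup F] [NormedSpace ℝ F] {E : Fin γ.N → E3 → F}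

theorem continuous_sum {a : ℝ → Fin γ.N → ℝ} (ha : Continuous a) (hE : ∀ i, Continuous (E i)) :
    Continuous fun z : ℝ × E3 => ∑ i, a z.1 i • E i z.2 := by
  refine continuous_finsetSum _ fun i _ => Continuous.smul ?_ ((hE i).comp continuous_snd)
  exact (continuous_apply i).comp (ha.comp continuous_fst)

theorem hasDerivAt_toL {t : ℝ} (ht : t ∈ Icc 0 T) (hE : ∀ i, Continuous (E i)) (q : ℝ≥0∞)
    [Fact (1 ≤ q)] : HasDerivAt (fun t => toL q fun x => ∑ i, γ.c t i • E i x)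
      (toL q fun x => ∑ i, γ.c' t i • E i x) t := by
  simp_rw [toL_sum_smul Finset.univ _ fun i => memLp_of_continuous (hE i) q]
  exact HasDerivAt.fun_sum fun i _ => (hasDerivAt_pi.1 (γ.deriv t ht) i).smul_const _

end Curve

theorem grad_sum {ι : Type*} {s : Finset ι} (c : ι → ℝ) {e : ι → E3 → E3} (he : ∀ i, SP (e i)) (x : E3) :
    grad (fun x => ∑ i ∈ s, c i • e i x) x = ∑ i ∈ s, c i • grad (e i) x := by
  ext ⟨i, j⟩
  rw [grad_apply (SP.sum fun i _ => (he i).const_smul (c i)), dd_sum fun i _ => (he i).const_smul (c i)]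
  simp [dd_const_smul (he _), grad_apply (he _)]

theorem sg_sum {ι : Type*} {s : Finset ι} (c : ι → ℝ) {e : ι → E3 → E3} (he : ∀ i, SP (e i)) (x : E3) :
    sg (fun x => ∑ i ∈ s, c i • e i x) x = ∑ i ∈ s, c i • sg (e i) x := by
  rw [sg, grad_sum c he]
  have := map_sum symL (fun i => c i • grad (e i) x) s
  simp only [map_smul, symL_apply] at this
  exact this

theorem tgrad_sum {ι : Type*} {s : Finset ι} (c : ι → ℝ) {A : ι → E3 → Mat3} (hA : ∀ i, SP (A i)) (x : E3) :
    tgrad (fun x => ∑ i ∈ s, c i • A i x) x = ∑ i ∈ s, c i • tgrad (A i) x := by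
  ext t
  simp only [tgrad]
  rw [dd_sum fun i _ => (hA i).const_smul (c i)]
  simp [dd_const_smul (hA _)]

namespace Curve

variable {n : ℕ} {T : ℝ} (γ : Curve n T)

theorem continuous_v : Continuous fun z : ℝ × E3 => γ.v z.1 z.2 :=
  γ.continuous_sum γ.cont fun i => (γ.sp_e i).continuous

theorem continuous_v' : Continuous fun z : ℝ × E3 => γ.v' z.1 z.2 :=
  γ.continuous_sum γ.cont' fun i => (γ.sp_e i).continuous

theorem grad_v (t : ℝ) : grad (γ.v t) = fun x => ∑ i, γ.c t i • grad (γ.e i) x :=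
  funext fun x => grad_sum _ γ.sp_e x

theorem grad_v' (t : ℝ) : grad (γ.v' t) = fun x => ∑ i, γ.c' t i • grad (γ.e i) x :=
  funext fun x => grad_sum _ γ.sp_e x

theorem sg_v (t : ℝ) : sg (γ.v t) = fun x => ∑ i, γ.c t i • sg (γ.e i) x :=
  funext fun x => sg_sum _ γ.sp_e x

theorem sg_v' (t : ℝ) : sg (γ.v' t) = fun x => ∑ i, γ.c' t i • sg (γ.e i) x :=
  funext fun x => sg_sum _ γ.sp_e x

theorem continuous_grad : Continuous fun z : ℝ × E3 => grad (γ.v z.1) z.2 := by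
  simp_rw [grad_v]
  exact γ.continuous_sum γ.cont fun i => (γ.sp_e i).grad.continuous

theorem continuous_sg : Continuous fun z : ℝ × E3 => sg (γ.v z.1) z.2 := by
  simp_rw [sg_v]
  exact γ.continuous_sum γ.cont fun i => (γ.sp_e i).sg.continuous

theorem continuous_tgrad : Continuous fun z : ℝ × E3 => tgrad (sg (γ.v z.1)) z.2 := by
  have : ∀ t x, tgrad (sg (γ.v t)) x = ∑ i, γ.c t i • tgrad (sg (γ.e i)) x := fun t x => by
    rw [sg_v, tgrad_sum _ fun i => (γ.sp_e i).sg]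
  simp_rw [this]
  exact γ.continuous_sum γ.cont fun i => (γ.sp_e i).sg.tgrad.continuous

theorem hasDerivAt_v {t : ℝ} (ht : t ∈ Icc 0 T) : HasDerivAt (fun t => toL 2 (γ.v t)) (toL 2 (γ.v' t)) t :=
  γ.hasDerivAt_toL ht (fun i => (γ.sp_e i).continuous) 2

theorem hasDerivAt_grad {t : ℝ} (ht : t ∈ Icc 0 T) :
    HasDerivAt (fun t => toL 2 (grad (γ.v t))) (toL 2 (grad (γ.v' t))) t := by
  simp_rw [grad_v, grad_v']
  exact γ.hasDerivAt_toL ht (fun i => (γ.sp_e i).grad.continuous) 2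

theorem hasDerivAt_sg {t : ℝ} (ht : t ∈ Icc 0 T) :
    HasDerivAt (fun t => toL 2 (sg (γ.v t))) (toL 2 (sg (γ.v' t))) t := by
  simp_rw [sg_v, sg_v']
  exact γ.hasDerivAt_toL ht (fun i => (γ.sp_e i).sg.continuous) 2

end Curve

end Curves

theorem exists_orthonormal_basis_X (n : ℕ) : ∃ (N : ℕ) (e : Fin N → E3 → E3), (∀ i, e i ∈ X n) ∧
    (∀ i, nm 2 (e i) = 1) ∧ (∀ (c : Fin N → ℝ) (i : Fin N), ∫ x in cube, inner ℝ (e i x) (∑ j, c j • e j x) = c i) ∧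
    ∀ ψ ∈ X n, ψ = fun x => ∑ i, (∫ x in cube, inner ℝ (e i x) (ψ x) : ℝ) • e i x := by
  let ι : X n →ₗ[ℝ] LΩ E3 2 :=
    { toFun := fun ψ => toL 2 ψ.1
      map_add' := fun ψ χ => toL_eq_of_ae (by
        filter_upwards [Lp.coeFn_add (toL 2 ψ.1) (toL 2 χ.1), coeFn_toL (ψ.2.1.sp.memLp 2),
          coeFn_toL (χ.2.1.sp.memLp 2)] with x h1 h2 h3
        rw [h1, Pi.add_apply, h2, h3]; rfl)
      map_smul' := fun c ψ => toL_eq_of_ae (by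
        filter_upwards [Lp.coeFn_smul c (toL 2 ψ.1), coeFn_toL (ψ.2.1.sp.memLp 2)] with x h1 h2
        simp only [RingHom.id_apply]
        rw [h1, Pi.smul_apply, h2]; rfl) }
  let b := stdOrthonormalBasis ℝ (LinearMap.range ι)
  have hb : ∀ i, ∃ ψ : X n, ι ψ = b i := fun i => (b i).2
  choose e he using hb
  have hsp : ∀ i, SP (e i).1 := fun i => (e i).2.1.sp
  have hin : ∀ i j, ∫ x in cube, inner ℝ ((e i).1 x) ((e j).1 x) = if i = j then (1 : ℝ) else 0 := by
    intro i j
    rw [← inner_toL ((hsp i).memLp 2) ((hsp j).memLp 2)]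
    show inner ℝ (ι (e i)) (ι (e j)) = _
    rw [he, he, ← Submodule.coe_inner, orthonormal_iff_ite.1 b.orthonormal]
  have hint : ∀ (f : E3 → E3), SP f → ∀ c : Fin _ → ℝ,
      ∫ x in cube, inner ℝ (f x) (∑ j, c j • (e j).1 x) = ∑ j, c j * ∫ x in cube, inner ℝ (f x) ((e j).1 x) := by
    intro f hf c
    simp_rw [inner_sum, inner_smul_right]
    rw [integral_finsetSum _ fun j _ => ((hf.inner (hsp j)).integrable.const_mul _)]
    simp_rw [integral_const_mul]
  refine ⟨_, fun i => (e i).1, fun i => (e i).2, fun i => ?_, fun c i => ?_, fun ψ hψ => ?_⟩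
  · rw [← norm_toL ((hsp i).memLp 2)]
    show ‖ι (e i)‖ = 1
    rw [he]; exact b.orthonormal.1 i
  · rw [hint _ (hsp i)]
    simp [hin]
  · have h1 := b.sum_repr' ⟨ι ⟨ψ, hψ⟩, ⟨ψ, hψ⟩, rfl⟩
    have h2 : ∀ i, (inner ℝ (b i) ⟨ι ⟨ψ, hψ⟩, ⟨ψ, hψ⟩, rfl⟩ : ℝ) = ∫ x in cube, inner ℝ ((e i).1 x) (ψ x) := by
      intro i
      rw [Submodule.coe_inner, ← he]
      exact inner_toL ((hsp i).memLp 2) (hψ.1.sp.memLp 2)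
    simp_rw [h2] at h1
    have h3 : toL 2 ψ = toL 2 (fun x => ∑ i, (∫ x in cube, inner ℝ ((e i).1 x) (ψ x) : ℝ) • (e i).1 x) := by
      rw [toL_sum_smul _ _ fun i => (hsp i).memLp 2]
      have h4 := congrArg (Subtype.val) h1
      rw [AddSubmonoidClass.coe_finsetSum] at h4
      simp only [Submodule.coe_smul, ← he] at h4
      exact h4.symm
    have hs : SP fun x => ∑ i, (∫ x in cube, inner ℝ ((e i).1 x) (ψ x) : ℝ) • (e i).1 x :=
      SP.sum fun i _ => (hsp i).const_smul _
    have hd := hψ.1.sp.sub hs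
    ext1 x
    refine sub_eq_zero.1 (hd.eq_zero_of_integral ?_ x)
    rw [← nm_two_sq (hd.memLp 2), ← norm_toL_sub (hψ.1.sp.memLp 2) (hs.memLp 2), h3]
    simp

/-- Hölder continuous maps are continuous. -/
theorem continuous_of_norm_sub_le {X Y : Type*} [SeminormedAddCommGroup X] [SeminormedAddCommGroup Y] {f : X → Y}
    {c α : ℝ} (hα : 0 < α) (h : ∀ x y, ‖f x - f y‖ ≤ c * ‖x - y‖ ^ α) : Continuous f := by
  refine continuous_iff_continuousAt.2 fun y => tendsto_iff_norm_sub_tendsto_zero.2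
    (squeeze_zero (fun _ => norm_nonneg _) (fun x => h x y) ?_)
  have : Continuous fun x => c * ‖x - y‖ ^ α :=
    continuous_const.mul ((continuous_id.sub continuous_const).norm.rpow_const fun _ => Or.inr hα.le)
  simpa [Real.zero_rpow hα.ne'] using this.tendsto y

section Pairing

variable {F : Type} [NormedAddCommGroup F] [InnerProductSpace ℝ F] {a b : ℝ≥0∞} [ENNReal.HolderConjugate a b]
  [Fact (1 ≤ a)] {f : E3 → F}

theorem abs_integral_inner_sub_le (hf : MemLp f b volΩ) (u w : LΩ F a) :
    |(∫ x in cube, inner ℝ (u x) (f x)) - ∫ x in cube, inner ℝ (w x) (f x)| ≤ ‖u - w‖ * nm b f := by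
  rw [← integral_sub (integrable_inner (Lp.memLp u) hf) (integrable_inner (Lp.memLp w) hf), norm_sub_eq_nm]
  simp_rw [← inner_sub_left]
  exact abs_integral_inner_le ((Lp.memLp u).sub (Lp.memLp w)) hf

theorem continuous_integral_inner (hf : MemLp f b volΩ) :
    Continuous fun u : LΩ F a => ∫ x in cube, (inner ℝ (u x) (f x) : ℝ) :=
  continuous_of_norm_sub_le (c := nm b f) one_pos fun u w => by
    rw [Real.rpow_one, mul_comm]; exact abs_integral_inner_sub_le hf u w

end Pairing

theorem exists_sobolev_nm (F : Type) [NormedAddCommGroup F] [NormedSpace ℝ F] [FiniteDimensional ℝ F]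
    (s r : NNReal) (hs : 1 ≤ s) (hr : (r : ℝ)⁻¹ = (s : ℝ)⁻¹ - 3⁻¹) {q : ℝ≥0∞} (hsq : s ≤ q) :
    ∃ C : ℝ, 1 ≤ C ∧ ∀ u : E3 → F, SP u → ∫ x in cube, u x = 0 → nm r u ≤ C * nm q (fderiv ℝ u) := by
  obtain ⟨C, hC⟩ := exists_sobolev F s r hs hr
  refine ⟨max 1 C, le_max_left _ _, fun u hu h0 => ?_⟩
  have h1 := ENNReal.toReal_mono (ENNReal.mul_ne_top ENNReal.coe_ne_top (hu.fderiv.memLp s).2.ne) (hC u hu h0)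
  rw [ENNReal.toReal_mul, ENNReal.coe_toReal] at h1
  calc nm r u ≤ C * nm s (fderiv ℝ u) := h1
    _ ≤ max 1 C * nm q (fderiv ℝ u) := mul_le_mul (le_max_right _ _)
        (nm_exponent_le hsq (hu.fderiv.memLp q)) (nm_nonneg _ _) (by positivity)

/-- `C` is a constant for the embedding of `W^{1,4/(4-p)}` into `L⁴`, for fields and gradients. -/
structure SobolevConst (p : Ico (5 / 3 : ℝ) 2) (C : ℝ) : Prop where
  one_le : 1 ≤ C
  vel : ∀ φ : E3 → E3, SP φ → ∫ x in cube, φ x = 0 → nm 4 φ ≤ C * nm (expHess p) (grad φ)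
  grad : ∀ φ : E3 → E3, SP φ → nm 4 (grad φ) ≤ C * nm (expHess p) (tgrad (sg φ))

theorem ofReal_le_expHess (p : Ico (5 / 3 : ℝ) 2) : ((12 / 7 : NNReal) : ℝ≥0∞) ≤ expHess p := by
  have h1 := p.2.1
  have h2 := p.2.2
  rw [expHess, show ((12 / 7 : NNReal) : ℝ≥0∞) = ENNReal.ofReal (12 / 7) by
    rw [ENNReal.ofReal, ENNReal.coe_inj]; ext; simp; positivity]
  apply ENNReal.ofReal_le_ofReal
  rw [le_div_iff₀ (by linarith)]; linarith

theorem exists_sobolevConst (p : Ico (5 / 3 : ℝ) 2) : ∃ C, SobolevConst p C := by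
  have hs : (1 : NNReal) ≤ 12 / 7 := by rw [← NNReal.coe_le_coe]; push_cast; norm_num
  have hr : ((4 : NNReal) : ℝ)⁻¹ = ((12 / 7 : NNReal) : ℝ)⁻¹ - 3⁻¹ := by push_cast; norm_num
  obtain ⟨C₁, h₁, hC₁⟩ := exists_sobolev_nm E3 (12 / 7) 4 hs hr (ofReal_le_expHess p)
  obtain ⟨C₂, h₂, hC₂⟩ := exists_sobolev_nm Mat3 (12 / 7) 4 hs hr (ofReal_le_expHess p)
  refine ⟨C₁ + 3 * C₂, by linarith, fun φ hφ h0 => ?_, fun φ hφ => ?_⟩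
  · refine (hC₁ φ hφ h0).trans ?_
    have : nm (expHess p) (fderiv ℝ φ) ≤ nm (expHess p) (PNavierStokes.grad φ) :=
      nm_mono (hφ.grad.memLp _) (ae_of_all _ fun x => norm_fderiv_le_grad hφ x)
    exact mul_le_mul (by linarith) this (nm_nonneg _ _) (by linarith)
  · refine (hC₂ _ hφ.grad (integral_grad_eq_zero hφ)).trans ?_
    have : nm (expHess p) (fderiv ℝ (PNavierStokes.grad φ)) ≤ 3 * nm (expHess p) (tgrad (sg φ)) :=
      nm_le_mul (hφ.sg.tgrad.memLp _) (by norm_num) (ae_of_all _ fun x => by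
        refine (norm_fderiv_le_tgrad _ x).trans ?_
        rw [tgrad_grad_eq hφ]
        exact norm_hessT_le _)
    nlinarith [nm_nonneg (expHess p) (tgrad (sg φ))]

/-- The smallness conditions on the data. -/
structure SmallData (p : Ico (5 / 3 : ℝ) 2) (C Λ K κ : ℝ) : Prop where
  pos : 0 < Λ
  nonneg : 0 ≤ K
  kappa : κ = ((p : ℝ) - 1) / 8 * (2 * Λ) ^ (-((2 - (p : ℝ)) / 2))
  conv : C ^ 2 * √Λ ≤ 2 * κ
  force : 21 * C ^ 2 * K ^ 2 < κ ^ 2 * Λ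

theorem SmallData.kappa_pos {p : Ico (5 / 3 : ℝ) 2} {C Λ K κ : ℝ} (h : SmallData p C Λ K κ) : 0 < κ := by
  have h1 := p.2.1
  rw [h.kappa]
  have := Real.rpow_pos_of_pos (by linarith [h.pos] : 0 < 2 * Λ) (-((2 - (p : ℝ)) / 2))
  have : 0 < (p : ℝ) - 1 := by linarith
  positivity

theorem two_le_expForce (p : Ico (5 / 3 : ℝ) 2) : 2 ≤ expForce p := by
  have h1 := p.2.1
  have h2 := p.2.2
  rw [expForce, show (2 : ℝ≥0∞) = ENNReal.ofReal 2 by simp]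
  apply ENNReal.ofReal_le_ofReal
  rw [le_div_iff₀ (by linarith)]; linarith

theorem expHess_le_two (p : Ico (5 / 3 : ℝ) 2) : expHess p ≤ 2 := by
  have h1 := p.2.1
  have h2 := p.2.2
  rw [expHess, show (2 : ℝ≥0∞) = ENNReal.ofReal 2 by simp]
  apply ENNReal.ofReal_le_ofReal
  rw [div_le_iff₀ (by linarith)]; linarith

instance (p : Ico (5 / 3 : ℝ) 2) : ENNReal.HolderConjugate (expForce p) (expHess p) := ⟨by
  have h1 := p.2.1
  have h2 := p.2.2
  have h3 : 0 < (p : ℝ) := by linarith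
  have h4 : 0 < 4 - (p : ℝ) := by linarith
  rw [expHess, expForce, ← ENNReal.ofReal_inv_of_pos (by positivity),
    ← ENNReal.ofReal_inv_of_pos (by positivity), ← ENNReal.ofReal_add (by positivity) (by positivity)]
  have : (4 / (p : ℝ))⁻¹ + (4 / (4 - (p : ℝ)))⁻¹ = 1 := by field_simp; ring
  rw [this]; simp⟩

theorem norm_lap_le {φ : E3 → E3} (hφ : SP φ) (x : E3) : ‖lap φ x‖ ≤ 9 * ‖tgrad (sg φ) x‖ := by
  have h1 : ∀ k, ‖dd k (dd k φ) x‖ ≤ ‖tgrad (grad φ) x‖ := by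
    intro k
    refine (sq_le_sq₀ (norm_nonneg _) (norm_nonneg _)).1 ?_
    rw [norm_tgrad_sq]
    have h2 : ‖dd k (dd k φ) x‖ ^ 2 ≤ ‖dd k (grad φ) x‖ ^ 2 := by
      rw [← grad_dd hφ, norm_grad_sq (hφ.dd k)]
      exact Finset.single_le_sum (f := fun j => ‖dd j (dd k φ) x‖ ^ 2) (fun _ _ => by positivity)
        (Finset.mem_univ k)
    exact h2.trans (Finset.single_le_sum (f := fun k => ‖dd k (grad φ) x‖ ^ 2)
      (fun _ _ => by positivity) (Finset.mem_univ k))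
  have h2 : ‖tgrad (grad φ) x‖ ≤ 3 * ‖tgrad (sg φ) x‖ := by
    rw [tgrad_grad_eq hφ]; exact norm_hessT_le _
  calc ‖lap φ x‖ ≤ ∑ k : Fin 3, ‖dd k (dd k φ) x‖ := norm_sum_le _ _
    _ ≤ ∑ _k : Fin 3, 3 * ‖tgrad (sg φ) x‖ := Finset.sum_le_sum fun k _ => (h1 k).trans h2
    _ = _ := by simp; ring

/-- The weighted dissipation `∫ (μ + |𝒟φ|²)^((p-2)/2) |∇𝒟φ|²`. -/
def diss (μ p : ℝ) (φ : E3 → E3) : ℝ := ∫ x in cube, wt μ p (sg φ x) * ‖tgrad (sg φ) x‖ ^ 2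

theorem diss_nonneg {μ p : ℝ} (hμ : 0 ≤ μ) (φ : E3 → E3) : 0 ≤ diss μ p φ :=
  integral_nonneg fun x => mul_nonneg (wt_nonneg hμ _) (by positivity)

theorem integral_add_norm_sg_sq_le {μ Λ : ℝ} (hμ : μ ≤ Λ) {φ : E3 → E3} (hφ : SP φ)
    (hy : nm 2 (grad φ) ^ 2 ≤ Λ) : ∫ x in cube, (μ + ‖sg φ x‖ ^ 2) ≤ 2 * Λ := by
  have hi : Integrable (fun x => ‖sg φ x‖ ^ 2) volΩ := integrable_of_continuous (by have := hφ.sg.continuous; fun_prop)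
  rw [integral_add (integrable_const _) hi, ← nm_two_sq (hφ.sg.memLp 2)]
  have h2 := pow_le_pow_left₀ (nm_nonneg _ _) (nm_sg_le hφ 2) 2
  have h3 : ∫ _ in cube, μ = μ := by simp
  rw [h3]; linarith

theorem kappa_mul_le_diss {p : Ico (5 / 3 : ℝ) 2} {C Λ K κ : ℝ} (h : SmallData p C Λ K κ) {μ : ℝ}
    (hμ : 0 < μ) (hμΛ : μ ≤ Λ) {φ : E3 → E3} (hφ : SP φ) (hy : nm 2 (grad φ) ^ 2 ≤ Λ) :
    8 * κ * nm (expHess p) (tgrad (sg φ)) ^ 2 ≤ ((p : ℝ) - 1) * diss μ p φ := by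
  have h1 := p.2.1
  have h2 := p.2.2
  have hΛ := h.pos
  have hρ : ∀ x, 0 < μ + ‖sg φ x‖ ^ 2 := fun x => by positivity
  have hw := nm_sq_le_weighted p hφ.sg.tgrad.continuous (ρ := fun x => μ + ‖sg φ x‖ ^ 2)
    (by have := hφ.sg.continuous; fun_prop) hρ
  have hle : (∫ x in cube, (μ + ‖sg φ x‖ ^ 2)) ^ ((2 - (p : ℝ)) / 2) ≤ (2 * Λ) ^ ((2 - (p : ℝ)) / 2) :=
    Real.rpow_le_rpow (integral_nonneg fun x => (hρ x).le) (integral_add_norm_sg_sq_le hμΛ hφ hy) (by linarith)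
  have hd : (∫ x in cube, (μ + ‖sg φ x‖ ^ 2) ^ (((p : ℝ) - 2) / 2) * ‖tgrad (sg φ) x‖ ^ 2) = diss μ p φ := rfl
  rw [hd] at hw
  have hB := hw.trans (mul_le_mul_of_nonneg_left hle (diss_nonneg hμ.le φ))
  have hm := Real.rpow_pos_of_pos (by linarith : 0 < 2 * Λ) ((2 - (p : ℝ)) / 2)
  rw [h.kappa, Real.rpow_neg (by positivity)]
  have h3 : 8 * (((p : ℝ) - 1) / 8 * ((2 * Λ) ^ ((2 - (p : ℝ)) / 2))⁻¹) * nm (expHess p) (tgrad (sg φ)) ^ 2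
      = ((p : ℝ) - 1) * (((2 * Λ) ^ ((2 - (p : ℝ)) / 2))⁻¹ * nm (expHess p) (tgrad (sg φ)) ^ 2) := by ring
  rw [h3]
  refine mul_le_mul_of_nonneg_left ?_ (by linarith)
  rw [inv_mul_le_iff₀ hm, mul_comm]
  exact hB

/-- The a priori estimate obtained by testing with `-Δφ`. -/
theorem laplace_test_le {p : Ico (5 / 3 : ℝ) 2} {C Λ K κ : ℝ} (hS : SobolevConst p C)
    (h : SmallData p C Λ K κ) {μ : ℝ} (hμ : 0 < μ) (hμΛ : μ ≤ Λ) {φ : E3 → E3}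
    (hφ : IsSolenoidalTest φ) (hy : nm 2 (grad φ) ^ 2 ≤ Λ) {g : E3 → E3}
    (hg : MemLp g (expForce p) volΩ) (hgK : nm (expForce p) g ≤ K) :
    (∫ x in cube, inner ℝ (convect (φ x) (grad φ x)) (lap φ x)) +
      (∫ x in cube, inner ℝ (Sv μ p (sg φ x)) (sg (lap φ) x)) - (∫ x in cube, inner ℝ (g x) (lap φ x)) ≤
    -(((p : ℝ) - 1) / 2 * diss μ p φ) - μ * (∫ x in cube, ‖tgrad (sg φ) x‖ ^ 2) -
      κ * nm (expHess p) (tgrad (sg φ)) ^ 2 + 21 * K ^ 2 / κ := by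
  have h2 := p.2.2
  have hκ := h.kappa_pos
  have hsp := hφ.sp
  set B := nm (expHess p) (tgrad (sg φ))
  have hB : 0 ≤ B := nm_nonneg _ _
  have e1 := dissipation_le hμ h2.le hsp
  rw [← diss] at e1
  have e2 := kappa_mul_le_diss h hμ hμΛ hsp hy
  have e3 := (abs_le.1 (integral_convect_lap hφ)).2
  have e4 : nm 2 (grad φ) * nm 4 (grad φ) ^ 2 ≤ 2 * κ * B ^ 2 := by
    have a1 : nm 2 (grad φ) ≤ √Λ := Real.le_sqrt_of_sq_le hy
    have a2 : nm 4 (grad φ) ^ 2 ≤ C ^ 2 * B ^ 2 := by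
      rw [← mul_pow]; exact pow_le_pow_left₀ (nm_nonneg _ _) (hS.grad φ hsp) 2
    calc nm 2 (grad φ) * nm 4 (grad φ) ^ 2 ≤ √Λ * (C ^ 2 * B ^ 2) :=
          mul_le_mul a1 a2 (by positivity) (by positivity)
      _ = (C ^ 2 * √Λ) * B ^ 2 := by ring
      _ ≤ _ := mul_le_mul_of_nonneg_right h.conv (by positivity)
  have e5 : -(∫ x in cube, inner ℝ (g x) (lap φ x)) ≤ K * (9 * B) := by
    refine (neg_le_abs _).trans ((abs_integral_inner_le hg (hsp.lap.memLp (expHess p))).trans ?_)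
    refine mul_le_mul hgK ?_ (nm_nonneg _ _) h.nonneg
    exact nm_le_mul (hsp.sg.tgrad.memLp _) (by norm_num) (ae_of_all _ fun x => norm_lap_le hsp x)
  have e6 : K * (9 * B) ≤ κ * B ^ 2 + 21 * K ^ 2 / κ := by
    have : 0 ≤ (κ * B - 9 / 2 * K) ^ 2 / κ := by positivity
    have h3 : (κ * B - 9 / 2 * K) ^ 2 / κ = κ * B ^ 2 - 9 * K * B + 81 / 4 * K ^ 2 / κ := by
      field_simp; ring
    have h4 : 81 / 4 * K ^ 2 / κ ≤ 21 * K ^ 2 / κ := by gcongr; norm_num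
    linarith
  nlinarith

theorem integral_inner_grad {φ ψ : E3 → E3} (hφ : SP φ) (hψ : SP ψ) :
    ∫ x in cube, inner ℝ (grad φ x) (grad ψ x) = -∫ x in cube, inner ℝ (ψ x) (lap φ x) := by
  have h1 : ∀ x, (inner ℝ (grad φ x) (grad ψ x) : ℝ) = ∑ k, inner ℝ (dd k φ x) (dd k ψ x) := by
    intro x
    simp only [PiLp.inner_apply, Fintype.sum_prod_type, grad_apply hφ, grad_apply hψ]
    rw [Finset.sum_comm]
  simp_rw [h1, lap, inner_sum]
  rw [integral_finsetSum _ fun k _ => ((hφ.dd k).inner (hψ.dd k)).integrable,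
    integral_finsetSum _ fun k _ => (hψ.inner ((hφ.dd k).dd k)).integrable, ← Finset.sum_neg_distrib]
  refine Finset.sum_congr rfl fun k _ => ?_
  have := integral_inner_dd (hφ.dd k) hψ k
  simp_rw [real_inner_comm (dd k (dd k φ) _)]
  linarith

theorem lap_mem_X {n : ℕ} {φ : E3 → E3} (hφ : φ ∈ X n) : lap φ ∈ X n := by
  have : lap φ = ∑ k, dd k (dd k φ) := by ext1 x; simp [lap]
  rw [this]
  exact Submodule.sum_mem _ fun k _ => dd_mem_X (dd_mem_X hφ k) k

theorem nm_le_two_mul_grad {φ : E3 → E3} (hφ : IsSolenoidalTest φ) {q : ℝ≥0∞} (hq : 1 ≤ q) (hq' : q ≠ ⊤) :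
    nm q φ ≤ 2 * nm q (grad φ) := by
  have h1 := ENNReal.toReal_mono (ENNReal.mul_ne_top (by simp) (hφ.sp.fderiv.memLp q).2.ne)
    (eLpNorm_le_two_mul_fderiv hφ.sp hφ.mean_zero hq hq')
  rw [ENNReal.toReal_mul, ENNReal.toReal_ofNat] at h1
  have h2 : nm q (fderiv ℝ φ) ≤ nm q (grad φ) :=
    nm_mono (hφ.sp.grad.memLp q) (ae_of_all _ fun x => norm_fderiv_le_grad hφ.sp x)
  exact h1.trans (by gcongr; exact h2)

theorem integral_inner_sum_smul {F : Type} [NormedAddCommGroup F] [InnerProductSpace ℝ F] {ι : Type*}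
    {s : Finset ι} {f : E3 → F} (hf : MemLp f 2 volΩ) (c : ι → ℝ) {e : ι → E3 → F} (he : ∀ i, SP (e i)) :
    ∫ x in cube, inner ℝ (f x) (∑ i ∈ s, c i • e i x) = ∑ i ∈ s, c i * ∫ x in cube, inner ℝ (f x) (e i x) := by
  simp_rw [inner_sum, inner_smul_right]
  rw [integral_finsetSum _ fun i _ => ((integrable_inner hf ((he i).memLp 2)).const_mul _)]
  simp_rw [integral_const_mul]

theorem norm_Sv_sub_le {μ p : ℝ} (hμ : 0 < μ) (hp1 : 1 ≤ p) (hp2 : p ≤ 2) (A B : Mat3) :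
    ‖Sv μ p A - Sv μ p B‖ ≤ (μ ^ ((p - 2) / 2) + μ) * ‖A - B‖ := by
  have h1 := norm_Sm_sub_le hμ hp1 hp2 A B
  have h2 : Sv μ p A - Sv μ p B = (Sm μ p A - Sm μ p B) + μ • (A - B) := by
    simp only [Sv, smul_sub]; abel
  rw [h2]
  refine (norm_add_le _ _).trans ?_
  rw [norm_smul, Real.norm_of_nonneg hμ.le]
  linarith

theorem convect_sum_left {ι : Type*} (s : Finset ι) (c : ι → ℝ) (u : ι → E3) (A : Mat3) :
    convect (∑ i ∈ s, c i • u i) A = ∑ i ∈ s, c i • convect (u i) A := by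
  ext l
  simp only [convect, WithLp.ofLp_sum, WithLp.ofLp_smul, Finset.sum_apply, Pi.smul_apply, smul_eq_mul,
    Finset.mul_sum, Finset.sum_mul]
  rw [Finset.sum_comm]
  exact Finset.sum_congr rfl fun _ _ => Finset.sum_congr rfl fun _ _ => by ring

theorem convect_sum_right {ι : Type*} (s : Finset ι) (d : ι → ℝ) (u : E3) (A : ι → Mat3) :
    convect u (∑ k ∈ s, d k • A k) = ∑ k ∈ s, d k • convect u (A k) := by
  ext l
  simp only [convect, WithLp.ofLp_sum, WithLp.ofLp_smul, Finset.sum_apply, Pi.smul_apply, smul_eq_mul, Finset.mul_sum]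
  rw [Finset.sum_comm]
  exact Finset.sum_congr rfl fun _ _ => Finset.sum_congr rfl fun _ _ => by ring

/-- Weak form of the regularised system in the Galerkin space, with the uniform gradient bound. -/
structure IsGalerkin (p : Ico (5 / 3 : ℝ) 2) (Λ μ : ℝ) {n : ℕ} {T : ℝ} (g : ℝ → LΩ E3 (expForce p))
    (γ : Curve n T) : Prop where
  weak : ∀ t ∈ Icc 0 T, ∀ ψ ∈ X n, (∫ x in cube, inner ℝ (γ.v' t x) (ψ x)) +
      (∫ x in cube, inner ℝ (convect (γ.v t x) (grad (γ.v t) x)) (ψ x)) +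
      (∫ x in cube, inner ℝ (Sv μ p (sg (γ.v t) x)) (sg ψ x)) = ∫ x in cube, inner ℝ (g t x) (ψ x)
  bound : ∀ t ∈ Icc 0 T, nm 2 (grad (γ.v t)) ^ 2 ≤ Λ

/-- Coordinatewise truncation. -/
def clip {N : ℕ} (ρ : ℝ) (c : Fin N → ℝ) : Fin N → ℝ := fun i => max (-ρ) (min ρ (c i))

theorem clip_eq {N : ℕ} {ρ : ℝ} {c : Fin N → ℝ} (h : ∀ i, |c i| ≤ ρ) : clip ρ c = c := by
  ext i
  have := abs_le.1 (h i)
  rw [clip, min_eq_right this.2, max_eq_right this.1]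

theorem norm_clip_le {N : ℕ} {ρ : ℝ} (hρ : 0 ≤ ρ) (c : Fin N → ℝ) : ‖clip ρ c‖ ≤ ρ := by
  rw [pi_norm_le_iff_of_nonneg hρ]
  intro i
  rw [Real.norm_eq_abs, abs_le]
  exact ⟨le_max_left _ _, max_le (by linarith) (min_le_left _ _)⟩

theorem lipschitzWith_clip {N : ℕ} (ρ : ℝ) : LipschitzWith 1 (clip (N := N) ρ) := by
  refine LipschitzWith.of_dist_le_mul fun c d => ?_
  rw [NNReal.coe_one, one_mul, dist_pi_le_iff dist_nonneg]
  intro i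
  refine le_trans ?_ (dist_le_pi_dist c d i)
  rw [Real.dist_eq, Real.dist_eq]
  refine (abs_max_sub_max_le_max _ _ _ _).trans ?_
  rw [sub_self, abs_zero]
  refine max_le (abs_nonneg _) ((abs_min_sub_min_le_max _ _ _ _).trans ?_)
  rw [sub_self, abs_zero]
  exact max_le (abs_nonneg _) le_rfl

/-- Global solvability for a bounded and Lipschitz autonomous field plus a bounded forcing. -/
theorem exists_hasDerivAt {E : Type} [NormedAddCommGroup E] [NormedSpace ℝ E] [CompleteSpace E] {T : ℝ}
    (hT : 0 ≤ T) (x₀ : E) {G : ℝ → E} {H : E → E} (hG : Continuous G) {K : NNReal} (hH : LipschitzWith K H)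
    {L : NNReal} (hL : ∀ t x, ‖G t + H x‖ ≤ L) :
    ∃ c : ℝ → E, Continuous c ∧ c 0 = x₀ ∧ ∀ t ∈ Icc 0 T, HasDerivAt c (G t + H (c t)) t := by
  have h01 : (0 : ℝ) ∈ Icc (-1) (T + 1) := ⟨by norm_num, by linarith⟩
  have hP : IsPicardLindelof (fun t x => G t + H x) (⟨0, h01⟩ : Icc (-1) (T + 1)) x₀ (L * ⟨T + 1, by linarith⟩) 0 L K :=
    { lipschitzOnWith := fun t _ => by
        have := (LipschitzWith.const (G t)).add hH
        rw [zero_add] at this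
        exact this.lipschitzOnWith
      continuousOn := fun x _ => (hG.add continuous_const).continuousOn
      norm_le := fun t _ x _ => hL t x
      mul_max_le := by
        simp only [NNReal.coe_zero, sub_zero]
        refine mul_le_mul_of_nonneg_left (max_le le_rfl (by linarith)) L.2 }
  obtain ⟨α, hα0, hα⟩ := hP.exists_eq_forall_mem_Icc_hasDerivWithinAt₀
  have hle : (-1 : ℝ) ≤ T + 1 := by linarith
  have hαc : ContinuousOn α (Icc (-1) (T + 1)) := fun t ht => (hα t ht).continuousWithinAt
  refine ⟨fun t => α (projIcc (-1) (T + 1) hle t), ?_, ?_, fun t ht => ?_⟩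
  · exact hαc.comp_continuous (continuous_subtype_val.comp continuous_projIcc) fun t => (projIcc _ _ _ t).2
  · simp only [projIcc_of_mem hle h01]; exact hα0
  · have hm : Icc (-1) (T + 1) ∈ 𝓝 t := Icc_mem_nhds (by linarith [ht.1]) (by linarith [ht.2])
    have h1 := (hα t (mem_of_mem_nhds hm)).hasDerivAt hm
    simp only [projIcc_of_mem hle (mem_of_mem_nhds hm)]
    refine h1.congr_of_eventuallyEq ?_
    filter_upwards [hm] with s hs
    rw [projIcc_of_mem hle hs]

section Field

variable {n N : ℕ} {e : Fin N → E3 → E3} {μ p : ℝ}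

/-- The Galerkin vector field in coordinates, without the force. -/
def galerkinField (μ p : ℝ) (e : Fin N → E3 → E3) (c : Fin N → ℝ) : Fin N → ℝ := fun i =>
  -(∫ x in cube, inner ℝ (convect (∑ j, c j • e j x) (grad (fun x => ∑ j, c j • e j x) x)) (e i x)) -
    ∫ x in cube, inner ℝ (Sv μ p (sg (fun x => ∑ j, c j • e j x) x)) (sg (e i) x)

theorem locallyLipschitz_convect (he : ∀ i, SP (e i)) (i : Fin N) : LocallyLipschitz fun c : Fin N → ℝ =>
      ∫ x in cube, inner ℝ (convect (∑ j, c j • e j x) (grad (fun x => ∑ j, c j • e j x) x)) (e i x) := by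
  have h1 : ∀ c : Fin N → ℝ,
      ∫ x in cube, (inner ℝ (convect (∑ j, c j • e j x) (grad (fun x => ∑ j, c j • e j x) x)) (e i x) : ℝ) =
      ∑ j, ∑ k, c j * c k * ∫ x in cube, inner ℝ (convect (e j x) (grad (e k) x)) (e i x) := by
    intro c
    have hi : ∀ j k, Integrable (fun x => c j * (c k * (inner ℝ (convect (e j x) (grad (e k) x)) (e i x) : ℝ))) volΩ :=
      fun j k => ((((he j).convect (he k).grad).inner (he i)).integrable.const_mul _).const_mul _
    simp_rw [grad_sum c he, convect_sum_left, convect_sum_right, sum_inner, inner_smul_left, sum_inner,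
      inner_smul_left, conj_trivial, Finset.mul_sum]
    rw [integral_finsetSum _ fun j _ => integrable_finsetSum _ fun k _ => hi j k]
    refine Finset.sum_congr rfl fun j _ => ?_
    rw [integral_finsetSum _ fun k _ => hi j k]
    refine Finset.sum_congr rfl fun k _ => ?_
    rw [integral_const_mul, integral_const_mul, mul_assoc]
  simp_rw [h1]
  refine ContDiff.locallyLipschitz (𝕂 := ℝ) ?_
  fun_prop

theorem lipschitzWith_stress (hμ : 0 < μ) (hp1 : 1 ≤ p) (hp2 : p ≤ 2) (he : ∀ i, SP (e i)) (i : Fin N) :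
    ∃ M, LipschitzWith M fun c : Fin N → ℝ =>
      ∫ x in cube, inner ℝ (Sv μ p (sg (fun x => ∑ j, c j • e j x) x)) (sg (e i) x) := by
  obtain ⟨f, hf⟩ : ∃ f : (Fin N → ℝ) → E3 → Mat3, ∀ c, f c = fun x => ∑ j, c j • sg (e j) x := ⟨_, fun _ => rfl⟩
  have hfc : ∀ c, SP (f c) := fun c => by rw [hf]; exact SP.sum fun j _ => (he j).sg.const_smul (c j)
  have hSc : ∀ c, MemLp (fun x => Sv μ p (f c x)) 2 volΩ := fun c => (SP.comp (contDiff_Sv hμ) (hfc c)).memLp 2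
  have hsg : ∀ c : Fin N → ℝ, sg (fun x => ∑ j, c j • e j x) = f c := fun c => by
    rw [hf]; exact funext fun x => sg_sum c he x
  have hi := (he i).sg.memLp 2
  have hs := Finset.sum_nonneg fun j (_ : j ∈ Finset.univ) => nm_nonneg 2 (sg (e j))
  have hL : 0 ≤ μ ^ ((p - 2) / 2) + μ := add_nonneg (Real.rpow_nonneg hμ.le _) hμ.le
  have hM : 0 ≤ (μ ^ ((p - 2) / 2) + μ) * (∑ j, nm 2 (sg (e j))) * nm 2 (sg (e i)) :=
    mul_nonneg (mul_nonneg hL hs) (nm_nonneg _ _)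
  simp_rw [hsg]
  refine ⟨⟨_, hM⟩, LipschitzWith.of_dist_le_mul fun c d => ?_⟩
  rw [Real.dist_eq, ← integral_sub (integrable_inner (hSc c) hi) (integrable_inner (hSc d) hi)]
  simp_rw [← inner_sub_left]
  refine (abs_integral_inner_le ((hSc c).sub (hSc d)) hi).trans ?_
  have h2 : nm 2 (fun x => Sv μ p (f c x) - Sv μ p (f d x)) ≤ (μ ^ ((p - 2) / 2) + μ) * nm 2 (fun x => f c x - f d x) :=
    nm_le_mul (((hfc c).sub (hfc d)).memLp 2) hL (ae_of_all _ fun x => norm_Sv_sub_le hμ hp1 hp2 _ _)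
  have h3 : nm 2 (fun x => f c x - f d x) ≤ dist c d * ∑ j, nm 2 (sg (e j)) := by
    have h4 : (fun x => f c x - f d x) = fun x => ∑ j, (c j - d j) • sg (e j) x := by
      ext1 x; simp_rw [hf, sub_smul, Finset.sum_sub_distrib]
    rw [h4, ← norm_toL ((SP.sum fun j _ => (he j).sg.const_smul _).memLp 2),
      toL_sum_smul _ _ fun j => (he j).sg.memLp 2, Finset.mul_sum]
    refine (norm_sum_le _ _).trans (Finset.sum_le_sum fun j _ => ?_)
    rw [norm_smul, norm_toL ((he j).sg.memLp 2)]
    exact mul_le_mul_of_nonneg_right (dist_le_pi_dist c d j) (nm_nonneg _ _)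
  refine (mul_le_mul_of_nonneg_right (h2.trans (mul_le_mul_of_nonneg_left h3 hL)) (nm_nonneg _ _)).trans_eq ?_
  show _ = _ * _ * _ * dist c d
  ring

theorem exists_lipschitzOnWith_galerkinField (hμ : 0 < μ) (hp1 : 1 ≤ p) (hp2 : p ≤ 2) (he : ∀ i, SP (e i)) (ρ : ℝ) :
    ∃ K, LipschitzOnWith K (galerkinField μ p e) (Metric.closedBall 0 ρ) := by
  have hK : ∀ i, ∃ K, LipschitzOnWith K (fun c => galerkinField μ p e c i) (Metric.closedBall 0 ρ) := by
    intro i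
    obtain ⟨M, hM⟩ := lipschitzWith_stress hμ hp1 hp2 he i
    exact ((locallyLipschitz_convect he i).neg.sub
      hM.locallyLipschitz).locallyLipschitzOn.exists_lipschitzOnWith_of_compact (isCompact_closedBall _ _)
  choose K hK using hK
  refine ⟨∑ i, K i, LipschitzOnWith.of_dist_le_mul fun c hc d hd => ?_⟩
  rw [dist_pi_le_iff (by positivity)]
  intro i
  refine ((hK i).dist_le_mul c hc d hd).trans (mul_le_mul_of_nonneg_right ?_ dist_nonneg)
  exact_mod_cast Finset.single_le_sum (f := K) (fun _ _ => zero_le) (Finset.mem_univ i)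

theorem exists_galerkin {p : Ico (5 / 3 : ℝ) 2} {C Λ K κ : ℝ} (hS : SobolevConst p C)
    (h : SmallData p C Λ K κ) {μ : ℝ} (hμ : 0 < μ) (hμΛ : μ ≤ Λ) {T : ℝ} (hT : 0 ≤ T)
    {g : ℝ → LΩ E3 (expForce p)} (hg : Continuous g) (hgK : ∀ t, ‖g t‖ ≤ K) {n : ℕ} {φ : E3 → E3}
    (hφ : φ ∈ X n) (hφΛ : nm 2 (grad φ) ^ 2 ≤ Λ) :
    ∃ γ : Curve n T, IsGalerkin p Λ μ g γ ∧ γ.v 0 = φ := by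
  have hp1 := p.2.1
  have hp2 := p.2.2
  obtain ⟨N, e, hmem, hone, hcoord, hrepr⟩ := exists_orthonormal_basis_X n
  have he : ∀ i, SP (e i) := fun i => (hmem i).1.sp
  set ρ : ℝ := 2 * √Λ
  have hρ : 0 ≤ ρ := by positivity
  obtain ⟨K₁, hK₁⟩ := exists_lipschitzOnWith_galerkinField (p := p) hμ (by linarith) hp2.le he ρ
  have hclipmem : ∀ c : Fin N → ℝ, clip ρ c ∈ Metric.closedBall (0 : Fin N → ℝ) ρ := fun c => by
    rw [mem_closedBall_zero_iff]; exact norm_clip_le hρ c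
  set H : (Fin N → ℝ) → Fin N → ℝ := fun c => galerkinField μ p e (clip ρ c)
  have hH : LipschitzWith K₁ H := by
    refine LipschitzWith.of_dist_le_mul fun c d => ?_
    refine (hK₁.dist_le_mul _ (hclipmem c) _ (hclipmem d)).trans ?_
    have := (lipschitzWith_clip ρ).dist_le_mul c d
    rw [NNReal.coe_one, one_mul] at this
    gcongr
  set G : ℝ → Fin N → ℝ := fun t i => ∫ x in cube, inner ℝ (g t x) (e i x)
  have hGle : ∀ (u : LΩ E3 (expForce p)) i, |∫ x in cube, inner ℝ (u x) (e i x)| ≤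
      ‖u‖ * nm (expHess p) (e i) := fun u i =>
    abs_integral_inner_le (Lp.memLp u) ((he i).memLp (expHess p))
  have hG : Continuous G := continuous_pi fun i => (continuous_integral_inner ((he i).memLp (expHess p))).comp hg
  have hb : ∃ L : NNReal, ∀ t x, ‖G t + H x‖ ≤ L := by
    have hs := Finset.sum_nonneg fun j (_ : j ∈ Finset.univ) => nm_nonneg (expHess p) (e j)
    have hL : 0 ≤ K * (∑ j, nm (expHess p) (e j)) + (K₁ * ρ + ‖galerkinField μ p e 0‖) := by
      have := h.nonneg
      positivity
    refine ⟨⟨_, hL⟩, fun t x => (norm_add_le _ _).trans (add_le_add ?_ ?_)⟩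
    · rw [pi_norm_le_iff_of_nonneg (mul_nonneg h.nonneg hs)]
      intro i
      refine (hGle _ i).trans (mul_le_mul (hgK t) ?_ (nm_nonneg _ _) h.nonneg)
      exact Finset.single_le_sum (f := fun j => nm (expHess p) (e j)) (fun _ _ => nm_nonneg _ _) (Finset.mem_univ i)
    · have h1 := hK₁.dist_le_mul _ (hclipmem x) 0 (Metric.mem_closedBall_self hρ)
      rw [dist_eq_norm, dist_zero_right] at h1
      have h2 := norm_clip_le hρ x
      have h3 := norm_sub_norm_le (H x) (galerkinField μ p e 0)
      have h4 : (K₁ : ℝ) * ‖clip ρ x‖ ≤ K₁ * ρ := by gcongr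
      linarith
  obtain ⟨L, hL⟩ := hb
  obtain ⟨c, hc, hc0, hcd⟩ := exists_hasDerivAt hT (fun i => ∫ x in cube, inner ℝ (e i x) (φ x)) hG hH hL
  set γ : Curve n T :=
    { N := N, e := e, mem := hmem, c := c, c' := fun t => G t + H (c t), cont := hc
      cont' := hG.add (hH.continuous.comp hc), deriv := hcd }
  have hγv : ∀ t, γ.v t = fun x => ∑ i, c t i • e i x := fun t => rfl
  have hγv' : ∀ t, γ.v' t = fun x => ∑ i, (G t + H (c t)) i • e i x := fun t => rfl
  have hweak : ∀ t, nm 2 (grad (γ.v t)) ^ 2 ≤ Λ → ∀ ψ ∈ X n, (∫ x in cube, inner ℝ (γ.v' t x) (ψ x)) +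
      (∫ x in cube, inner ℝ (convect (γ.v t x) (grad (γ.v t) x)) (ψ x)) +
      (∫ x in cube, inner ℝ (Sv μ p (sg (γ.v t) x)) (sg ψ x)) = ∫ x in cube, inner ℝ (g t x) (ψ x) := by
    intro t ht ψ hψ
    have hclip : clip ρ (c t) = c t := by
      refine clip_eq fun i => ?_
      rw [← hcoord (c t) i]
      refine (abs_integral_inner_le ((he i).memLp 2) ((γ.sp t).memLp 2)).trans ?_
      rw [hone, one_mul]
      refine (nm_le_two_mul_grad (γ.test t) (by norm_num) (by norm_num)).trans ?_
      have := Real.le_sqrt_of_sq_le ht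
      simp only [ρ]; linarith
    set a : Fin N → ℝ := fun i => ∫ x in cube, inner ℝ (e i x) (ψ x)
    have hψa : ψ = fun x => ∑ i, a i • e i x := hrepr ψ hψ
    have hgt : MemLp (g t) 2 volΩ := memLp_of_le (two_le_expForce p) (Lp.memLp (g t))
    have h1 := integral_inner_sum_smul (s := Finset.univ) ((γ.sp' t).memLp 2) a he
    have h2 := integral_inner_sum_smul (s := Finset.univ) (((γ.sp t).convect (γ.sp t).grad).memLp 2) a he
    have h3 := integral_inner_sum_smul (s := Finset.univ)
      ((SP.comp (contDiff_Sv (p := p) hμ) (γ.sp t).sg).memLp 2) a fun i => (he i).sg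
    have h4 := integral_inner_sum_smul (s := Finset.univ) hgt a he
    have h5 : ∀ x, sg ψ x = ∑ i, a i • sg (e i) x := fun x => by rw [hψa]; exact sg_sum a he x
    have h6 : ∀ x, ψ x = ∑ i, a i • e i x := fun x => by conv_lhs => rw [hψa]
    simp_rw [h5, h6]
    rw [h1, h2, h3, h4, ← Finset.sum_add_distrib, ← Finset.sum_add_distrib]
    refine Finset.sum_congr rfl fun i _ => ?_
    rw [← mul_add, ← mul_add]
    congr 1
    have h7 : ∫ x in cube, inner ℝ (γ.v' t x) (e i x) = (G t + H (c t)) i := by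
      simp_rw [real_inner_comm (e i _)]
      exact hcoord _ i
    rw [h7, Pi.add_apply]
    simp only [H, hclip, G, galerkinField, hγv]
    ring
  refine ⟨γ, ?_, by rw [hγv, hc0]; exact (hrepr φ hφ).symm⟩
  have hy : ∀ t ∈ Icc 0 T, HasDerivAt (fun t => nm 2 (grad (γ.v t)) ^ 2)
      (2 * ∫ x in cube, inner ℝ (grad (γ.v t) x) (grad (γ.v' t) x)) t := by
    intro t ht
    have h1 := (γ.hasDerivAt_grad ht).norm_sq
    rw [inner_toL ((γ.sp t).grad.memLp 2) ((γ.sp' t).grad.memLp 2)] at h1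
    simp_rw [norm_toL ((γ.sp _).grad.memLp 2)] at h1
    exact h1
  have hbound : ∀ t ∈ Icc 0 T, nm 2 (grad (γ.v t)) ^ 2 ≤ Λ := by
    refine image_le_of_deriv_right_lt_deriv_boundary (B := fun _ => Λ) (B' := fun _ => 0)
      (fun t ht => (hy t ht).continuousAt.continuousWithinAt)
      (fun t ht => (hy t ⟨ht.1, ht.2.le⟩).hasDerivWithinAt) ?_ (fun t => hasDerivAt_const t Λ) ?_
    · rw [hγv, hc0, ← hrepr φ hφ]; exact hφΛ
    · intro t ht hyt
      have hw := hweak t hyt.le _ (lap_mem_X (γ.v_mem t))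
      have hl := laplace_test_le hS h hμ hμΛ (γ.test t) hyt.le (Lp.memLp (g t)) (hgK t)
      rw [integral_inner_grad (γ.sp t) (γ.sp' t)]
      have hd := diss_nonneg (p := p) hμ.le (γ.v t)
      have hJ : 0 ≤ ∫ x in cube, ‖tgrad (sg (γ.v t)) x‖ ^ 2 := integral_nonneg fun x => by positivity
      set B := nm (expHess p) (tgrad (sg (γ.v t)))
      have hκ := h.kappa_pos
      have hB : Λ ≤ C ^ 2 * B ^ 2 := by
        rw [← hyt, ← mul_pow]
        exact pow_le_pow_left₀ (nm_nonneg _ _) ((nm_exponent_le (by norm_num)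
          ((γ.sp t).grad.memLp 4)).trans (hS.grad _ (γ.sp t))) 2
      have hC : 0 < C ^ 2 := by have := hS.one_le; positivity
      have h1 : C ^ 2 * (21 * K ^ 2) < C ^ 2 * (κ ^ 2 * B ^ 2) := by
        have := mul_le_mul_of_nonneg_left hB (by positivity : 0 ≤ κ ^ 2)
        linarith [h.force]
      have h2 := lt_of_mul_lt_mul_left h1 hC.le
      have h3 : 21 * K ^ 2 / κ < κ * B ^ 2 := by
        rw [div_lt_iff₀ hκ]; linarith
      have h4 : 0 ≤ ((p : ℝ) - 1) / 2 * diss μ p (γ.v t) := mul_nonneg (by linarith) hd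
      have h5 := mul_nonneg hμ.le hJ
      linarith
  exact ⟨fun t ht => hweak t (hbound t ht), hbound⟩

end Field

/-- Integration of a differential inequality. -/
theorem add_integral_le_of_hasDerivAt {f f' a b : ℝ → ℝ} {s t : ℝ} (hst : s ≤ t) (ha : Continuous a)
    (hb : Continuous b) (hf : ∀ τ ∈ Icc s t, HasDerivAt f (f' τ) τ)
    (h : ∀ τ ∈ Icc s t, f' τ + a τ ≤ b τ) :
    f t + (∫ τ in s..t, a τ) ≤ f s + ∫ τ in s..t, b τ := by
  have hF : ∀ τ ∈ Icc s t, HasDerivAt (fun τ => f τ + (∫ σ in s..τ, a σ) - ∫ σ in s..τ, b σ)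
      (f' τ + a τ - b τ) τ := fun τ hτ =>
    ((hf τ hτ).add (intervalIntegral.integral_hasDerivAt_right (ha.intervalIntegrable _ _)
      (ha.stronglyMeasurableAtFilter _ _) ha.continuousAt)).sub
      (intervalIntegral.integral_hasDerivAt_right (hb.intervalIntegrable _ _)
      (hb.stronglyMeasurableAtFilter _ _) hb.continuousAt)
  have hanti := antitoneOn_of_hasDerivWithinAt_nonpos (convex_Icc s t)
    (fun τ hτ => (hF τ hτ).continuousAt.continuousWithinAt)
    (fun τ hτ => (hF τ (interior_subset hτ)).hasDerivWithinAt)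
    (fun τ hτ => by linarith [h τ (interior_subset hτ)])
  have := hanti (left_mem_Icc.2 hst) (right_mem_Icc.2 hst) hst
  simp only [intervalIntegral.integral_same] at this
  linarith

/-- The weighted gradient of `𝒟φ`. -/
def wgrad (μ p : ℝ) (φ : E3 → E3) (x : E3) : Ten3 := wt μ ((p + 2) / 2) (sg φ x) • tgrad (sg φ) x

theorem wt_sq {μ p : ℝ} (hμ : 0 < μ) (A : Mat3) : wt μ ((p + 2) / 2) A ^ 2 = wt μ p A := by
  unfold wt
  rw [← Real.rpow_natCast, ← Real.rpow_mul (by positivity)]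
  congr 1; push_cast; ring

theorem SP.wgrad {μ p : ℝ} (hμ : 0 < μ) {φ : E3 → E3} (hφ : SP φ) : SP (wgrad μ p φ) :=
  SP.smul (SP.comp (contDiff_wt hμ) hφ.sg) hφ.sg.tgrad

theorem nm_wgrad_sq {μ p : ℝ} (hμ : 0 < μ) {φ : E3 → E3} (hφ : SP φ) : nm 2 (wgrad μ p φ) ^ 2 = diss μ p φ := by
  rw [nm_two_sq ((hφ.wgrad hμ).memLp 2), diss]
  refine integral_congr_ae (ae_of_all _ fun x => ?_)
  simp only [wgrad, norm_smul, mul_pow]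
  rw [Real.norm_of_nonneg (wt_nonneg hμ.le _), wt_sq hμ]

/-- The potential of the regularised stress. -/
def pot (μ p : ℝ) (A : Mat3) : ℝ := p⁻¹ * (μ + ‖A‖ ^ 2) ^ (p / 2) + μ / 2 * ‖A‖ ^ 2

theorem hasFDerivAt_pot {μ p : ℝ} (hμ : 0 < μ) (hp : 0 < p) (A : Mat3) :
    HasFDerivAt (pot μ p) (innerSL ℝ (Sv μ p A)) A := by
  have h1 := ((hasFDerivAt_rpow hμ (p / 2) A).const_mul p⁻¹).add
    (((hasStrictFDerivAt_norm_sq A).hasFDerivAt).const_mul (μ / 2))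
  refine h1.congr_fderiv ?_
  ext H
  simp [Sv, Sm, wt]
  have : p / 2 - 1 = (p - 2) / 2 := by ring
  rw [this]
  field_simp

theorem abs_pot_sub_le {μ p : ℝ} (hμ : 0 < μ) (hp1 : 1 ≤ p) (hp2 : p ≤ 2) (A B : Mat3) :
    |pot μ p B - pot μ p A - inner ℝ (Sv μ p A) (B - A)| ≤ (μ ^ ((p - 2) / 2) + μ) * ‖B - A‖ ^ 2 := by
  have hL : 0 ≤ μ ^ ((p - 2) / 2) + μ := add_nonneg (Real.rpow_nonneg hμ.le _) hμ.le
  have hd : ∀ s : ℝ, HasDerivAt (fun s : ℝ => pot μ p (A + s • (B - A)))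
      (inner ℝ (Sv μ p (A + s • (B - A))) (B - A)) s := by
    intro s
    have hl : HasDerivAt (fun s : ℝ => A + s • (B - A)) (B - A) s := by
      simpa using ((hasDerivAt_id s).smul_const (B - A)).const_add A
    exact (hasFDerivAt_pot hμ (by linarith) _).comp_hasDerivAt s hl
  obtain ⟨s, hs, h⟩ := exists_hasDerivAt_eq_slope _ _ zero_lt_one
    (fun s _ => (hd s).continuousAt.continuousWithinAt) (fun s _ => hd s)
  simp only [sub_zero, div_one, one_smul, zero_smul, add_zero, add_sub_cancel] at h
  rw [← h, ← inner_sub_left]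
  refine (abs_real_inner_le_norm _ _).trans ?_
  have h1 := norm_Sv_sub_le hμ hp1 hp2 (A + s • (B - A)) A
  rw [add_sub_cancel_left, norm_smul, Real.norm_of_nonneg hs.1.le] at h1
  have h2 : s * ‖B - A‖ ≤ ‖B - A‖ := mul_le_of_le_one_left (norm_nonneg _) hs.2.le
  calc _ ≤ (μ ^ ((p - 2) / 2) + μ) * ‖B - A‖ * ‖B - A‖ :=
        mul_le_mul_of_nonneg_right (h1.trans (mul_le_mul_of_nonneg_left h2 hL)) (norm_nonneg _)
    _ = _ := by ring

theorem continuous_pot {μ p : ℝ} (hμ : 0 < μ) (hp : 0 < p) : Continuous (pot μ p) :=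
  continuous_iff_continuousAt.2 fun A => (hasFDerivAt_pot hμ hp A).continuousAt

/-- The total potential along a curve is differentiable. -/
theorem Curve.hasDerivAt_pot {n : ℕ} {T : ℝ} (γ : Curve n T) {μ p : ℝ} (hμ : 0 < μ) (hp1 : 1 ≤ p)
    (hp2 : p ≤ 2) {t : ℝ} (ht : t ∈ Icc 0 T) :
    HasDerivAt (fun t => ∫ x in cube, pot μ p (sg (γ.v t) x))
      (∫ x in cube, inner ℝ (Sv μ p (sg (γ.v t) x)) (sg (γ.v' t) x)) t := by
  have hA := γ.hasDerivAt_sg ht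
  have hSm : MemLp (fun x => Sv μ p (sg (γ.v t) x)) 2 volΩ := (SP.comp (contDiff_Sv hμ) (γ.sp t).sg).memLp 2
  set S : LΩ Mat3 2 := toL 2 fun x => Sv μ p (sg (γ.v t) x)
  set L := μ ^ ((p - 2) / 2) + μ
  have hpi : ∀ s, Integrable (fun x => pot μ p (sg (γ.v s) x)) volΩ := fun s =>
    integrable_of_continuous ((continuous_pot hμ (by linarith)).comp (γ.sp s).sg.continuous)
  have hkey : ∀ s, |(∫ x in cube, pot μ p (sg (γ.v s) x)) - (∫ x in cube, pot μ p (sg (γ.v t) x)) -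
      inner ℝ S (toL 2 (sg (γ.v s)) - toL 2 (sg (γ.v t)))| ≤
      L * ‖toL 2 (sg (γ.v s)) - toL 2 (sg (γ.v t))‖ ^ 2 := by
    intro s
    have hsub := (γ.sp s).sg.sub (γ.sp t).sg
    have hpd : Integrable (fun x => pot μ p (sg (γ.v s) x) - pot μ p (sg (γ.v t) x)) volΩ := (hpi s).sub (hpi t)
    rw [norm_toL_sub ((γ.sp s).sg.memLp 2) ((γ.sp t).sg.memLp 2),
      ← toL_sub ((γ.sp s).sg.memLp 2) ((γ.sp t).sg.memLp 2), inner_toL hSm (hsub.memLp 2),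
      nm_two_sq (hsub.memLp 2), ← integral_sub (hpi s) (hpi t),
      ← integral_sub hpd (integrable_inner hSm (hsub.memLp 2)),
      ← integral_const_mul, ← Real.norm_eq_abs]
    refine norm_integral_le_of_norm_le (hsub.norm_sq.integrable.const_mul L) (ae_of_all _ fun x => ?_)
    exact abs_pot_sub_le hμ hp1 hp2 _ _
  have hlin : HasDerivAt (fun s => (inner ℝ S (toL 2 (sg (γ.v s)) - toL 2 (sg (γ.v t))) : ℝ))
      (inner ℝ S (toL 2 (sg (γ.v' t)))) t :=
    (innerSL ℝ S).hasFDerivAt.comp_hasDerivAt t (hA.sub_const _)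
  rw [inner_toL hSm ((γ.sp' t).sg.memLp 2)] at hlin
  have hrem : HasDerivAt (fun s => (∫ x in cube, pot μ p (sg (γ.v s) x)) -
      (∫ x in cube, pot μ p (sg (γ.v t) x)) - inner ℝ S (toL 2 (sg (γ.v s)) - toL 2 (sg (γ.v t)))) 0 t := by
    rw [hasDerivAt_iff_isLittleO]
    simp only [sub_self, inner_zero_right, sub_zero, smul_zero]
    have h1 : (fun s => (∫ x in cube, pot μ p (sg (γ.v s) x)) -
        (∫ x in cube, pot μ p (sg (γ.v t) x)) - inner ℝ S (toL 2 (sg (γ.v s)) - toL 2 (sg (γ.v t)))) =O[𝓝 t]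
        fun s => ‖toL 2 (sg (γ.v s)) - toL 2 (sg (γ.v t))‖ ^ 2 :=
      Asymptotics.IsBigO.of_bound L (Eventually.of_forall fun s => by
        rw [Real.norm_eq_abs, norm_pow, norm_norm]; exact hkey s)
    have h2 : (fun s => toL 2 (sg (γ.v s)) - toL 2 (sg (γ.v t))) =O[𝓝 t] fun s => s - t := hA.isBigO_sub
    refine h1.trans_isLittleO ?_
    have h3 := (h2.norm_left.pow 2).trans_isLittleO
      ((Asymptotics.isLittleO_pow_id one_lt_two).comp_tendsto (tendsto_sub_nhds_zero_iff.2 tendsto_id : Tendsto (fun s => id s - t) (𝓝 t) (𝓝 0)))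
    exact h3
  have h := hrem.add hlin
  simp only [zero_add] at h
  refine (h.add_const (∫ x in cube, pot μ p (sg (γ.v t) x))).congr_of_eventuallyEq (Eventually.of_forall fun s => ?_)
  simp

namespace Curve

variable {n : ℕ} {T : ℝ} (γ : Curve n T)

theorem continuous_nm_tgrad {q : ℝ≥0∞} [Fact (1 ≤ q)] : Continuous fun t => nm q (tgrad (sg (γ.v t))) := by
  have := (continuous_toL (q := q) (Φ := fun t => tgrad (sg (γ.v t)))
    (zero_lt_one.trans_le Fact.out).ne' γ.continuous_tgrad).norm
  simp_rw [norm_toL ((γ.sp _).sg.tgrad.memLp q)] at this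
  exact this

theorem continuous_wgrad {μ p : ℝ} (hμ : 0 < μ) : Continuous fun z : ℝ × E3 => wgrad μ p (γ.v z.1) z.2 :=
  ((contDiff_wt hμ).continuous.comp γ.continuous_sg).smul γ.continuous_tgrad

theorem continuous_diss {μ p : ℝ} (hμ : 0 < μ) : Continuous fun t => diss μ p (γ.v t) := by
  have : Continuous fun t => ‖toL 2 (wgrad μ p (γ.v t))‖ ^ 2 :=
    (continuous_toL (q := 2) (Φ := fun t => wgrad μ p (γ.v t)) (by norm_num) (γ.continuous_wgrad (p := p) hμ)).norm.pow 2
  simp_rw [norm_toL (((γ.sp _).wgrad hμ).memLp 2), nm_wgrad_sq hμ (γ.sp _)] at this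
  exact this

theorem continuous_nm_v' : Continuous fun t => nm 2 (γ.v' t) := by
  have := (continuous_toL (q := 2) (by norm_num) γ.continuous_v').norm
  simp_rw [norm_toL ((γ.sp' _).memLp 2)] at this
  exact this

theorem hasDerivAt_nm_grad_sq {t : ℝ} (ht : t ∈ Icc 0 T) : HasDerivAt (fun t => nm 2 (grad (γ.v t)) ^ 2)
      (-2 * ∫ x in cube, inner ℝ (γ.v' t x) (lap (γ.v t) x)) t := by
  have h1 := (γ.hasDerivAt_grad ht).norm_sq
  rw [inner_toL ((γ.sp t).grad.memLp 2) ((γ.sp' t).grad.memLp 2), integral_inner_grad (γ.sp t) (γ.sp' t)] at h1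
  simp_rw [norm_toL ((γ.sp _).grad.memLp 2)] at h1
  exact h1.congr_deriv (by ring)

end Curve

theorem nm_convect_le {φ ψ : E3 → E3} (hφ : SP φ) (hψ : SP ψ) :
    nm 2 (fun x => convect (φ x) (grad ψ x)) ≤ nm 4 φ * nm 4 (grad ψ) :=
  (nm_mono (g := fun x => ‖φ x‖ * ‖grad ψ x‖) (memLp_mul_norm (hφ.memLp 4) (hψ.grad.memLp 4)) (ae_of_all _ fun x => by
      rw [Real.norm_of_nonneg (by positivity : 0 ≤ ‖φ x‖ * ‖grad ψ x‖)]
      exact norm_convect_le _ _)).trans (nm_mul_norm_le (hφ.memLp 4) (hψ.grad.memLp 4))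

theorem nm_four_le {p : Ico (5 / 3 : ℝ) 2} {C Λ : ℝ} (hS : SobolevConst p C) {φ : E3 → E3}
    (hφ : IsSolenoidalTest φ) (hy : nm 2 (grad φ) ^ 2 ≤ Λ) : nm 4 φ ≤ C * √Λ := by
  refine (hS.vel φ hφ.sp hφ.mean_zero).trans (mul_le_mul_of_nonneg_left ?_ (by linarith [hS.one_le]))
  exact (nm_exponent_le (expHess_le_two p) (hφ.sp.grad.memLp 2)).trans (Real.le_sqrt_of_sq_le hy)

theorem integral_pot_nonneg {μ p : ℝ} (hμ : 0 < μ) (hp : 0 < p) (φ : E3 → E3) : 0 ≤ ∫ x in cube, pot μ p (sg φ x) :=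
  integral_nonneg fun x => by simp only [pot, Pi.zero_apply]; positivity

theorem integral_pot_le {μ p Λ : ℝ} (hμ : 0 < μ) (hμΛ : μ ≤ Λ) (hp1 : 1 ≤ p) (hp2 : p ≤ 2) {φ : E3 → E3}
    (hφ : SP φ) (hy : nm 2 (grad φ) ^ 2 ≤ Λ) : ∫ x in cube, pot μ p (sg φ x) ≤ 1 + 2 * Λ + Λ * Λ := by
  have hle : ∀ A : Mat3, pot μ p A ≤ 1 + (μ + ‖A‖ ^ 2) + μ * (μ + ‖A‖ ^ 2) / 2 := by
    intro A
    have h0 : 0 ≤ μ + ‖A‖ ^ 2 := by positivity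
    have h1 : (μ + ‖A‖ ^ 2) ^ (p / 2) ≤ 1 + (μ + ‖A‖ ^ 2) := by
      calc (μ + ‖A‖ ^ 2) ^ (p / 2) ≤ (1 + (μ + ‖A‖ ^ 2)) ^ (p / 2) :=
            Real.rpow_le_rpow h0 (by linarith) (by linarith)
        _ ≤ (1 + (μ + ‖A‖ ^ 2)) ^ (1 : ℝ) := Real.rpow_le_rpow_of_exponent_le (by linarith) (by linarith)
        _ = _ := Real.rpow_one _
    have h2 : p⁻¹ ≤ 1 := inv_le_one_of_one_le₀ hp1
    have h3 : p⁻¹ * (μ + ‖A‖ ^ 2) ^ (p / 2) ≤ 1 * (1 + (μ + ‖A‖ ^ 2)) := mul_le_mul h2 h1 (by positivity) (by norm_num)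
    unfold pot
    nlinarith [mul_pos hμ hμ]
  have hi : Integrable (fun x => μ + ‖sg φ x‖ ^ 2) volΩ :=
    integrable_of_continuous (by have := hφ.sg.continuous; fun_prop)
  have h1 := integral_add_norm_sg_sq_le hμΛ hφ hy
  have h2 : ∫ x in cube, pot μ p (sg φ x) ≤ ∫ x in cube, (1 + (1 + μ / 2) * (μ + ‖sg φ x‖ ^ 2)) := by
    refine integral_mono (integrable_of_continuous ((continuous_pot hμ (by linarith)).comp
      hφ.sg.continuous)) ((integrable_const _).add (hi.const_mul _)) fun x => ?_
    have := hle (sg φ x)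
    simp only
    linarith
  rw [integral_add (integrable_const _) (hi.const_mul _), integral_const_mul] at h2
  have h3 : ∫ _ in cube, (1 : ℝ) = 1 := by simp
  rw [h3] at h2
  have h0 : 0 ≤ ∫ x in cube, (μ + ‖sg φ x‖ ^ 2) := integral_nonneg fun x => by
    simp only [Pi.zero_apply]; positivity
  nlinarith

theorem nm_two_force_le {p : Ico (5 / 3 : ℝ) 2} (u : LΩ E3 (expForce p)) : nm 2 u ≤ ‖u‖ :=
  nm_exponent_le (two_le_expForce p) (Lp.memLp u)

/-- Uniform bounds for the Galerkin approximations on a time interval. -/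
theorem exists_time_bound {p : Ico (5 / 3 : ℝ) 2} {C Λ K κ : ℝ} (hS : SobolevConst p C)
    (h : SmallData p C Λ K κ) {T : ℝ} (hT : 0 ≤ T) :
    ∃ M, 0 ≤ M ∧ ∀ μ, 0 < μ → μ ≤ Λ → ∀ (n : ℕ) (T' : ℝ), T ≤ T' → ∀ (g : ℝ → LΩ E3 (expForce p))
      (γ : Curve n T'), (∀ t, ‖g t‖ ≤ K) → IsGalerkin p Λ μ g γ →
      (∫ t in (0 : ℝ)..T, diss μ p (γ.v t)) ≤ M ∧
      (∫ t in (0 : ℝ)..T, nm (expHess p) (tgrad (sg (γ.v t))) ^ 2) ≤ M ∧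
      μ * (∫ t in (0 : ℝ)..T, nm 2 (tgrad (sg (γ.v t))) ^ 2) ≤ M ∧
      (∫ t in (0 : ℝ)..T, nm 2 (γ.v' t) ^ 2) ≤ M := by
  have hp1 := p.2.1
  have hp2 := p.2.2
  have hκ := h.kappa_pos
  have hΛ := h.pos
  have hK := h.nonneg
  set M₀ := Λ / 2 + T * (21 * K ^ 2 / κ)
  have hM₀ : 0 ≤ M₀ := by positivity
  set M₁ := 2 * (1 + 2 * Λ + Λ * Λ + (C ^ 4 * Λ * (M₀ / κ) + T * K ^ 2))
  have hM₁ : 0 ≤ M₁ := by positivity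
  refine ⟨3 * M₀ + M₀ / κ + M₁, by positivity, ?_⟩
  intro μ hμ hμΛ n T' hTT' g γ hgK hγ
  have hq : Fact (1 ≤ expHess p) := inferInstance
  have hcd := γ.continuous_diss (p := p) hμ
  have hcB : Continuous fun t => nm (expHess p) (tgrad (sg (γ.v t))) ^ 2 := γ.continuous_nm_tgrad.pow 2
  have hcJ : Continuous fun t => nm 2 (tgrad (sg (γ.v t))) ^ 2 := γ.continuous_nm_tgrad.pow 2
  have hcv : Continuous fun t => nm 2 (γ.v' t) ^ 2 := γ.continuous_nm_v'.pow 2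
  have hca : Continuous fun t => ((p : ℝ) - 1) / 2 * diss μ p (γ.v t) +
      μ * nm 2 (tgrad (sg (γ.v t))) ^ 2 + κ * nm (expHess p) (tgrad (sg (γ.v t))) ^ 2 := by fun_prop
  have e1 : ∫ t in (0 : ℝ)..T, (((p : ℝ) - 1) / 2 * diss μ p (γ.v t) +
      μ * nm 2 (tgrad (sg (γ.v t))) ^ 2 + κ * nm (expHess p) (tgrad (sg (γ.v t))) ^ 2) ≤ M₀ := by
    have h1 := add_integral_le_of_hasDerivAt hT (f := fun t => nm 2 (grad (γ.v t)) ^ 2 / 2)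
      (f' := fun t => (-2 * ∫ x in cube, inner ℝ (γ.v' t x) (lap (γ.v t) x)) / 2)
      (a := fun t => ((p : ℝ) - 1) / 2 * diss μ p (γ.v t) +
        μ * nm 2 (tgrad (sg (γ.v t))) ^ 2 + κ * nm (expHess p) (tgrad (sg (γ.v t))) ^ 2)
      (b := fun _ => 21 * K ^ 2 / κ)
      hca continuous_const
      (fun t ht => (γ.hasDerivAt_nm_grad_sq ⟨ht.1, ht.2.trans hTT'⟩).div_const 2) ?_
    · have h2 := hγ.bound 0 ⟨le_rfl, hT.trans hTT'⟩
      simp only [intervalIntegral.integral_const, smul_eq_mul, sub_zero] at h1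
      have h3 := sq_nonneg (nm 2 (grad (γ.v T)))
      simp only [M₀]
      linarith
    · intro t ht
      have ht' : t ∈ Icc 0 T' := ⟨ht.1, ht.2.trans hTT'⟩
      have hw := hγ.weak t ht' _ (lap_mem_X (γ.v_mem t))
      have hl := laplace_test_le hS h hμ hμΛ (γ.test t) (hγ.bound t ht') (Lp.memLp (g t)) (hgK t)
      rw [← nm_two_sq ((γ.sp t).sg.tgrad.memLp 2)] at hl
      linarith
  have hdn : ∀ t, 0 ≤ diss μ p (γ.v t) := fun t => diss_nonneg hμ.le _
  have a1 : (∫ t in (0 : ℝ)..T, diss μ p (γ.v t)) ≤ 3 * M₀ := by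
    have : ∫ t in (0 : ℝ)..T, diss μ p (γ.v t) / 3 ≤ M₀ := by
      refine le_trans (intervalIntegral.integral_mono_on hT ((hcd.div_const 3).intervalIntegrable _ _)
        (hca.intervalIntegrable _ _)
        fun t _ => ?_) e1
      have := hdn t
      have h1 : 0 ≤ μ * nm 2 (tgrad (sg (γ.v t))) ^ 2 := by positivity
      have h2 : 0 ≤ κ * nm (expHess p) (tgrad (sg (γ.v t))) ^ 2 := by positivity
      have h3 : diss μ p (γ.v t) / 3 ≤ ((p : ℝ) - 1) / 2 * diss μ p (γ.v t) := by nlinarith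
      linarith
    rw [intervalIntegral.integral_div] at this
    linarith
  have a2 : (∫ t in (0 : ℝ)..T, nm (expHess p) (tgrad (sg (γ.v t))) ^ 2) ≤ M₀ / κ := by
    have : ∫ t in (0 : ℝ)..T, κ * nm (expHess p) (tgrad (sg (γ.v t))) ^ 2 ≤ M₀ := by
      refine le_trans (intervalIntegral.integral_mono_on hT ((hcB.const_mul κ).intervalIntegrable _ _)
        (hca.intervalIntegrable _ _)
        fun t _ => ?_) e1
      have h1 : 0 ≤ μ * nm 2 (tgrad (sg (γ.v t))) ^ 2 := by positivity
      have h2 : 0 ≤ ((p : ℝ) - 1) / 2 * diss μ p (γ.v t) := mul_nonneg (by linarith) (hdn t)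
      linarith
    rw [intervalIntegral.integral_const_mul] at this
    rw [le_div_iff₀ hκ]; linarith
  have a3 : μ * (∫ t in (0 : ℝ)..T, nm 2 (tgrad (sg (γ.v t))) ^ 2) ≤ M₀ := by
    rw [← intervalIntegral.integral_const_mul]
    refine le_trans (intervalIntegral.integral_mono_on hT ((hcJ.const_mul μ).intervalIntegrable _ _)
        (hca.intervalIntegrable _ _)
        fun t _ => ?_) e1
    have h1 : 0 ≤ κ * nm (expHess p) (tgrad (sg (γ.v t))) ^ 2 := by positivity
    have h2 : 0 ≤ ((p : ℝ) - 1) / 2 * diss μ p (γ.v t) := mul_nonneg (by linarith) (hdn t)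
    linarith
  have a4 : (∫ t in (0 : ℝ)..T, nm 2 (γ.v' t) ^ 2) ≤ M₁ := by
    have h1 := add_integral_le_of_hasDerivAt hT (f := fun t => ∫ x in cube, pot μ p (sg (γ.v t) x))
      (a := fun t => 1 / 2 * nm 2 (γ.v' t) ^ 2)
      (b := fun t => C ^ 4 * Λ * nm (expHess p) (tgrad (sg (γ.v t))) ^ 2 + K ^ 2)
      (hcv.const_mul _) ((hcB.const_mul _).add continuous_const)
      (fun t ht => γ.hasDerivAt_pot hμ (by linarith) hp2.le ⟨ht.1, ht.2.trans hTT'⟩) ?_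
    · have h2 := integral_pot_le hμ hμΛ (by linarith) hp2.le (γ.sp 0) (hγ.bound 0 ⟨le_rfl, hT.trans hTT'⟩)
      have h3 := integral_pot_nonneg hμ (by linarith : 0 < (p : ℝ)) (γ.v T)
      rw [intervalIntegral.integral_const_mul, intervalIntegral.integral_add
        ((hcB.const_mul _).intervalIntegrable _ _) (continuous_const.intervalIntegrable _ _),
        intervalIntegral.integral_const_mul, intervalIntegral.integral_const, smul_eq_mul, sub_zero] at h1
      have h4 : C ^ 4 * Λ * (∫ t in (0 : ℝ)..T, nm (expHess p) (tgrad (sg (γ.v t))) ^ 2) ≤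
          C ^ 4 * Λ * (M₀ / κ) := mul_le_mul_of_nonneg_left a2 (by positivity)
      simp only [M₁]
      linarith
    · intro t ht
      have ht' : t ∈ Icc 0 T' := ⟨ht.1, ht.2.trans hTT'⟩
      have hw := hγ.weak t ht' _ (γ.v'_mem t)
      have hv' := (γ.sp' t).memLp 2
      have hself : ∫ x in cube, (inner ℝ (γ.v' t x) (γ.v' t x) : ℝ) = nm 2 (γ.v' t) ^ 2 := by
        rw [nm_two_sq hv']; simp_rw [real_inner_self_eq_norm_sq]
      have hc := abs_integral_inner_le (((γ.sp t).convect (γ.sp t).grad).memLp 2) hv'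
      have hg := abs_integral_inner_le ((Lp.memLp (g t)).mono_exponent (two_le_expForce p)) hv'
      have hg2 : nm 2 (g t) ≤ K := (nm_two_force_le (g t)).trans (hgK t)
      have hc2 : nm 2 (fun x => convect (γ.v t x) (grad (γ.v t) x)) ≤
          (C * √Λ) * (C * nm (expHess p) (tgrad (sg (γ.v t)))) :=
        (nm_convect_le (γ.sp t) (γ.sp t)).trans (mul_le_mul (nm_four_le hS (γ.test t) (hγ.bound t ht'))
          (hS.grad _ (γ.sp t)) (nm_nonneg _ _) (mul_nonneg (by linarith [hS.one_le]) (Real.sqrt_nonneg _)))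
      rw [hself] at hw
      set w := nm 2 (γ.v' t)
      set B := nm (expHess p) (tgrad (sg (γ.v t)))
      have hw0 : 0 ≤ w := nm_nonneg _ _
      have b1 := (abs_le.1 hc).1
      have b2 := (abs_le.1 hg).2
      have b3 := mul_le_mul_of_nonneg_right hc2 hw0
      have b4 := mul_le_mul_of_nonneg_right hg2 hw0
      have b5 : (C * √Λ * (C * B)) ^ 2 = C ^ 4 * Λ * B ^ 2 := by
        have := Real.sq_sqrt hΛ.le
        linear_combination (C ^ 4 * B ^ 2) * this
      have b6 := sq_nonneg (C * √Λ * (C * B) - w / 2)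
      have b7 := sq_nonneg (K - w / 2)
      linarith
  refine ⟨?_, ?_, ?_, ?_⟩
  · have : 0 ≤ M₀ / κ := by positivity
    linarith
  · linarith
  · have : 0 ≤ M₀ / κ := by positivity
    linarith
  · have : 0 ≤ M₀ / κ := by positivity
    linarith

/-- `C₀` is a Korn constant, and `C` a Sobolev constant in terms of the symmetric gradient. -/
structure KornConst (p : Ico (5 / 3 : ℝ) 2) (C C₀ : ℝ) : Prop where
  pos : 0 < C₀
  korn : ∀ φ : E3 → E3, IsSolenoidalTest φ → nm (expHess p) (PNavierStokes.grad φ) ≤ C₀ * nm (expHess p) (sg φ)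
  sob : ∀ φ : E3 → E3, IsSolenoidalTest φ → nm 4 φ ≤ C * nm (expHess p) (sg φ)

/-- Coercivity of the regularised stress in `L^{4/(4-p)}`. -/
theorem kappa_mul_sq_le_monotone {p : Ico (5 / 3 : ℝ) 2} {C Λ K κ : ℝ} (h : SmallData p C Λ K κ) {μ : ℝ}
    (hμ : 0 < μ) (hμΛ : μ ≤ Λ) {φ ψ : E3 → E3} (hφ : SP φ) (hψ : SP ψ)
    (hφΛ : nm 2 (grad φ) ^ 2 ≤ Λ) (hψΛ : nm 2 (grad ψ) ^ 2 ≤ Λ) :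
    4 * κ * nm (expHess p) (fun x => sg φ x - sg ψ x) ^ 2 ≤
      ∫ x in cube, inner ℝ (Sm μ p (sg φ x) - Sm μ p (sg ψ x)) (sg φ x - sg ψ x) := by
  have h1 := p.2.1
  have h2 := p.2.2
  have hΛ := h.pos
  have hcφ := hφ.sg.continuous
  have hcψ := hψ.sg.continuous
  set ρ : E3 → ℝ := fun x => μ + (‖sg φ x‖ + ‖sg ψ x‖) ^ 2
  have hρ : ∀ x, 0 < ρ x := fun x => by positivity
  have hρc : Continuous ρ := by fun_prop
  have hw := nm_sq_le_weighted p (hφ.sg.sub hψ.sg).continuous hρc hρ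
  have hρint : ∫ x in cube, ρ x ≤ 5 * Λ := by
    have a1 := (pow_le_pow_left₀ (nm_nonneg _ _) (nm_sg_le hφ 2) 2).trans hφΛ
    have a2 := (pow_le_pow_left₀ (nm_nonneg _ _) (nm_sg_le hψ 2) 2).trans hψΛ
    rw [nm_two_sq (hφ.sg.memLp 2)] at a1
    rw [nm_two_sq (hψ.sg.memLp 2)] at a2
    have i1 := hφ.sg.norm_sq.integrable
    have i2 := hψ.sg.norm_sq.integrable
    have : ∫ x in cube, ρ x ≤ ∫ x in cube, (μ + (2 * ‖sg φ x‖ ^ 2 + 2 * ‖sg ψ x‖ ^ 2)) := by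
      refine integral_mono (integrable_of_continuous hρc)
        ((integrable_const _).add ((i1.const_mul 2).add (i2.const_mul 2))) fun x => ?_
      simp only [ρ]
      nlinarith [sq_nonneg (‖sg φ x‖ - ‖sg ψ x‖)]
    have i3 : Integrable (fun x => 2 * ‖sg φ x‖ ^ 2 + 2 * ‖sg ψ x‖ ^ 2) volΩ := (i1.const_mul 2).add (i2.const_mul 2)
    rw [integral_add (integrable_const _) i3, integral_add (i1.const_mul 2) (i2.const_mul 2), integral_const_mul, integral_const_mul] at this
    have h3 : ∫ _ in cube, μ = μ := by simp
    rw [h3] at this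
    linarith
  set a := (2 - (p : ℝ)) / 2
  have ha : 0 < a := by simp only [a]; linarith
  have hle : (∫ x in cube, ρ x) ^ a ≤ 2 * (2 * Λ) ^ a := by
    calc (∫ x in cube, ρ x) ^ a ≤ (4 * (2 * Λ)) ^ a :=
          Real.rpow_le_rpow (integral_nonneg fun x => (hρ x).le) (by linarith) ha.le
      _ = 4 ^ a * (2 * Λ) ^ a := Real.mul_rpow (by norm_num) (by positivity)
      _ ≤ 4 ^ (1 / 2 : ℝ) * (2 * Λ) ^ a := by
          gcongr
          · norm_num
          · simp only [a]; linarith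
      _ = 2 * (2 * Λ) ^ a := by
          congr 1
          rw [show (4 : ℝ) = 2 ^ (2 : ℝ) by norm_num, ← Real.rpow_mul (by norm_num)]
          norm_num
  set W := ∫ x in cube, ρ x ^ (((p : ℝ) - 2) / 2) * ‖sg φ x - sg ψ x‖ ^ 2
  have hWc : Continuous fun x => ρ x ^ (((p : ℝ) - 2) / 2) * ‖sg φ x - sg ψ x‖ ^ 2 :=
    (hρc.rpow_const fun x => Or.inl (hρ x).ne').mul ((hcφ.sub hcψ).norm.pow 2)
  have hW0 : 0 ≤ W := integral_nonneg fun x => by simp only [Pi.zero_apply]; have := hρ x; positivity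
  have hB := hw.trans (mul_le_mul_of_nonneg_left hle hW0)
  have hm := Real.rpow_pos_of_pos (by linarith : 0 < 2 * Λ) a
  have hmono : ((p : ℝ) - 1) * W ≤ ∫ x in cube, inner ℝ (Sm μ p (sg φ x) - Sm μ p (sg ψ x)) (sg φ x - sg ψ x) := by
    rw [← integral_const_mul]
    refine integral_mono (integrable_of_continuous (hWc.const_mul _)) ?_ fun x =>
      Sm_monotone hμ (by linarith) h2.le _ _
    exact (((SP.comp (contDiff_Sm hμ) hφ.sg).sub (SP.comp (contDiff_Sm hμ) hψ.sg)).inner (hφ.sg.sub hψ.sg)).integrable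
  refine le_trans ?_ hmono
  rw [h.kappa, Real.rpow_neg (by positivity)]
  have h3 : ∀ b : ℝ, 4 * (((p : ℝ) - 1) / 8 * ((2 * Λ) ^ a)⁻¹) * b
      = ((p : ℝ) - 1) * (((2 * Λ) ^ a)⁻¹ * (b / 2)) := fun b => by ring
  rw [h3]
  refine mul_le_mul_of_nonneg_left ?_ (by linarith)
  rw [inv_mul_le_iff₀ hm]
  linarith

theorem norm_Sv_le {μ p : ℝ} (hμ : 0 < μ) (hμ1 : μ ≤ 1) (hp1 : 1 < p) (hp2 : p ≤ 2) (A : Mat3) :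
    ‖Sv μ p A‖ ≤ 2 + 2 * ‖A‖ := by
  have h1 := norm_Sm_sub_St_le hμ hp1 hp2 A
  have h2 : μ ^ ((p - 1) / 2) ≤ 1 := Real.rpow_le_one hμ.le hμ1 (by linarith)
  have h3 : ‖St p A‖ ≤ 1 + ‖A‖ := by
    rw [norm_St hp1]
    calc ‖A‖ ^ (p - 1) ≤ (1 + ‖A‖) ^ (p - 1) := Real.rpow_le_rpow (norm_nonneg _) (by linarith) (by linarith)
      _ ≤ (1 + ‖A‖) ^ (1 : ℝ) := Real.rpow_le_rpow_of_exponent_le (by linarith [norm_nonneg A]) (by linarith)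
      _ = _ := Real.rpow_one _
  have h4 : ‖Sm μ p A‖ ≤ ‖St p A‖ + ‖Sm μ p A - St p A‖ := by
    have := norm_add_le (St p A) (Sm μ p A - St p A)
    rwa [add_sub_cancel] at this
  have h5 : ‖Sv μ p A‖ ≤ ‖Sm μ p A‖ + μ * ‖A‖ := by
    refine (norm_add_le _ _).trans_eq ?_
    rw [norm_smul, Real.norm_of_nonneg hμ.le]
  nlinarith [norm_nonneg A]

theorem nm_affine_le {F : Type} [NormedAddCommGroup F] {f : E3 → F} (hf : MemLp f 2 volΩ)
    {G : Type} [NormedAddCommGroup G] {h : E3 → G} {a b : ℝ} (ha : 0 ≤ a) (hb : 0 ≤ b)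
    (hle : ∀ x, ‖h x‖ ≤ a + b * ‖f x‖) : nm 2 h ≤ a + b * nm 2 f := by
  have h1 : MemLp (fun x => b * ‖f x‖) 2 volΩ := hf.norm.const_mul b
  have h2 : nm 2 h ≤ nm 2 fun x => a + b * ‖f x‖ :=
    nm_mono ((memLp_const a).add h1) (ae_of_all _ fun x => (hle x).trans (le_abs_self _))
  have h3 := nm_add_le (q := 2) (by norm_num) (memLp_const (μ := volΩ) a) h1
  rw [nm_const 2 (by norm_num), Real.norm_of_nonneg ha] at h3
  have h4 : nm 2 (fun x => b * ‖f x‖) ≤ b * nm 2 f :=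
    nm_le_mul hf hb (ae_of_all _ fun x => by rw [norm_mul, norm_norm, Real.norm_of_nonneg hb])
  linarith

/-- `L²` bounds for the projection error. -/
theorem nm_Sv_le {μ p : ℝ} (hμ : 0 < μ) (hμ1 : μ ≤ 1) (hp1 : 1 < p) (hp2 : p ≤ 2) {φ : E3 → E3} (hφ : SP φ) :
    nm 2 (fun x => Sv μ p (sg φ x)) ≤ 2 + 2 * nm 2 (grad φ) :=
  (nm_affine_le (hφ.sg.memLp 2) (by norm_num) (by norm_num) fun x => norm_Sv_le hμ hμ1 hp1 hp2 _).trans (by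
    linarith [nm_sg_le hφ 2])

theorem exists_projection_nm {n : ℕ} (hn : 1 ≤ n) {φ : E3 → E3} (hφ : IsSolenoidalTest φ) :
    ∃ ψ ∈ X n, (∀ χ ∈ X n, ∫ x in cube, inner ℝ (φ x - ψ x) (χ x) = 0) ∧
      nm 2 (fun x => φ x - ψ x) ≤ (n : ℝ)⁻¹ * nm 2 (grad φ) ∧ nm 2 (grad ψ) ≤ nm 2 (grad φ) ∧
      nm 2 (fun x => grad φ x - grad ψ x) ≤ (n : ℝ)⁻¹ * (3 * nm 2 (tgrad (sg φ))) := by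
  obtain ⟨ψ, hψ, horth, h1, h2, h3⟩ := exists_projection hn hφ
  have hψs := hψ.1.sp
  have hsp := hφ.sp
  refine ⟨ψ, hψ, horth, ?_, ?_, ?_⟩
  · refine (sq_le_sq₀ (nm_nonneg _ _) (mul_nonneg (by positivity) (nm_nonneg _ _))).1 ?_
    rw [mul_pow, nm_two_sq ((hsp.sub hψs).memLp 2), nm_two_sq (hsp.grad.memLp 2), inv_pow]
    exact h1
  · refine (sq_le_sq₀ (nm_nonneg _ _) (nm_nonneg _ _)).1 ?_
    rw [nm_two_sq (hψs.grad.memLp 2), nm_two_sq (hsp.grad.memLp 2)]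
    exact h2
  · have h4 : ∑ j, ∫ x in cube, ‖grad (dd j φ) x‖ ^ 2 = nm 2 (tgrad (grad φ)) ^ 2 := by
      rw [nm_two_sq (hsp.grad.tgrad.memLp 2)]
      simp_rw [norm_tgrad_sq, grad_dd hsp]
      rw [integral_finsetSum _ fun j _ => (hsp.grad.dd j).norm_sq.integrable]
    have h5 : nm 2 (tgrad (grad φ)) ≤ 3 * nm 2 (tgrad (sg φ)) :=
      nm_le_mul (hsp.sg.tgrad.memLp 2) (by norm_num) (ae_of_all _ fun x => by
        rw [tgrad_grad_eq hsp]; exact norm_hessT_le _)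
    refine le_trans ((sq_le_sq₀ (nm_nonneg _ _) (mul_nonneg (by positivity : 0 ≤ (n : ℝ)⁻¹)
      (nm_nonneg _ _))).1 ?_) (mul_le_mul_of_nonneg_left h5 (by positivity))
    rw [mul_pow, nm_two_sq ((hsp.grad.sub hψs.grad).memLp 2), ← h4, inv_pow]
    exact h3

/-- The error in the estimate for the difference of two approximations. -/
def diffError (p C Λ K μ ν : ℝ) (n : ℕ) (G B J : ℝ) : ℝ :=
  2 * √Λ * (ν ^ ((p - 1) / 2) + μ ^ ((p - 1) / 2) + (ν + μ) * √Λ) + 4 * √Λ * G +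
    (n : ℝ)⁻¹ * (2 * √Λ * (C ^ 2 * √Λ * B + K) + (2 + 2 * √Λ) * (3 * J))

theorem difference_test_le {p : Ico (5 / 3 : ℝ) 2} {C C₀ Λ K κ : ℝ} (hS : SobolevConst p C)
    (h : SmallData p C Λ K κ) (hKo : KornConst p C C₀) {μ ν : ℝ} (hμ : 0 < μ) (hμΛ : μ ≤ Λ) (hμ1 : μ ≤ 1)
    (hν : 0 < ν) {n m : ℕ} (hn : 1 ≤ n) (hnm : n ≤ m) {φ φ' ψ ψ' : E3 → E3}
    (hφ : φ ∈ X m) (hψ : ψ ∈ X n) (hφ' : SP φ') (hψ' : ψ' ∈ X n)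
    (hφΛ : nm 2 (grad φ) ^ 2 ≤ Λ) (hψΛ : nm 2 (grad ψ) ^ 2 ≤ Λ) {g₁ g₂ : LΩ E3 (expForce p)} (hg : ‖g₂‖ ≤ K)
    (hφw : ∀ χ ∈ X m, (∫ x in cube, inner ℝ (φ' x) (χ x)) + (∫ x in cube, inner ℝ (convect (φ x) (grad φ x)) (χ x)) +
      (∫ x in cube, inner ℝ (Sv ν p (sg φ x)) (sg χ x)) = ∫ x in cube, inner ℝ (g₁ x) (χ x))
    (hψw : ∀ χ ∈ X n, (∫ x in cube, inner ℝ (ψ' x) (χ x)) + (∫ x in cube, inner ℝ (convect (ψ x) (grad ψ x)) (χ x)) +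
      (∫ x in cube, inner ℝ (Sv μ p (sg ψ x)) (sg χ x)) = ∫ x in cube, inner ℝ (g₂ x) (χ x)) :
    (∫ x in cube, inner ℝ (φ' x - ψ' x) (φ x - ψ x)) +
      2 * κ / C₀ ^ 2 * nm (expHess p) (fun x => grad φ x - grad ψ x) ^ 2 ≤
    diffError p C Λ K μ ν n ‖g₁ - g₂‖ (nm (expHess p) (tgrad (sg ψ))) (nm 2 (tgrad (sg fun x => φ x - ψ x))) := by
  have hp1 := p.2.1
  have hp2 := p.2.2
  have hκ := h.kappa_pos
  have hC₀ := hKo.pos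
  have hsφ := hφ.1.sp
  have hsψ := hψ.1.sp
  have hsψ' := hψ'.1.sp
  have hsΛ := Real.sqrt_nonneg Λ
  have hφΛ' := Real.le_sqrt_of_sq_le hφΛ
  have hψΛ' := Real.le_sqrt_of_sq_le hψΛ
  obtain ⟨w, hw⟩ : ∃ w : E3 → E3, w = fun x => φ x - ψ x := ⟨_, rfl⟩
  have hwX : w ∈ X m := by rw [hw]; exact Submodule.sub_mem _ hφ (X_mono hnm hψ)
  have hsw := hwX.1.sp
  have hgw : grad w = fun x => grad φ x - grad ψ x := by
    rw [hw]; exact funext fun x => grad_sub hsφ hsψ x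
  have hdw : sg w = fun x => sg φ x - sg ψ x := by
    rw [hw]; exact funext fun x => sg_sub hsφ hsψ x
  have hwx : ∀ x, φ x - ψ x = w x := fun x => by rw [hw]
  have hgwx : (fun x => grad φ x - grad ψ x) = grad w := hgw.symm
  have hwΛ : nm 2 (grad w) ≤ 2 * √Λ := by
    rw [hgw]
    linarith [nm_sub_le (q := 2) (by norm_num) (hsφ.grad.memLp 2) (hsψ.grad.memLp 2)]
  have hdΛ : nm 2 (sg w) ≤ 2 * √Λ := (nm_sg_le hsw 2).trans hwΛ
  have hwΛ2 : nm 2 w ≤ 4 * √Λ := by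
    linarith [nm_le_two_mul_grad hwX.1 (q := 2) (by norm_num) (by norm_num)]
  obtain ⟨π, hπ, horth, hr1, -, hr2⟩ := exists_projection_nm hn hwX.1
  have hsπ := hπ.1.sp
  obtain ⟨r, hr⟩ : ∃ r : E3 → E3, r = fun x => w x - π x := ⟨_, rfl⟩
  have hsr : SP r := by rw [hr]; exact hsw.sub hsπ
  have hgr : grad r = fun x => grad w x - grad π x := by rw [hr]; exact funext fun x => grad_sub hsw hsπ x
  have hdr : ∀ x, sg r x = sg w x - sg π x := by rw [hr]; exact fun x => sg_sub hsw hsπ x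
  rw [← hgr] at hr2
  rw [← hr] at hr1
  have hninv : 0 ≤ (n : ℝ)⁻¹ := by positivity
  have hr1' : nm 2 r ≤ (n : ℝ)⁻¹ * (2 * √Λ) := hr1.trans (mul_le_mul_of_nonneg_left hwΛ hninv)
  have e1 := hφw w hwX
  have e2 := hψw π hπ
  -- the projection can be removed at the price of the error `r`
  have splitπ : ∀ {f : E3 → E3}, MemLp f 2 volΩ → ∫ x in cube, inner ℝ (f x) (π x) =
      (∫ x in cube, inner ℝ (f x) (w x)) - ∫ x in cube, inner ℝ (f x) (r x) := by
    intro f hf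
    rw [← integral_sub (integrable_inner hf (hsw.memLp 2)) (integrable_inner hf (hsr.memLp 2))]
    simp_rw [← inner_sub_right, hr, sub_sub_cancel]
  have splitD : ∀ {f : E3 → Mat3}, MemLp f 2 volΩ → ∫ x in cube, inner ℝ (f x) (sg π x) =
      (∫ x in cube, inner ℝ (f x) (sg w x)) - ∫ x in cube, inner ℝ (f x) (sg r x) := by
    intro f hf
    rw [← integral_sub (integrable_inner hf (hsw.sg.memLp 2)) (integrable_inner hf (hsr.sg.memLp 2))]
    simp_rw [← inner_sub_right, hdr, sub_sub_cancel]
  have hg₁ := (Lp.memLp g₁).mono_exponent (two_le_expForce p)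
  have hg₂ := (Lp.memLp g₂).mono_exponent (two_le_expForce p)
  have hSφ : SP fun x => Sv ν p (sg φ x) := SP.comp (contDiff_Sv hν) hsφ.sg
  have hSψ : SP fun x => Sv μ p (sg ψ x) := SP.comp (contDiff_Sv hμ) hsψ.sg
  rw [splitπ (hsψ'.memLp 2), splitπ ((hsψ.convect hsψ.grad).memLp 2), splitD (hSψ.memLp 2), splitπ hg₂] at e2
  have e3 : ∫ x in cube, inner ℝ (ψ' x) (r x) = 0 := by
    have := horth _ hψ'
    simp_rw [real_inner_comm (r _), hr]
    exact this
  -- the individual terms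
  have tconv : |(∫ x in cube, inner ℝ (convect (φ x) (grad φ x)) (w x)) -
      ∫ x in cube, inner ℝ (convect (ψ x) (grad ψ x)) (w x)| ≤ √Λ * nm 4 w ^ 2 := by
    have hsplit : (∫ x in cube, inner ℝ (convect (φ x) (grad φ x)) (w x)) -
        (∫ x in cube, inner ℝ (convect (ψ x) (grad ψ x)) (w x)) =
        ∫ x in cube, inner ℝ (convect (w x) (grad φ x)) (w x) := by
      have i1 := ((hsw.convect hsφ.grad).inner hsw).integrable
      have i2 := ((hsψ.convect hsw.grad).inner hsw).integrable
      rw [← integral_sub ((hsφ.convect hsφ.grad).inner hsw).integrable ((hsψ.convect hsψ.grad).inner hsw).integrable]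
      have h0 := integral_convect_self hψ.1 hsw
      rw [← add_zero (∫ x in cube, inner ℝ (convect (w x) (grad φ x)) (w x)), ← h0, ← integral_add i1 i2]
      refine integral_congr_ae (ae_of_all _ fun x => ?_)
      simp only
      rw [← inner_sub_left, ← inner_add_left, hgw]
      simp only [hw, convect_sub_left, convect_sub_right]
      congr 1
      abel
    rw [hsplit, ← Real.norm_eq_abs]
    refine (norm_integral_le_of_norm_le (integrable_mul_mul_norm (hsw.memLp 4) (hsφ.grad.memLp 2)
      (hsw.memLp 4)) (ae_of_all _ fun x => (norm_inner_le_norm _ _).trans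
        (mul_le_mul_of_nonneg_right (norm_convect_le _ _) (norm_nonneg _)))).trans ?_
    refine (integral_mul_mul_norm_le (hsw.memLp 4) (hsφ.grad.memLp 2) (hsw.memLp 4)).trans ?_
    nlinarith [sq_nonneg (nm 4 w)]
  have tstress : 4 * κ * nm (expHess p) (sg w) ^ 2 -
      (ν ^ (((p : ℝ) - 1) / 2) + μ ^ (((p : ℝ) - 1) / 2) + (ν + μ) * √Λ) * (2 * √Λ) ≤
      (∫ x in cube, inner ℝ (Sv ν p (sg φ x)) (sg w x)) - ∫ x in cube, inner ℝ (Sv μ p (sg ψ x)) (sg w x) := by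
    have hmon := kappa_mul_sq_le_monotone h hμ hμΛ hsφ hsψ hφΛ hψΛ
    obtain ⟨R, hR⟩ : ∃ R : E3 → Mat3, R = fun x => (Sv ν p (sg φ x) - Sv μ p (sg ψ x)) -
      (Sm μ p (sg φ x) - Sm μ p (sg ψ x)) := ⟨_, rfl⟩
    have hSm : SP fun x => Sm μ p (sg φ x) - Sm μ p (sg ψ x) :=
      (SP.comp (contDiff_Sm hμ) hsφ.sg).sub (SP.comp (contDiff_Sm hμ) hsψ.sg)
    have hsR : SP R := by rw [hR]; exact (hSφ.sub hSψ).sub hSm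
    have hRn : nm 2 R ≤ ν ^ (((p : ℝ) - 1) / 2) + μ ^ (((p : ℝ) - 1) / 2) + (ν + μ) * √Λ := by
      have hle : ∀ x, ‖R x‖ ≤ (ν ^ (((p : ℝ) - 1) / 2) + μ ^ (((p : ℝ) - 1) / 2)) + 1 * ‖ν • sg φ x - μ • sg ψ x‖ := by
        intro x
        have a1 := norm_Sm_sub_St_le hν (by linarith : 1 < (p : ℝ)) hp2.le (sg φ x)
        have a2 := norm_Sm_sub_St_le hμ (by linarith : 1 < (p : ℝ)) hp2.le (sg φ x)
        have a3 : R x = (Sm ν p (sg φ x) - St p (sg φ x)) - (Sm μ p (sg φ x) - St p (sg φ x)) +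
            (ν • sg φ x - μ • sg ψ x) := by rw [hR]; simp only [Sv]; abel
        rw [a3, one_mul]
        exact (norm_add_le _ _).trans (add_le_add ((norm_sub_le _ _).trans (add_le_add a1 a2)) le_rfl)
      have m1 := (hsφ.sg.memLp 2).const_smul ν
      have m2 := (hsψ.sg.memLp 2).const_smul μ
      have b1 := nm_affine_le (m1.sub m2) (h := R) (by positivity) zero_le_one hle
      have b2 := nm_sub_le (q := 2) (by norm_num) m1 m2
      have b3 : ∀ {c : ℝ} {χ : E3 → E3}, 0 < c → SP χ → nm 2 (c • sg χ) ≤ c * nm 2 (grad χ) := fun hc hχ =>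
        (nm_le_mul (hχ.sg.memLp 2) hc.le (ae_of_all _ fun x => by
          rw [Pi.smul_apply, norm_smul, Real.norm_of_nonneg hc.le])).trans (mul_le_mul_of_nonneg_left (nm_sg_le hχ 2) hc.le)
      have b5 : nm 2 (ν • sg φ - μ • sg ψ) = nm 2 (fun x => (ν • sg φ) x - (μ • sg ψ) x) := rfl
      have b6 := mul_le_mul_of_nonneg_left hφΛ' hν.le
      have b7 := mul_le_mul_of_nonneg_left hψΛ' hμ.le
      rw [b5] at b1
      linarith [b3 hν hsφ, b3 hμ hsψ]
    have hRw := abs_integral_inner_le (hsR.memLp 2) (hsw.sg.memLp 2)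
    have hRw2 : nm 2 R * nm 2 (sg w) ≤ (ν ^ (((p : ℝ) - 1) / 2) + μ ^ (((p : ℝ) - 1) / 2) + (ν + μ) * √Λ) * (2 * √Λ) :=
      mul_le_mul hRn hdΛ (nm_nonneg _ _) ((nm_nonneg _ _).trans hRn)
    have hsum : (∫ x in cube, inner ℝ (Sv ν p (sg φ x)) (sg w x)) - (∫ x in cube, inner ℝ (Sv μ p (sg ψ x)) (sg w x)) =
        (∫ x in cube, inner ℝ (R x) (sg w x)) +
        ∫ x in cube, inner ℝ (Sm μ p (sg φ x) - Sm μ p (sg ψ x)) (sg φ x - sg ψ x) := by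
      have hd : ∀ x, sg φ x - sg ψ x = sg w x := fun x => by rw [hdw]
      simp_rw [hd]
      rw [← integral_sub (hSφ.inner hsw.sg).integrable (hSψ.inner hsw.sg).integrable,
        ← integral_add (hsR.inner hsw.sg).integrable (hSm.inner hsw.sg).integrable]
      refine integral_congr_ae (ae_of_all _ fun x => ?_)
      simp only
      rw [← inner_sub_left, ← inner_add_left, hR]
      simp only [sub_add_cancel]
    rw [← hdw] at hmon
    rw [hsum]
    have := (abs_le.1 hRw).1
    linarith
  have tforce : (∫ x in cube, inner ℝ (g₁ x) (w x)) - (∫ x in cube, inner ℝ (g₂ x) (w x)) ≤ ‖g₁ - g₂‖ * (4 * √Λ) := by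
    rw [← integral_sub (integrable_inner hg₁ (hsw.memLp 2)) (integrable_inner hg₂ (hsw.memLp 2))]
    simp_rw [← inner_sub_left]
    refine (le_abs_self _).trans ((abs_integral_inner_le (a := expForce p) (b := expHess p)
      ((Lp.memLp g₁).sub (Lp.memLp g₂)) (hsw.memLp _)).trans ?_)
    rw [norm_sub_eq_nm]
    exact mul_le_mul_of_nonneg_left ((nm_exponent_le (expHess_le_two p) (hsw.memLp 2)).trans hwΛ2) (nm_nonneg _ _)
  set B := nm (expHess p) (tgrad (sg ψ))
  have tr1 : |∫ x in cube, inner ℝ (convect (ψ x) (grad ψ x)) (r x)| ≤ (C * √Λ * (C * B)) * ((n : ℝ)⁻¹ * (2 * √Λ)) := by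
    refine (abs_integral_inner_le ((hsψ.convect hsψ.grad).memLp 2) (hsr.memLp 2)).trans ?_
    have hc : nm 2 (fun x => convect (ψ x) (grad ψ x)) ≤ C * √Λ * (C * B) :=
      (nm_convect_le hsψ hsψ).trans (mul_le_mul (nm_four_le hS hψ.1 hψΛ) (hS.grad _ hsψ) (nm_nonneg _ _)
        (mul_nonneg (by linarith [hS.one_le]) hsΛ))
    exact mul_le_mul hc hr1' (nm_nonneg _ _) ((nm_nonneg _ _).trans hc)
  have tr2 : |∫ x in cube, inner ℝ (Sv μ p (sg ψ x)) (sg r x)| ≤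
      (2 + 2 * √Λ) * ((n : ℝ)⁻¹ * (3 * nm 2 (tgrad (sg w)))) := by
    refine (abs_integral_inner_le (hSψ.memLp 2) (hsr.sg.memLp 2)).trans ?_
    have hc := nm_Sv_le hμ hμ1 (by linarith : 1 < (p : ℝ)) hp2.le hsψ
    exact mul_le_mul (by linarith) ((nm_sg_le hsr 2).trans hr2) (nm_nonneg _ _) (by positivity)
  have tr3 : |∫ x in cube, inner ℝ (g₂ x) (r x)| ≤ K * ((n : ℝ)⁻¹ * (2 * √Λ)) := by
    refine (abs_integral_inner_le hg₂ (hsr.memLp 2)).trans ?_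
    exact mul_le_mul ((nm_two_force_le g₂).trans hg) hr1' (nm_nonneg _ _) h.nonneg
  have t0 : ∫ x in cube, inner ℝ (φ' x - ψ' x) (φ x - ψ x) =
      (∫ x in cube, inner ℝ (φ' x) (w x)) - ∫ x in cube, inner ℝ (ψ' x) (w x) := by
    simp_rw [hwx, inner_sub_left]
    exact integral_sub (hφ'.inner hsw).integrable (hsψ'.inner hsw).integrable
  have habs : √Λ * nm 4 w ^ 2 ≤ 2 * κ * nm (expHess p) (sg w) ^ 2 := by
    have a1 : nm 4 w ^ 2 ≤ C ^ 2 * nm (expHess p) (sg w) ^ 2 := by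
      rw [← mul_pow]; exact pow_le_pow_left₀ (nm_nonneg _ _) (hKo.sob w hwX.1) 2
    calc √Λ * nm 4 w ^ 2 ≤ √Λ * (C ^ 2 * nm (expHess p) (sg w) ^ 2) := mul_le_mul_of_nonneg_left a1 hsΛ
      _ = (C ^ 2 * √Λ) * nm (expHess p) (sg w) ^ 2 := by ring
      _ ≤ _ := mul_le_mul_of_nonneg_right h.conv (by positivity)
  have hkorn : 2 * κ / C₀ ^ 2 * nm (expHess p) (grad w) ^ 2 ≤ 2 * κ * nm (expHess p) (sg w) ^ 2 := by
    have a1 : nm (expHess p) (grad w) ^ 2 ≤ C₀ ^ 2 * nm (expHess p) (sg w) ^ 2 := by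
      rw [← mul_pow]; exact pow_le_pow_left₀ (nm_nonneg _ _) (hKo.korn w hwX.1) 2
    rw [div_mul_eq_mul_div, div_le_iff₀ (by positivity)]
    exact (mul_le_mul_of_nonneg_left a1 (by positivity)).trans_eq (by ring)
  have hE : diffError p C Λ K μ ν n ‖g₁ - g₂‖ B (nm 2 (tgrad (sg w))) =
      (ν ^ (((p : ℝ) - 1) / 2) + μ ^ (((p : ℝ) - 1) / 2) + (ν + μ) * √Λ) * (2 * √Λ) +
      ‖g₁ - g₂‖ * (4 * √Λ) + (C * √Λ * (C * B)) * ((n : ℝ)⁻¹ * (2 * √Λ)) +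
      (2 + 2 * √Λ) * ((n : ℝ)⁻¹ * (3 * nm 2 (tgrad (sg w)))) + K * ((n : ℝ)⁻¹ * (2 * √Λ)) := by
    rw [diffError]; ring
  rw [hgwx, t0, ← hw, hE]
  have k1 := (abs_le.1 tconv).1
  have k2 := (abs_le.1 tr1).1
  have k3 := (abs_le.1 tr2).1
  have k4 := (abs_le.1 tr3).2
  linarith only [e1, e2, e3, tstress, tforce, habs, hkorn, k1, k2, k3, k4]

theorem continuous_nm {F : Type} [NormedAddCommGroup F] {q : ℝ≥0∞} [Fact (1 ≤ q)] {Φ : ℝ → E3 → F}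
    (h : Continuous fun z : ℝ × E3 => Φ z.1 z.2) : Continuous fun t => nm q (Φ t) := by
  have h1 := (continuous_toL (q := q) (Φ := Φ) (zero_lt_one.trans_le Fact.out).ne' h).norm
  have hc : ∀ t, Continuous (Φ t) := fun t => h.comp (by fun_prop : Continuous fun x => (t, x))
  simp_rw [norm_toL (memLp_of_continuous (hc _) q)] at h1
  exact h1

theorem tgrad_sub {A B : E3 → Mat3} (hA : SP A) (hB : SP B) (x : E3) :
    tgrad (fun x => A x - B x) x = tgrad A x - tgrad B x := by
  ext t
  simp only [tgrad]
  rw [dd_sub hA hB]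
  simp

/-- The viscosities of the approximation scheme. -/
def visc (Λ : ℝ) (j : ℕ) : ℝ := min 1 Λ * (1 / 4096) ^ j

/-- A sequence of Galerkin approximations with quickly converging data. -/
structure ApproxSeq (p : Ico (5 / 3 : ℝ) 2) (Λ K : ℝ) where
  g : ℕ → ℝ → LΩ E3 (expForce p)
  g_cont : ∀ j, Continuous (g j)
  g_le : ∀ j t, ‖g j t‖ ≤ K
  g_cauchy : ∀ j : ℕ, ∫ t in (0 : ℝ)..j, ‖g (j + 1) t - g j t‖ ≤ 4 * (1 / 16) ^ j
  γ : ∀ j : ℕ, Curve (4096 ^ j) j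
  gal : ∀ j, IsGalerkin p Λ (visc Λ j) (g j) (γ j)
  init : ∀ j, nm 2 (fun x => (γ (j + 1)).v 0 x - (γ j).v 0 x) ^ 2 ≤ 4 * (1 / 16) ^ j

section Rates

variable {Λ : ℝ}

theorem visc_pos (hΛ : 0 < Λ) (j : ℕ) : 0 < visc Λ j :=
  mul_pos (lt_min one_pos hΛ) (by positivity)

theorem visc_le_rate (j : ℕ) : visc Λ j ≤ (1 / 4096) ^ j :=
  mul_le_of_le_one_left (by positivity) (min_le_left _ _)

theorem visc_le_one (j : ℕ) : visc Λ j ≤ 1 :=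
  (visc_le_rate j).trans (pow_le_one₀ (by norm_num) (by norm_num))

theorem visc_le (hΛ : 0 < Λ) (j : ℕ) : visc Λ j ≤ Λ := by
  calc visc Λ j ≤ min 1 Λ * 1 :=
        mul_le_mul_of_nonneg_left (pow_le_one₀ (by norm_num) (by norm_num)) (lt_min one_pos hΛ).le
    _ ≤ Λ := by rw [mul_one]; exact min_le_right _ _

theorem visc_succ (j : ℕ) : visc Λ (j + 1) = visc Λ j / 4096 := by rw [visc, visc, pow_succ]; ring

theorem visc_succ_le (hΛ : 0 < Λ) (j : ℕ) : visc Λ (j + 1) ≤ visc Λ j := by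
  rw [visc_succ]; linarith [visc_pos hΛ j]

theorem sqrt_visc (j : ℕ) : √(visc Λ j) = √(min 1 Λ) * (1 / 64) ^ j := by
  rw [visc, Real.sqrt_mul' _ (by positivity), show (1 / 4096 : ℝ) ^ j = ((1 / 64) ^ j) ^ 2 by
    rw [← pow_mul, mul_comm, pow_mul]; norm_num, Real.sqrt_sq (by positivity)]

theorem visc_rpow_le (hΛ : 0 < Λ) (p : Ico (5 / 3 : ℝ) 2) (j : ℕ) : visc Λ j ^ (((p : ℝ) - 1) / 2) ≤ (1 / 16) ^ j := by
  have h1 := p.2.1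
  calc visc Λ j ^ (((p : ℝ) - 1) / 2) ≤ visc Λ j ^ (1 / 3 : ℝ) :=
        Real.rpow_le_rpow_of_exponent_ge (visc_pos hΛ j) (visc_le_one j) (by linarith)
    _ ≤ ((1 / 4096 : ℝ) ^ j) ^ (1 / 3 : ℝ) := Real.rpow_le_rpow (visc_pos hΛ j).le (visc_le_rate j) (by norm_num)
    _ = (1 / 16) ^ j := by
        rw [show (1 / 4096 : ℝ) ^ j = ((1 / 16) ^ j) ^ (3 : ℝ) by
          rw [Real.rpow_ofNat, ← pow_mul, mul_comm, pow_mul]; norm_num,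
          ← Real.rpow_mul (by positivity)]
        norm_num

end Rates

theorem intervalIntegral_le_add_sq {u : ℝ → ℝ} (hu : Continuous u) {T M s : ℝ} (hT : 0 ≤ T) (hs : 0 < s)
    (h : s * ∫ t in (0 : ℝ)..T, u t ^ 2 ≤ M) : ∫ t in (0 : ℝ)..T, u t ≤ (T + M) / √s := by
  have hs' := Real.sqrt_pos.2 hs
  have h1 : ∫ t in (0 : ℝ)..T, u t ≤ ∫ t in (0 : ℝ)..T, (1 + s * u t ^ 2) / √s := by
    refine intervalIntegral.integral_mono_on hT (hu.intervalIntegrable _ _)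
      ((by fun_prop : Continuous fun t => (1 + s * u t ^ 2) / √s).intervalIntegrable _ _) fun t _ => ?_
    rw [le_div_iff₀ hs']
    have := Real.sq_sqrt hs.le
    nlinarith [sq_nonneg (√s * u t - 1), sq_nonneg (√s * u t)]
  rw [intervalIntegral.integral_div, intervalIntegral.integral_add (continuous_const.intervalIntegrable _ _)
    ((by fun_prop : Continuous fun t => s * u t ^ 2).intervalIntegrable _ _),
    intervalIntegral.integral_const_mul] at h1
  simp only [intervalIntegral.integral_const, smul_eq_mul, mul_one, sub_zero] at h1
  exact h1.trans (by gcongr)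

theorem nm_grad_sq_le {p : Ico (5 / 3 : ℝ) 2} {C : ℝ} (hS : SobolevConst p C) {w : E3 → E3}
    (hw : IsSolenoidalTest w) : nm 2 (grad w) ^ 2 ≤ 9 * C * (nm (expHess p) (grad w) * nm (expHess p) (tgrad (sg w))) := by
  have hsw := hw.sp
  have h4 : expForce p ≤ 4 := by
    have h1 := p.2.1
    rw [expForce, show (4 : ℝ≥0∞) = ENNReal.ofReal 4 by simp]
    apply ENNReal.ofReal_le_ofReal
    rw [div_le_iff₀ (by linarith)]; linarith
  have h1 : nm 2 (grad w) ^ 2 = -∫ x in cube, inner ℝ (w x) (lap w x) := by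
    rw [nm_two_sq (hsw.grad.memLp 2), ← integral_inner_grad hsw hsw]
    simp_rw [real_inner_self_eq_norm_sq]
  have h2 := abs_integral_inner_le (hsw.memLp (expForce p)) (hsw.lap.memLp (expHess p))
  have h3 : nm (expForce p) w ≤ C * nm (expHess p) (grad w) :=
    (nm_exponent_le h4 (hsw.memLp 4)).trans (hS.vel w hsw hw.mean_zero)
  have h5 : nm (expHess p) (lap w) ≤ 9 * nm (expHess p) (tgrad (sg w)) :=
    nm_le_mul (hsw.sg.tgrad.memLp _) (by norm_num) (ae_of_all _ fun x => norm_lap_le hsw x)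
  have h6 := mul_le_mul h3 h5 (nm_nonneg _ _) ((nm_nonneg _ _).trans h3)
  rw [h1]
  linarith [neg_abs_le (∫ x in cube, inner ℝ (w x) (lap w x))]

namespace ApproxSeq

variable {p : Ico (5 / 3 : ℝ) 2} {C C₀ Λ K κ : ℝ}

/-- Difference of consecutive approximations. -/
def w (a : ApproxSeq p Λ K) (j : ℕ) (t : ℝ) (x : E3) : E3 := (a.γ (j + 1)).v t x - (a.γ j).v t x

variable (a : ApproxSeq p Λ K)

theorem w_mem (j : ℕ) (t : ℝ) : a.w j t ∈ X (4096 ^ (j + 1)) :=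
  Submodule.sub_mem _ ((a.γ (j + 1)).v_mem t)
    (X_mono (Nat.pow_le_pow_right (by norm_num) (Nat.le_succ j)) ((a.γ j).v_mem t))

theorem grad_w (j : ℕ) (t : ℝ) : grad (a.w j t) = fun x => grad ((a.γ (j + 1)).v t) x - grad ((a.γ j).v t) x :=
  funext fun x => grad_sub ((a.γ _).sp t) ((a.γ _).sp t) x

theorem tgrad_w (j : ℕ) (t : ℝ) : tgrad (sg (a.w j t)) =
    fun x => tgrad (sg ((a.γ (j + 1)).v t)) x - tgrad (sg ((a.γ j).v t)) x := by
  have : sg (a.w j t) = fun x => sg ((a.γ (j + 1)).v t) x - sg ((a.γ j).v t) x :=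
    funext fun x => sg_sub ((a.γ _).sp t) ((a.γ _).sp t) x
  rw [this]
  exact funext fun x => tgrad_sub ((a.γ _).sp t).sg ((a.γ _).sp t).sg x

theorem continuous_grad_w (j : ℕ) : Continuous fun z : ℝ × E3 => grad (a.w j z.1) z.2 := by
  simp_rw [grad_w]
  exact (a.γ _).continuous_grad.sub (a.γ _).continuous_grad

theorem continuous_tgrad_w (j : ℕ) : Continuous fun z : ℝ × E3 => tgrad (sg (a.w j z.1)) z.2 := by
  simp_rw [tgrad_w]
  exact (a.γ _).continuous_tgrad.sub (a.γ _).continuous_tgrad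

/-- The consecutive approximations approach each other geometrically. -/
theorem exists_energy_bound (hS : SobolevConst p C) (h : SmallData p C Λ K κ) (hKo : KornConst p C C₀)
    {T : ℝ} (hT : 0 ≤ T) : ∃ A, 0 ≤ A ∧ ∀ j : ℕ, T ≤ j → (∀ t ∈ Icc 0 T, nm 2 (a.w j t) ^ 2 ≤ A * (1 / 16) ^ j) ∧
      (∫ t in (0 : ℝ)..T, nm (expHess p) (grad (a.w j t)) ^ 2) ≤ A * (1 / 16) ^ j := by
  have hΛ := h.pos
  have hκ := h.kappa_pos
  have hK := h.nonneg
  have hC₀ := hKo.pos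
  obtain ⟨M, hM0, hM⟩ := exists_time_bound hS h hT
  set c := 2 * κ / C₀ ^ 2
  have hc : 0 < c := by positivity
  set σ := √(min 1 Λ)
  have hσ : 0 < σ := Real.sqrt_pos.2 (lt_min one_pos hΛ)
  set D := T * (2 * √Λ * (2 + 2 * √Λ)) + 16 * √Λ + (2 * √Λ * (C ^ 2 * √Λ * (T + M) + T * K)) +
      (2 + 2 * √Λ) * (3 * (128 * (T + M) / σ))
  have hD : 0 ≤ D := by positivity
  refine ⟨2 * (2 + D) + (2 + D) / c, by positivity, fun j hj => ?_⟩
  have hj1 : T ≤ ((j + 1 : ℕ) : ℝ) := by push_cast; linarith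
  obtain ⟨-, -, hJ1, -⟩ := hM _ (visc_pos hΛ (j + 1)) (visc_le hΛ _) _ _ hj1 _ (a.γ (j + 1)) (a.g_le _) (a.gal _)
  obtain ⟨-, hB0, hJ0, -⟩ := hM _ (visc_pos hΛ j) (visc_le hΛ _) _ _ hj _ (a.γ j) (a.g_le _) (a.gal _)
  set ρ : ℝ := (1 / 16) ^ j
  have hρ : 0 < ρ := by positivity
  have hcG : Continuous fun t => ‖a.g (j + 1) t - a.g j t‖ := ((a.g_cont _).sub (a.g_cont _)).norm
  have hcB : Continuous fun t => nm (expHess p) (tgrad (sg ((a.γ j).v t))) := (a.γ j).continuous_nm_tgrad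
  have hcJ1 : Continuous fun t => nm 2 (tgrad (sg ((a.γ (j + 1)).v t))) := (a.γ _).continuous_nm_tgrad
  have hcJ0 : Continuous fun t => nm 2 (tgrad (sg ((a.γ j).v t))) := (a.γ _).continuous_nm_tgrad
  have hcJ : Continuous fun t => nm 2 (tgrad (sg (a.w j t))) := continuous_nm (a.continuous_tgrad_w j)
  have hcW : Continuous fun t => nm (expHess p) (grad (a.w j t)) := continuous_nm (a.continuous_grad_w j)
  -- integrals of the error terms
  have iG : ∫ t in (0 : ℝ)..T, ‖a.g (j + 1) t - a.g j t‖ ≤ 4 * ρ := by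
    refine le_trans ?_ (a.g_cauchy j)
    exact intervalIntegral.integral_mono_interval le_rfl hT hj (ae_of_all _ fun t => norm_nonneg _)
      (hcG.intervalIntegrable _ _)
  have iB : ∫ t in (0 : ℝ)..T, nm (expHess p) (tgrad (sg ((a.γ j).v t))) ≤ T + M := by
    have := intervalIntegral_le_add_sq (M := M) hcB hT one_pos (by rw [one_mul]; exact hB0)
    simpa using this
  have iJ : ∫ t in (0 : ℝ)..T, nm 2 (tgrad (sg (a.w j t))) ≤ 2 * ((T + M) / √(visc Λ (j + 1))) := by
    have e1 := intervalIntegral_le_add_sq hcJ1 hT (visc_pos hΛ (j + 1)) hJ1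
    have e0 := intervalIntegral_le_add_sq hcJ0 hT (visc_pos hΛ (j + 1)) (le_trans
      (mul_le_mul_of_nonneg_right (visc_succ_le hΛ j) (intervalIntegral.integral_nonneg hT fun t _ => sq_nonneg _)) hJ0)
    have e2 : ∫ t in (0 : ℝ)..T, nm 2 (tgrad (sg (a.w j t))) ≤
        ∫ t in (0 : ℝ)..T, (nm 2 (tgrad (sg ((a.γ (j + 1)).v t))) + nm 2 (tgrad (sg ((a.γ j).v t)))) := by
      refine intervalIntegral.integral_mono_on hT (hcJ.intervalIntegrable _ _)
        ((hcJ1.add hcJ0).intervalIntegrable _ _) fun t _ => ?_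
      rw [tgrad_w]
      exact nm_sub_le (by norm_num) (((a.γ _).sp t).sg.tgrad.memLp 2) (((a.γ _).sp t).sg.tgrad.memLp 2)
    rw [intervalIntegral.integral_add (hcJ1.intervalIntegrable _ _) (hcJ0.intervalIntegrable _ _)] at e2
    linarith
  have r1 : (1 / 4096 : ℝ) ^ j ≤ ρ := by simp only [ρ]; gcongr; norm_num
  have r2 : (((4096 ^ j : ℕ) : ℝ))⁻¹ = (1 / 4096) ^ j := by push_cast; rw [one_div, inv_pow]
  have r3 : (1 / 4096 : ℝ) ^ j * (2 * ((T + M) / √(visc Λ (j + 1)))) ≤ ρ * (128 * (T + M) / σ) := by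
    rw [sqrt_visc]
    have e1 : (1 / 4096 : ℝ) ^ j = (1 / 64) ^ j * (1 / 64) ^ j := by rw [← mul_pow]; norm_num
    have e2 : (1 / 64 : ℝ) ^ j ≤ ρ := by simp only [ρ]; gcongr; norm_num
    have e3 : (1 / 4096 : ℝ) ^ j * (2 * ((T + M) / (σ * (1 / 64) ^ (j + 1)))) = (1 / 64) ^ j * (128 * (T + M) / σ) := by
      rw [e1, pow_succ]
      have : (0 : ℝ) < (1 / 64) ^ j := by positivity
      field_simp
      ring
    rw [e3]
    exact mul_le_mul_of_nonneg_right e2 (by positivity)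
  set err : ℝ → ℝ := fun t => diffError p C Λ K (visc Λ j) (visc Λ (j + 1)) (4096 ^ j)
    ‖a.g (j + 1) t - a.g j t‖ (nm (expHess p) (tgrad (sg ((a.γ j).v t)))) (nm 2 (tgrad (sg (a.w j t))))
  have hcerr : Continuous err := by
    simp only [err, diffError]
    fun_prop
  have herr0 : ∀ t, 0 ≤ err t := fun t => by
    have h1 := Real.rpow_nonneg (visc_pos hΛ j).le (((p : ℝ) - 1) / 2)
    have h2 := Real.rpow_nonneg (visc_pos hΛ (j + 1)).le (((p : ℝ) - 1) / 2)
    have h3 := visc_pos hΛ j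
    have h4 := visc_pos hΛ (j + 1)
    have h5 := nm_nonneg (expHess p) (tgrad (sg ((a.γ j).v t)))
    have h6 := nm_nonneg 2 (tgrad (sg (a.w j t)))
    simp only [err, diffError]
    positivity
  have ierr : ∫ t in (0 : ℝ)..T, err t ≤ D * ρ := by
    have e0 : ∀ t, err t = 2 * √Λ * (visc Λ (j + 1) ^ (((p : ℝ) - 1) / 2) + visc Λ j ^ (((p : ℝ) - 1) / 2) +
        (visc Λ (j + 1) + visc Λ j) * √Λ) + (1 / 4096) ^ j * (2 * √Λ * K) +
        4 * √Λ * ‖a.g (j + 1) t - a.g j t‖ +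
        (1 / 4096) ^ j * (2 * √Λ * (C ^ 2 * √Λ)) * nm (expHess p) (tgrad (sg ((a.γ j).v t))) +
        (2 + 2 * √Λ) * 3 * (1 / 4096) ^ j * nm 2 (tgrad (sg (a.w j t))) := fun t => by
      simp only [err, diffError, r2]; ring
    simp_rw [e0]
    rw [intervalIntegral.integral_add ((by fun_prop : Continuous _).intervalIntegrable _ _)
        ((by fun_prop : Continuous _).intervalIntegrable _ _),
      intervalIntegral.integral_add ((by fun_prop : Continuous _).intervalIntegrable _ _)
        ((by fun_prop : Continuous _).intervalIntegrable _ _),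
      intervalIntegral.integral_add (continuous_const.intervalIntegrable _ _)
        ((by fun_prop : Continuous _).intervalIntegrable _ _),
      intervalIntegral.integral_const_mul, intervalIntegral.integral_const_mul,
      intervalIntegral.integral_const_mul, intervalIntegral.integral_const, smul_eq_mul, sub_zero]
    have v1 := visc_rpow_le hΛ p j
    have v2 : visc Λ (j + 1) ^ (((p : ℝ) - 1) / 2) ≤ ρ := (visc_rpow_le hΛ p (j + 1)).trans
      (pow_le_pow_of_le_one (by norm_num) (by norm_num) (Nat.le_succ j))
    have v3 := (visc_le_rate (Λ := Λ) j).trans r1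
    have v4 := (visc_succ_le hΛ j).trans v3
    have t1 : 2 * √Λ * (visc Λ (j + 1) ^ (((p : ℝ) - 1) / 2) + visc Λ j ^ (((p : ℝ) - 1) / 2) +
        (visc Λ (j + 1) + visc Λ j) * √Λ) ≤ 2 * √Λ * (ρ + ρ + (ρ + ρ) * √Λ) := by gcongr
    have t2 : (1 / 4096 : ℝ) ^ j * (2 * √Λ * K) ≤ ρ * (2 * √Λ * K) := by gcongr
    have t3 : 4 * √Λ * (∫ t in (0 : ℝ)..T, ‖a.g (j + 1) t - a.g j t‖) ≤ 4 * √Λ * (4 * ρ) := by gcongr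
    have hC := hS.one_le
    have t4 : (1 / 4096 : ℝ) ^ j * (2 * √Λ * (C ^ 2 * √Λ)) *
        (∫ t in (0 : ℝ)..T, nm (expHess p) (tgrad (sg ((a.γ j).v t)))) ≤
        ρ * (2 * √Λ * (C ^ 2 * √Λ)) * (T + M) := by
      refine mul_le_mul (by gcongr) iB (intervalIntegral.integral_nonneg hT fun t _ => nm_nonneg _ _) (by positivity)
    have t5 : (2 + 2 * √Λ) * 3 * (1 / 4096) ^ j * (∫ t in (0 : ℝ)..T, nm 2 (tgrad (sg (a.w j t)))) ≤
        (2 + 2 * √Λ) * 3 * (ρ * (128 * (T + M) / σ)) := by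
      rw [mul_assoc]
      refine mul_le_mul_of_nonneg_left (le_trans ?_ r3) (by positivity)
      gcongr
    have t6 := mul_le_mul_of_nonneg_left (add_le_add t1 t2) hT
    simp only [D]
    linarith
  have hd : ∀ t ∈ Icc 0 T, HasDerivAt (fun t => nm 2 (a.w j t) ^ 2 / 2)
      (∫ x in cube, inner ℝ ((a.γ (j + 1)).v' t x - (a.γ j).v' t x) (a.w j t x)) t := by
    intro t ht
    have h1 := (((a.γ (j + 1)).hasDerivAt_v ⟨ht.1, ht.2.trans hj1⟩).fun_sub
      ((a.γ j).hasDerivAt_v ⟨ht.1, ht.2.trans hj⟩)).norm_sq.div_const 2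
    rw [← toL_sub (((a.γ _).sp t).memLp 2) (((a.γ _).sp t).memLp 2),
      ← toL_sub (((a.γ _).sp' t).memLp 2) (((a.γ _).sp' t).memLp 2),
      inner_toL ((((a.γ _).sp t).sub ((a.γ _).sp t)).memLp 2)
      ((((a.γ _).sp' t).sub ((a.γ _).sp' t)).memLp 2)] at h1
    simp_rw [norm_toL_sub (((a.γ _).sp _).memLp 2) (((a.γ _).sp _).memLp 2)] at h1
    refine h1.congr_deriv ?_
    rw [mul_div_cancel_left₀ _ (two_ne_zero)]
    exact integral_congr_ae (ae_of_all _ fun x => real_inner_comm _ _)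
  have hineq : ∀ t ∈ Icc 0 T, (∫ x in cube, inner ℝ ((a.γ (j + 1)).v' t x - (a.γ j).v' t x) (a.w j t x)) +
      c * nm (expHess p) (grad (a.w j t)) ^ 2 ≤ err t := by
    intro t ht
    rw [grad_w]
    exact difference_test_le hS h hKo (visc_pos hΛ j) (visc_le hΛ j) (visc_le_one j) (visc_pos hΛ _)
      (Nat.one_le_pow _ _ (by norm_num)) (Nat.pow_le_pow_right (by norm_num) (Nat.le_succ j))
      ((a.γ _).v_mem t) ((a.γ _).v_mem t) ((a.γ _).sp' t) ((a.γ _).v'_mem t)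
      ((a.gal _).bound t ⟨ht.1, ht.2.trans hj1⟩) ((a.gal _).bound t ⟨ht.1, ht.2.trans hj⟩) (a.g_le _ _)
      ((a.gal _).weak t ⟨ht.1, ht.2.trans hj1⟩) ((a.gal _).weak t ⟨ht.1, ht.2.trans hj⟩)
  have hmain : ∀ t ∈ Icc 0 T, nm 2 (a.w j t) ^ 2 / 2 +
      c * (∫ τ in (0 : ℝ)..t, nm (expHess p) (grad (a.w j τ)) ^ 2) ≤ (2 + D) * ρ := by
    intro t ht
    have h1 := add_integral_le_of_hasDerivAt ht.1 (f := fun t => nm 2 (a.w j t) ^ 2 / 2)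
      (a := fun t => c * nm (expHess p) (grad (a.w j t)) ^ 2) ((hcW.pow 2).const_mul c) hcerr
      (fun τ hτ => hd τ ⟨hτ.1, hτ.2.trans ht.2⟩) (fun τ hτ => hineq τ ⟨hτ.1, hτ.2.trans ht.2⟩)
    rw [intervalIntegral.integral_const_mul] at h1
    have h2 : ∫ τ in (0 : ℝ)..t, err τ ≤ ∫ τ in (0 : ℝ)..T, err τ :=
      intervalIntegral.integral_mono_interval le_rfl ht.1 ht.2 (ae_of_all _ herr0) (hcerr.intervalIntegrable _ _)
    have h3 : nm 2 (a.w j 0) ^ 2 ≤ 4 * ρ := a.init j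
    linarith
  constructor
  · intro t ht
    have h1 := hmain t ht
    have h2 : 0 ≤ ∫ τ in (0 : ℝ)..t, nm (expHess p) (grad (a.w j τ)) ^ 2 :=
      intervalIntegral.integral_nonneg ht.1 fun _ _ => sq_nonneg _
    have h3 : 0 ≤ (2 + D) / c * ρ := by positivity
    have h4 := mul_nonneg hc.le h2
    linarith
  · have h1 := hmain T ⟨hT, le_rfl⟩
    have h2 := sq_nonneg (nm 2 (a.w j T))
    have h3 : c * (∫ τ in (0 : ℝ)..T, nm (expHess p) (grad (a.w j τ)) ^ 2) ≤ (2 + D) * ρ := by linarith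
    rw [← le_div_iff₀' hc] at h3
    have h4 : 0 ≤ 2 * (2 + D) * ρ := by positivity
    calc _ ≤ (2 + D) * ρ / c := h3
      _ = (2 + D) / c * ρ := by ring
      _ ≤ _ := by rw [add_mul]; linarith

theorem exists_cauchy_bound (hS : SobolevConst p C) (h : SmallData p C Λ K κ) (hKo : KornConst p C C₀)
    {T : ℝ} (hT : 0 ≤ T) : ∃ A, 0 ≤ A ∧ ∀ j : ℕ, T ≤ j → (∀ t ∈ Icc 0 T, nm 2 (a.w j t) ≤ A * (1 / 4) ^ j) ∧
      (∫ t in (0 : ℝ)..T, nm 2 (grad (a.w j t))) ≤ A * (1 / 2) ^ j := by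
  have hΛ := h.pos
  have hC := hS.one_le
  obtain ⟨M, hM0, hM⟩ := exists_time_bound hS h hT
  obtain ⟨A, hA, hAj⟩ := a.exists_energy_bound hS h hKo hT
  refine ⟨√A + (T + 9 * C * (A + 4 * M)), by positivity, fun j hj => ?_⟩
  have hj1 : T ≤ ((j + 1 : ℕ) : ℝ) := by push_cast; linarith
  obtain ⟨h1, h2⟩ := hAj j hj
  constructor
  · intro t ht
    have e1 : nm 2 (a.w j t) ≤ √A * (1 / 4) ^ j := by
      refine le_trans (Real.le_sqrt_of_sq_le (h1 t ht)) (le_of_eq ?_)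
      rw [Real.sqrt_mul hA, show (1 / 16 : ℝ) ^ j = ((1 / 4) ^ j) ^ 2 by
        rw [← pow_mul, mul_comm, pow_mul]; norm_num, Real.sqrt_sq (by positivity)]
    refine e1.trans (mul_le_mul_of_nonneg_right ?_ (by positivity))
    have : 0 ≤ T + 9 * C * (A + 4 * M) := by positivity
    linarith
  · obtain ⟨-, hB1, -, -⟩ := hM _ (visc_pos hΛ (j + 1)) (visc_le hΛ _) _ _ hj1 _ (a.γ (j + 1)) (a.g_le _) (a.gal _)
    obtain ⟨-, hB0, -, -⟩ := hM _ (visc_pos hΛ j) (visc_le hΛ _) _ _ hj _ (a.γ j) (a.g_le _) (a.gal _)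
    have hcB1 : Continuous fun t => nm (expHess p) (tgrad (sg ((a.γ (j + 1)).v t))) := (a.γ _).continuous_nm_tgrad
    have hcB0 : Continuous fun t => nm (expHess p) (tgrad (sg ((a.γ j).v t))) := (a.γ j).continuous_nm_tgrad
    have hcW : Continuous fun t => nm (expHess p) (grad (a.w j t)) := continuous_nm (a.continuous_grad_w j)
    have hcW2 : Continuous fun t => nm 2 (grad (a.w j t)) := continuous_nm (a.continuous_grad_w j)
    have e1 : ∀ t, nm 2 (grad (a.w j t)) ≤ (1 / 2) ^ j + 9 * C * (8 ^ j * nm (expHess p) (grad (a.w j t)) ^ 2 +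
        (1 / 2) ^ j * (2 * nm (expHess p) (tgrad (sg ((a.γ (j + 1)).v t))) ^ 2 +
          2 * nm (expHess p) (tgrad (sg ((a.γ j).v t))) ^ 2)) := by
      intro t
      have b1 := nm_grad_sq_le hS (a.w_mem j t).1
      have b2 : nm (expHess p) (tgrad (sg (a.w j t))) ≤ nm (expHess p) (tgrad (sg ((a.γ (j + 1)).v t))) +
          nm (expHess p) (tgrad (sg ((a.γ j).v t))) := by
        rw [tgrad_w]
        exact nm_sub_le Fact.out (((a.γ _).sp t).sg.tgrad.memLp _) (((a.γ _).sp t).sg.tgrad.memLp _)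
      set y := nm 2 (grad (a.w j t))
      set x := nm (expHess p) (grad (a.w j t))
      set B₁ := nm (expHess p) (tgrad (sg ((a.γ (j + 1)).v t)))
      set B₀ := nm (expHess p) (tgrad (sg ((a.γ j).v t)))
      have hx : 0 ≤ x := nm_nonneg _ _
      have b3 : x * nm (expHess p) (tgrad (sg (a.w j t))) ≤ x * (B₁ + B₀) := mul_le_mul_of_nonneg_left b2 hx
      set s : ℝ := 2 ^ j
      have hs : 0 < s := by positivity
      have hs1 : (1 / 2 : ℝ) ^ j = s⁻¹ := by simp only [s]; rw [one_div, inv_pow]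
      have hs2 : (8 : ℝ) ^ j = s ^ 3 := by simp only [s]; rw [← pow_mul, mul_comm, pow_mul]; norm_num
      rw [hs1, hs2]
      have b4 : y ≤ s⁻¹ + s * y ^ 2 := by
        have := sq_nonneg (s * y - 1)
        have h5 : 0 ≤ s⁻¹ * (s * y - 1) ^ 2 := by positivity
        have h6 : s⁻¹ * (s * y - 1) ^ 2 = s * y ^ 2 - 2 * y + s⁻¹ := by field_simp; ring
        have h7 : 0 ≤ y := nm_nonneg _ _
        linarith
      have b5 : s * (x * (B₁ + B₀)) ≤ s ^ 3 * x ^ 2 + s⁻¹ * (2 * B₁ ^ 2 + 2 * B₀ ^ 2) := by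
        have h5 : 0 ≤ s⁻¹ * (s ^ 2 * x - (B₁ + B₀)) ^ 2 := by positivity
        have h6 : s⁻¹ * (s ^ 2 * x - (B₁ + B₀)) ^ 2 = s ^ 3 * x ^ 2 - 2 * (s * (x * (B₁ + B₀))) + s⁻¹ * (B₁ + B₀) ^ 2 := by
          field_simp
          ring
        have h7 : s⁻¹ * (B₁ + B₀) ^ 2 ≤ s⁻¹ * (2 * B₁ ^ 2 + 2 * B₀ ^ 2) := by
          gcongr; nlinarith [sq_nonneg (B₁ - B₀)]
        have h8 : 0 ≤ s * (x * (B₁ + B₀)) := by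
          have : 0 ≤ B₁ := nm_nonneg _ _
          have : 0 ≤ B₀ := nm_nonneg _ _
          positivity
        linarith
      calc y ≤ s⁻¹ + s * y ^ 2 := b4
        _ ≤ s⁻¹ + s * (9 * C * (x * (B₁ + B₀))) := by
            gcongr
            exact b1.trans (mul_le_mul_of_nonneg_left b3 (by positivity))
        _ = s⁻¹ + 9 * C * (s * (x * (B₁ + B₀))) := by ring
        _ ≤ _ := by gcongr
    have e2 := intervalIntegral.integral_mono_on (μ := volume) hT (hcW2.intervalIntegrable _ _)
      ((by fun_prop : Continuous fun t => (1 / 2 : ℝ) ^ j + 9 * C * (8 ^ j * nm (expHess p) (grad (a.w j t)) ^ 2 +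
        (1 / 2) ^ j * (2 * nm (expHess p) (tgrad (sg ((a.γ (j + 1)).v t))) ^ 2 +
          2 * nm (expHess p) (tgrad (sg ((a.γ j).v t))) ^ 2))).intervalIntegrable _ _) fun t _ => e1 t
    refine e2.trans ?_
    rw [intervalIntegral.integral_add ((by fun_prop : Continuous _).intervalIntegrable _ _)
        ((by fun_prop : Continuous _).intervalIntegrable _ _), intervalIntegral.integral_const_mul,
      intervalIntegral.integral_add ((by fun_prop : Continuous _).intervalIntegrable _ _)
        ((by fun_prop : Continuous _).intervalIntegrable _ _), intervalIntegral.integral_const_mul,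
      intervalIntegral.integral_const_mul,
      intervalIntegral.integral_add ((by fun_prop : Continuous _).intervalIntegrable _ _)
        ((by fun_prop : Continuous _).intervalIntegrable _ _), intervalIntegral.integral_const_mul,
      intervalIntegral.integral_const_mul, intervalIntegral.integral_const, smul_eq_mul, sub_zero]
    have f1 : (8 : ℝ) ^ j * (∫ t in (0 : ℝ)..T, nm (expHess p) (grad (a.w j t)) ^ 2) ≤ A * (1 / 2) ^ j := by
      calc (8 : ℝ) ^ j * (∫ t in (0 : ℝ)..T, nm (expHess p) (grad (a.w j t)) ^ 2) ≤ 8 ^ j * (A * (1 / 16) ^ j) := by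
            gcongr
        _ = A * (8 * (1 / 16)) ^ j := by rw [mul_pow]; ring
        _ = A * (1 / 2) ^ j := by norm_num
    have f2 : (1 / 2 : ℝ) ^ j * (2 * (∫ t in (0 : ℝ)..T, nm (expHess p) (tgrad (sg ((a.γ (j + 1)).v t))) ^ 2) +
        2 * (∫ t in (0 : ℝ)..T, nm (expHess p) (tgrad (sg ((a.γ j).v t))) ^ 2)) ≤ (1 / 2) ^ j * (4 * M) := by
      gcongr; linarith
    have f3 := mul_le_mul_of_nonneg_left (add_le_add f1 f2) (by positivity : 0 ≤ 9 * C)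
    have f4 : 0 ≤ √A * (1 / 2 : ℝ) ^ j := by positivity
    linarith

end ApproxSeq

section WeakLimits

variable {E F : Type} [NormedAddCommGroup E] [InnerProductSpace ℝ E] [CompleteSpace E]

/-- Weak convergence along the hyperfilter. -/
def WeakLim (x : ℕ → E) (z : E) : Prop :=
  ∀ y : E, Tendsto (fun j => (inner ℝ (x j) y : ℝ)) (hyperfilter ℕ : Filter ℕ) (𝓝 (inner ℝ z y))

theorem exists_weakLim {x : ℕ → E} {M : ℝ} (hx : ∀ᶠ j in atTop, ‖x j‖ ≤ M) : ∃ z, WeakLim x z := by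
  have hx' : ∀ᶠ j in (hyperfilter ℕ : Filter ℕ), ‖x j‖ ≤ M := Nat.hyperfilter_le_atTop hx
  have h1 : ∀ y : E, ∃ l : ℝ, |l| ≤ M * ‖y‖ ∧
      Tendsto (fun j => (inner ℝ (x j) y : ℝ)) (hyperfilter ℕ : Filter ℕ) (𝓝 l) := by
    intro y
    obtain ⟨l, hl, h⟩ := (isCompact_Icc (a := -(M * ‖y‖)) (b := M * ‖y‖)).ultrafilter_le_nhds
      ((hyperfilter ℕ).map fun j => (inner ℝ (x j) y : ℝ)) (by
        rw [le_principal_iff]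
        change ∀ᶠ j in (hyperfilter ℕ : Filter ℕ), _
        filter_upwards [hx'] with j hj
        exact abs_le.1 ((abs_real_inner_le_norm _ _).trans (by gcongr)))
    exact ⟨l, abs_le.2 hl, h⟩
  choose l hl hlim using h1
  let ℓ : E →L[ℝ] ℝ := LinearMap.mkContinuous
    { toFun := l
      map_add' := fun y y' => tendsto_nhds_unique (hlim (y + y')) (by
        simp_rw [inner_add_right]; exact (hlim y).add (hlim y'))
      map_smul' := fun c y => tendsto_nhds_unique (hlim (c • y)) (by
        simp_rw [inner_smul_right]; exact (hlim y).const_mul c) } M hl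
  refine ⟨(InnerProductSpace.toDual ℝ E).symm ℓ, fun y => ?_⟩
  rw [InnerProductSpace.toDual_symm_apply]
  exact hlim y

theorem WeakLim.norm_le {x : ℕ → E} {z : E} {M : ℝ} (h : WeakLim x z) (hx : ∀ᶠ j in atTop, ‖x j‖ ≤ M) : ‖z‖ ≤ M := by
  have hx' : ∀ᶠ j in (hyperfilter ℕ : Filter ℕ), ‖x j‖ ≤ M := Nat.hyperfilter_le_atTop hx
  have h1 : (inner ℝ z z : ℝ) ≤ M * ‖z‖ := le_of_tendsto (h z) (by
    filter_upwards [hx'] with j hj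
    exact (real_inner_le_norm _ _).trans (by gcongr))
  rw [real_inner_self_eq_norm_mul_norm] at h1
  rcases (norm_nonneg z).eq_or_lt with h0 | h0
  · obtain ⟨j, hj⟩ := hx.exists
    rw [← h0]; exact (norm_nonneg _).trans hj
  · exact le_of_mul_le_mul_right h1 h0

theorem WeakLim.eq_of_tendsto {x : ℕ → E} {z z' : E} (h : WeakLim x z) (h' : Tendsto x atTop (𝓝 z')) : z = z' := by
  refine ext_inner_right ℝ fun y => tendsto_nhds_unique (h y) ?_
  exact (h'.inner tendsto_const_nhds).mono_left Nat.hyperfilter_le_atTop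

/-- Weak against strong convergence. -/
theorem WeakLim.inner_tendsto {x y : ℕ → E} {z w : E} {M : ℝ} (h : WeakLim x z)
    (hx : ∀ᶠ j in atTop, ‖x j‖ ≤ M) (hy : Tendsto y atTop (𝓝 w)) :
    Tendsto (fun j => (inner ℝ (x j) (y j) : ℝ)) (hyperfilter ℕ : Filter ℕ) (𝓝 (inner ℝ z w)) := by
  have h1 : Tendsto (fun j => M * ‖y j - w‖) (hyperfilter ℕ : Filter ℕ) (𝓝 (M * 0)) :=
    ((tendsto_iff_norm_sub_tendsto_zero.1 hy).mono_left Nat.hyperfilter_le_atTop).const_mul M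
  rw [mul_zero] at h1
  have h2 : Tendsto (fun j => (inner ℝ (x j) (y j - w) : ℝ)) (hyperfilter ℕ : Filter ℕ) (𝓝 0) := by
    refine squeeze_zero_norm' ?_ h1
    filter_upwards [Nat.hyperfilter_le_atTop hx] with j hj
    exact (norm_inner_le_norm _ _).trans (by gcongr)
  have h3 := h2.add (h w)
  simp_rw [← inner_add_right, sub_add_cancel, zero_add] at h3
  exact h3

/-- A closed convex set is closed under strong limits in the first and weak limits in the second component. -/
theorem WeakLim.mem_prod [NormedAddCommGroup F] [NormedSpace ℝ F] {S : Set (F × E)} (hS : IsClosed S)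
    (hc : Convex ℝ S) {u : ℕ → F} {x : ℕ → E} {a : F} {z : E} (hu : Tendsto u atTop (𝓝 a)) (hx : WeakLim x z)
    (h : ∀ᶠ j in atTop, (u j, x j) ∈ S) : (a, z) ∈ S := by
  by_contra hn
  obtain ⟨f, c, h1, h2⟩ := geometric_hahn_banach_point_closed hc hS hn
  have hf : ∀ b w, f (b, w) = f (b, 0) +
      inner ℝ w ((InnerProductSpace.toDual ℝ E).symm (f.comp (ContinuousLinearMap.inr ℝ F E))) := by
    intro b w
    rw [real_inner_comm, InnerProductSpace.toDual_symm_apply]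
    rw [ContinuousLinearMap.comp_apply, ← map_add]
    change f (b, w) = f (b + 0, 0 + w)
    rw [add_zero, zero_add]
  have h3 : Tendsto (fun j => f (u j, x j)) (hyperfilter ℕ : Filter ℕ) (𝓝 (f (a, z))) := by
    rw [hf]
    refine Tendsto.congr (fun j => (hf _ _).symm) (Tendsto.add ?_ (hx _))
    have hcont : Continuous fun b : F => f (b, (0 : E)) := by fun_prop
    exact ((hcont.tendsto a).comp hu).mono_left Nat.hyperfilter_le_atTop
  have h4 := ge_of_tendsto h3 (b := c) (by
    filter_upwards [Nat.hyperfilter_le_atTop h] with j hj using (h2 _ hj).le)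
  linarith

end WeakLimits

section SobolevSpace

variable {q : ℝ≥0∞}

/-- A smooth field as an element of `J^{1,q}`. -/
def pairL (q : ℝ≥0∞) (φ : E3 → E3) : LΩ E3 q × LΩ Mat3 q := (toL q φ, toL q (grad φ))

theorem grad_add {φ ψ : E3 → E3} (hφ : SP φ) (hψ : SP ψ) (x : E3) :
    grad (fun x => φ x + ψ x) x = grad φ x + grad ψ x := by
  ext ⟨i, j⟩
  rw [grad_apply (hφ.add hψ), dd_add hφ hψ]
  simp [grad_apply hφ, grad_apply hψ]

theorem grad_const_smul {φ : E3 → E3} (hφ : SP φ) (c : ℝ) (x : E3) : grad (fun x => c • φ x) x = c • grad φ x := by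
  ext ⟨i, j⟩
  rw [grad_apply (hφ.const_smul c), dd_const_smul hφ c]
  simp [grad_apply hφ]

theorem IsSolenoidalTest.add {φ ψ : E3 → E3} (hφ : IsSolenoidalTest φ) (hψ : IsSolenoidalTest ψ) :
    IsSolenoidalTest fun x => φ x + ψ x :=
  isSolenoidalTest_iff.2 ⟨hφ.sp.add hψ.sp, by
    rw [integral_add hφ.sp.integrable hψ.sp.integrable, hφ.mean_zero, hψ.mean_zero, add_zero], fun x => by
    simp_rw [dd_add hφ.sp hψ.sp, PiLp.add_apply, Finset.sum_add_distrib, hφ.div_dd, hψ.div_dd, add_zero]⟩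

theorem IsSolenoidalTest.const_smul {φ : E3 → E3} (hφ : IsSolenoidalTest φ) (c : ℝ) :
    IsSolenoidalTest fun x => c • φ x :=
  isSolenoidalTest_iff.2 ⟨hφ.sp.const_smul c, by rw [integral_smul, hφ.mean_zero, smul_zero], fun x => by
    simp_rw [dd_const_smul hφ.sp, PiLp.smul_apply, smul_eq_mul, ← Finset.mul_sum, hφ.div_dd, mul_zero]⟩

theorem pairL_add {φ ψ : E3 → E3} (hφ : SP φ) (hψ : SP ψ) : pairL q (fun x => φ x + ψ x) = pairL q φ + pairL q ψ := by
  refine Prod.ext ?_ ?_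
  · refine toL_eq_of_ae ?_
    filter_upwards [Lp.coeFn_add (toL q φ) (toL q ψ), coeFn_toL (hφ.memLp q), coeFn_toL (hψ.memLp q)] with x h1 h2 h3
    rw [← h2, ← h3]; exact h1
  · refine toL_eq_of_ae ?_
    filter_upwards [Lp.coeFn_add (toL q (grad φ)) (toL q (grad ψ)), coeFn_toL (hφ.grad.memLp q),
      coeFn_toL (hψ.grad.memLp q)] with x h1 h2 h3
    rw [grad_add hφ hψ, ← h2, ← h3]; exact h1

theorem pairL_const_smul {φ : E3 → E3} (hφ : SP φ) (c : ℝ) : pairL q (fun x => c • φ x) = c • pairL q φ := by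
  refine Prod.ext ?_ ?_
  · refine toL_eq_of_ae ?_
    filter_upwards [Lp.coeFn_smul c (toL q φ), coeFn_toL (hφ.memLp q)] with x h1 h2
    rw [← h2]; exact h1
  · refine toL_eq_of_ae ?_
    filter_upwards [Lp.coeFn_smul c (toL q (grad φ)), coeFn_toL (hφ.grad.memLp q)] with x h1 h2
    rw [grad_const_smul hφ, ← h2]; exact h1

/-- The smooth elements of `J^{1,q}`. -/
def testSub (q : ℝ≥0∞) [Fact (1 ≤ q)] : Submodule ℝ (LΩ E3 q × LΩ Mat3 q) where
  carrier := {U | ∃ φ : E3 → E3, IsSolenoidalTest φ ∧ U = pairL q φ}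
  add_mem' := by
    rintro _ _ ⟨φ, hφ, rfl⟩ ⟨ψ, hψ, rfl⟩
    exact ⟨_, hφ.add hψ, (pairL_add hφ.sp hψ.sp).symm⟩
  zero_mem' := ⟨fun _ => 0, (X 0).zero_mem.1, by
    have := pairL_const_smul (q := q) (SP.const (0 : E3)) 0
    rw [zero_smul] at this
    simpa only [zero_smul] using this.symm⟩
  smul_mem' := by
    rintro c _ ⟨φ, hφ, rfl⟩
    exact ⟨_, hφ.const_smul c, (pairL_const_smul hφ.sp c).symm⟩

variable [Fact (1 ≤ q)]

theorem J1_eq : J1 q = ((testSub q).topologicalClosure : Set (LΩ E3 q × LΩ Mat3 q)) := by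
  rw [Submodule.topologicalClosure_coe, J1]
  congr 1
  ext U
  constructor
  · rintro ⟨φ, hφ, h1, h2⟩
    exact ⟨φ, hφ, Prod.ext (toL_eq_of_ae h1).symm (toL_eq_of_ae h2).symm⟩
  · rintro ⟨φ, hφ, rfl⟩
    exact ⟨φ, hφ, coeFn_toL (hφ.sp.memLp q), coeFn_toL (hφ.sp.grad.memLp q)⟩

theorem isClosed_J1 : IsClosed (J1 q) := isClosed_closure

theorem convex_J1 : Convex ℝ (J1 q) := by
  rw [J1_eq]; exact Submodule.convex _

theorem pairL_mem_J1 {φ : E3 → E3} (hφ : IsSolenoidalTest φ) : pairL q φ ∈ J1 q := by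
  rw [J1_eq]; exact subset_closure ⟨φ, hφ, rfl⟩

theorem sub_mem_J1 {U W : LΩ E3 q × LΩ Mat3 q} (hU : U ∈ J1 q) (hW : W ∈ J1 q) : U - W ∈ J1 q := by
  rw [J1_eq] at *; exact Submodule.sub_mem _ hU hW

theorem exists_test_seq {U : LΩ E3 q × LΩ Mat3 q} (hU : U ∈ J1 q) :
    ∃ φ : ℕ → E3 → E3, (∀ n, IsSolenoidalTest (φ n)) ∧ Tendsto (fun n => pairL q (φ n)) atTop (𝓝 U) := by
  rw [J1_eq] at hU
  obtain ⟨x, hx, hlim⟩ := mem_closure_iff_seq_limit.1 (show U ∈ closure (testSub q : Set _) from hU)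
  choose φ hφ hφx using hx
  exact ⟨φ, hφ, by simpa only [← hφx] using hlim⟩

theorem J1_induction {P : LΩ E3 q × LΩ Mat3 q → Prop} (hP : IsClosed {U | P U})
    (h : ∀ φ, IsSolenoidalTest φ → P (pairL q φ)) {U : LΩ E3 q × LΩ Mat3 q} (hU : U ∈ J1 q) : P U := by
  obtain ⟨φ, hφ, hlim⟩ := exists_test_seq hU
  exact hP.mem_of_tendsto hlim (Eventually.of_forall fun n => h _ (hφ n))

/-- Trigonometric polynomials are dense. -/
theorem J1_subset_closure (hq : q ≤ 2) : J1 q ⊆ closure {U | ∃ n, ∃ φ ∈ X n, U = pairL q φ} := by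
  rw [J1_eq]
  refine closure_minimal ?_ isClosed_closure
  rintro _ ⟨φ, hφ, rfl⟩
  have hsp := hφ.sp
  choose ψ hψ ho h1 h2 h3 using fun n : ℕ => exists_projection_nm (n := n + 1) (by omega) hφ
  refine mem_closure_of_tendsto (b := atTop) (f := fun n => pairL q (ψ n)) ?_ (Eventually.of_forall fun n => ⟨_, ψ n, hψ n, rfl⟩)
  have hinv : ∀ c : ℝ, Tendsto (fun n : ℕ => (((n + 1 : ℕ) : ℝ))⁻¹ * c) atTop (𝓝 0) := fun c => by
    have := (tendsto_inv_atTop_nhds_zero_nat (𝕜 := ℝ)).comp (tendsto_add_atTop_nat 1)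
    simpa using this.mul_const c
  refine Tendsto.prodMk_nhds ?_ ?_
  · rw [tendsto_iff_norm_sub_tendsto_zero]
    refine squeeze_zero (fun _ => norm_nonneg _) (fun n => ?_) (hinv (nm 2 (grad φ)))
    rw [norm_sub_rev, norm_toL_sub (hsp.memLp q) ((hψ n).1.sp.memLp q)]
    exact (nm_exponent_le hq ((hsp.sub (hψ n).1.sp).memLp 2)).trans (h1 n)
  · rw [tendsto_iff_norm_sub_tendsto_zero]
    refine squeeze_zero (fun _ => norm_nonneg _) (fun n => ?_) (hinv (3 * nm 2 (tgrad (sg φ))))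
    rw [norm_sub_rev, norm_toL_sub (hsp.grad.memLp q) ((hψ n).1.sp.grad.memLp q)]
    exact (nm_exponent_le hq ((hsp.grad.sub (hψ n).1.sp.grad).memLp 2)).trans (h3 n)

/-- Sobolev's inequality in `J^{1,q}`. -/
theorem exists_sobolev_J1 (s r : NNReal) (hs : 1 ≤ s) (hr : (r : ℝ)⁻¹ = (s : ℝ)⁻¹ - 3⁻¹) (hsq : (s : ℝ≥0∞) ≤ q) :
    ∃ C : ℝ, 1 ≤ C ∧ ∀ U ∈ J1 q, MemLp U.1 r volΩ ∧ nm r U.1 ≤ C * ‖U.2‖ := by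
  obtain ⟨C, hC1, hC⟩ := exists_sobolev_nm E3 s r hs hr hsq
  refine ⟨C, hC1, fun U hU => ?_⟩
  obtain ⟨φ, hφ, hlim⟩ := exists_test_seq hU
  have l1 : Tendsto (fun n => toL q (φ n)) atTop (𝓝 U.1) := (continuous_fst.tendsto U).comp hlim
  have l2 : Tendsto (fun n => ‖toL q (grad (φ n))‖) atTop (𝓝 ‖U.2‖) := ((continuous_snd.tendsto U).comp hlim).norm
  obtain ⟨ns, hns, hae⟩ := (tendstoInMeasure_of_tendsto_Lp l1).exists_seq_tendsto_ae
  have hb : ∀ n, eLpNorm (φ n) r volΩ ≤ ENNReal.ofReal (C * ‖toL q (grad (φ n))‖) := by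
    intro n
    rw [← ENNReal.ofReal_toReal ((hφ n).sp.memLp r).2.ne]
    refine ENNReal.ofReal_le_ofReal ((hC _ (hφ n).sp (hφ n).mean_zero).trans ?_)
    rw [norm_toL ((hφ n).sp.grad.memLp q)]
    refine mul_le_mul_of_nonneg_left ?_ (by linarith)
    exact nm_mono ((hφ n).sp.grad.memLp q) (ae_of_all _ fun x => norm_fderiv_le_grad (hφ n).sp x)
  have hae' : ∀ᵐ x ∂volΩ, Tendsto (fun i => φ (ns i) x) atTop (𝓝 (U.1 x)) := by
    have h1 : ∀ᵐ x ∂volΩ, ∀ n, toL q (φ n) x = φ n x := ae_all_iff.2 fun n => coeFn_toL ((hφ n).sp.memLp q)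
    filter_upwards [hae, h1] with x hx h1
    simpa only [h1] using hx
  have h5 := Lp.eLpNorm_lim_le_liminf_eLpNorm (p := (r : ℝ≥0∞)) (f := fun i => φ (ns i))
    (fun i => (hφ _).sp.continuous.aestronglyMeasurable) U.1 hae'
  have h6 : Tendsto (fun i => ENNReal.ofReal (C * ‖toL q (grad (φ (ns i)))‖)) atTop (𝓝 (ENNReal.ofReal (C * ‖U.2‖))) :=
    ENNReal.tendsto_ofReal ((l2.comp hns.tendsto_atTop).const_mul C)
  have h7 : eLpNorm U.1 r volΩ ≤ ENNReal.ofReal (C * ‖U.2‖) := by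
    refine h5.trans ((liminf_le_liminf (Eventually.of_forall fun i => hb (ns i))).trans ?_)
    rw [h6.liminf_eq]
  refine ⟨⟨(Lp.memLp U.1).1, h7.trans_lt ENNReal.ofReal_lt_top⟩, ?_⟩
  exact ENNReal.toReal_le_of_le_ofReal (mul_nonneg (by linarith) (norm_nonneg _)) h7

end SobolevSpace

/-- A closed condition that holds almost surely at each point of a set holds almost surely on its closure. -/
theorem ae_forall_mem_closure {Ω E : Type} [MeasurableSpace Ω] {μ : Measure Ω} [PseudoMetricSpace E]
    [SecondCountableTopology E] {S : Set E} {P : Ω → E → Prop} (hcl : ∀ᵐ τ ∂μ, IsClosed {x | P τ x})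
    (h : ∀ x ∈ S, ∀ᵐ τ ∂μ, P τ x) : ∀ᵐ τ ∂μ, ∀ x ∈ closure S, P τ x := by
  obtain ⟨t, htS, htc, hSt⟩ := (TopologicalSpace.IsSeparable.of_separableSpace S).exists_countable_dense_subset
  have h1 : ∀ᵐ τ ∂μ, ∀ x ∈ t, P τ x := (ae_ball_iff htc).2 fun x hx => h x (htS hx)
  filter_upwards [hcl, h1] with τ h2 h3 x hx
  exact closure_minimal (s := t) h3 h2 (closure_minimal hSt isClosed_closure hx)

section Shift

variable {F : Type} [NormedAddCommGroup F] {q : ℝ≥0∞}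

theorem shift_shift (y z x : E3) : shift y (shift z x) = shift (z + y) x := by
  ext i
  simp only [shift, fractPt, PiLp.add_apply]
  rw [Int.fract_eq_fract]
  refine ⟨-⌊x i + z i⌋, ?_⟩
  have := Int.floor_add_fract (x i + z i)
  push_cast
  linarith

/-- The difference of a field and its translate on the torus. -/
def dq (y : E3) (g : E3 → F) (x : E3) : F := g (shift y x) - g x

theorem IsPeriodic.dq_eq {g : E3 → F} (hg : IsPeriodic g) (y : E3) : dq y g = fun x => g (x + y) - g x :=
  funext fun x => by rw [dq, hg.shift]

theorem memLp_comp_shift {g : E3 → F} (hg : MemLp g q volΩ) (y : E3) : MemLp (fun x => g (shift y x)) q volΩ :=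
  hg.comp_measurePreserving (measurePreserving_shift y)

theorem nm_comp_shift {g : E3 → F} (hg : AEStronglyMeasurable g volΩ) (y : E3) :
    nm q (fun x => g (shift y x)) = nm q g := by
  rw [nm, nm]
  exact congrArg _ (eLpNorm_comp_measurePreserving hg (measurePreserving_shift y))

theorem memLp_dq {g : E3 → F} (hg : MemLp g q volΩ) (y : E3) : MemLp (dq y g) q volΩ :=
  (memLp_comp_shift hg y).sub hg

theorem nm_dq_le_two_mul (hq : 1 ≤ q) {g : E3 → F} (hg : MemLp g q volΩ) (y : E3) : nm q (dq y g) ≤ 2 * nm q g := by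
  refine (nm_sub_le hq (memLp_comp_shift hg y) hg).trans ?_
  rw [nm_comp_shift hg.1]; linarith

theorem dq_congr {g g' : E3 → F} (h : g =ᵐ[volΩ] g') (y : E3) : dq y g =ᵐ[volΩ] dq y g' := by
  have h1 : ∀ᵐ x ∂volΩ, g (shift y x) = g' (shift y x) := (measurePreserving_shift y).quasiMeasurePreserving.ae h
  filter_upwards [h, h1] with x hx hx1
  rw [dq, dq, hx, hx1]

theorem nm_dq_double (hq : 1 ≤ q) {g : E3 → F} (hg : MemLp g q volΩ) (y : E3) :
    nm q (dq ((2 : ℝ) • y) g) ≤ 2 * nm q (dq y g) := by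
  have h1 : dq ((2 : ℝ) • y) g = fun x => dq y g (shift y x) + dq y g x := by
    funext x
    rw [dq, dq, dq, shift_shift, two_smul]
    abel
  rw [h1]
  refine (nm_add_le hq (memLp_comp_shift (memLp_dq hg y) y) (memLp_dq hg y)).trans ?_
  rw [nm_comp_shift (memLp_dq hg y).1]; linarith

theorem abs_nm_sub_le (hq : 1 ≤ q) {f g : E3 → F} (hf : MemLp f q volΩ) (hg : MemLp g q volΩ) :
    |nm q f - nm q g| ≤ nm q fun x => f x - g x := by
  have h1 : nm q f ≤ nm q g + nm q fun x => f x - g x := by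
    have := nm_add_le hq hg (hf.sub hg)
    simp only [Pi.sub_apply, add_sub_cancel] at this
    exact this
  have h2 : nm q g ≤ nm q f + nm q fun x => f x - g x := by
    have := nm_sub_le hq hf (hf.sub hg)
    simp only [Pi.sub_apply, sub_sub_cancel] at this
    exact this
  rw [abs_le]; constructor <;> linarith

theorem abs_nm_dq_sub_le (hq : 1 ≤ q) {f g : E3 → F} (hf : MemLp f q volΩ) (hg : MemLp g q volΩ) (y : E3) :
    |nm q (dq y f) - nm q (dq y g)| ≤ 2 * nm q fun x => f x - g x := by
  refine (abs_nm_sub_le hq (memLp_dq hf y) (memLp_dq hg y)).trans ?_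
  refine le_trans (le_of_eq ?_) (nm_dq_le_two_mul hq (hf.sub hg) y)
  congr 1; funext x; simp only [dq, Pi.sub_apply]; abel

theorem nm_dq_le_fderiv [NormedSpace ℝ F] [CompleteSpace F] (hq : 1 ≤ q) (hq' : q ≠ ⊤) {g : E3 → F} (hg : SP g) (y : E3) :
    nm q (dq y g) ≤ ‖y‖ * nm q (fderiv ℝ g) := by
  rw [hg.2.dq_eq]
  have h1 : nm q (fun x => g (x + y) - g x) ≤ nm q fun x => fderiv ℝ g x y :=
    ENNReal.toReal_mono ((hg.fderiv_apply y).memLp q).2.ne (eLpNorm_sub_comp_add_le hg y hq hq')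
  refine h1.trans (nm_le_mul (hg.fderiv.memLp q) (norm_nonneg _) (ae_of_all _ fun x => ?_))
  rw [mul_comm]; exact (fderiv ℝ g x).le_opNorm y

end Shift

section Gradient

/-- The `i`-th column of a tensor. -/
def col (i : Fin 3) (A : Mat3) : E3 := WithLp.toLp 2 fun a => A (a, i)

theorem norm_sq_eq_sum_col (A : Mat3) : ‖A‖ ^ 2 = ∑ i, ‖col i A‖ ^ 2 := by
  simp only [EuclideanSpace.norm_sq_eq, Fintype.sum_prod_type, col]
  exact Finset.sum_comm

theorem norm_col_le (i : Fin 3) (A : Mat3) : ‖col i A‖ ≤ ‖A‖ := by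
  refine (sq_le_sq₀ (norm_nonneg _) (norm_nonneg _)).1 ?_
  rw [norm_sq_eq_sum_col A]
  exact Finset.single_le_sum (f := fun i => ‖col i A‖ ^ 2) (fun _ _ => sq_nonneg _) (Finset.mem_univ i)

theorem col_sub (i : Fin 3) (A B : Mat3) : col i (A - B) = col i A - col i B := rfl

theorem continuous_col (i : Fin 3) : Continuous (col i) :=
  (PiLp.continuous_toLp 2 _).comp (continuous_pi fun a => by fun_prop)

theorem col_grad {φ : E3 → E3} (hφ : SP φ) (i : Fin 3) (x : E3) : col i (grad φ x) = dd i φ x := by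
  ext a; rw [col]; exact grad_apply hφ x a i

theorem memLp_col {q : ℝ≥0∞} (i : Fin 3) {A : E3 → Mat3} (hA : MemLp A q volΩ) : MemLp (fun x => col i (A x)) q volΩ :=
  hA.mono ((continuous_col i).comp_aestronglyMeasurable hA.1) (ae_of_all _ fun _ => norm_col_le i _)

theorem sum_nm_col_sq {A : E3 → Mat3} (hA : MemLp A 2 volΩ) : ∑ i, nm 2 (fun x => col i (A x)) ^ 2 = nm 2 A ^ 2 := by
  rw [nm_two_sq hA]
  simp_rw [fun i => nm_two_sq (memLp_col i hA), norm_sq_eq_sum_col]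
  rw [integral_finsetSum]
  intro i _
  exact (memLp_col i hA).integrable_norm_pow (by norm_num)

/-- The dyadic steps in a coordinate direction. -/
def step (i : Fin 3) (k : ℕ) : E3 := ((1 / 2 : ℝ) ^ k) • EuclideanSpace.single i 1

theorem norm_step (i : Fin 3) (k : ℕ) : ‖step i k‖ = (1 / 2) ^ k := by
  rw [step, norm_smul, PiLp.norm_single, norm_one, mul_one, Real.norm_of_nonneg (by positivity)]

theorem step_eq_two_smul (i : Fin 3) (k : ℕ) : step i k = (2 : ℝ) • step i (k + 1) := by
  rw [step, step, smul_smul, pow_succ]; congr 1; ring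

theorem tendsto_nm_dq_test {φ : E3 → E3} (hφ : SP φ) (i : Fin 3) :
    Tendsto (fun k => nm 2 (dq (step i k) φ) / (1 / 2) ^ k) atTop (𝓝 (nm 2 (dd i φ))) := by
  have h0 : Tendsto (fun k : ℕ => (1 / 2 : ℝ) ^ k) atTop (𝓝[≠] 0) := by
    refine tendsto_nhdsWithin_iff.2 ⟨tendsto_pow_atTop_nhds_zero_of_lt_one (by norm_num) (by norm_num), ?_⟩
    exact Eventually.of_forall fun k => by simp
  let g : ℕ → E3 → E3 := fun k x => ((1 / 2 : ℝ) ^ k)⁻¹ • dq (step i k) φ x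
  have hg : ∀ k, nm 2 (g k) = nm 2 (dq (step i k) φ) / (1 / 2) ^ k := by
    intro k
    have := eLpNorm_const_smul (((1 / 2 : ℝ) ^ k)⁻¹) (dq (step i k) φ) 2 volΩ
    have e : nm 2 (g k) = (eLpNorm (((1 / 2 : ℝ) ^ k)⁻¹ • dq (step i k) φ) 2 volΩ).toReal := rfl
    rw [e, this, ENNReal.toReal_mul, toReal_enorm, Real.norm_of_nonneg (by positivity), nm]
    field_simp
  have hmem : ∀ k, MemLp (g k) 2 volΩ := fun k => (memLp_dq (hφ.memLp 2) (step i k)).const_smul (((1 / 2 : ℝ) ^ k)⁻¹)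
  have hpt : ∀ x, Tendsto (fun k => g k x) atTop (𝓝 (dd i φ x)) := by
    intro x
    have hd : HasDerivAt (fun s : ℝ => φ (x + s • EuclideanSpace.single i 1)) (dd i φ x) 0 := by
      have h1 : HasDerivAt (fun s : ℝ => x + s • EuclideanSpace.single i (1 : ℝ)) (EuclideanSpace.single i 1) 0 := by
        simpa using ((hasDerivAt_id (0 : ℝ)).smul_const (EuclideanSpace.single i (1 : ℝ))).const_add x
      have h2 : HasFDerivAt φ (fderiv ℝ φ x) (x + (0 : ℝ) • EuclideanSpace.single i (1 : ℝ)) := by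
        rw [zero_smul, add_zero]; exact (hφ.differentiable x).hasFDerivAt
      exact h2.comp_hasDerivAt (0 : ℝ) h1
    have h3 := hd.tendsto_slope.comp h0
    refine h3.congr fun k => ?_
    simp only [g, Function.comp, slope, vsub_eq_sub, sub_zero, zero_smul, add_zero]
    rw [hφ.2.dq_eq]; rfl
  obtain ⟨M, hM⟩ : ∃ M : ℝ, ∀ x ∈ cube, ∀ k, ‖g k x‖ ≤ M := by
    obtain ⟨M, hM⟩ := (isCompact_closedBall (0 : E3) 3).exists_bound_of_continuousOn hφ.fderiv.continuous.continuousOn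
    refine ⟨M, fun x hx k => ?_⟩
    have hpos : (0 : ℝ) < (1 / 2) ^ k := by positivity
    have hx3 : x ∈ Metric.closedBall (0 : E3) 3 :=
      Metric.closedBall_subset_closedBall (by norm_num) (cube_subset_closedBall hx)
    have hx3' : x + step i k ∈ Metric.closedBall (0 : E3) 3 := by
      have h1 := cube_subset_closedBall hx
      rw [mem_closedBall_zero_iff] at *
      refine (norm_add_le _ _).trans ?_
      rw [norm_step]
      have : (1 / 2 : ℝ) ^ k ≤ 1 := pow_le_one₀ (by norm_num) (by norm_num)
      linarith
    have := (convex_closedBall (0 : E3) 3).norm_image_sub_le_of_norm_fderiv_le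
      (fun z _ => hφ.differentiable z) hM hx3 hx3'
    rw [add_sub_cancel_left, norm_step] at this
    simp only [g]
    rw [norm_smul, norm_inv, Real.norm_of_nonneg hpos.le, hφ.2.dq_eq, inv_mul_le_iff₀ hpos, mul_comm]
    exact this
  have hsq : Tendsto (fun k => nm 2 (g k) ^ 2) atTop (𝓝 (nm 2 (dd i φ) ^ 2)) := by
    simp_rw [fun k => nm_two_sq (hmem k)]
    rw [nm_two_sq ((hφ.dd i).memLp 2)]
    refine tendsto_integral_of_dominated_convergence (fun _ => M ^ 2) (fun k => ?_) (integrable_const _) (fun k => ?_) ?_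
    · exact ((hmem k).integrable_norm_pow (by norm_num)).1
    · filter_upwards [ae_restrict_mem measurableSet_cube] with x hx
      rw [Real.norm_of_nonneg (by positivity)]
      exact pow_le_pow_left₀ (norm_nonneg _) (hM x hx k) 2
    · exact ae_of_all _ fun x => ((hpt x).norm).pow 2
  have := (Real.continuous_sqrt.tendsto _).comp hsq
  rw [Real.sqrt_sq (nm_nonneg _ _)] at this
  refine this.congr fun k => ?_
  simp only [Function.comp]
  rw [Real.sqrt_sq (nm_nonneg _ _), hg]

variable {U : LΩ E3 2 × LΩ Mat3 2}

theorem nm_dq_fst_le (hU : U ∈ J1 2) (y : E3) : nm 2 (dq y U.1) ≤ ‖y‖ * ‖U.2‖ := by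
  refine J1_induction (P := fun U => nm 2 (dq y U.1) ≤ ‖y‖ * ‖U.2‖) ?_ (fun φ hφ => ?_) hU
  · refine isClosed_le ?_ (by fun_prop)
    have h1 : Continuous fun u : LΩ E3 2 => nm 2 (dq y u) := continuous_of_norm_sub_le (c := 2) one_pos fun w u => by
        rw [Real.rpow_one, norm_sub_eq_nm]
        exact abs_nm_dq_sub_le (by norm_num) (Lp.memLp w) (Lp.memLp u) y
    exact h1.comp continuous_fst
  · have e1 : nm 2 (dq y (pairL 2 φ).1) = nm 2 (dq y φ) := nm_congr (dq_congr (coeFn_toL (hφ.sp.memLp 2)) y)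
    have e2 : ‖(pairL 2 φ).2‖ = nm 2 (grad φ) := norm_toL (hφ.sp.grad.memLp 2)
    rw [e1, e2]
    refine (nm_dq_le_fderiv (by norm_num) (by norm_num) hφ.sp y).trans (mul_le_mul_of_nonneg_left ?_ (norm_nonneg _))
    exact nm_mono (hφ.sp.grad.memLp 2) (ae_of_all _ fun x => norm_fderiv_le_grad hφ.sp x)

/-- Difference quotients converge to the columns of the gradient. -/
theorem tendsto_nm_dq_J1 (hU : U ∈ J1 2) (i : Fin 3) :
    Tendsto (fun k => nm 2 (dq (step i k) U.1) / (1 / 2) ^ k) atTop (𝓝 (nm 2 fun x => col i (U.2 x))) := by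
  rw [Metric.tendsto_atTop]
  intro ε hε
  obtain ⟨φ, hφ, hlim⟩ := exists_test_seq hU
  obtain ⟨n, hn⟩ := (Metric.tendsto_atTop.1 hlim) (ε / 4) (by linarith)
  have hn := hn n le_rfl
  have hs := (hφ n).sp
  have hd : U - pairL 2 (φ n) ∈ J1 2 := sub_mem_J1 hU (pairL_mem_J1 (hφ n))
  have h2 : ‖U.2 - toL 2 (grad (φ n))‖ < ε / 4 := by
    rw [dist_comm, dist_eq_norm] at hn
    exact (norm_snd_le (U - pairL 2 (φ n))).trans_lt hn
  obtain ⟨k₀, hk₀⟩ := (Metric.tendsto_atTop.1 (tendsto_nm_dq_test hs i)) (ε / 4) (by linarith)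
  refine ⟨k₀, fun k hk => ?_⟩
  have h3 := hk₀ k hk
  have hpos : (0 : ℝ) < (1 / 2) ^ k := by positivity
  have h4 : |nm 2 (dq (step i k) U.1) / (1 / 2) ^ k - nm 2 (dq (step i k) (φ n)) / (1 / 2) ^ k| ≤ ε / 4 := by
    rw [← sub_div, abs_div, abs_of_pos hpos, div_le_iff₀ hpos]
    refine (abs_nm_sub_le (by norm_num) (memLp_dq (Lp.memLp U.1) _) (memLp_dq (hs.memLp 2) _)).trans ?_
    have e : nm 2 (fun x => dq (step i k) U.1 x - dq (step i k) (φ n) x) = nm 2 (dq (step i k) (U - pairL 2 (φ n)).1) := by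
      refine nm_congr (EventuallyEq.trans (ae_of_all _ fun x => ?_) (dq_congr (g := fun x => U.1 x - φ n x) ?_ _))
      · simp only [dq]; abel
      · filter_upwards [Lp.coeFn_sub U.1 (toL 2 (φ n)), coeFn_toL (hs.memLp 2)] with x h1 h2
        rw [← h2]; exact h1.symm
    rw [e]
    refine (nm_dq_fst_le hd _).trans ?_
    rw [norm_step, mul_comm]
    exact mul_le_mul_of_nonneg_right h2.le hpos.le
  have h5 : |nm 2 (dd i (φ n)) - nm 2 (fun x => col i (U.2 x))| ≤ ε / 4 := by
    rw [abs_sub_comm]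
    refine (abs_nm_sub_le (by norm_num) (memLp_col i (Lp.memLp U.2)) ((hs.dd i).memLp 2)).trans (le_trans ?_ h2.le)
    rw [norm_sub_toL _ (hs.grad.memLp 2)]
    refine nm_mono ((Lp.memLp U.2).sub (hs.grad.memLp 2)) (ae_of_all _ fun x => ?_)
    rw [← col_grad hs, ← col_sub]
    exact norm_col_le _ _
  rw [Real.dist_eq] at h3 ⊢
  rw [abs_lt] at h3 ⊢
  rw [abs_le] at h4 h5
  constructor <;> linarith [h4.1, h4.2, h5.1, h5.2, h3.1, h3.2]

theorem inner_grad_of_mem_J1 (hU : U ∈ J1 2) {φ : E3 → E3} (hφ : SP φ) :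
    (inner ℝ U.2 (toL 2 (grad φ)) : ℝ) = -inner ℝ U.1 (toL 2 (lap φ)) := by
  refine J1_induction (P := fun U => (inner ℝ U.2 (toL 2 (grad φ)) : ℝ) = -inner ℝ U.1 (toL 2 (lap φ))) ?_
    (fun ψ hψ => ?_) hU
  · exact isClosed_eq (by fun_prop) (by fun_prop)
  · simp only [pairL]
    rw [inner_toL (hψ.sp.grad.memLp 2) (hφ.grad.memLp 2), inner_toL (hψ.sp.memLp 2) (hφ.lap.memLp 2),
      ← integral_inner_grad hφ hψ.sp]
    exact integral_congr_ae (ae_of_all _ fun x => real_inner_comm _ _)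

end Gradient

section Stress

theorem memLp_norm_rpow {F : Type} [NormedAddCommGroup F] {q r : ℝ≥0∞} {α : ℝ} (hα : 0 < α)
    (hr : q * ENNReal.ofReal α = r) {g : E3 → F} (hg : MemLp g r volΩ) :
    MemLp (fun x => ‖g x‖ ^ α) q volΩ ∧ nm q (fun x => ‖g x‖ ^ α) = nm r g ^ α := by
  have h1 := eLpNorm_norm_rpow (p := q) (μ := volΩ) g hα
  rw [hr] at h1
  refine ⟨⟨(hg.1.norm.aemeasurable.pow_const α).aestronglyMeasurable, ?_⟩, ?_⟩
  · rw [h1]; exact ENNReal.rpow_lt_top_of_nonneg hα.le hg.2.ne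
  · rw [nm, h1, ← ENNReal.toReal_rpow]; rfl

theorem nm_rpow_le {F : Type} [NormedAddCommGroup F] {q : ℝ≥0∞} {α : ℝ} (hα0 : 0 < α) (hα1 : α ≤ 1) {g : E3 → F}
    (hg : MemLp g q volΩ) : MemLp (fun x => ‖g x‖ ^ α) q volΩ ∧ nm q (fun x => ‖g x‖ ^ α) ≤ nm q g ^ α := by
  have hle : q * ENNReal.ofReal α ≤ q := mul_le_of_le_one_right' (ENNReal.ofReal_le_one.2 hα1)
  obtain ⟨h1, h2⟩ := memLp_norm_rpow hα0 rfl (memLp_of_le hle hg)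
  exact ⟨h1, h2.trans_le (Real.rpow_le_rpow (nm_nonneg _ _) (nm_exponent_le hle hg) hα0.le)⟩

theorem continuous_St {r : ℝ} (hr1 : 1 < r) (hr2 : r ≤ 2) : Continuous (St r : Mat3 → Mat3) :=
  continuous_of_norm_sub_le (sub_pos.2 hr1) (norm_St_sub_le hr1 hr2)

theorem memLp_St {r : ℝ} (hr1 : 1 < r) (hr2 : r ≤ 2) {q : ℝ≥0∞} {A : E3 → Mat3} (hA : MemLp A q volΩ) :
    MemLp (fun x => St r (A x)) q volΩ := by
  refine (nm_rpow_le (by linarith : 0 < r - 1) (by linarith) hA).1.mono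
    ((continuous_St hr1 hr2).comp_aestronglyMeasurable hA.1) (ae_of_all _ fun x => ?_)
  rw [norm_St hr1, Real.norm_of_nonneg (by positivity)]

theorem nm_Sm_sub_St_le {μ r : ℝ} (hμ : 0 < μ) (hr1 : 1 < r) (hr2 : r ≤ 2) {A B : E3 → Mat3} (hA : MemLp A 2 volΩ)
    (hB : MemLp B 2 volΩ) : nm 2 (fun x => Sm μ r (A x) - St r (B x)) ≤
      μ ^ ((r - 1) / 2) + 3 * nm 2 (fun x => A x - B x) ^ (r - 1) := by
  obtain ⟨h1, h2⟩ := nm_rpow_le (by linarith : 0 < r - 1) (by linarith) (hA.sub hB)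
  have h3 : MemLp (fun _ : E3 => μ ^ ((r - 1) / 2)) 2 volΩ := memLp_const _
  have h4 : MemLp (fun x => 3 * ‖(A - B) x‖ ^ (r - 1)) 2 volΩ := h1.const_mul 3
  calc _ ≤ nm 2 (fun x => μ ^ ((r - 1) / 2) + 3 * ‖(A - B) x‖ ^ (r - 1)) := by
        refine nm_mono (h3.add h4) (ae_of_all _ fun x => ?_)
        rw [Real.norm_of_nonneg (by positivity)]
        calc ‖Sm μ r (A x) - St r (B x)‖ ≤ ‖Sm μ r (A x) - St r (A x)‖ + ‖St r (A x) - St r (B x)‖ :=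
              norm_sub_le_norm_sub_add_norm_sub _ _ _
          _ ≤ _ := add_le_add (norm_Sm_sub_St_le hμ hr1 hr2 _) (norm_St_sub_le hr1 hr2 _ _)
    _ ≤ nm 2 (fun _ : E3 => μ ^ ((r - 1) / 2)) + nm 2 (fun x => 3 * ‖(A - B) x‖ ^ (r - 1)) :=
        nm_add_le (by norm_num) h3 h4
    _ ≤ μ ^ ((r - 1) / 2) + 3 * nm 2 (fun x => ‖(A - B) x‖ ^ (r - 1)) := by
        refine add_le_add (le_of_eq ?_) (nm_le_mul h1 (by norm_num) (ae_of_all _ fun x => ?_))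
        · rw [nm_const 2 (by norm_num), Real.norm_of_nonneg (by positivity)]
        · rw [norm_mul]; norm_num
    _ ≤ _ := by gcongr; exact h2

end Stress

namespace ApproxSeq

variable {p : Ico (5 / 3 : ℝ) 2} {C C₀ Λ K κ : ℝ}

/-- The limit of a sequence of Galerkin approximations. -/
structure IsLimit (a : ApproxSeq p Λ K) (v : ℝ → LΩ E3 2 × LΩ Mat3 2) : Prop where
  mem : ∀ t, 0 ≤ t → v t ∈ J1 2
  bound : ∀ t, 0 ≤ t → ‖(v t).2‖ ^ 2 ≤ Λ
  unif : ∀ T, 0 ≤ T → TendstoUniformlyOn (fun (j : ℕ) t => toL 2 ((a.γ j).v t)) (fun t => (v t).1) atTop (Icc 0 T)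
  ae_grad : ∀ T, 0 ≤ T → ∀ᵐ t ∂vol[T], Tendsto (fun j => toL 2 (PNavierStokes.grad ((a.γ j).v t))) atTop (𝓝 (v t).2)

variable (a : ApproxSeq p Λ K)

theorem norm_grad_le {j : ℕ} {t : ℝ} (ht : t ∈ Icc 0 (j : ℝ)) : ‖toL 2 (grad ((a.γ j).v t))‖ ≤ √Λ := by
  rw [norm_toL (((a.γ j).sp t).grad.memLp 2)]
  exact Real.le_sqrt_of_sq_le ((a.gal j).bound t ht)

theorem ae_tendsto_grad (hS : SobolevConst p C) (h : SmallData p C Λ K κ) (hKo : KornConst p C C₀)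
    {T : ℝ} (hT : 0 ≤ T) : ∀ᵐ t ∂vol[T], ∃ G, Tendsto (fun j => toL 2 (grad ((a.γ j).v t))) atTop (𝓝 G) := by
  obtain ⟨A, hA, hAj⟩ := a.exists_cauchy_bound hS h hKo hT
  obtain ⟨j₀, hj₀⟩ := exists_nat_ge T
  let S : ℕ → ℝ → ℝ := fun j t => nm 2 (grad (a.w (j + j₀) t))
  have hSc : ∀ j, Continuous (S j) := fun j => continuous_nm (a.continuous_grad_w _)
  have h1 : ∀ j, ∫⁻ t in Ioo 0 T, ENNReal.ofReal (S j t) ≤ ENNReal.ofReal (A * (1 / 2) ^ j) := by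
    intro j
    have h2 := (hAj (j + j₀) (by push_cast; linarith [(Nat.cast_nonneg j : (0 : ℝ) ≤ j)])).2
    rw [intervalIntegral.integral_of_le hT, integral_Ioc_eq_integral_Ioo] at h2
    rw [← ofReal_integral_eq_lintegral_ofReal (((hSc j).integrableOn_Icc (a := 0) (b := T)).mono_set Ioo_subset_Icc_self)
      (ae_of_all _ fun t => nm_nonneg _ _)]
    refine ENNReal.ofReal_le_ofReal (h2.trans (mul_le_mul_of_nonneg_left ?_ hA))
    exact pow_le_pow_of_le_one (by norm_num) (by norm_num) (by omega)
  have h2 : ∫⁻ t in Ioo 0 T, ∑' j, ENNReal.ofReal (S j t) ≠ ⊤ := by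
    rw [lintegral_tsum fun j => ((hSc j).measurable.ennreal_ofReal).aemeasurable]
    have hs : Summable fun j : ℕ => A * (1 / 2 : ℝ) ^ j := (summable_geometric_of_lt_one (by norm_num) (by norm_num)).mul_left A
    refine ((ENNReal.tsum_le_tsum h1).trans_lt ?_).ne
    rw [← ENNReal.ofReal_tsum_of_nonneg (fun j => by positivity) hs]
    exact ENNReal.ofReal_lt_top
  have h3 := ae_lt_top' (AEMeasurable.tsum fun j => ((hSc j).measurable.ennreal_ofReal).aemeasurable) h2
  filter_upwards [h3] with t ht
  have h4 : Summable fun j => S j t := by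
    have := ENNReal.summable_toReal ht.ne
    simpa only [ENNReal.toReal_ofReal (nm_nonneg _ _), S] using this
  have h5 : CauchySeq fun j => toL 2 (grad ((a.γ (j + j₀)).v t)) := by
    refine cauchySeq_of_summable_dist (h4.congr fun j => ?_)
    rw [dist_comm, dist_eq_norm, norm_toL_sub (((a.γ _).sp t).grad.memLp 2) (((a.γ _).sp t).grad.memLp 2)]
    simp only [S]
    rw [grad_w, show j + 1 + j₀ = j + j₀ + 1 by ring]
  obtain ⟨G, hG⟩ := cauchySeq_tendsto_of_complete h5
  exact ⟨G, (tendsto_add_atTop_iff_nat j₀).1 hG⟩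

theorem exists_limit (hS : SobolevConst p C) (h : SmallData p C Λ K κ) (hKo : KornConst p C C₀) : ∃ v, a.IsLimit v := by
  have hΛ := h.pos
  have hdist : ∀ T, 0 ≤ T → ∃ A, 0 ≤ A ∧ ∃ j₀ : ℕ, ∀ t ∈ Icc 0 T, ∀ j,
      dist (toL 2 ((a.γ (j + j₀)).v t)) (toL 2 ((a.γ (j + 1 + j₀)).v t)) ≤ A * (1 / 4) ^ j := by
    intro T hT
    obtain ⟨A, hA, hAj⟩ := a.exists_cauchy_bound hS h hKo hT
    obtain ⟨j₀, hj₀⟩ := exists_nat_ge T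
    refine ⟨A, hA, j₀, fun t ht j => ?_⟩
    have h2 := (hAj (j + j₀) (by push_cast; linarith [(Nat.cast_nonneg j : (0 : ℝ) ≤ j)])).1 t ht
    rw [dist_comm, dist_eq_norm, norm_toL_sub (((a.γ _).sp t).memLp 2) (((a.γ _).sp t).memLp 2),
      show j + 1 + j₀ = j + j₀ + 1 by ring]
    refine h2.trans (mul_le_mul_of_nonneg_left ?_ hA)
    exact pow_le_pow_of_le_one (by norm_num) (by norm_num) (by omega)
  have hlim : ∀ t, 0 ≤ t → ∃ u, Tendsto (fun j => toL 2 ((a.γ j).v t)) atTop (𝓝 u) := by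
    intro t ht
    obtain ⟨A, hA, j₀, hd⟩ := hdist t ht
    obtain ⟨u, hu⟩ := cauchySeq_tendsto_of_complete
      (cauchySeq_of_le_geometric (1 / 4) A (by norm_num) (hd t ⟨ht, le_rfl⟩))
    exact ⟨u, (tendsto_add_atTop_iff_nat j₀).1 hu⟩
  have hbd : ∀ t, 0 ≤ t → ∀ᶠ j in atTop, ‖toL 2 (PNavierStokes.grad ((a.γ j).v t))‖ ≤ √Λ := by
    intro t ht
    obtain ⟨j₀, hj₀⟩ := exists_nat_ge t
    filter_upwards [eventually_ge_atTop j₀] with j hj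
    exact a.norm_grad_le ⟨ht, hj₀.trans (by exact_mod_cast hj)⟩
  have hex : ∀ t : ℝ, ∃ U : LΩ E3 2 × LΩ Mat3 2, 0 ≤ t → Tendsto (fun j => toL 2 ((a.γ j).v t)) atTop (𝓝 U.1) ∧
      WeakLim (fun j => toL 2 (PNavierStokes.grad ((a.γ j).v t))) U.2 := by
    intro t
    by_cases ht : 0 ≤ t
    · obtain ⟨u, hu⟩ := hlim t ht
      obtain ⟨G, hG⟩ := exists_weakLim (hbd t ht)
      exact ⟨(u, G), fun _ => ⟨hu, hG⟩⟩
    · exact ⟨0, fun h => absurd h ht⟩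
  choose v hv using hex
  refine ⟨v, fun t ht => ?_, fun t ht => ?_, fun T hT => ?_, fun T hT => ?_⟩
  · have hmem : ∀ j, pairL 2 ((a.γ j).v t) ∈ J1 2 := fun j => pairL_mem_J1 ((a.γ j).test t)
    have := WeakLim.mem_prod (S := J1 2) (u := fun j => toL 2 ((a.γ j).v t)) isClosed_J1 convex_J1 (hv t ht).1
      (hv t ht).2 (Eventually.of_forall hmem)
    exact this
  · have := (hv t ht).2.norm_le (hbd t ht)
    calc ‖(v t).2‖ ^ 2 ≤ √Λ ^ 2 := pow_le_pow_left₀ (norm_nonneg _) this 2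
      _ = Λ := Real.sq_sqrt hΛ.le
  · obtain ⟨A, hA, j₀, hd⟩ := hdist T hT
    rw [Metric.tendstoUniformlyOn_iff]
    intro ε hε
    have h1 : Tendsto (fun j : ℕ => A * (1 / 4 : ℝ) ^ j / (1 - 1 / 4)) atTop (𝓝 (A * 0 / (1 - 1 / 4))) :=
      ((tendsto_pow_atTop_nhds_zero_of_lt_one (by norm_num) (by norm_num)).const_mul A).div_const _
    rw [mul_zero, zero_div] at h1
    obtain ⟨j₁, hj₁⟩ := eventually_atTop.1 (h1.eventually_lt_const hε)
    filter_upwards [eventually_ge_atTop (j₁ + j₀)] with j hj t ht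
    obtain ⟨i, rfl⟩ : ∃ i, j = i + j₀ := ⟨j - j₀, by omega⟩
    rw [dist_comm]
    refine lt_of_le_of_lt (dist_le_of_le_geometric_of_tendsto (1 / 4) A (by norm_num) (hd t ht)
      ((tendsto_add_atTop_iff_nat j₀).2 (hv t ht.1).1) i) (hj₁ i (by omega))
  · filter_upwards [a.ae_tendsto_grad hS h hKo hT, ae_restrict_mem measurableSet_Ioo] with t ⟨G, hG⟩ ht
    rw [(hv t ht.1.le).2.eq_of_tendsto hG]
    exact hG

end ApproxSeq

section SmoothDifferences

variable {F : Type} [NormedAddCommGroup F] [NormedSpace ℝ F]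

theorem SP.dq {g : E3 → F} (hg : SP g) (y : E3) : SP (dq y g) := by
  rw [hg.2.dq_eq]; exact (hg.comp_add y).sub hg

theorem dq_mem_X {n : ℕ} {φ : E3 → E3} (hφ : φ ∈ X n) (y : E3) : dq y φ ∈ X n := by
  rw [hφ.1.periodic.dq_eq]
  exact Submodule.sub_mem _ (comp_add_mem_X hφ y) hφ

theorem grad_dq {φ : E3 → E3} (hφ : SP φ) (y : E3) : grad (dq y φ) = dq y (grad φ) := by
  rw [hφ.2.dq_eq, hφ.grad.2.dq_eq]
  funext x
  rw [grad_sub (hφ.comp_add y) hφ]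
  congr 1
  ext ⟨i, j⟩
  rw [grad_apply (hφ.comp_add y), grad_apply hφ, dd_comp_add]

theorem sg_dq {φ : E3 → E3} (hφ : SP φ) (y : E3) : sg (dq y φ) = dq y (sg φ) := by
  funext x
  rw [sg, grad_dq hφ, dq, dq]
  exact map_sub symL _ _

theorem integral_inner_dq {F : Type} [NormedAddCommGroup F] [InnerProductSpace ℝ F] {f g : E3 → F}
    (hf : SP f) (hg : SP g) (y : E3) :
    ∫ x in cube, (inner ℝ (dq y f x) (g x) : ℝ) = ∫ x in cube, inner ℝ (f x) (dq (-y) g x) := by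
  rw [hf.2.dq_eq, hg.2.dq_eq]
  have h1 := integral_comp_add (((hf.comp_add y).inner hg).2) ((hf.comp_add y).inner hg).continuous.aestronglyMeasurable (-y)
  simp only [neg_add_cancel_right] at h1
  have i1 := (hf.inner (hg.comp_add (-y))).integrable
  have i2 := ((hf.comp_add y).inner hg).integrable
  have i3 := (hf.inner hg).integrable
  simp_rw [inner_sub_left, inner_sub_right]
  rw [integral_sub i2 i3, integral_sub i1 i3, h1]

theorem nm_dq_grad_le {φ : E3 → E3} (hφ : SP φ) (y : E3) {q : ℝ≥0∞} (hq : 1 ≤ q) (hq' : q ≠ ⊤) :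
    nm q (dq y φ) ≤ ‖y‖ * nm q (grad φ) :=
  (nm_dq_le_fderiv hq hq' hφ y).trans (mul_le_mul_of_nonneg_left
    (nm_mono (hφ.grad.memLp q) (ae_of_all _ fun x => norm_fderiv_le_grad hφ x)) (norm_nonneg _))

theorem nm_dq_grad_le_tgrad {φ : E3 → E3} (hφ : SP φ) (y : E3) {q : ℝ≥0∞} (hq : 1 ≤ q) (hq' : q ≠ ⊤) :
    nm q (dq y (grad φ)) ≤ ‖y‖ * (3 * nm q (tgrad (sg φ))) := by
  refine (nm_dq_le_fderiv hq hq' hφ.grad y).trans (mul_le_mul_of_nonneg_left ?_ (norm_nonneg _))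
  refine nm_le_mul (hφ.sg.tgrad.memLp q) (by norm_num) (ae_of_all _ fun x => ?_)
  refine (norm_fderiv_le_tgrad _ x).trans ?_
  rw [tgrad_grad_eq hφ]
  exact norm_hessT_le _

theorem nm_dq_weighted_le {μ r : ℝ} (hμ : 0 < μ) (hr1 : 1 ≤ r) (hr2 : r ≤ 2) {φ : E3 → E3} (hφ : SP φ) (y : E3) :
    nm 2 (dq y fun x => Sm μ ((r + 2) / 2) (sg φ x)) ≤ ‖y‖ * nm 2 (wgrad μ r φ) := by
  have hsp : SP fun x => Sm μ ((r + 2) / 2) (sg φ x) := hφ.sg.comp (contDiff_Sm hμ)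
  refine (nm_dq_le_fderiv (by norm_num) (by norm_num) hsp y).trans (mul_le_mul_of_nonneg_left ?_ (norm_nonneg _))
  refine nm_mono ((hφ.wgrad hμ).memLp 2) (ae_of_all _ fun x => ?_)
  refine ContinuousLinearMap.opNorm_le_bound _ (norm_nonneg _) fun z => ?_
  have h1 : fderiv ℝ (fun x => Sm μ ((r + 2) / 2) (sg φ x)) x z =
      fderiv ℝ (Sm μ ((r + 2) / 2)) (sg φ x) (fderiv ℝ (sg φ) x z) := by
    have := fderiv_comp x (((contDiff_Sm (E := Mat3) (r := (r + 2) / 2) hμ).differentiable (by simp)) (sg φ x))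
      (hφ.sg.differentiable x)
    have e : (fun x => Sm μ ((r + 2) / 2) (sg φ x)) = Sm μ ((r + 2) / 2) ∘ sg φ := rfl
    rw [e, this]; rfl
  rw [h1, wgrad, norm_smul, Real.norm_of_nonneg (wt_nonneg hμ.le _), mul_assoc]
  refine (norm_fderiv_Sm_apply_le hμ (by linarith) (by linarith) _ _).trans ?_
  refine mul_le_mul_of_nonneg_left ?_ (wt_nonneg hμ.le _)
  refine ((fderiv ℝ (sg φ) x).le_opNorm z).trans ?_
  exact mul_le_mul_of_nonneg_right (norm_fderiv_le_tgrad _ x) (norm_nonneg _)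

theorem abs_integral_convect_dq_le {φ : E3 → E3} {n : ℕ} (hφ : φ ∈ X n) (y : E3) :
    |∫ x in cube, inner ℝ (dq y (fun x => convect (φ x) (grad φ x)) x) (dq y φ x)| ≤
      nm 4 (dq y φ) ^ 2 * nm 2 (grad φ) := by
  have hs := hφ.1.sp
  have hy := (comp_add_mem_X hφ y).1
  have hd := hs.dq y
  have h1 : ∀ x, dq y (fun x => convect (φ x) (grad φ x)) x =
      convect (dq y φ x) (grad φ x) + convect (φ (x + y)) (grad (dq y φ) x) := by
    intro x
    rw [grad_dq hs, (hs.convect hs.grad).2.dq_eq, hs.2.dq_eq, hs.grad.2.dq_eq, convect_sub_left, convect_sub_right]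
    beta_reduce
    abel
  simp_rw [h1, inner_add_left]
  have i1 := ((hd.convect hs.grad).inner hd).integrable
  have i2 := ((hy.sp.convect hd.grad).inner hd).integrable
  rw [integral_add i1 i2, integral_convect_self hy hd, add_zero, ← Real.norm_eq_abs]
  refine (norm_integral_le_integral_norm _).trans ((integral_mono i1.norm
    (integrable_mul_mul_norm (hd.memLp 4) (hs.grad.memLp 2) (hd.memLp 4)) fun x => ?_).trans
      ((integral_mul_mul_norm_le (hd.memLp 4) (hs.grad.memLp 2) (hd.memLp 4)).trans (le_of_eq (by ring))))
  refine (norm_inner_le_norm _ _).trans (mul_le_mul_of_nonneg_right (norm_convect_le _ _) (norm_nonneg _))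

end SmoothDifferences

section Galerkin

variable {p : Ico (5 / 3 : ℝ) 2} {C Λ K κ μ T : ℝ} {n : ℕ} {g : ℝ → LΩ E3 (expForce p)} {γ : Curve n T}

/-- The pairing of the differences of stress and strain. -/
def stressDiff (μ p : ℝ) (y : E3) (φ : E3 → E3) : ℝ :=
  ∫ x in cube, inner ℝ (dq y (fun x => Sv μ p (sg φ x)) x) (dq y (sg φ) x)

theorem Curve.continuous_stressDiff (hμ : 0 < μ) (γ : Curve n T) (y : E3) :
    Continuous fun t => stressDiff μ p y (γ.v t) := by
  have hS : ∀ t, SP fun x => Sv μ p (sg (γ.v t) x) := fun t => (γ.sp t).sg.comp (contDiff_Sv hμ)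
  have h1 : Continuous fun t => toL 2 (dq y (sg (γ.v t))) := by
    refine continuous_toL (Φ := fun t => dq y (sg (γ.v t))) (by norm_num) ?_
    simp_rw [fun t => (γ.sp t).sg.2.dq_eq y]
    exact (γ.continuous_sg.comp (by fun_prop : Continuous fun z : ℝ × E3 => (z.1, z.2 + y))).sub γ.continuous_sg
  have h2 : Continuous fun t => toL 2 (dq y fun x => Sv μ p (sg (γ.v t) x)) := by
    refine continuous_toL (Φ := fun t => dq y fun x => Sv μ p (sg (γ.v t) x)) (by norm_num) ?_
    simp_rw [fun t => (hS t).2.dq_eq y]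
    have h3 := (contDiff_Sv (p := p) hμ).continuous.comp γ.continuous_sg
    exact (h3.comp (by fun_prop : Continuous fun z : ℝ × E3 => (z.1, z.2 + y))).sub h3
  have h3 := h2.inner (𝕜 := ℝ) h1
  simp_rw [fun t => inner_toL (((hS t).dq y).memLp 2) (((γ.sp t).sg.dq y).memLp 2)] at h3
  exact h3

theorem Curve.continuous_nm_dq_grad (γ : Curve n T) (y : E3) (q : ℝ≥0∞) [Fact (1 ≤ q)] :
    Continuous fun t => nm q (dq y (grad (γ.v t))) := by
  refine continuous_nm (Φ := fun t => dq y (grad (γ.v t))) ?_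
  simp_rw [fun t => (γ.sp t).grad.2.dq_eq y]
  exact (γ.continuous_grad.comp (by fun_prop : Continuous fun z : ℝ × E3 => (z.1, z.2 + y))).sub γ.continuous_grad

theorem Curve.hasDerivAt_nm_dq_sq (γ : Curve n T) {t : ℝ} (ht : t ∈ Icc 0 T) (y : E3) :
    HasDerivAt (fun t => nm 2 (dq y (γ.v t)) ^ 2) (2 * ∫ x in cube, inner ℝ (dq y (γ.v' t) x) (dq y (γ.v t) x)) t := by
  have e : ∀ a : Fin γ.N → ℝ, dq y (fun x => ∑ i, a i • γ.e i x) = fun x => ∑ i, a i • dq y (γ.e i) x := by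
    intro a; funext x; simp only [dq, smul_sub, Finset.sum_sub_distrib]
  have h1 := (γ.hasDerivAt_toL ht (E := fun i => dq y (γ.e i)) (fun i => ((γ.sp_e i).dq y).continuous) 2).norm_sq
  simp_rw [← e] at h1
  replace h1 : HasDerivAt (fun t => ‖toL 2 (dq y (γ.v t))‖ ^ 2)
    (2 * inner ℝ (toL 2 (dq y (γ.v t))) (toL 2 (dq y (γ.v' t)))) t := h1
  have e1 : ∀ t, ‖toL 2 (dq y (γ.v t))‖ = nm 2 (dq y (γ.v t)) := fun t => norm_toL (((γ.sp t).dq y).memLp 2)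
  have e2 := inner_toL (((γ.sp t).dq y).memLp 2) (((γ.sp' t).dq y).memLp 2)
  simp_rw [e1] at h1
  rw [e2] at h1
  exact h1.congr_deriv (congrArg _ (integral_congr_ae (ae_of_all _ fun x => real_inner_comm _ _)))

/-- The rate of change of the differences of a Galerkin solution. -/
theorem IsGalerkin.abs_deriv_dq_le (hS : SobolevConst p C) (hμ : 0 < μ) (hg : ∀ t, ‖g t‖ ≤ K)
    (hγ : IsGalerkin p Λ μ g γ) {t : ℝ} (ht : t ∈ Icc 0 T) (y : E3) :
    |∫ x in cube, inner ℝ (dq y (γ.v' t) x) (dq y (γ.v t) x)| ≤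
      C ^ 2 * √Λ * nm (expHess p) (dq y (grad (γ.v t))) ^ 2 +
        K * ‖y‖ * nm (expHess p) (dq y (grad (γ.v t))) + |stressDiff μ p y (γ.v t)| := by
  have hs := γ.sp t
  have hdX := dq_mem_X (γ.v_mem t) y
  have hsd := hdX.1.sp
  have hψ := dq_mem_X hdX (-y)
  have hSs : SP fun x => Sv μ p (sg (γ.v t) x) := hs.sg.comp (contDiff_Sv hμ)
  have hw := hγ.weak t ht _ hψ
  rw [← integral_inner_dq (γ.sp' t) hsd, ← integral_inner_dq (hs.convect hs.grad) hsd, sg_dq hsd, sg_dq hs,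
    ← integral_inner_dq hSs (hs.sg.dq y)] at hw
  have h1 := abs_integral_convect_dq_le (γ.v_mem t) y
  have h2 : nm 4 (dq y (γ.v t)) ≤ C * nm (expHess p) (dq y (grad (γ.v t))) := by
    rw [← grad_dq hs]; exact hS.vel _ hsd hdX.1.mean_zero
  have h3 : nm 4 (dq y (γ.v t)) ^ 2 * nm 2 (grad (γ.v t)) ≤ (C * nm (expHess p) (dq y (grad (γ.v t)))) ^ 2 * √Λ := by
    refine mul_le_mul (pow_le_pow_left₀ (nm_nonneg _ _) h2 2) (Real.le_sqrt_of_sq_le (hγ.bound t ht)) (nm_nonneg _ _) (sq_nonneg _)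
  have h4 : |∫ x in cube, inner ℝ (g t x) (dq (-y) (dq y (γ.v t)) x)| ≤
      K * (‖y‖ * nm (expHess p) (dq y (grad (γ.v t)))) := by
    refine (abs_integral_inner_le (Lp.memLp (g t)) (hψ.1.sp.memLp (expHess p))).trans ?_
    rw [← norm_eq_nm]
    have h5 := nm_dq_grad_le hsd (-y) (q := expHess p) Fact.out ENNReal.ofReal_ne_top
    rw [norm_neg, grad_dq hs] at h5
    exact mul_le_mul (hg t) h5 (nm_nonneg _ _) ((norm_nonneg _).trans (hg t))
  have h6 : |stressDiff μ p y (γ.v t)| = |∫ x in cube, inner ℝ (dq y (fun x => Sv μ p (sg (γ.v t) x)) x) (dq y (sg (γ.v t)) x)| := rfl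
  rw [h6]
  generalize (∫ x in cube, inner ℝ (dq y (fun x => Sv μ p (sg (γ.v t) x)) x) (dq y (sg (γ.v t)) x) : ℝ) = e3 at *
  generalize (∫ x in cube, inner ℝ (g t x) (dq (-y) (dq y (γ.v t)) x) : ℝ) = e4 at *
  generalize (∫ x in cube, inner ℝ (dq y (fun x => convect (γ.v t x) (grad (γ.v t) x)) x) (dq y (γ.v t) x) : ℝ) = e2 at *
  have h7 : (∫ x in cube, inner ℝ (dq y (γ.v' t) x) (dq y (γ.v t) x) : ℝ) = e4 - e2 - e3 := by linarith only [hw]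
  rw [h7]
  have h8 : |e4 - e2 - e3| ≤ |e4| + |e2| + |e3| := (abs_sub _ _).trans (by gcongr; exact abs_sub _ _)
  have h9 := h1.trans h3
  rw [mul_pow] at h9
  linarith only [h8, h9, h4]

theorem IsGalerkin.abs_sub_nm_dq_sq_le (hS : SobolevConst p C) (hμ : 0 < μ) (hg : ∀ t, ‖g t‖ ≤ K)
    (hγ : IsGalerkin p Λ μ g γ) {s t : ℝ} (hs : 0 ≤ s) (hst : s ≤ t) (ht : t ≤ T) (y : E3) :
    |nm 2 (dq y (γ.v t)) ^ 2 - nm 2 (dq y (γ.v s)) ^ 2| ≤ ∫ τ in s..t, 2 *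
      (C ^ 2 * √Λ * nm (expHess p) (dq y (grad (γ.v τ))) ^ 2 +
        K * ‖y‖ * nm (expHess p) (dq y (grad (γ.v τ))) + |stressDiff μ p y (γ.v τ)|) := by
  have hc1 := γ.continuous_nm_dq_grad y (expHess p)
  have hc2 := γ.continuous_stressDiff (p := p) hμ y
  have hc : Continuous fun τ => 2 * (C ^ 2 * √Λ * nm (expHess p) (dq y (grad (γ.v τ))) ^ 2 +
        K * ‖y‖ * nm (expHess p) (dq y (grad (γ.v τ))) + |stressDiff μ p y (γ.v τ)|) := by fun_prop
  have hd : ∀ τ ∈ Icc s t, _ := fun τ hτ => hγ.abs_deriv_dq_le hS hμ hg (t := τ) ⟨hs.trans hτ.1, hτ.2.trans ht⟩ y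
  have hD : ∀ τ ∈ Icc s t, _ := fun τ hτ => γ.hasDerivAt_nm_dq_sq (t := τ) ⟨hs.trans hτ.1, hτ.2.trans ht⟩ y
  have h1 := add_integral_le_of_hasDerivAt hst continuous_const (a := fun _ => 0) hc hD
    fun τ hτ => by have := (abs_le.1 (hd τ hτ)).2; linarith only [this]
  have h2 := add_integral_le_of_hasDerivAt hst continuous_const (a := fun _ => 0) hc (fun τ hτ => (hD τ hτ).fun_neg)
    fun τ hτ => by have := (abs_le.1 (hd τ hτ)).1; linarith only [this]
  simp only [intervalIntegral.integral_zero, add_zero] at h1 h2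
  rw [abs_le]
  constructor
  · linarith only [h2]
  · linarith only [h1]

theorem abs_stressDiff_le (hμ : 0 < μ) (hμ1 : μ ≤ 1) {φ : E3 → E3} (hφ : SP φ) {B : ℝ} (hB : nm 2 (grad φ) ≤ B) (y : E3) :
    |stressDiff μ p y φ| ≤ 2 * (2 + 2 * B) * (2 * B) := by
  have hp1 := p.2.1
  have hp2 := p.2.2
  have hSs : SP fun x => Sv μ p (sg φ x) := hφ.sg.comp (contDiff_Sv hμ)
  have hsg := (nm_sg_le hφ 2).trans hB
  have hB0 : 0 ≤ B := (nm_nonneg _ _).trans hB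
  refine (abs_integral_inner_le (a := 2) (b := 2) ((hSs.dq y).memLp 2) ((hφ.sg.dq y).memLp 2)).trans ?_
  have h1 := nm_Sv_le hμ hμ1 (by linarith) hp2.le hφ (p := p)
  have h2 := nm_dq_le_two_mul (q := 2) (by norm_num) (hSs.memLp 2) y
  have h3 := nm_dq_le_two_mul (q := 2) (by norm_num) (hφ.sg.memLp 2) y
  refine mul_le_mul ?_ ?_ (nm_nonneg _ _) (by positivity)
  · linarith
  · linarith

end Galerkin

section StrongLimits

variable {F : Type} [NormedAddCommGroup F] {p : Ico (5 / 3 : ℝ) 2} {Λ : ℝ}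

theorem tendsto_nm_dq {q r : ℝ≥0∞} (hq : 1 ≤ q) (hqr : q ≤ r) {f : ℕ → E3 → F} {g : E3 → F}
    (hf : ∀ j, MemLp (f j) r volΩ) (hg : MemLp g r volΩ)
    (h : Tendsto (fun j => nm r fun x => f j x - g x) atTop (𝓝 0)) (y : E3) :
    Tendsto (fun j => nm q (dq y (f j))) atTop (𝓝 (nm q (dq y g))) := by
  rw [tendsto_iff_norm_sub_tendsto_zero]
  have h2 := h.const_mul 2
  rw [mul_zero] at h2
  refine squeeze_zero (fun _ => norm_nonneg _) (fun j => ?_) h2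
  rw [Real.norm_eq_abs]
  refine (abs_nm_dq_sub_le hq (memLp_of_le hqr (hf j)) (memLp_of_le hqr hg) y).trans ?_
  exact mul_le_mul_of_nonneg_left (nm_exponent_le hqr ((hf j).sub hg)) (by norm_num)

theorem tendsto_toL {q : ℝ≥0∞} [Fact (1 ≤ q)] {f : ℕ → E3 → F} {g : E3 → F}
    (hf : ∀ j, MemLp (f j) q volΩ) (hg : MemLp g q volΩ)
    (h : Tendsto (fun j => nm q fun x => f j x - g x) atTop (𝓝 0)) :
    Tendsto (fun j => toL q (f j)) atTop (𝓝 (toL q g)) := by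
  rw [tendsto_iff_norm_sub_tendsto_zero]
  exact h.congr fun j => (norm_toL_sub (hf j) hg).symm

theorem tendsto_nm_sub_of_toL {q : ℝ≥0∞} [Fact (1 ≤ q)] {f : ℕ → E3 → F} {g : LΩ F q}
    (hf : ∀ j, MemLp (f j) q volΩ) (h : Tendsto (fun j => toL q (f j)) atTop (𝓝 g)) :
    Tendsto (fun j => nm q fun x => f j x - g x) atTop (𝓝 0) := by
  refine (tendsto_iff_norm_sub_tendsto_zero.1 h).congr fun j => ?_
  rw [norm_sub_eq_nm]
  refine nm_congr ?_
  filter_upwards [coeFn_toL (hf j)] with x hx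
  rw [hx]

theorem tendsto_toL_dq {f : ℕ → E3 → F} {g : E3 → F} (hf : ∀ j, MemLp (f j) 2 volΩ) (hg : MemLp g 2 volΩ)
    (h : Tendsto (fun j => nm 2 fun x => f j x - g x) atTop (𝓝 0)) (y : E3) :
    Tendsto (fun j => toL 2 (dq y (f j))) atTop (𝓝 (toL 2 (dq y g))) := by
  refine tendsto_toL (fun j => memLp_dq (hf j) y) (memLp_dq hg y) ?_
  have h2 := h.const_mul 2
  rw [mul_zero] at h2
  refine squeeze_zero (fun _ => nm_nonneg _ _) (fun j => ?_) h2
  refine le_trans (le_of_eq (congrArg _ (funext fun x => ?_))) (nm_dq_le_two_mul (by norm_num) ((hf j).sub hg) y)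
  simp only [dq, Pi.sub_apply]; abel

theorem memLp_sym {q : ℝ≥0∞} {A : E3 → Mat3} (hA : MemLp A q volΩ) : MemLp (fun x => sym (A x)) q volΩ :=
  hA.mono (symL.continuous.comp_aestronglyMeasurable hA.1) (ae_of_all _ fun _ => norm_sym_le _)

theorem sym_sub (A B : Mat3) : sym (A - B) = sym A - sym B := map_sub symL A B

theorem tendsto_visc (Λ : ℝ) : Tendsto (visc Λ) atTop (𝓝 0) := by
  have := (tendsto_pow_atTop_nhds_zero_of_lt_one (r := (1 / 4096 : ℝ)) (by norm_num) (by norm_num)).const_mul (min 1 Λ)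
  rw [mul_zero] at this
  exact this

theorem tendsto_visc_rpow {s : ℝ} (hs : 0 < s) : Tendsto (fun j => visc Λ j ^ s) atTop (𝓝 0) := by
  have := ((Real.continuousAt_rpow_const 0 s (Or.inr hs.le)).tendsto.comp (tendsto_visc Λ))
  rw [Real.zero_rpow hs.ne'] at this
  exact this

variable {φ : ℕ → E3 → E3} {G : LΩ Mat3 2}

theorem tendsto_nm_sg (hφ : ∀ j, SP (φ j)) (h : Tendsto (fun j => toL 2 (grad (φ j))) atTop (𝓝 G)) :
    Tendsto (fun j => nm 2 fun x => sg (φ j) x - sym (G x)) atTop (𝓝 0) := by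
  refine squeeze_zero (fun _ => nm_nonneg _ _) (fun j => ?_) (tendsto_nm_sub_of_toL (fun j => (hφ j).grad.memLp 2) h)
  refine nm_mono (((hφ j).grad.memLp 2).sub (Lp.memLp G)) (ae_of_all _ fun x => ?_)
  rw [sg, ← sym_sub]
  exact norm_sym_le _

theorem tendsto_nm_Sm (hΛ : 0 < Λ) {r : ℝ} (hr1 : 1 < r) (hr2 : r ≤ 2) (hφ : ∀ j, SP (φ j))
    (h : Tendsto (fun j => toL 2 (grad (φ j))) atTop (𝓝 G)) :
    Tendsto (fun j => nm 2 fun x => Sm (visc Λ j) r (sg (φ j) x) - St r (sym (G x))) atTop (𝓝 0) := by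
  have h1 := tendsto_nm_sg hφ h
  have h2 : Tendsto (fun j => visc Λ j ^ ((r - 1) / 2) +
      3 * (nm 2 fun x => sg (φ j) x - sym (G x)) ^ (r - 1)) atTop (𝓝 (0 + 3 * 0 ^ (r - 1))) :=
    (tendsto_visc_rpow (Λ := Λ) (by linarith)).add ((h1.rpow_const (Or.inr (by linarith))).const_mul 3)
  rw [Real.zero_rpow (by linarith), mul_zero, add_zero] at h2
  exact squeeze_zero (fun _ => nm_nonneg _ _)
    (fun j => nm_Sm_sub_St_le (visc_pos hΛ j) hr1 hr2 ((hφ j).sg.memLp 2) (memLp_sym (Lp.memLp G))) h2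

theorem tendsto_nm_Sv (hΛ : 0 < Λ) {r : ℝ} (hr1 : 1 < r) (hr2 : r ≤ 2) (hφ : ∀ j, SP (φ j))
    (h : Tendsto (fun j => toL 2 (grad (φ j))) atTop (𝓝 G)) :
    Tendsto (fun j => nm 2 fun x => Sv (visc Λ j) r (sg (φ j) x) - St r (sym (G x))) atTop (𝓝 0) := by
  have h1 := tendsto_nm_Sm hΛ hr1 hr2 hφ h
  have h2 : Tendsto (fun j => visc Λ j * ‖toL 2 (grad (φ j))‖) atTop (𝓝 (0 * ‖G‖)) := (tendsto_visc Λ).mul h.norm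
  rw [zero_mul] at h2
  have h3 := h1.add h2
  rw [add_zero] at h3
  refine squeeze_zero (fun _ => nm_nonneg _ _) (fun j => ?_) h3
  have hSm : SP fun x => Sm (visc Λ j) r (sg (φ j) x) := (hφ j).sg.comp (contDiff_Sm (visc_pos hΛ j))
  have e : (fun x => Sv (visc Λ j) r (sg (φ j) x) - St r (sym (G x))) =
      fun x => (Sm (visc Λ j) r (sg (φ j) x) - St r (sym (G x))) + visc Λ j • sg (φ j) x := by
    funext x; rw [Sv]; abel
  rw [e]
  refine (nm_add_le (by norm_num) ((hSm.memLp 2).sub (memLp_St hr1 hr2 (memLp_sym (Lp.memLp G))))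
    (((hφ j).sg.memLp 2).const_smul (visc Λ j))).trans ?_
  refine add_le_add le_rfl ?_
  rw [norm_toL ((hφ j).grad.memLp 2)]
  refine nm_le_mul ((hφ j).grad.memLp 2) (visc_pos hΛ j).le (ae_of_all _ fun x => ?_)
  rw [Pi.smul_apply, norm_smul, Real.norm_of_nonneg (visc_pos hΛ j).le]
  exact mul_le_mul_of_nonneg_left (norm_sg_le _ _) (visc_pos hΛ j).le

/-- The weighted symmetric gradient. -/
def vfun (p : ℝ) (G : E3 → Mat3) (x : E3) : Mat3 := St ((p + 2) / 2) (sym (G x))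

/-- The pairing of the differences of stress and strain in the limit. -/
def stressLim (p : ℝ) (y : E3) (G : E3 → Mat3) : ℝ :=
  ∫ x in cube, inner ℝ (dq y (fun x => St p (sym (G x))) x) (dq y (fun x => sym (G x)) x)

theorem tendsto_stressDiff (hΛ : 0 < Λ) (hφ : ∀ j, SP (φ j))
    (h : Tendsto (fun j => toL 2 (grad (φ j))) atTop (𝓝 G)) (y : E3) :
    Tendsto (fun j => stressDiff (visc Λ j) p y (φ j)) atTop (𝓝 (stressLim p y G)) := by
  have hp1 : (1 : ℝ) < p := by linarith [p.2.1]
  have hS : ∀ j, SP fun x => Sv (visc Λ j) p (sg (φ j) x) := fun j => (hφ j).sg.comp (contDiff_Sv (visc_pos hΛ j))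
  have mS := memLp_St hp1 p.2.2.le (memLp_sym (Lp.memLp G))
  have h1 := tendsto_toL_dq (fun j => (hS j).memLp 2) mS (tendsto_nm_Sv hΛ hp1 p.2.2.le hφ h) y
  have h2 := tendsto_toL_dq (fun j => (hφ j).sg.memLp 2) (memLp_sym (Lp.memLp G)) (tendsto_nm_sg hφ h) y
  have h3 := h1.inner (𝕜 := ℝ) h2
  rw [inner_toL (memLp_dq mS y) (memLp_dq (memLp_sym (Lp.memLp G)) y)] at h3
  simp_rw [fun j => inner_toL (((hS j).dq y).memLp 2) (((hφ j).sg.dq y).memLp 2)] at h3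
  exact h3

theorem abs_stressLim_le (G : LΩ Mat3 2) (y : E3) : |stressLim p y G| ≤ 32 * nm 2 (dq y (vfun p G)) ^ 2 := by
  have hp1 : (1 : ℝ) < p := by linarith [p.2.1]
  have hp2 := p.2.2
  have mV : MemLp (vfun p G) 2 volΩ := memLp_St (by linarith) (by linarith) (memLp_sym (Lp.memLp G))
  rw [stressLim, abs_of_nonneg (integral_nonneg fun x => ?_), nm_two_sq (memLp_dq mV y), ← integral_const_mul]
  · refine integral_mono (integrable_inner (a := 2) (b := 2) (memLp_dq (memLp_St hp1 hp2.le (memLp_sym (Lp.memLp G))) y)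
      (memLp_dq (memLp_sym (Lp.memLp G)) y))
      (((memLp_dq mV y).integrable_norm_pow (by norm_num)).const_mul 32) fun x => ?_
    exact inner_St_sub_le hp1 hp2.le _ _
  · refine le_trans ?_ (St_monotone hp1 hp2.le _ _)
    have : (0 : ℝ) ≤ p - 1 := by linarith
    positivity

end StrongLimits

namespace ApproxSeq

variable {p : Ico (5 / 3 : ℝ) 2} {C C₀ Λ K κ T : ℝ}

variable {a : ApproxSeq p Λ K} {v : ℝ → LΩ E3 2 × LΩ Mat3 2}

theorem IsLimit.tendsto_fst (hv : a.IsLimit v) {t : ℝ} (ht : 0 ≤ t) :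
    Tendsto (fun j => toL 2 ((a.γ j).v t)) atTop (𝓝 (v t).1) :=
  (hv.unif t ht).tendsto_at ⟨ht, le_rfl⟩

theorem IsLimit.abs_sub_nm_dq_sq_le (hv : a.IsLimit v) (hS : SobolevConst p C) (h : SmallData p C Λ K κ)
    {s t : ℝ} (hs : 0 ≤ s) (hst : s ≤ t) (y : E3) :
    |nm 2 (dq y (v t).1) ^ 2 - nm 2 (dq y (v s).1) ^ 2| ≤ ∫ τ in Ioo s t,
      2 * (C ^ 2 * √Λ * nm (expHess p) (dq y (v τ).2) ^ 2 +
        K * ‖y‖ * nm (expHess p) (dq y (v τ).2) + |stressLim p y (v τ).2|) := by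
  have hΛ := h.pos
  have hC := hS.one_le
  have hK := h.nonneg
  have ht := hs.trans hst
  obtain ⟨j₀, hj₀⟩ := exists_nat_ge t
  have hsub : Ioo s t ⊆ Ioo 0 t := Ioo_subset_Ioo_left hs
  have hconv : ∀ r, 0 ≤ r → Tendsto (fun j => nm 2 (dq y ((a.γ j).v r)) ^ 2) atTop (𝓝 (nm 2 (dq y (v r).1) ^ 2)) := by
    intro r hr
    exact (tendsto_nm_dq (by norm_num) le_rfl (fun j => ((a.γ j).sp r).memLp 2) (Lp.memLp _)
      (tendsto_nm_sub_of_toL (fun j => ((a.γ j).sp r).memLp 2) (hv.tendsto_fst hr)) y).pow 2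
  have hL : Tendsto (fun j => |nm 2 (dq y ((a.γ j).v t)) ^ 2 - nm 2 (dq y ((a.γ j).v s)) ^ 2|) atTop
      (𝓝 |nm 2 (dq y (v t).1) ^ 2 - nm 2 (dq y (v s).1) ^ 2|) := ((hconv t ht).sub (hconv s hs)).abs
  let R : ℕ → ℝ → ℝ := fun j τ => 2 * (C ^ 2 * √Λ * nm (expHess p) (dq y (grad ((a.γ j).v τ))) ^ 2 +
        K * ‖y‖ * nm (expHess p) (dq y (grad ((a.γ j).v τ))) + |stressDiff (visc Λ j) p y ((a.γ j).v τ)|)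
  have hRc : ∀ j, Continuous (R j) := fun j => by
    have hc1 := (a.γ j).continuous_nm_dq_grad y (expHess p)
    have hc2 := (a.γ j).continuous_stressDiff (p := p) (visc_pos hΛ j) y
    simp only [R]; fun_prop
  let B : ℝ := 2 * (C ^ 2 * √Λ * (2 * √Λ) ^ 2 + K * ‖y‖ * (2 * √Λ) + 2 * (2 + 2 * √Λ) * (2 * √Λ))
  have hR : Tendsto (fun j => ∫ τ in Ioo s t, R (j + j₀) τ) atTop (𝓝 (∫ τ in Ioo s t,
      2 * (C ^ 2 * √Λ * nm (expHess p) (dq y (v τ).2) ^ 2 +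
        K * ‖y‖ * nm (expHess p) (dq y (v τ).2) + |stressLim p y (v τ).2|))) := by
    refine tendsto_integral_of_dominated_convergence (fun _ => B) (fun j => (hRc _).aestronglyMeasurable)
      (integrable_const _) (fun j => ?_) ?_
    · filter_upwards [ae_restrict_mem measurableSet_Ioo] with τ hτ
      have hτj : τ ∈ Icc 0 ((j + j₀ : ℕ) : ℝ) := ⟨hs.trans hτ.1.le, hτ.2.le.trans (hj₀.trans (by push_cast; simp))⟩
      have hb := a.norm_grad_le hτj
      have hsp := (a.γ (j + j₀)).sp τ
      rw [norm_toL (hsp.grad.memLp 2)] at hb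
      have b1 : nm (expHess p) (dq y (grad ((a.γ (j + j₀)).v τ))) ≤ 2 * √Λ :=
        (nm_dq_le_two_mul Fact.out (hsp.grad.memLp _) y).trans (mul_le_mul_of_nonneg_left
          ((nm_exponent_le (expHess_le_two p) (hsp.grad.memLp 2)).trans hb) (by norm_num))
      have b2 := abs_stressDiff_le (p := p) (visc_pos hΛ (j + j₀)) (visc_le_one _) hsp hb y
      have n1 := nm_nonneg (expHess p) (dq y (grad ((a.γ (j + j₀)).v τ)))
      rw [Real.norm_of_nonneg (by simp only [R]; positivity)]
      simp only [R, B]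
      gcongr
    · filter_upwards [ae_restrict_of_ae_restrict_of_subset hsub (hv.ae_grad t ht)] with τ hτ
      have hτ' : Tendsto (fun j => R j τ) atTop (𝓝 _) :=
        ((((tendsto_nm_dq Fact.out (expHess_le_two p) (fun j => ((a.γ j).sp τ).grad.memLp 2) (Lp.memLp _)
          (tendsto_nm_sub_of_toL (fun j => ((a.γ j).sp τ).grad.memLp 2) hτ) y).pow 2).const_mul _).add
          ((tendsto_nm_dq Fact.out (expHess_le_two p) (fun j => ((a.γ j).sp τ).grad.memLp 2) (Lp.memLp _)
          (tendsto_nm_sub_of_toL (fun j => ((a.γ j).sp τ).grad.memLp 2) hτ) y).const_mul _)).add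
          (tendsto_stressDiff hΛ (fun j => (a.γ j).sp τ) hτ y).abs |>.const_mul 2
      exact (tendsto_add_atTop_iff_nat j₀).2 hτ'
  refine le_of_tendsto_of_tendsto' ((tendsto_add_atTop_iff_nat j₀).2 hL) hR fun j => ?_
  have := (a.gal (j + j₀)).abs_sub_nm_dq_sq_le hS (visc_pos hΛ _) (a.g_le _) hs hst (hj₀.trans (by push_cast; simp)) y
  rwa [intervalIntegral.integral_of_le hst, integral_Ioc_eq_integral_Ioo] at this

/-- Uniform bounds for the difference quotients in the limit. -/
theorem IsLimit.aemeasurable_and_lintegral_le (hv : a.IsLimit v) (hS : SobolevConst p C) (h : SmallData p C Λ K κ)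
    (hT : 0 ≤ T) : ∃ M, 0 ≤ M ∧ ∀ y : E3, AEMeasurable (fun τ => nm (expHess p) (dq y (v τ).2)) vol[T] ∧
      AEMeasurable (fun τ => nm 2 (dq y (vfun p (v τ).2))) vol[T] ∧
      (∫⁻ τ in Ioo 0 T, ENNReal.ofReal (nm (expHess p) (dq y (v τ).2) ^ 2 + nm 2 (dq y (vfun p (v τ).2)) ^ 2)) ≤
        ENNReal.ofReal (‖y‖ ^ 2 * M) := by
  have hΛ := h.pos
  have hp1 := p.2.1
  have hp2 := p.2.2
  obtain ⟨M, hM0, hM⟩ := exists_time_bound hS h hT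
  obtain ⟨j₀, hj₀⟩ := exists_nat_ge T
  refine ⟨9 * M + M, by positivity, fun y => ?_⟩
  have mV : ∀ τ, MemLp (vfun p (v τ).2) 2 volΩ := fun τ =>
    memLp_St (by linarith) (by linarith) (memLp_sym (Lp.memLp _))
  have hSm : ∀ j τ, SP fun x => Sm (visc Λ j) ((p + 2) / 2) (sg ((a.γ j).v τ) x) := fun j τ =>
    ((a.γ j).sp τ).sg.comp (contDiff_Sm (visc_pos hΛ j))
  have c1 : ∀ j, Continuous fun τ => nm (expHess p) (dq y (grad ((a.γ j).v τ))) := fun j =>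
    (a.γ j).continuous_nm_dq_grad y (expHess p)
  have c2 : ∀ j, Continuous fun τ => nm 2 (dq y fun x => Sm (visc Λ j) ((p + 2) / 2) (sg ((a.γ j).v τ) x)) := by
    intro j
    refine continuous_nm (Φ := fun τ => dq y fun x => Sm (visc Λ j) ((p + 2) / 2) (sg ((a.γ j).v τ) x)) ?_
    simp_rw [fun t => (hSm j t).2.dq_eq y]
    have h3 := (contDiff_Sm (E := Mat3) (r := ((p : ℝ) + 2) / 2) (visc_pos hΛ j)).continuous.comp (a.γ j).continuous_sg
    exact (h3.comp (by fun_prop : Continuous fun z : ℝ × E3 => (z.1, z.2 + y))).sub h3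
  have t1 : ∀ᵐ τ ∂vol[T], Tendsto (fun j => nm (expHess p) (dq y (grad ((a.γ j).v τ)))) atTop
      (𝓝 (nm (expHess p) (dq y (v τ).2))) := by
    filter_upwards [hv.ae_grad T hT] with τ hτ
    exact tendsto_nm_dq Fact.out (expHess_le_two p) (fun j => ((a.γ j).sp τ).grad.memLp 2) (Lp.memLp _)
          (tendsto_nm_sub_of_toL (fun j => ((a.γ j).sp τ).grad.memLp 2) hτ) y
  have t2 : ∀ᵐ τ ∂vol[T], Tendsto (fun j =>
      nm 2 (dq y fun x => Sm (visc Λ j) ((p + 2) / 2) (sg ((a.γ j).v τ) x))) atTop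
      (𝓝 (nm 2 (dq y (vfun p (v τ).2)))) := by
    filter_upwards [hv.ae_grad T hT] with τ hτ
    exact tendsto_nm_dq (by norm_num) le_rfl (fun j => (hSm j τ).memLp 2) (mV τ)
      (tendsto_nm_Sm hΛ (by linarith) (by linarith) (fun j => (a.γ j).sp τ) hτ) y
  refine ⟨aemeasurable_of_tendsto_metrizable_ae atTop (fun j => (c1 j).aemeasurable) t1,
    aemeasurable_of_tendsto_metrizable_ae atTop (fun j => (c2 j).aemeasurable) t2, ?_⟩
  let D : ℕ → ℝ → ℝ := fun j τ => nm (expHess p) (dq y (grad ((a.γ j).v τ))) ^ 2 +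
    nm 2 (dq y fun x => Sm (visc Λ j) ((p + 2) / 2) (sg ((a.γ j).v τ) x)) ^ 2
  have hDc : ∀ j, Continuous (D j) := fun j => by
    have := c1 j
    have := c2 j
    simp only [D]; fun_prop
  have hD0 : ∀ j τ, 0 ≤ D j τ := fun j τ => by simp only [D]; positivity
  have hDb : ∀ j, ∫⁻ τ in Ioo 0 T, ENNReal.ofReal (D (j + j₀) τ) ≤ ENNReal.ofReal (‖y‖ ^ 2 * (9 * M + M)) := by
    intro j
    rw [← ofReal_integral_eq_lintegral_ofReal (((hDc _).integrableOn_Icc (a := 0) (b := T)).mono_set Ioo_subset_Icc_self)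
      (ae_of_all _ (hD0 _)), ← integral_Ioc_eq_integral_Ioo, ← intervalIntegral.integral_of_le hT]
    refine ENNReal.ofReal_le_ofReal ?_
    obtain ⟨b1, b2, -, -⟩ := hM _ (visc_pos hΛ (j + j₀)) (visc_le hΛ _) _ _
      (hj₀.trans (by push_cast; simp)) _ (a.γ (j + j₀)) (a.g_le _) (a.gal _)
    have k1 : Continuous fun τ => nm (expHess p) (tgrad (sg ((a.γ (j + j₀)).v τ))) ^ 2 := (a.γ _).continuous_nm_tgrad.pow 2
    have k2 : Continuous fun τ => diss (visc Λ (j + j₀)) p ((a.γ (j + j₀)).v τ) := (a.γ _).continuous_diss (visc_pos hΛ _)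
    have i1 := (k1.const_mul 9).intervalIntegrable (μ := volume) 0 T
    have i2 := k2.intervalIntegrable (μ := volume) 0 T
    have e1 : ∫ τ in (0 : ℝ)..T, D (j + j₀) τ ≤ ∫ τ in (0 : ℝ)..T, ‖y‖ ^ 2 *
        (9 * nm (expHess p) (tgrad (sg ((a.γ (j + j₀)).v τ))) ^ 2 + diss (visc Λ (j + j₀)) p ((a.γ (j + j₀)).v τ)) := by
      refine intervalIntegral.integral_mono_on hT ((hDc _).intervalIntegrable _ _) ((i1.add i2).const_mul _) fun τ _ => ?_
      have hsp := (a.γ (j + j₀)).sp τ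
      have d1 := nm_dq_grad_le_tgrad hsp y (q := expHess p) Fact.out ENNReal.ofReal_ne_top
      have d2 := nm_dq_weighted_le (r := p) (visc_pos hΛ (j + j₀)) (by linarith) hp2.le hsp y
      have d1' := pow_le_pow_left₀ (nm_nonneg _ _) d1 2
      have d2' := pow_le_pow_left₀ (nm_nonneg _ _) d2 2
      rw [mul_pow, mul_pow] at d1'
      rw [mul_pow, nm_wgrad_sq (visc_pos hΛ _) hsp] at d2'
      rw [mul_add]
      exact add_le_add (d1'.trans (le_of_eq (by ring))) d2'
    refine e1.trans ?_
    rw [intervalIntegral.integral_const_mul, intervalIntegral.integral_add i1 i2, intervalIntegral.integral_const_mul]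
    exact mul_le_mul_of_nonneg_left (by linarith) (sq_nonneg _)
  have hlim : ∀ᵐ τ ∂vol[T], Tendsto (fun j => ENNReal.ofReal (D (j + j₀) τ)) atTop
      (𝓝 (ENNReal.ofReal (nm (expHess p) (dq y (v τ).2) ^ 2 + nm 2 (dq y (vfun p (v τ).2)) ^ 2))) := by
    filter_upwards [t1, t2] with τ h1 h2
    exact (tendsto_add_atTop_iff_nat j₀).2 (ENNReal.tendsto_ofReal ((h1.pow 2).add (h2.pow 2)))
  calc _ = ∫⁻ τ in Ioo 0 T, liminf (fun j => ENNReal.ofReal (D (j + j₀) τ)) atTop := by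
        refine lintegral_congr_ae ?_
        filter_upwards [hlim] with τ hτ
        exact hτ.liminf_eq.symm
    _ ≤ liminf (fun j => ∫⁻ τ in Ioo 0 T, ENNReal.ofReal (D (j + j₀) τ)) atTop :=
        lintegral_liminf_le' fun j => (hDc _).aemeasurable.ennreal_ofReal
    _ ≤ liminf (fun _ : ℕ => ENNReal.ofReal (‖y‖ ^ 2 * (9 * M + M))) atTop :=
        liminf_le_liminf (Eventually.of_forall hDb)
    _ = _ := liminf_const _

end ApproxSeq

/-- Dyadic difference quotients increase as the step decreases. -/
theorem monotone_nm_dq_div {F : Type} [NormedAddCommGroup F] {q : ℝ≥0∞} (hq : 1 ≤ q) {g : E3 → F}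
    (hg : MemLp g q volΩ) (i : Fin 3) : Monotone fun k => nm q (dq (step i k) g) / (1 / 2) ^ k := by
  refine monotone_nat_of_le_succ fun k => ?_
  have h1 : (0 : ℝ) < (1 / 2) ^ k := by positivity
  have h2 := nm_dq_double hq hg (step i (k + 1))
  rw [← step_eq_two_smul] at h2
  rw [pow_succ, div_le_div_iff₀ h1 (by positivity)]
  nlinarith

namespace ApproxSeq

variable {p : Ico (5 / 3 : ℝ) 2} {C C₀ Λ K κ T : ℝ} {a : ApproxSeq p Λ K} {v : ℝ → LΩ E3 2 × LΩ Mat3 2}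

theorem IsLimit.exists_rate_col (hv : a.IsLimit v) (hS : SobolevConst p C) (h : SmallData p C Λ K κ) (hT : 0 ≤ T)
    (i : Fin 3) : ∃ m : ℝ → ℝ, IntegrableOn m (Ioo 0 T) ∧ ∀ s t, 0 ≤ s → s ≤ t → t ≤ T →
      |nm 2 (fun x => col i ((v t).2 x)) ^ 2 - nm 2 (fun x => col i ((v s).2 x)) ^ 2| ≤ ∫ τ in Ioo s t, m τ := by
  have hΛ := h.pos
  have hK := h.nonneg
  have hC := hS.one_le
  have hp1 := p.2.1
  have hp2 := p.2.2
  obtain ⟨M, hM0, hM⟩ := hv.aemeasurable_and_lintegral_le hS h hT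
  let c : ℝ := C ^ 2 * √Λ + K + 32
  have hc : 0 ≤ c := by positivity
  let b : ℕ → ℝ → ℝ := fun k τ => nm (expHess p) (dq (step i k) (v τ).2) / (1 / 2) ^ k
  let d : ℕ → ℝ → ℝ := fun k τ => nm 2 (dq (step i k) (vfun p (v τ).2)) / (1 / 2) ^ k
  let m : ℕ → ℝ → ℝ := fun k τ => 2 * (c * (1 + (b k τ ^ 2 + d k τ ^ 2)))
  have mV : ∀ τ, MemLp (vfun p (v τ).2) 2 volΩ := fun τ =>
    memLp_St (by linarith) (by linarith) (memLp_sym (Lp.memLp _))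
  have mG : ∀ τ, MemLp (v τ).2 (expHess p) volΩ := fun τ => memLp_of_le (expHess_le_two p) (Lp.memLp _)
  have hb0 : ∀ k τ, 0 ≤ b k τ := fun k τ => div_nonneg (nm_nonneg _ _) (by positivity)
  have hd0 : ∀ k τ, 0 ≤ d k τ := fun k τ => div_nonneg (nm_nonneg _ _) (by positivity)
  have hm0 : ∀ k τ, 0 ≤ m k τ := fun k τ => by simp only [m]; positivity
  have hmono : ∀ τ, Monotone fun k => m k τ := by
    intro τ k l hkl
    have h1 := monotone_nm_dq_div Fact.out (mG τ) i hkl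
    have h2 := monotone_nm_dq_div (by norm_num) (mV τ) i hkl
    have h3 := pow_le_pow_left₀ (hb0 k τ) h1 2
    have h4 := pow_le_pow_left₀ (hd0 k τ) h2 2
    simp only [m]
    gcongr
  have hmm : ∀ k, AEMeasurable (m k) vol[T] := by
    intro k
    obtain ⟨h1, h2, -⟩ := hM (step i k)
    exact (((((h1.div_const _).pow_const 2).add ((h2.div_const _).pow_const 2)).const_add 1).const_mul c).const_mul 2
  have hint : ∀ k, ∫⁻ τ in Ioo 0 T, ENNReal.ofReal (m k τ) ≤ ENNReal.ofReal (2 * c * (T + M)) := by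
    intro k
    obtain ⟨-, -, h3⟩ := hM (step i k)
    have hpos : (0 : ℝ) < (1 / 2) ^ k := by positivity
    have e : ∀ τ, ENNReal.ofReal (m k τ) = ENNReal.ofReal (2 * c) * (1 + ENNReal.ofReal (((1 / 2 : ℝ) ^ k) ^ 2)⁻¹ *
        ENNReal.ofReal (nm (expHess p) (dq (step i k) (v τ).2) ^ 2 + nm 2 (dq (step i k) (vfun p (v τ).2)) ^ 2)) := by
      intro τ
      rw [← ENNReal.ofReal_mul (by positivity), ← ENNReal.ofReal_one, ← ENNReal.ofReal_add (by norm_num) (by positivity),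
        ← ENNReal.ofReal_mul (by positivity)]
      congr 1
      simp only [m, b, d, div_pow]
      field_simp
    simp_rw [e]
    rw [lintegral_const_mul' _ _ ENNReal.ofReal_ne_top, lintegral_add_left measurable_const,
      lintegral_const_mul' _ _ ENNReal.ofReal_ne_top, ENNReal.ofReal_mul (by positivity : 0 ≤ 2 * c),
      ENNReal.ofReal_add hT hM0]
    refine mul_le_mul_right (add_le_add ?_ ?_) _
    · simp
    · refine (mul_le_mul_right h3 _).trans ?_
      rw [← ENNReal.ofReal_mul (by positivity), norm_step]
      refine ENNReal.ofReal_le_ofReal (le_of_eq ?_)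
      field_simp
  let S : ℝ → ℝ≥0∞ := fun τ => ⨆ k, ENNReal.ofReal (m k τ)
  have hSm : AEMeasurable S vol[T] := AEMeasurable.iSup fun k => (hmm k).ennreal_ofReal
  have hSint : ∫⁻ τ in Ioo 0 T, S τ ≤ ENNReal.ofReal (2 * c * (T + M)) := by
    rw [lintegral_iSup' (fun k => (hmm k).ennreal_ofReal)
      (ae_of_all _ fun τ k l hkl => ENNReal.ofReal_le_ofReal (hmono τ hkl))]
    exact iSup_le hint
  have hStop : ∫⁻ τ in Ioo 0 T, S τ ≠ ⊤ := (hSint.trans_lt ENNReal.ofReal_lt_top).ne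
  have hSI : IntegrableOn (fun τ => (S τ).toReal) (Ioo 0 T) := integrable_toReal_of_lintegral_ne_top hSm hStop
  refine ⟨fun τ => (S τ).toReal, hSI, fun s t hs hst htT => ?_⟩
  have hsub : Ioo s t ⊆ Ioo 0 T := Ioo_subset_Ioo hs htT
  have hkey : ∀ k, |(nm 2 (dq (step i k) (v t).1) / (1 / 2) ^ k) ^ 2 - (nm 2 (dq (step i k) (v s).1) / (1 / 2) ^ k) ^ 2| ≤
      ∫ τ in Ioo s t, (S τ).toReal := by
    intro k
    have hpos : (0 : ℝ) < (1 / 2) ^ k := by positivity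
    have h1 := hv.abs_sub_nm_dq_sq_le hS h hs hst (step i k)
    rw [div_pow (nm 2 (dq (step i k) (v t).1)), div_pow (nm 2 (dq (step i k) (v s).1)), ← sub_div, abs_div, abs_of_pos (by positivity : (0 : ℝ) < ((1 / 2) ^ k) ^ 2),
      div_le_iff₀ (by positivity), ← integral_mul_const]
    refine h1.trans (integral_mono_of_nonneg (ae_of_all _ fun τ => ?_) ((hSI.mono_set hsub).mul_const _) ?_)
    · have := nm_nonneg (expHess p) (dq (step i k) (v τ).2)
      simp only [Pi.zero_apply]; positivity
    · filter_upwards [ae_restrict_of_ae_restrict_of_subset hsub (ae_lt_top' hSm hStop)] with τ hτ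
      have h2 : m k τ ≤ (S τ).toReal := by
        rw [← ENNReal.toReal_ofReal (hm0 k τ)]
        exact ENNReal.toReal_mono hτ.ne (le_iSup (fun k => ENNReal.ofReal (m k τ)) k)
      refine le_trans ?_ (mul_le_mul_of_nonneg_right h2 (by positivity))
      have h3 := abs_stressLim_le (p := p) (v τ).2 (step i k)
      have e1 : nm (expHess p) (dq (step i k) (v τ).2) = (1 / 2) ^ k * b k τ := by simp only [b]; field_simp
      have e2 : nm 2 (dq (step i k) (vfun p (v τ).2)) = (1 / 2) ^ k * d k τ := by simp only [d]; field_simp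
      rw [e2] at h3
      rw [e1, norm_step]
      generalize hη : ((1 : ℝ) / 2) ^ k = η at *
      have hb := hb0 k τ
      have hd := hd0 k τ
      simp only [m, c]
      generalize b k τ = β at *
      generalize d k τ = δ at *
      have hs0 : 0 ≤ C ^ 2 * √Λ := by positivity
      generalize C ^ 2 * √Λ = A at *
      have f1 : 0 ≤ A * (1 + δ ^ 2) * η ^ 2 := by positivity
      have f2 : K * η * (η * β) ≤ K * (1 + (β ^ 2 + δ ^ 2)) * η ^ 2 := by
        have : β ≤ 1 + (β ^ 2 + δ ^ 2) := by nlinarith [sq_nonneg (β - 1), sq_nonneg δ]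
        calc K * η * (η * β) = K * β * η ^ 2 := by ring
          _ ≤ _ := by gcongr
      have f3 : 0 ≤ 32 * (1 + β ^ 2) * η ^ 2 := by positivity
      linarith only [f1, f2, f3, h3]
  refine le_of_tendsto' (((tendsto_nm_dq_J1 (hv.mem t (hs.trans hst)) i).pow 2).sub
    ((tendsto_nm_dq_J1 (hv.mem s hs) i).pow 2)).abs hkey

theorem IsLimit.continuousOn_norm_grad_sq (hv : a.IsLimit v) (hS : SobolevConst p C) (h : SmallData p C Λ K κ)
    (hT : 0 ≤ T) : ContinuousOn (fun t => ‖(v t).2‖ ^ 2) (Icc 0 T) := by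
  choose m hm hle using fun i => hv.exists_rate_col hS h hT i
  have key : ∀ i, ContinuousOn (fun t => nm 2 (fun x => col i ((v t).2 x)) ^ 2) (Icc 0 T) := by
    intro i
    have hc : ContinuousOn (fun t => ∫ τ in Ioc 0 t, m i τ) (Icc 0 T) :=
      intervalIntegral.continuousOn_primitive ((integrableOn_Icc_iff_integrableOn_Ioo).2 (hm i))
    have hI : ∀ s t, 0 ≤ s → s ≤ t → t ≤ T →
        |nm 2 (fun x => col i ((v t).2 x)) ^ 2 - nm 2 (fun x => col i ((v s).2 x)) ^ 2| ≤
          |(∫ τ in Ioc 0 t, m i τ) - ∫ τ in Ioc 0 s, m i τ| := by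
      intro s t hs hst ht
      refine (hle i s t hs hst ht).trans (le_trans (le_of_eq ?_) (le_abs_self _))
      have hii : ∀ x y, 0 ≤ x → x ≤ y → y ≤ T → IntervalIntegrable (m i) volume x y := fun x y hx hxy hy => by
        rw [intervalIntegrable_iff_integrableOn_Ioo_of_le hxy]
        exact (hm i).mono_set (Ioo_subset_Ioo hx hy)
      rw [← intervalIntegral.integral_of_le (hs.trans hst), ← intervalIntegral.integral_of_le hs,
        intervalIntegral.integral_interval_sub_left (hii _ _ le_rfl (hs.trans hst) ht) (hii _ _ le_rfl hs (hst.trans ht)),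
        intervalIntegral.integral_of_le hst, integral_Ioc_eq_integral_Ioo]
    intro s hs
    have h1 := hc s hs
    rw [ContinuousWithinAt, tendsto_iff_norm_sub_tendsto_zero] at h1 ⊢
    refine squeeze_zero' (Eventually.of_forall fun _ => norm_nonneg _) ?_ h1
    filter_upwards [self_mem_nhdsWithin] with t ht
    rw [Real.norm_eq_abs, Real.norm_eq_abs]
    rcases le_total s t with hst | hst
    · exact hI s t hs.1 hst ht.2
    · rw [abs_sub_comm]
      refine (hI t s ht.1 hst hs.2).trans (le_of_eq (abs_sub_comm _ _))
  have e : (fun t => ‖(v t).2‖ ^ 2) = fun t => ∑ i, nm 2 (fun x => col i ((v t).2 x)) ^ 2 := by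
    funext t
    rw [sum_nm_col_sq (Lp.memLp _), norm_eq_nm]
  rw [e]
  exact continuousOn_finsetSum _ fun i _ => key i

theorem IsLimit.continuousOn_fst (hv : a.IsLimit v) (hT : 0 ≤ T) : ContinuousOn (fun t => (v t).1) (Icc 0 T) :=
  (hv.unif T hT).continuousOn (Eventually.of_forall fun j =>
    (continuous_toL (q := 2) (by norm_num) (a.γ j).continuous_v).continuousOn).frequently

theorem IsLimit.continuousOn (hv : a.IsLimit v) (hS : SobolevConst p C) (h : SmallData p C Λ K κ)
    (hT : 0 ≤ T) : ContinuousOn v (Icc 0 T) := by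
  have hc1 := hv.continuousOn_fst hT
  suffices hc2 : ContinuousOn (fun t => (v t).2) (Icc 0 T) from hc1.prodMk hc2
  have hc3 := hv.continuousOn_norm_grad_sq hS h hT
  have hweak : ∀ F : LΩ Mat3 2, (∃ u, (u, F) ∈ J1 2) → ContinuousOn (fun t => (inner ℝ (v t).2 F : ℝ)) (Icc 0 T) := by
    rintro F ⟨u, hu⟩
    obtain ⟨φ, hφ, hlim⟩ := exists_test_seq hu
    have hl2 : Tendsto (fun n => toL 2 (grad (φ n))) atTop (𝓝 F) := (continuous_snd.tendsto (u, F)).comp hlim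
    have hun : TendstoUniformlyOn (fun n t => (inner ℝ (v t).2 (toL 2 (grad (φ n))) : ℝ))
        (fun t => inner ℝ (v t).2 F) atTop (Icc 0 T) := by
      rw [Metric.tendstoUniformlyOn_iff]
      intro ε hε
      have h1 : Tendsto (fun n => √Λ * ‖toL 2 (grad (φ n)) - F‖) atTop (𝓝 (√Λ * 0)) :=
        (tendsto_iff_norm_sub_tendsto_zero.1 hl2).const_mul _
      rw [mul_zero] at h1
      filter_upwards [h1.eventually_lt_const hε] with n hn t ht
      rw [dist_comm, dist_eq_norm, ← inner_sub_right]
      refine lt_of_le_of_lt (norm_inner_le_norm _ _) (lt_of_le_of_lt ?_ hn)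
      exact mul_le_mul_of_nonneg_right (Real.le_sqrt_of_sq_le (hv.bound t ht.1)) (norm_nonneg _)
    refine hun.continuousOn (Eventually.of_forall fun n => ?_).frequently
    have h2 : ContinuousOn (fun t => -(inner ℝ (v t).1 (toL 2 (lap (φ n))) : ℝ)) (Icc 0 T) :=
      (hc1.inner continuousOn_const).neg
    exact h2.congr fun t ht => inner_grad_of_mem_J1 (hv.mem t ht.1) (hφ n).sp
  intro s hs
  have h1 := (hweak (v s).2 ⟨(v s).1, hv.mem s hs.1⟩) s hs
  have h2 := hc3 s hs
  rw [ContinuousWithinAt] at h1 h2 ⊢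
  rw [tendsto_iff_norm_sub_tendsto_zero]
  have h3 : Tendsto (fun t => ‖(v t).2‖ ^ 2 - 2 * inner ℝ (v t).2 (v s).2 + ‖(v s).2‖ ^ 2) (𝓝[Icc 0 T] s)
      (𝓝 (‖(v s).2‖ ^ 2 - 2 * inner ℝ (v s).2 (v s).2 + ‖(v s).2‖ ^ 2)) :=
    (h2.sub (h1.const_mul 2)).add tendsto_const_nhds
  rw [real_inner_self_eq_norm_sq, show ‖(v s).2‖ ^ 2 - 2 * ‖(v s).2‖ ^ 2 + ‖(v s).2‖ ^ 2 = 0 by ring] at h3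
  have h4 := (Real.continuous_sqrt.tendsto _).comp h3
  rw [Real.sqrt_zero] at h4
  refine h4.congr fun t => ?_
  simp only [Function.comp]
  rw [← norm_sub_sq_real, Real.sqrt_sq (norm_nonneg _)]

end ApproxSeq

section Time

variable {T : ℝ}

theorem memLp_Ioo_of_continuous {E : Type} [NormedAddCommGroup E] {h : ℝ → E} (hc : Continuous h) (q : ℝ≥0∞) :
    MemLp h q vol[T] := by
  obtain ⟨M, hM⟩ := (isCompact_Icc (a := (0 : ℝ)) (b := T)).exists_bound_of_continuousOn hc.continuousOn
  refine MemLp.of_bound hc.aestronglyMeasurable M ?_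
  filter_upwards [ae_restrict_mem measurableSet_Ioo] with t ht using hM t (Ioo_subset_Icc_self ht)

variable {E : Type} [NormedAddCommGroup E] [InnerProductSpace ℝ E] [CompleteSpace E]

/-- Weak compactness in `L²` in time, together with convergence of weak-strong pairings. -/
theorem exists_weakLim_time {x : ℕ → ℝ → E} (hx : ∀ j, MemLp (x j) 2 vol[T]) {M : ℝ}
    (hM : ∀ᶠ j in atTop, ∫ t in Ioo 0 T, ‖x j t‖ ^ 2 ≤ M) :
    ∃ z, MemLp z 2 vol[T] ∧ ∀ (ξ : ℕ → ℝ → E) (ξ₀ : ℝ → E), (∀ j, MemLp (ξ j) 2 vol[T]) → MemLp ξ₀ 2 vol[T] →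
      Tendsto (fun j => ∫ t in Ioo 0 T, ‖ξ j t - ξ₀ t‖ ^ 2) atTop (𝓝 0) →
      Tendsto (fun j => ∫ t in Ioo 0 T, (inner ℝ (x j t) (ξ j t) : ℝ)) (hyperfilter ℕ : Filter ℕ)
        (𝓝 (∫ t in Ioo 0 T, inner ℝ (z t) (ξ₀ t))) := by
  have hsq : ∀ {g : ℝ → E} (hg : MemLp g 2 vol[T]), ‖hg.toLp g‖ ^ 2 = ∫ t in Ioo 0 T, ‖g t‖ ^ 2 := by
    intro g hg
    rw [← real_inner_self_eq_norm_sq, L2.inner_def]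
    refine integral_congr_ae ?_
    filter_upwards [hg.coeFn_toLp] with t ht
    rw [ht, real_inner_self_eq_norm_sq]
  have hinner : ∀ {g h : ℝ → E} (hg : MemLp g 2 vol[T]) (hh : MemLp h 2 vol[T]),
      (inner ℝ (hg.toLp g) (hh.toLp h) : ℝ) = ∫ t in Ioo 0 T, inner ℝ (g t) (h t) := by
    intro g h hg hh
    rw [L2.inner_def]
    refine integral_congr_ae ?_
    filter_upwards [hg.coeFn_toLp, hh.coeFn_toLp] with t h1 h2
    rw [h1, h2]
  have hb : ∀ᶠ j in atTop, ‖(hx j).toLp (x j)‖ ≤ √M := by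
    filter_upwards [hM] with j hj
    exact Real.le_sqrt_of_sq_le (by rw [hsq]; exact hj)
  obtain ⟨z, hz⟩ := exists_weakLim hb
  refine ⟨z, Lp.memLp z, fun ξ ξ₀ hξ hξ₀ hlim => ?_⟩
  have h1 : Tendsto (fun j => (hξ j).toLp (ξ j)) atTop (𝓝 (hξ₀.toLp ξ₀)) := by
    rw [tendsto_iff_norm_sub_tendsto_zero]
    have h2 := (Real.continuous_sqrt.tendsto _).comp hlim
    rw [Real.sqrt_zero] at h2
    refine h2.congr fun j => ?_
    simp only [Function.comp]
    rw [← MemLp.toLp_sub, ← Real.sqrt_sq (norm_nonneg _), hsq]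
    rfl
  have h3 := hz.inner_tendsto hb h1
  simp_rw [hinner] at h3
  have e : (inner ℝ z (hξ₀.toLp ξ₀) : ℝ) = ∫ t in Ioo 0 T, inner ℝ (z t) (ξ₀ t) := by
    have := hinner (Lp.memLp z) hξ₀
    rwa [Lp.toLp_coeFn] at this
  rw [← e]
  exact h3

theorem tendsto_setIntegral_of_bounded {k : ℕ → ℝ → ℝ} {c : ℝ → ℝ} {B : ℝ} (hk : ∀ j, Continuous (k j))
    (hB : ∀ᶠ j in atTop, ∀ t ∈ Ioo 0 T, |k j t| ≤ B)
    (hlim : ∀ᵐ t ∂vol[T], Tendsto (fun j => k j t) atTop (𝓝 (c t))) :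
    Integrable c vol[T] ∧ ∀ s, MeasurableSet s → Tendsto (fun j => ∫ t in s, k j t ∂vol[T]) atTop
        (𝓝 (∫ t in s, c t ∂vol[T])) := by
  have hm : AEStronglyMeasurable c vol[T] :=
    aestronglyMeasurable_of_tendsto_ae atTop (fun j => (hk j).aestronglyMeasurable) hlim
  constructor
  · refine (integrable_const B).mono' hm ?_
    filter_upwards [hlim, ae_restrict_mem measurableSet_Ioo] with t h1 h2
    refine le_of_tendsto h1.norm ?_
    filter_upwards [hB] with j hj using hj t h2
  · intro s hs
    refine tendsto_integral_filter_of_dominated_convergence (fun _ => B)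
      (Eventually.of_forall fun j => (hk j).aestronglyMeasurable) ?_ (integrable_const B) (ae_restrict_of_ae hlim)
    filter_upwards [hB] with j hj
    filter_upwards [ae_restrict_of_ae (ae_restrict_mem (μ := (volume : Measure ℝ)) measurableSet_Ioo)] with t ht
    exact hj t ht

theorem integral_inner_indicator {w u : ℝ → E} {s : Set ℝ} (hs : MeasurableSet s) :
    (∫ t in Ioo 0 T, (inner ℝ (w t) (s.indicator u t) : ℝ)) = ∫ t in s, inner ℝ (w t) (u t) ∂vol[T] := by
  rw [← integral_indicator hs]
  refine integral_congr_ae (ae_of_all _ fun t => ?_)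
  by_cases ht : t ∈ s <;> simp [ht]

end Time

section Convection

/-- The tensor product `(w ⊗ u) (i, j) = wᵢ uⱼ`. -/
def tens (w u : E3) : Mat3 := WithLp.toLp 2 fun ij => w ij.1 * u ij.2

theorem inner_convect (u w : E3) (A : Mat3) : (inner ℝ (convect u A) w : ℝ) = inner ℝ A (tens w u) := by
  simp only [PiLp.inner_apply, convect, tens, Fintype.sum_prod_type, RCLike.inner_apply, conj_trivial]
  refine Finset.sum_congr rfl fun i _ => ?_
  rw [Finset.mul_sum]
  exact Finset.sum_congr rfl fun j _ => by ring

theorem norm_tens (w u : E3) : ‖tens w u‖ = ‖w‖ * ‖u‖ := by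
  refine (sq_eq_sq₀ (norm_nonneg _) (by positivity)).1 ?_
  rw [mul_pow]
  simp only [EuclideanSpace.norm_sq_eq, tens, Fintype.sum_prod_type, norm_mul, mul_pow, Finset.sum_mul_sum]

theorem tens_sub (w u u' : E3) : tens w (u - u') = tens w u - tens w u' := by
  ext ij; simp [tens, mul_sub]

theorem continuous_tens : Continuous fun z : E3 × E3 => tens z.1 z.2 :=
  (PiLp.continuous_toLp 2 _).comp (continuous_pi fun ij => by fun_prop)

theorem SP.exists_bound {F : Type} [NormedAddCommGroup F] [NormedSpace ℝ F] {g : E3 → F} (hg : SP g) :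
    ∃ M, 0 ≤ M ∧ ∀ x ∈ cube, ‖g x‖ ≤ M := by
  obtain ⟨M, hM⟩ := (isCompact_closedBall (0 : E3) 2).exists_bound_of_continuousOn hg.continuous.continuousOn
  exact ⟨M, (norm_nonneg _).trans (hM 0 (by simp)), fun x hx => hM x (cube_subset_closedBall hx)⟩

theorem nm_tens_le {w u : E3 → E3} {M : ℝ} (hM0 : 0 ≤ M) (hM : ∀ x ∈ cube, ‖w x‖ ≤ M) (hw : Continuous w)
    (hu : MemLp u 2 volΩ) : MemLp (fun x => tens (w x) (u x)) 2 volΩ ∧ nm 2 (fun x => tens (w x) (u x)) ≤ M * nm 2 u := by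
  have h : ∀ᵐ x ∂volΩ, ‖tens (w x) (u x)‖ ≤ M * ‖u x‖ := by
    filter_upwards [ae_restrict_mem measurableSet_cube] with x hx
    rw [norm_tens]; exact mul_le_mul_of_nonneg_right (hM x hx) (norm_nonneg _)
  exact ⟨hu.of_le_mul (continuous_tens.comp_aestronglyMeasurable
    (hw.aestronglyMeasurable.prodMk hu.1)) h, nm_le_mul hu hM0 h⟩

end Convection

namespace ApproxSeq

variable {p : Ico (5 / 3 : ℝ) 2} {C C₀ Λ K κ T : ℝ} {a : ApproxSeq p Λ K} {v : ℝ → LΩ E3 2 × LΩ Mat3 2}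

/-- The convergence of the approximating forces. -/
structure ForceLimit (a : ApproxSeq p Λ K) (f : ℝ → LΩ E3 (expForce p)) : Prop where
  integrable : ∀ T, Integrable f vol[T]
  tendsto : ∀ T, Tendsto (fun j => ∫ t in Ioo 0 T, ‖a.g j t - f t‖) atTop (𝓝 0)

/-- The limit of the time derivatives. -/
structure IsTimeDeriv (a : ApproxSeq p Λ K) (T : ℝ) (vt : ℝ → LΩ E3 2) : Prop where
  memLp : MemLp vt 2 vol[T]
  tendsto : ∀ ξ : ℝ → LΩ E3 2, MemLp ξ 2 vol[T] →
    Tendsto (fun j => ∫ t in Ioo 0 T, (inner ℝ (toL 2 ((a.γ j).v' t)) (ξ t) : ℝ)) (hyperfilter ℕ : Filter ℕ)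
      (𝓝 (∫ t in Ioo 0 T, inner ℝ (vt t) (ξ t)))

theorem exists_isTimeDeriv (a : ApproxSeq p Λ K) (hS : SobolevConst p C) (h : SmallData p C Λ K κ) (hT : 0 ≤ T) :
    ∃ vt, a.IsTimeDeriv T vt := by
  obtain ⟨M, hM0, hM⟩ := exists_time_bound hS h hT
  obtain ⟨j₀, hj₀⟩ := exists_nat_ge T
  have hc : ∀ j, Continuous fun t => toL 2 ((a.γ j).v' t) := fun j =>
    continuous_toL (by norm_num) (a.γ j).continuous_v'
  have hb : ∀ᶠ j in atTop, ∫ t in Ioo 0 T, ‖toL 2 ((a.γ j).v' t)‖ ^ 2 ≤ M := by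
    filter_upwards [eventually_ge_atTop j₀] with j hj
    obtain ⟨-, -, -, b⟩ := hM _ (visc_pos h.pos j) (visc_le h.pos _) _ _
      (hj₀.trans (by exact_mod_cast hj)) _ (a.γ j) (a.g_le _) (a.gal _)
    simp_rw [fun t => norm_toL (((a.γ j).sp' t).memLp 2)]
    rwa [intervalIntegral.integral_of_le hT, integral_Ioc_eq_integral_Ioo] at b
  obtain ⟨z, hz, hlim⟩ := exists_weakLim_time (fun j => memLp_Ioo_of_continuous (hc j) 2) hb
  refine ⟨z, hz, fun ξ hξ => hlim (fun _ => ξ) ξ (fun _ => hξ) hξ ?_⟩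
  simp

theorem IsLimit.isWeakTimeDeriv (hv : a.IsLimit v) (hT : 0 ≤ T)
    {vt : ℝ → LΩ E3 2} (hvt : a.IsTimeDeriv T vt) : IsWeakTimeDeriv T (fun t => (v t).1) vt := by
  intro η hη hηc hηs
  obtain ⟨j₀, hj₀⟩ := exists_nat_ge T
  have hη0 : η 0 = 0 := image_eq_zero_of_notMem_tsupport fun h0 => (hηs h0).1.false
  have hηT : η T = 0 := image_eq_zero_of_notMem_tsupport fun h0 => (hηs h0).2.false
  have hη' : Continuous (deriv η) := hη.continuous_deriv (by simp)
  have cU : ∀ j, Continuous fun t => toL 2 ((a.γ j).v t) := fun j =>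
    continuous_toL (by norm_num) (a.γ j).continuous_v
  have cU' : ∀ j, Continuous fun t => toL 2 ((a.γ j).v' t) := fun j =>
    continuous_toL (by norm_num) (a.γ j).continuous_v'
  have cu := hv.continuousOn_fst hT
  have iu : Integrable (fun t => deriv η t • (v t).1) vol[T] :=
    ((hη'.continuousOn.smul cu).integrableOn_Icc).mono_set Ioo_subset_Icc_self
  have mvt : ∀ ψ : LΩ E3 2, MemLp (fun t => η t • ψ) 2 vol[T] := fun ψ =>
    memLp_Ioo_of_continuous (hη.continuous.smul continuous_const) 2
  have ivt : Integrable (fun t => η t • vt t) vol[T] := by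
    have := (memLp_Ioo_of_continuous (T := T) hη.continuous 2).integrable_mul (hvt.memLp.norm)
    refine this.mono (hη.continuous.aestronglyMeasurable.smul hvt.memLp.1) (ae_of_all _ fun t => ?_)
    simp [norm_smul]
  refine ext_inner_left ℝ fun ψ => ?_
  rw [inner_neg_right, ← integral_inner iu, ← integral_inner ivt]
  have hR := (hvt.tendsto _ (mvt ψ)).neg
  have e1 : (∫ t in Ioo 0 T, (inner ℝ ψ (η t • vt t) : ℝ)) = ∫ t in Ioo 0 T, inner ℝ (vt t) (η t • ψ) := by
    refine integral_congr_ae (ae_of_all _ fun t => ?_)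
    simp only [inner_smul_right]; rw [real_inner_comm]
  rw [e1]
  refine tendsto_nhds_unique (f := fun j => ∫ t in Ioo 0 T, (inner ℝ ψ (deriv η t • toL 2 ((a.γ j).v t)) : ℝ)) ?_
    (Tendsto.congr' ?_ hR)
  · obtain ⟨B, hB⟩ := (isCompact_Icc (a := (0 : ℝ)) (b := T)).exists_bound_of_continuousOn hη'.continuousOn
    have := (tendsto_setIntegral_of_bounded (T := T) (k := fun j t => inner ℝ ψ (deriv η t • toL 2 ((a.γ j).v t)))
      (c := fun t => inner ℝ ψ (deriv η t • (v t).1)) (B := ‖ψ‖ * (B * (2 * √Λ)))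
      (fun j => continuous_const.inner (hη'.smul (cU j))) ?_ ?_).2 univ MeasurableSet.univ
    · simp only [Measure.restrict_univ] at this
      exact this.mono_left Nat.hyperfilter_le_atTop
    · filter_upwards [eventually_ge_atTop j₀] with j hj t ht
      rw [← Real.norm_eq_abs]
      refine (norm_inner_le_norm _ _).trans (mul_le_mul_of_nonneg_left ?_ (norm_nonneg _))
      have htj : t ∈ Icc 0 (j : ℝ) := ⟨ht.1.le, ht.2.le.trans (hj₀.trans (by exact_mod_cast hj))⟩
      rw [norm_smul]
      refine mul_le_mul (hB t (Ioo_subset_Icc_self ht)) ?_ (norm_nonneg _) ((norm_nonneg _).trans (hB t (Ioo_subset_Icc_self ht)))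
      rw [norm_toL (((a.γ j).sp t).memLp 2)]
      have h1 := nm_le_two_mul_grad ((a.γ j).test t) (q := 2) (by norm_num) (by norm_num)
      have h2 := a.norm_grad_le htj
      rw [norm_toL (((a.γ j).sp t).grad.memLp 2)] at h2
      linarith
    · filter_upwards [ae_restrict_mem measurableSet_Ioo] with t ht
      exact tendsto_const_nhds.inner ((hv.tendsto_fst ht.1.le).const_smul _)
  · refine Nat.hyperfilter_le_atTop ?_
    filter_upwards [eventually_ge_atTop j₀] with j hj
    have hjT : T ≤ (j : ℝ) := hj₀.trans (by exact_mod_cast hj)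
    have hd : ∀ t ∈ uIcc 0 T, HasDerivAt (fun t => η t * inner ℝ ψ (toL 2 ((a.γ j).v t)))
        (inner ℝ ψ (deriv η t • toL 2 ((a.γ j).v t)) + inner ℝ (toL 2 ((a.γ j).v' t)) (η t • ψ)) t := by
      intro t ht
      rw [uIcc_of_le hT] at ht
      have h1 := (hη.differentiable (by simp) t).hasDerivAt
      have h2 := ((hasDerivAt_const t ψ).inner ℝ ((a.γ j).hasDerivAt_v ⟨ht.1, ht.2.trans hjT⟩))
      refine (h1.mul h2).congr_deriv ?_
      simp only [inner_smul_right, inner_zero_left, add_zero]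
      rw [real_inner_comm ψ (toL 2 ((a.γ j).v' t))]
    have c1 : Continuous fun t => (inner ℝ ψ (deriv η t • toL 2 ((a.γ j).v t)) : ℝ) := continuous_const.inner (hη'.smul (cU j))
    have c2 : Continuous fun t => (inner ℝ (toL 2 ((a.γ j).v' t)) (η t • ψ) : ℝ) :=
      (cU' j).inner (hη.continuous.smul continuous_const)
    have h1 := intervalIntegral.integral_eq_sub_of_hasDerivAt hd ((c1.add c2).intervalIntegrable _ _)
    rw [hη0, hηT, zero_mul, zero_mul, sub_zero, intervalIntegral.integral_add (c1.intervalIntegrable _ _)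
      (c2.intervalIntegrable _ _), intervalIntegral.integral_of_le hT, intervalIntegral.integral_of_le hT,
      integral_Ioc_eq_integral_Ioo, integral_Ioc_eq_integral_Ioo] at h1
    linarith

/-- The weak form of the system for trigonometric polynomials. -/
theorem IsLimit.weak_form_of_mem_X (hv : a.IsLimit v) (h : SmallData p C Λ K κ) (hT : 0 ≤ T)
    {vt : ℝ → LΩ E3 2} (hvt : a.IsTimeDeriv T vt) {f : ℝ → LΩ E3 (expForce p)} (hf : a.ForceLimit f) {n : ℕ}
    {ψ : E3 → E3} (hψ : ψ ∈ X n) : ∀ᵐ t ∂vol[T],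
      (∫ x in cube, inner ℝ (vt t x) (ψ x)) + (∫ x in cube, inner ℝ (convect ((v t).1 x) ((v t).2 x)) (ψ x)) +
        (∫ x in cube, inner ℝ (St p (sym ((v t).2 x))) (sg ψ x)) = ∫ x in cube, inner ℝ (f t x) (ψ x) := by
  have hΛ := h.pos
  have hp1 : (1 : ℝ) < p := by linarith [p.2.1]
  have hp2 := p.2.2
  have hs := hψ.1.sp
  obtain ⟨M, hM0, hM⟩ := hs.exists_bound
  obtain ⟨j₀, hj₀⟩ := exists_nat_ge T
  have hTj : ∀ j, j₀ + n ≤ j → T ≤ (j : ℝ) := fun j hj => hj₀.trans (by exact_mod_cast (by omega : j₀ ≤ j))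
  have hnj : ∀ j, j₀ + n ≤ j → ψ ∈ X (4096 ^ j) := fun j hj =>
    X_mono ((by omega : n ≤ j).trans (Nat.lt_pow_self (by norm_num)).le) hψ
  have cU' : ∀ j, Continuous fun t => toL 2 ((a.γ j).v' t) := fun j =>
    continuous_toL (by norm_num) (a.γ j).continuous_v'
  -- the pairing with the force
  let ℓ : LΩ E3 (expForce p) → ℝ := fun u => ∫ x in cube, inner ℝ (u x) (ψ x)
  have hℓ : ∀ u w, |ℓ u - ℓ w| ≤ ‖u - w‖ * nm (expHess p) ψ := abs_integral_inner_sub_le (hs.memLp _)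
  have hℓc : Continuous ℓ := continuous_integral_inner (hs.memLp (expHess p))
  have hℓ0 : ∀ u, |ℓ u| ≤ ‖u‖ * nm (expHess p) ψ := fun u =>
    abs_integral_inner_le (Lp.memLp u) (hs.memLp (expHess p))
  -- the remaining terms
  let k : ℕ → ℝ → ℝ := fun j t => ℓ (a.g j t) - inner ℝ (toL 2 ((a.γ j).v' t)) (toL 2 ψ)
  have hk : ∀ j, Continuous (k j) := fun j => (hℓc.comp (a.g_cont j)).sub ((cU' j).inner continuous_const)
  have hkeq : ∀ j, j₀ + n ≤ j → ∀ t ∈ Ioo 0 T, k j t =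
      inner ℝ (toL 2 (grad ((a.γ j).v t))) (toL 2 fun x => tens (ψ x) ((a.γ j).v t x)) +
        inner ℝ (toL 2 fun x => Sv (visc Λ j) p (sg ((a.γ j).v t) x)) (toL 2 (sg ψ)) := by
    intro j hj t ht
    have hw := (a.gal j).weak t ⟨ht.1.le, ht.2.le.trans (hTj j hj)⟩ ψ (hnj j hj)
    have hsp := (a.γ j).sp t
    have hSv : SP fun x => Sv (visc Λ j) p (sg ((a.γ j).v t) x) := hsp.sg.comp (contDiff_Sv (visc_pos hΛ j))
    simp_rw [inner_convect] at hw
    rw [inner_toL (hsp.grad.memLp 2) (nm_tens_le hM0 hM hs.continuous (hsp.memLp 2)).1,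
      inner_toL (hSv.memLp 2) (hs.sg.memLp 2)]
    simp only [k, ℓ]
    rw [inner_toL (((a.γ j).sp' t).memLp 2) (hs.memLp 2)]
    linarith
  let c : ℝ → ℝ := fun t => (∫ x in cube, inner ℝ (convect ((v t).1 x) ((v t).2 x)) (ψ x)) +
        ∫ x in cube, inner ℝ (St p (sym ((v t).2 x))) (sg ψ x)
  obtain ⟨ci, clim⟩ := tendsto_setIntegral_of_bounded (T := T) (k := k) (c := c)
    (B := √Λ * (M * (2 * √Λ)) + (2 + 2 * √Λ) * nm 2 (sg ψ)) hk (by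
      filter_upwards [eventually_ge_atTop (j₀ + n)] with j hj t ht
      rw [hkeq j hj t ht]
      have hsp := (a.γ j).sp t
      have hSv : SP fun x => Sv (visc Λ j) p (sg ((a.γ j).v t) x) := hsp.sg.comp (contDiff_Sv (visc_pos hΛ j))
      have hb := a.norm_grad_le (j := j) (t := t) ⟨ht.1.le, ht.2.le.trans (hTj j hj)⟩
      obtain ⟨t1, t2⟩ := nm_tens_le hM0 hM hs.continuous (hsp.memLp 2)
      have b1 : nm 2 ((a.γ j).v t) ≤ 2 * √Λ := by
        have h1 := nm_le_two_mul_grad ((a.γ j).test t) (q := 2) (by norm_num) (by norm_num)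
        rw [norm_toL (hsp.grad.memLp 2)] at hb
        linarith
      have b2 : nm 2 (fun x => Sv (visc Λ j) p (sg ((a.γ j).v t) x)) ≤ 2 + 2 * √Λ := by
        have h1 := nm_Sv_le (visc_pos hΛ j) (visc_le_one j) hp1 hp2.le hsp
        rw [norm_toL (hsp.grad.memLp 2)] at hb
        linarith
      refine (abs_add_le _ _).trans (add_le_add ?_ ?_)
      · refine (abs_real_inner_le_norm _ _).trans (mul_le_mul hb ?_ (norm_nonneg _) (Real.sqrt_nonneg _))
        rw [norm_toL t1]
        exact t2.trans (mul_le_mul_of_nonneg_left b1 hM0)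
      · refine (abs_real_inner_le_norm _ _).trans ?_
        rw [norm_toL (hSv.memLp 2), norm_toL (hs.sg.memLp 2)]
        exact mul_le_mul_of_nonneg_right b2 (nm_nonneg _ _)) (by
      filter_upwards [hv.ae_grad T hT, ae_restrict_mem measurableSet_Ioo] with t hG ht
      have hsp := fun j => (a.γ j).sp t
      have hSv : ∀ j, SP fun x => Sv (visc Λ j) p (sg ((a.γ j).v t) x) := fun j =>
        (hsp j).sg.comp (contDiff_Sv (visc_pos hΛ j))
      have mS := memLp_St hp1 hp2.le (memLp_sym (Lp.memLp (v t).2))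
      have h1 := tendsto_toL (fun j => (hSv j).memLp 2) mS (tendsto_nm_Sv hΛ hp1 hp2.le hsp hG)
      obtain ⟨m1, -⟩ := nm_tens_le hM0 hM hs.continuous (Lp.memLp (v t).1)
      have h2 : Tendsto (fun j => toL 2 fun x => tens (ψ x) ((a.γ j).v t x)) atTop
          (𝓝 (toL 2 fun x => tens (ψ x) ((v t).1 x))) := by
        refine tendsto_toL (fun j => (nm_tens_le hM0 hM hs.continuous ((hsp j).memLp 2)).1) m1 ?_
        have h3 := (tendsto_nm_sub_of_toL (fun j => (hsp j).memLp 2) (hv.tendsto_fst ht.1.le)).const_mul M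
        rw [mul_zero] at h3
        refine squeeze_zero (fun _ => nm_nonneg _ _) (fun j => ?_) h3
        simp_rw [← tens_sub]
        exact (nm_tens_le hM0 hM hs.continuous (((hsp j).memLp 2).sub (Lp.memLp (v t).1))).2
      have h4 := (hG.inner (𝕜 := ℝ) h2).add (h1.inner (𝕜 := ℝ) (tendsto_const_nhds (x := toL 2 (sg ψ))))
      have e : (inner ℝ (v t).2 (toL 2 fun x => tens (ψ x) ((v t).1 x)) : ℝ) +
          inner ℝ (toL 2 fun x => St p (sym ((v t).2 x))) (toL 2 (sg ψ)) = c t := by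
        rw [inner_toL_right _ m1, inner_toL mS (hs.sg.memLp 2)]
        simp_rw [← inner_convect]
        rfl
      rw [e] at h4
      refine h4.congr' ?_
      filter_upwards [eventually_ge_atTop (j₀ + n)] with j hj
      exact (hkeq j hj t ht).symm)
  have if_ : Integrable (fun t => ℓ (f t)) vol[T] := by
    refine ((hf.integrable T).norm.mul_const (nm (expHess p) ψ)).mono'
      (hℓc.comp_aestronglyMeasurable (hf.integrable T).1) (ae_of_all _ fun t => hℓ0 (f t))
  have ivt : Integrable (fun t => (inner ℝ (vt t) (toL 2 ψ) : ℝ)) vol[T] :=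
    ((hvt.memLp.integrable (by norm_num)).inner_const _)
  have hzero : (fun t => (inner ℝ (vt t) (toL 2 ψ) : ℝ) + c t - ℓ (f t)) =ᵐ[vol[T]] 0 := by
    refine Integrable.ae_eq_zero_of_forall_setIntegral_eq_zero ((ivt.add ci).sub if_) fun s hs' _ => ?_
    have hg : Tendsto (fun j => ∫ t in s, ℓ (a.g j t) ∂vol[T]) atTop (𝓝 (∫ t in s, ℓ (f t) ∂vol[T])) := by
      rw [tendsto_iff_norm_sub_tendsto_zero]
      have h3 := (hf.tendsto T).mul_const (nm (expHess p) ψ)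
      rw [zero_mul] at h3
      refine squeeze_zero (fun _ => norm_nonneg _) (fun j => ?_) h3
      have ig : Integrable (fun t => ℓ (a.g j t)) vol[T] :=
        (memLp_Ioo_of_continuous (hℓc.comp (a.g_cont j)) 1).integrable le_rfl
      have igf : Integrable (fun t => ‖a.g j t - f t‖) vol[T] :=
        ((memLp_one_iff_integrable.1 (memLp_Ioo_of_continuous (a.g_cont j) 1)).sub (hf.integrable T)).norm
      rw [← integral_sub ig.integrableOn if_.integrableOn, ← integral_mul_const]
      refine (norm_integral_le_integral_norm _).trans ?_
      refine le_trans (integral_mono ((ig.sub if_).norm.integrableOn) ((igf.mul_const _).integrableOn) fun t => hℓ _ _) ?_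
      exact setIntegral_le_integral (igf.mul_const _) (ae_of_all _ fun t => mul_nonneg (norm_nonneg _) (nm_nonneg _ _))
    have h1 := hvt.tendsto (s.indicator fun _ => toL 2 ψ) (((memLp_const (toL 2 ψ)).indicator hs'))
    simp_rw [integral_inner_indicator hs'] at h1
    have h2 : Tendsto (fun j => ∫ t in s, (inner ℝ (toL 2 ((a.γ j).v' t)) (toL 2 ψ) : ℝ) ∂vol[T]) atTop
        (𝓝 ((∫ t in s, ℓ (f t) ∂vol[T]) - ∫ t in s, c t ∂vol[T])) := by
      refine (hg.sub (clim s hs')).congr fun j => ?_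
      have ig : Integrable (fun t => ℓ (a.g j t)) vol[T] :=
        (memLp_Ioo_of_continuous (hℓc.comp (a.g_cont j)) 1).integrable le_rfl
      have ik : Integrable (k j) vol[T] := (memLp_Ioo_of_continuous (hk j) 1).integrable le_rfl
      rw [← integral_sub ig.integrableOn ik.integrableOn]
      refine integral_congr_ae (ae_of_all _ fun t => ?_)
      simp only [k]; ring
    have h3 := tendsto_nhds_unique h1 (h2.mono_left Nat.hyperfilter_le_atTop)
    have e2 : ∫ t in s, ((inner ℝ (vt t) (toL 2 ψ) : ℝ) + c t) ∂vol[T] =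
        (∫ t in s, (inner ℝ (vt t) (toL 2 ψ) : ℝ) ∂vol[T]) +
          ∫ t in s, c t ∂vol[T] := integral_add ivt.integrableOn ci.integrableOn
    rw [integral_sub (f := fun t => (inner ℝ (vt t) (toL 2 ψ) : ℝ) + c t) (ivt.add ci).integrableOn if_.integrableOn, e2]
    linarith
  filter_upwards [hzero] with t ht
  rw [← inner_toL_right (vt t) (hs.memLp 2)]
  simp only [c, ℓ, Pi.zero_apply] at ht
  linarith

end ApproxSeq

section WeakForm

variable {p : Ico (5 / 3 : ℝ) 2}

/-- The dual exponent `p/(p-1)`. -/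
def expDual (p : Ico (5 / 3 : ℝ) 2) : ℝ≥0∞ := ENNReal.ofReal (p / (p - 1))

instance : ENNReal.HolderConjugate (expDual p) (expP p) := ⟨by
  have h1 := p.2.1
  have h3 : 0 < (p : ℝ) := by linarith
  have h4 : 0 < (p : ℝ) - 1 := by linarith
  rw [expDual, expP, ← ENNReal.ofReal_inv_of_pos (by positivity),
    ← ENNReal.ofReal_inv_of_pos (by positivity), ← ENNReal.ofReal_add (by positivity) (by positivity)]
  have : ((p : ℝ) / (p - 1))⁻¹ + (p : ℝ)⁻¹ = 1 := by field_simp; ring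
  rw [this]; simp⟩

theorem memLp_St_dual {A : E3 → Mat3} (hA : MemLp A 2 volΩ) : MemLp (fun x => St p (A x)) (expDual p) volΩ := by
  have h1 := p.2.1
  have h2 := p.2.2
  have hp1 : (1 : ℝ) < p := by linarith
  have hα : 0 < (p : ℝ) - 1 := by linarith
  have hle : expDual p * ENNReal.ofReal (p - 1) ≤ 2 := by
    rw [expDual, ← ENNReal.ofReal_mul (by positivity), show (2 : ℝ≥0∞) = ENNReal.ofReal 2 by simp]
    refine ENNReal.ofReal_le_ofReal ?_
    rw [div_mul_cancel₀ _ hα.ne']; linarith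
  have h5 := (memLp_norm_rpow hα rfl (memLp_of_le hle hA)).1
  refine h5.mono ((continuous_St hp1 h2.le).comp_aestronglyMeasurable hA.1) (ae_of_all _ fun x => ?_)
  rw [norm_St hp1, Real.norm_of_nonneg (by positivity)]

theorem exists_sobolev_three (p : Ico (5 / 3 : ℝ) 2) :
    ∃ C : ℝ, 1 ≤ C ∧ ∀ W ∈ J1 (expP p), MemLp W.1 3 volΩ ∧ nm 3 W.1 ≤ C * ‖W.2‖ := by
  have h := exists_sobolev_J1 (q := expP p) (3 / 2) 3 (by
    rw [← NNReal.coe_le_coe]; norm_num) (by norm_num) (by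
    have h1 := p.2.1
    rw [expP, show ((3 / 2 : NNReal) : ℝ≥0∞) = ENNReal.ofReal (3 / 2) by
      rw [ENNReal.ofReal]; congr 1; ext; simp; norm_num]
    exact ENNReal.ofReal_le_ofReal (by linarith))
  simpa using h

theorem exists_sobolev_six : ∃ C : ℝ, 1 ≤ C ∧ ∀ U ∈ J1 2, MemLp U.1 6 volΩ ∧ nm 6 U.1 ≤ C * ‖U.2‖ := by
  have h := exists_sobolev_J1 (q := 2) 2 6 (by norm_num) (by norm_num) (by simp)
  simpa using h

/-- The residual of the weak form at a fixed time. -/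
def weakResidual (p : Ico (5 / 3 : ℝ) 2) (U : LΩ E3 2 × LΩ Mat3 2) (z : LΩ E3 2) (f : LΩ E3 (expForce p))
    (W : LΩ E3 (expP p) × LΩ Mat3 (expP p)) : ℝ :=
  (∫ x in cube, inner ℝ (z x) (W.1 x)) + (∫ x in cube, inner ℝ (convect (U.1 x) (U.2 x)) (W.1 x)) +
    (∫ x in cube, inner ℝ (St p (sym (U.2 x))) (sym (W.2 x))) - ∫ x in cube, inner ℝ (f x) (W.1 x)

theorem exists_weakResidual_bound {U : LΩ E3 2 × LΩ Mat3 2} (hU : U ∈ J1 2) (z : LΩ E3 2) (f : LΩ E3 (expForce p)) :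
    ∃ B, ∀ W ∈ J1 (expP p), ∀ W' ∈ J1 (expP p),
      |weakResidual p U z f W - weakResidual p U z f W'| ≤ B * ‖W.2 - W'.2‖ := by
  obtain ⟨C, hC1, hC⟩ := exists_sobolev_three p
  obtain ⟨C', -, hC'⟩ := exists_sobolev_six
  have hU6 := (hC' U hU).1
  have mS : MemLp (fun x => St p (sym (U.2 x))) (expDual p) volΩ := memLp_St_dual (memLp_sym (Lp.memLp U.2))
  have mf : MemLp f 2 volΩ := memLp_of_le (two_le_expForce p) (Lp.memLp f)
  have cm : AEStronglyMeasurable (fun x => convect (U.1 x) (U.2 x)) volΩ :=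
    contDiff_convect.continuous.comp_aestronglyMeasurable ((Lp.memLp U.1).1.prodMk (Lp.memLp U.2).1)
  refine ⟨nm 2 z * C + nm 6 U.1 * nm 2 U.2 * C + nm (expDual p) (fun x => St p (sym (U.2 x))) + nm 2 f * C,
    fun W hW W' hW' => ?_⟩
  have hD := hC _ (sub_mem_J1 hW hW')
  have h3 : ∀ V ∈ J1 (expP p), MemLp V.1 2 volΩ := fun V hV => memLp_of_le (by norm_num) (hC V hV).1
  have iconv : ∀ V ∈ J1 (expP p), Integrable (fun x => (inner ℝ (convect (U.1 x) (U.2 x)) (V.1 x) : ℝ)) volΩ := by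
    intro V hV
    refine (integrable_mul_mul_norm hU6 (Lp.memLp U.2) (hC V hV).1).mono' (cm.inner (Lp.memLp V.1).1) (ae_of_all _ fun x => ?_)
    exact (norm_inner_le_norm _ _).trans (mul_le_mul_of_nonneg_right (norm_convect_le _ _) (norm_nonneg _))
  have e1 : (W - W').1 =ᵐ[volΩ] fun x => W.1 x - W'.1 x := Lp.coeFn_sub W.1 W'.1
  have hn3 : nm 3 (fun x => W.1 x - W'.1 x) ≤ C * ‖W.2 - W'.2‖ := by rw [← nm_congr e1]; exact hD.2
  have m3 : MemLp (fun x => W.1 x - W'.1 x) 3 volΩ := (hC W hW).1.sub (hC W' hW').1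
  have hn2 : nm 2 (fun x => W.1 x - W'.1 x) ≤ C * ‖W.2 - W'.2‖ := (nm_exponent_le (by norm_num) m3).trans hn3
  have m2 : MemLp (fun x => W.1 x - W'.1 x) 2 volΩ := memLp_of_le (by norm_num) m3
  have b1 : ∀ g : E3 → E3, MemLp g 2 volΩ → |(∫ x in cube, (inner ℝ (g x) (W.1 x) : ℝ)) - ∫ x in cube, inner ℝ (g x) (W'.1 x)| ≤
      nm 2 g * (C * ‖W.2 - W'.2‖) := by
    intro g hg
    rw [← integral_sub (integrable_inner (a := 2) (b := 2) hg (h3 W hW)) (integrable_inner (a := 2) (b := 2) hg (h3 W' hW'))]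
    simp_rw [← inner_sub_right]
    exact (abs_integral_inner_le hg m2).trans (mul_le_mul_of_nonneg_left hn2 (nm_nonneg _ _))
  have b2 : |(∫ x in cube, (inner ℝ (convect (U.1 x) (U.2 x)) (W.1 x) : ℝ)) -
      ∫ x in cube, inner ℝ (convect (U.1 x) (U.2 x)) (W'.1 x)| ≤ nm 6 U.1 * nm 2 U.2 * (C * ‖W.2 - W'.2‖) := by
    rw [← integral_sub (iconv W hW) (iconv W' hW'), ← Real.norm_eq_abs]
    refine (norm_integral_le_integral_norm _).trans ((integral_mono_of_nonneg (ae_of_all _ fun x => norm_nonneg _)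
      (integrable_mul_mul_norm hU6 (Lp.memLp U.2) m3) (ae_of_all _ fun x => ?_)).trans
      ((integral_mul_mul_norm_le hU6 (Lp.memLp U.2) m3).trans
        (mul_le_mul_of_nonneg_left hn3 (mul_nonneg (nm_nonneg _ _) (nm_nonneg _ _)))))
    simp only
    rw [← inner_sub_right]
    exact (norm_inner_le_norm _ _).trans (mul_le_mul_of_nonneg_right (norm_convect_le _ _) (norm_nonneg _))
  have b3 : |(∫ x in cube, (inner ℝ (St p (sym (U.2 x))) (sym (W.2 x)) : ℝ)) -
      ∫ x in cube, inner ℝ (St p (sym (U.2 x))) (sym (W'.2 x))| ≤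
      nm (expDual p) (fun x => St p (sym (U.2 x))) * ‖W.2 - W'.2‖ := by
    rw [← integral_sub (integrable_inner (a := expDual p) (b := expP p) mS (memLp_sym (Lp.memLp _)))
      (integrable_inner (a := expDual p) (b := expP p) mS (memLp_sym (Lp.memLp _)))]
    simp_rw [← inner_sub_right, ← sym_sub]
    refine (abs_integral_inner_le mS (memLp_sym ((Lp.memLp W.2).sub (Lp.memLp W'.2)))).trans
      (mul_le_mul_of_nonneg_left ?_ (nm_nonneg _ _))
    rw [norm_sub_eq_nm]
    exact nm_mono ((Lp.memLp W.2).sub (Lp.memLp W'.2)) (ae_of_all _ fun x => norm_sym_le _)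
  have b0 := b1 z (Lp.memLp z)
  have b4 := b1 f mf
  simp only [weakResidual]
  rw [abs_le] at *
  constructor <;> linarith only [b0.1, b0.2, b2.1, b2.2, b3.1, b3.2, b4.1, b4.2]

theorem isClosed_weakResidual_eq_zero {U : LΩ E3 2 × LΩ Mat3 2} (hU : U ∈ J1 2) (z : LΩ E3 2) (f : LΩ E3 (expForce p)) :
    IsClosed {W | W ∈ J1 (expP p) ∧ weakResidual p U z f W = 0} := by
  obtain ⟨B, hB⟩ := exists_weakResidual_bound hU z f
  refine IsSeqClosed.isClosed fun W W₀ hW hlim => ?_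
  have hW₀ : W₀ ∈ J1 (expP p) := isClosed_J1.mem_of_tendsto hlim (Eventually.of_forall fun n => (hW n).1)
  refine ⟨hW₀, ?_⟩
  have h1 : Tendsto (fun n => B * ‖W₀.2 - (W n).2‖) atTop (𝓝 (B * 0)) := by
    refine Tendsto.const_mul B ?_
    have := (tendsto_iff_norm_sub_tendsto_zero.1 ((continuous_snd.tendsto W₀).comp hlim))
    refine this.congr fun n => ?_
    exact norm_sub_rev _ _
  rw [mul_zero] at h1
  have h2 : |weakResidual p U z f W₀| ≤ 0 := ge_of_tendsto' h1 fun n => by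
    have := hB W₀ hW₀ (W n) (hW n).1
    rwa [(hW n).2, sub_zero] at this
  exact abs_nonpos_iff.1 h2

end WeakForm

namespace ApproxSeq

variable {p : Ico (5 / 3 : ℝ) 2} {C C₀ Λ K κ T : ℝ} {a : ApproxSeq p Λ K} {v : ℝ → LΩ E3 2 × LΩ Mat3 2}

theorem IsLimit.weak_form (hv : a.IsLimit v) (h : SmallData p C Λ K κ) (hT : 0 ≤ T)
    {vt : ℝ → LΩ E3 2} (hvt : a.IsTimeDeriv T vt) {f : ℝ → LΩ E3 (expForce p)} (hf : a.ForceLimit f) :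
    ∀ᵐ t ∂vol[T], ∀ W ∈ J1 (expP p), weakResidual p (v t) (vt t) (f t) W = 0 := by
  have hp2 : expP p ≤ 2 := by
    rw [expP, show (2 : ℝ≥0∞) = ENNReal.ofReal 2 by simp]
    exact ENNReal.ofReal_le_ofReal p.2.2.le
  haveI : Fact (expP p ≠ ⊤) := ⟨ENNReal.ofReal_ne_top⟩
  haveI : SecondCountableTopology (LΩ E3 (expP p)) := Lp.SecondCountableTopology
  haveI : SecondCountableTopology (LΩ Mat3 (expP p)) := Lp.SecondCountableTopology
  have hp1 : (1 : ℝ) < p := by linarith [p.2.1]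
  have hcl : ∀ᵐ t ∂vol[T], IsClosed {W | W ∈ J1 (expP p) ∧ weakResidual p (v t) (vt t) (f t) W = 0} := by
    filter_upwards [ae_restrict_mem measurableSet_Ioo] with t ht
    exact isClosed_weakResidual_eq_zero (hv.mem t ht.1.le) _ _
  have := ae_forall_mem_closure (S := {U | ∃ n, ∃ φ ∈ X n, U = pairL (expP p) φ}) hcl (by
    rintro _ ⟨n, φ, hφ, rfl⟩
    filter_upwards [hv.weak_form_of_mem_X h hT hvt hf hφ] with t ht
    refine ⟨pairL_mem_J1 hφ.1, ?_⟩
    have hs := hφ.1.sp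
    have e1 : ∀ g : E3 → E3, (∫ x in cube, (inner ℝ (g x) ((pairL (expP p) φ).1 x) : ℝ)) = ∫ x in cube, inner ℝ (g x) (φ x) := by
      intro g
      refine integral_congr_ae ?_
      filter_upwards [coeFn_toL (hs.memLp (expP p))] with x hx
      simp only [pairL]; rw [hx]
    have e2 : (∫ x in cube, (inner ℝ (St p (sym ((v t).2 x))) (sym ((pairL (expP p) φ).2 x)) : ℝ)) =
        ∫ x in cube, inner ℝ (St p (sym ((v t).2 x))) (sg φ x) := by
      refine integral_congr_ae ?_
      filter_upwards [coeFn_toL (hs.grad.memLp (expP p))] with x hx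
      simp only [pairL]; rw [hx]; rfl
    simp only [weakResidual]
    rw [e1, e1, e1, e2, ht, sub_self])
  filter_upwards [this] with t ht W hW
  exact (ht W (J1_subset_closure hp2 hW)).2

end ApproxSeq

section Hessian

variable {p : Ico (5 / 3 : ℝ) 2}

/-- The inverse of the weight in `wgrad`. -/
def amp (μ p : ℝ) (A : Mat3) : ℝ := (μ + ‖A‖ ^ 2) ^ ((2 - p) / 2 / 2)

theorem continuous_amp {μ p : ℝ} (hμ : 0 < μ) : Continuous (amp μ p) := by
  unfold amp
  exact (by fun_prop : Continuous fun A : Mat3 => μ + ‖A‖ ^ 2).rpow_const fun A => Or.inl (by positivity)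

/-- The tensor representing a component of `hessL`. -/
def hessDual (i j k : Fin 3) : Ten3 := ContinuousLinearMap.adjoint hessL (EuclideanSpace.single (i, j, k) 1)

theorem inner_hessDual (i j k : Fin 3) (A : Ten3) : (inner ℝ A (hessDual i j k) : ℝ) = hessL A (i, j, k) := by
  rw [hessDual, ContinuousLinearMap.adjoint_inner_right, EuclideanSpace.inner_single_right]; simp

theorem amp_smul_wgrad {μ p : ℝ} (hμ : 0 < μ) (φ : E3 → E3) (x : E3) :
    amp μ p (sg φ x) • wgrad μ p φ x = tgrad (sg φ) x := by
  rw [wgrad, smul_smul, amp, wt, ← Real.rpow_add (by positivity)]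
  rw [show (2 - p) / 2 / 2 + ((p + 2) / 2 - 2) / 2 = 0 by ring, Real.rpow_zero, one_smul]

theorem integral_grad_mul_dd {μ p : ℝ} (hμ : 0 < μ) {φ : E3 → E3} (hφ : SP φ) {η : E3 → ℝ} (hη : SP η) (i j k : Fin 3) :
    ∫ x in cube, grad φ x (i, j) * dd k η x =
      -∫ x in cube, inner ℝ (wgrad μ p φ x) ((amp μ p (sg φ x) * η x) • hessDual i j k) := by
  have h := integral_inner_dd (hφ.grad.apply (i, j)) hη k
  have e1 : ∀ x, (inner ℝ (grad φ x (i, j)) (dd k η x) : ℝ) = grad φ x (i, j) * dd k η x := fun x => by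
    simp [mul_comm]
  simp_rw [e1] at h
  rw [← neg_eq_iff_eq_neg, ← h]
  refine integral_congr_ae (ae_of_all _ fun x => ?_)
  simp only
  rw [inner_smul_right, mul_comm (amp _ _ _), mul_assoc, ← real_inner_smul_left, amp_smul_wgrad hμ, inner_hessDual,
    hessL_apply, ← tgrad_grad_eq hφ, dd_apply hφ.grad]
  rfl

theorem memLp_norm_rpow_expAmp {g : E3 → Mat3} (hg : MemLp g 2 volΩ) :
    MemLp (fun x => ‖g x‖ ^ ((2 - (p : ℝ)) / 2)) (expAmp p) volΩ ∧
      nm (expAmp p) (fun x => ‖g x‖ ^ ((2 - (p : ℝ)) / 2)) = nm 2 g ^ ((2 - (p : ℝ)) / 2) := by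
  have hp2 := p.2.2
  have hα : 0 < (2 - (p : ℝ)) / 2 := by linarith
  have e : expAmp p * ENNReal.ofReal ((2 - (p : ℝ)) / 2) = 2 := by
    have : 4 / (2 - (p : ℝ)) * ((2 - (p : ℝ)) / 2) = 2 := by
      have : 2 - (p : ℝ) ≠ 0 := by linarith
      field_simp; norm_num
    rw [expAmp, ← ENNReal.ofReal_mul (by apply div_nonneg <;> linarith), this]; simp
  exact memLp_norm_rpow hα e hg

theorem continuous_ampLim :
    Continuous fun G : LΩ Mat3 2 => toL (expAmp p) fun x => ‖sym (G x)‖ ^ ((2 - (p : ℝ)) / 2) := by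
  have hp1 := p.2.1
  have hp2 := p.2.2
  have hα : 0 < (2 - (p : ℝ)) / 2 := by linarith
  have hm : ∀ G : LΩ Mat3 2, MemLp (fun x => ‖sym (G x)‖ ^ ((2 - (p : ℝ)) / 2)) (expAmp p) volΩ := fun G =>
    (memLp_norm_rpow_expAmp (memLp_sym (Lp.memLp G))).1
  refine continuous_of_norm_sub_le (c := 1) hα fun G G₀ => ?_
  rw [norm_toL_sub (hm G) (hm G₀), norm_sub_eq_nm, one_mul]
  obtain ⟨m1, e1⟩ := memLp_norm_rpow_expAmp (p := p) ((Lp.memLp G).sub (Lp.memLp G₀))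
  simp only [Pi.sub_apply] at m1 e1
  refine le_trans ?_ e1.le
  refine nm_mono m1 (ae_of_all _ fun x => ?_)
  have h := abs_rpow_weight_sub_le hα (by linarith : (2 - (p : ℝ)) / 2 ≤ 1) le_rfl (sym (G x)) (sym (G₀ x))
  have e : (0 + ‖sym (G x)‖ ^ 2) ^ ((2 - (p : ℝ)) / 2 / 2) = ‖sym (G x)‖ ^ ((2 - (p : ℝ)) / 2) := by
    rw [zero_add, ← Real.rpow_natCast_mul (norm_nonneg _)]; congr 1; push_cast; ring
  rw [e, Real.zero_rpow (by linarith), zero_add, ← sym_sub] at h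
  rw [Real.norm_eq_abs, Real.norm_of_nonneg (Real.rpow_nonneg (norm_nonneg _) _)]
  exact h.trans (Real.rpow_le_rpow (norm_nonneg _) (norm_sym_le _) hα.le)

/-- The bilinear map `(c, T) ↦ c • hessL T`. -/
def hessB : ℝ →L[ℝ] Ten3 →L[ℝ] Ten3 := (ContinuousLinearMap.id ℝ ℝ).smulRight hessL

/-- The Hessian, recovered from `∇𝒟v` weighted by a power of `|𝒟v|`. -/
def hessLim (p : Ico (5 / 3 : ℝ) 2) (G : LΩ Mat3 2) (Z : LΩ Ten3 2) : LΩ Ten3 (expHess p) :=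
  hessB.holderL volΩ (expAmp p) 2 (expHess p) (toL (expAmp p) fun x => ‖sym (G x)‖ ^ ((2 - (p : ℝ)) / 2)) Z

theorem coeFn_hessLim (G : LΩ Mat3 2) (Z : LΩ Ten3 2) :
    hessLim p G Z =ᵐ[volΩ] fun x => ‖sym (G x)‖ ^ ((2 - (p : ℝ)) / 2) • hessL (Z x) := by
  rw [hessLim, ContinuousLinearMap.holderL_apply_apply]
  filter_upwards [ContinuousLinearMap.coeFn_holder (r := expHess p) hessB
    (toL (expAmp p) fun x => ‖sym (G x)‖ ^ ((2 - (p : ℝ)) / 2)) Z,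
    coeFn_toL (memLp_norm_rpow_expAmp (p := p) (memLp_sym (Lp.memLp G))).1] with x h1 h2
  rw [h1, h2]; rfl

theorem memLp_hessLim {T : ℝ} {G : ℝ → LΩ Mat3 2} (hG : ContinuousOn G (Icc 0 T)) {Z : ℝ → LΩ Ten3 2}
    (hZ : MemLp Z 2 vol[T]) :
    MemLp (fun t => hessLim p (G t) (Z t)) 2 vol[T] := by
  have hc : ContinuousOn (fun t => hessB.holderL volΩ (expAmp p) 2 (expHess p)
      (toL (expAmp p) fun x => ‖sym (G t x)‖ ^ ((2 - (p : ℝ)) / 2))) (Icc 0 T) :=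
    (ContinuousLinearMap.continuous _).comp_continuousOn (continuous_ampLim.comp_continuousOn hG)
  obtain ⟨M, hM⟩ := isCompact_Icc.exists_bound_of_continuousOn hc
  have hm := (hc.mono Ioo_subset_Icc_self).aestronglyMeasurable (μ := volume) measurableSet_Ioo
  refine hZ.of_le_mul (c := M) ?_ ?_
  · exact isBoundedBilinearMap_apply.continuous.comp_aestronglyMeasurable (hm.prodMk hZ.1)
  · filter_upwards [ae_restrict_mem measurableSet_Ioo] with t ht
    exact ContinuousLinearMap.le_of_opNorm_le _ (hM t (Ioo_subset_Icc_self ht)) _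

/-- The test function paired with `wgrad`. -/
def ampTest (μ p : ℝ) (φ : E3 → E3) (η : E3 → ℝ) (N : Ten3) (x : E3) : Ten3 := (amp μ p (sg φ x) * η x) • N

/-- The limit of `ampTest`. -/
def ampTestLim (p : ℝ) (G : E3 → Mat3) (η : E3 → ℝ) (N : Ten3) (x : E3) : Ten3 :=
  (‖sym (G x)‖ ^ ((2 - p) / 2) * η x) • N

theorem memLp_ampTestLim {G : E3 → Mat3} (hG : MemLp G 2 volΩ) {η : E3 → ℝ} (hη : SP η) (N : Ten3) :
    MemLp (ampTestLim p G η N) 2 volΩ := by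
  have hα : 0 < (2 - (p : ℝ)) / 2 := by linarith [p.2.2]
  have hm := (nm_rpow_le hα (by linarith [p.2.1]) (memLp_sym hG)).1
  obtain ⟨M, hM0, hM⟩ := hη.exists_bound
  refine MemLp.of_le_mul (c := M * ‖N‖) hm ((hm.1.mul hη.continuous.aestronglyMeasurable).smul_const N) ?_
  filter_upwards [ae_restrict_mem measurableSet_cube] with x hx
  rw [ampTestLim, norm_smul, norm_mul]
  have := mul_le_mul_of_nonneg_right (hM x hx) (mul_nonneg (norm_nonneg (‖sym (G x)‖ ^ ((2 - (p : ℝ)) / 2))) (norm_nonneg N))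
  linarith

theorem nm_ampTest_sub_le {μ : ℝ} (hμ : 0 < μ) {φ : E3 → E3} (hφ : SP φ) (G : LΩ Mat3 2)
    {η : E3 → ℝ} {M : ℝ} (hM0 : 0 ≤ M) (hM : ∀ x ∈ cube, ‖η x‖ ≤ M) (N : Ten3) :
    nm 2 (fun x => ampTest μ p φ η N x - ampTestLim p G η N x) ≤
      M * ‖N‖ * (μ ^ ((2 - (p : ℝ)) / 2 / 2) + (nm 2 fun x => sg φ x - sym (G x)) ^ ((2 - (p : ℝ)) / 2)) := by
  have hα : 0 < (2 - (p : ℝ)) / 2 := by linarith [p.2.2]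
  have hα1 : (2 - (p : ℝ)) / 2 ≤ 1 := by linarith [p.2.1]
  have hd : MemLp (fun x => sg φ x - sym (G x)) 2 volΩ := (hφ.sg.memLp 2).sub (memLp_sym (Lp.memLp G))
  obtain ⟨m1, n1⟩ := nm_rpow_le hα hα1 hd
  set c : ℝ := μ ^ ((2 - (p : ℝ)) / 2 / 2)
  have hc : 0 ≤ c := by positivity
  have m0 : MemLp (fun _ : E3 => c) 2 volΩ := memLp_const c
  have m2 := MemLp.add m0 m1
  refine (nm_le_mul m2 (mul_nonneg hM0 (norm_nonneg N)) ?_).trans (mul_le_mul_of_nonneg_left ?_ (by positivity))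
  · filter_upwards [ae_restrict_mem measurableSet_cube] with x hx
    have h : |amp μ p (sg φ x) - ‖sym (G x)‖ ^ ((2 - (p : ℝ)) / 2)| ≤ _ :=
      abs_rpow_weight_sub_le hα hα1 hμ.le (sg φ x) (sym (G x))
    have h1 := mul_le_mul (h.trans (le_abs_self _)) (hM x hx) (norm_nonneg _) (abs_nonneg _)
    have e : ‖ampTest μ p φ η N x - ampTestLim p G η N x‖ =
        |amp μ p (sg φ x) - ‖sym (G x)‖ ^ ((2 - (p : ℝ)) / 2)| * ‖η x‖ * ‖N‖ := by
      rw [ampTest, ampTestLim, ← sub_smul, ← sub_mul, norm_smul, norm_mul, ← Real.norm_eq_abs]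
    rw [e]
    exact (mul_le_mul_of_nonneg_right h1 (norm_nonneg N)).trans_eq (by rw [Real.norm_eq_abs, mul_assoc, mul_comm, mul_comm M]; rfl)
  · refine (nm_add_le (by norm_num) m0 m1).trans ?_
    rw [nm_const _ (by norm_num), Real.norm_of_nonneg hc]
    exact add_le_add le_rfl n1

end Hessian

namespace ApproxSeq

variable {p : Ico (5 / 3 : ℝ) 2} {C C₀ Λ K κ T : ℝ} {a : ApproxSeq p Λ K} {v : ℝ → LΩ E3 2 × LΩ Mat3 2}

/-- `Z` is the weak limit of the weighted gradients of `𝒟v` on `(0,T)`. -/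
structure IsWgradLimit (a : ApproxSeq p Λ K) (T : ℝ) (Z : ℝ → LΩ Ten3 2) : Prop where
  memLp : MemLp Z 2 vol[T]
  tendsto : ∀ (ξ : ℕ → ℝ → LΩ Ten3 2) (ξ₀ : ℝ → LΩ Ten3 2), (∀ j, MemLp (ξ j) 2 vol[T]) → MemLp ξ₀ 2 vol[T] →
      Tendsto (fun j => ∫ t in Ioo 0 T, ‖ξ j t - ξ₀ t‖ ^ 2) atTop (𝓝 0) →
      Tendsto (fun j => ∫ t in Ioo 0 T, (inner ℝ (toL 2 (wgrad (visc Λ j) p ((a.γ j).v t))) (ξ j t) : ℝ))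
        (hyperfilter ℕ : Filter ℕ) (𝓝 (∫ t in Ioo 0 T, inner ℝ (Z t) (ξ₀ t)))

theorem exists_isWgradLimit (a : ApproxSeq p Λ K) (hS : SobolevConst p C) (h : SmallData p C Λ K κ) (hT : 0 ≤ T) :
    ∃ Z, a.IsWgradLimit T Z := by
  obtain ⟨M, hM0, hM⟩ := exists_time_bound hS h hT
  obtain ⟨j₀, hj₀⟩ := exists_nat_ge T
  have hc : ∀ j, Continuous fun t => toL 2 (wgrad (visc Λ j) p ((a.γ j).v t)) := fun j =>
    continuous_toL (by norm_num) ((a.γ j).continuous_wgrad (visc_pos h.pos j))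
  have hb : ∀ᶠ j in atTop, ∫ t in Ioo 0 T, ‖toL 2 (wgrad (visc Λ j) p ((a.γ j).v t))‖ ^ 2 ≤ M := by
    filter_upwards [eventually_ge_atTop j₀] with j hj
    obtain ⟨b, -⟩ := hM _ (visc_pos h.pos j) (visc_le h.pos _) _ _
      (hj₀.trans (by exact_mod_cast hj)) _ (a.γ j) (a.g_le _) (a.gal _)
    simp_rw [fun t => norm_toL ((((a.γ j).sp t).wgrad (p := p) (visc_pos h.pos j)).memLp 2),
      fun t => nm_wgrad_sq (p := p) (visc_pos h.pos j) ((a.γ j).sp t)]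
    rwa [intervalIntegral.integral_of_le hT, integral_Ioc_eq_integral_Ioo] at b
  obtain ⟨Z, hZ, hlim⟩ := exists_weakLim_time (fun j => memLp_Ioo_of_continuous (hc j) 2) hb
  exact ⟨Z, hZ, hlim⟩

theorem IsLimit.inner_grad_eq (hv : a.IsLimit v) (h : SmallData p C Λ K κ) (hT : 0 ≤ T) {Z : ℝ → LΩ Ten3 2}
    (hZ : a.IsWgradLimit T Z) {η : E3 → ℝ} (hη : SP η) (i j k : Fin 3) :
    ∀ᵐ t ∂vol[T], ∫ x in cube, (v t).2 x (i, j) * dd k η x =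
      -∫ x in cube, inner ℝ (Z t x) (ampTestLim p (v t).2 η (hessDual i j k) x) := by
  have hΛ := h.pos
  have hα : 0 < (2 - (p : ℝ)) / 2 := by linarith [p.2.2]
  set N := hessDual i j k
  set e : Mat3 := EuclideanSpace.single (i, j) 1
  obtain ⟨M, hM0, hM⟩ := hη.exists_bound
  obtain ⟨j₀, hj₀⟩ := exists_nat_ge T
  have hTj : ∀ n, j₀ ≤ n → T ≤ (n : ℝ) := fun n hn => hj₀.trans (by exact_mod_cast hn)
  have hη' : SP fun x => dd k η x • e := (hη.dd k).smul (SP.const e)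
  have hin : ∀ u : LΩ Mat3 2, (inner ℝ u (toL 2 fun x => dd k η x • e) : ℝ) = ∫ x in cube, u x (i, j) * dd k η x := by
    intro u
    rw [inner_toL_right _ (hη'.memLp 2)]
    refine integral_congr_ae (ae_of_all _ fun x => ?_)
    simp only [e]
    rw [inner_smul_right, EuclideanSpace.inner_single_right]; simp [mul_comm]
  have mlim : ∀ t, MemLp (ampTestLim p (v t).2 η N) 2 volΩ := fun t => memLp_ampTestLim (Lp.memLp (v t).2) hη N
  have cT : ∀ n, Continuous fun z : ℝ × E3 => ampTest (visc Λ n) p ((a.γ n).v z.1) η N z.2 := fun n =>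
    ((((continuous_amp (visc_pos hΛ n)).comp (a.γ n).continuous_sg).mul (hη.continuous.comp continuous_snd)).smul
      continuous_const)
  have mT : ∀ n t, MemLp (ampTest (visc Λ n) p ((a.γ n).v t) η N) 2 volΩ := fun n t =>
    memLp_of_continuous ((cT n).comp (Continuous.prodMk_right t)) 2
  let ξ : ℕ → ℝ → LΩ Ten3 2 := fun n t => toL 2 (ampTest (visc Λ n) p ((a.γ n).v t) η N)
  let ξ₀ : ℝ → LΩ Ten3 2 := fun t => toL 2 (ampTestLim p (v t).2 η N)
  have cξ : ∀ n, Continuous (ξ n) := fun n =>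
    continuous_toL (by norm_num) (cT n)
  have hdist : ∀ n t, ‖ξ n t - ξ₀ t‖ ≤ M * ‖N‖ * (visc Λ n ^ ((2 - (p : ℝ)) / 2 / 2) +
      (nm 2 fun x => sg ((a.γ n).v t) x - sym ((v t).2 x)) ^ ((2 - (p : ℝ)) / 2)) := by
    intro n t
    simp only [ξ, ξ₀]
    rw [norm_toL_sub (mT n t) (mlim t)]
    exact nm_ampTest_sub_le (visc_pos hΛ n) ((a.γ n).sp t) _ hM0 hM N
  have hpt : ∀ᵐ t ∂vol[T], Tendsto (fun n => ‖ξ n t - ξ₀ t‖) atTop (𝓝 0) := by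
    filter_upwards [hv.ae_grad T hT] with t hG
    have h1 := (tendsto_nm_sg (fun n => (a.γ n).sp t) hG).rpow_const (p := (2 - (p : ℝ)) / 2) (Or.inr hα.le)
    have h2 := ((tendsto_visc_rpow (Λ := Λ) (s := (2 - (p : ℝ)) / 2 / 2) (by linarith)).add h1).const_mul (M * ‖N‖)
    rw [Real.zero_rpow hα.ne', add_zero, mul_zero] at h2
    exact squeeze_zero (fun _ => norm_nonneg _) (fun n => hdist n t) h2
  set B := M * ‖N‖ * (1 + (2 * √Λ) ^ ((2 - (p : ℝ)) / 2))
  have hbd : ∀ n, j₀ ≤ n → ∀ t ∈ Ioo 0 T, ‖ξ n t - ξ₀ t‖ ≤ B := by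
    intro n hn t ht
    refine (hdist n t).trans (mul_le_mul_of_nonneg_left (add_le_add ?_ ?_) (by positivity))
    · exact Real.rpow_le_one (visc_pos hΛ n).le (visc_le_one n) (by linarith)
    · refine Real.rpow_le_rpow (nm_nonneg _ _) ?_ hα.le
      have hsp := (a.γ n).sp t
      have b1 := a.norm_grad_le (j := n) (t := t) ⟨ht.1.le, ht.2.le.trans (hTj n hn)⟩
      rw [norm_toL (hsp.grad.memLp 2)] at b1
      have b2 : nm 2 (v t).2 ≤ √Λ := by
        rw [← norm_eq_nm]; exact Real.le_sqrt_of_sq_le (hv.bound t ht.1.le)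
      refine (nm_sub_le (by norm_num) (hsp.sg.memLp 2) (memLp_sym (Lp.memLp (v t).2))).trans ?_
      have b3 := nm_sg_le hsp 2
      have b4 := nm_mono (f := fun x => sym ((v t).2 x)) (Lp.memLp (v t).2) (ae_of_all _ fun x => norm_sym_le _)
      linarith
  have hξm : AEStronglyMeasurable ξ₀ vol[T] :=
    aestronglyMeasurable_of_tendsto_ae atTop (fun n => (cξ n).aestronglyMeasurable) (by
      filter_upwards [hpt] with t ht
      exact tendsto_iff_norm_sub_tendsto_zero.2 ht)
  have hξ : ∀ n, MemLp (ξ n) 2 vol[T] := fun n => memLp_Ioo_of_continuous (cξ n) 2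
  have hξ₀ : MemLp ξ₀ 2 vol[T] := by
    have : MemLp (fun t => ξ j₀ t - ξ₀ t) 2 vol[T] := MemLp.of_bound ((hξ j₀).1.sub hξm) B (by
        filter_upwards [ae_restrict_mem measurableSet_Ioo] with t ht using hbd j₀ le_rfl t ht)
    have h2 := (hξ j₀).sub this
    refine h2.ae_eq (ae_of_all _ fun t => ?_)
    simp
  have hconv : ∀ s, MeasurableSet s →
      Tendsto (fun n => ∫ t in Ioo 0 T, ‖s.indicator (ξ n) t - s.indicator ξ₀ t‖ ^ 2) atTop (𝓝 0) := by
    intro s hs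
    have h1 := tendsto_integral_filter_of_dominated_convergence (l := atTop) (μ := vol[T])
      (F := fun n t => ‖s.indicator (ξ n) t - s.indicator ξ₀ t‖ ^ 2) (f := fun _ => 0) (fun _ => B ^ 2)
      (Eventually.of_forall fun n => (((hξ n).1.indicator hs).sub (hξm.indicator hs)).norm.pow 2) (by
        filter_upwards [eventually_ge_atTop j₀] with n hn
        filter_upwards [ae_restrict_mem measurableSet_Ioo] with t ht
        have := hbd n hn t ht
        rw [norm_pow, norm_norm]
        refine pow_le_pow_left₀ (norm_nonneg _) ?_ 2
        by_cases hts : t ∈ s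
        · simpa [hts] using this
        · simpa [hts] using (norm_nonneg _).trans this) (integrable_const _) (by
        filter_upwards [hpt] with t ht
        by_cases hts : t ∈ s
        · simpa [hts] using ht.pow 2
        · simp [hts])
    simpa using h1
  have hkeq : ∀ n t, (inner ℝ (toL 2 (grad ((a.γ n).v t))) (toL 2 fun x => dd k η x • e) : ℝ) =
      -inner ℝ (toL 2 (wgrad (visc Λ n) p ((a.γ n).v t))) (ξ n t) := by
    intro n t
    have hsp := (a.γ n).sp t
    rw [hin, inner_toL ((hsp.wgrad (visc_pos hΛ n)).memLp 2) (mT n t)]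
    have := integral_grad_mul_dd (p := p) (visc_pos hΛ n) hsp hη i j k
    refine Eq.trans (integral_congr_ae ?_) this
    filter_upwards [coeFn_toL (hsp.grad.memLp 2)] with x hx
    rw [hx]
  obtain ⟨ci, clim⟩ := tendsto_setIntegral_of_bounded (T := T)
    (k := fun n t => (inner ℝ (toL 2 (grad ((a.γ n).v t))) (toL 2 fun x => dd k η x • e) : ℝ))
    (c := fun t => inner ℝ (v t).2 (toL 2 fun x => dd k η x • e)) (B := √Λ * ‖toL 2 fun x => dd k η x • e‖)
    (fun n => (continuous_toL (by norm_num) (a.γ n).continuous_grad).inner continuous_const) (by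
      filter_upwards [eventually_ge_atTop j₀] with n hn t ht
      exact (abs_real_inner_le_norm _ _).trans (mul_le_mul_of_nonneg_right
        (a.norm_grad_le ⟨ht.1.le, ht.2.le.trans (hTj n hn)⟩) (norm_nonneg _))) (by
      filter_upwards [hv.ae_grad T hT] with t hG
      exact hG.inner tendsto_const_nhds)
  have iZ : Integrable (fun t => (inner ℝ (Z t) (ξ₀ t) : ℝ)) vol[T] :=
    memLp_one_iff_integrable.1 (MemLp.of_bilin (r := 1) (fun x y => (inner ℝ x y : ℝ)) 1 hZ.memLp hξ₀
      (hZ.memLp.1.inner hξ₀.1) (ae_of_all _ fun t => by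
        rw [one_mul]; exact nnnorm_inner_le_nnnorm _ _))
  have hzero : (fun t => (inner ℝ (v t).2 (toL 2 fun x => dd k η x • e) : ℝ) + inner ℝ (Z t) (ξ₀ t)) =ᵐ[vol[T]] 0 := by
    refine Integrable.ae_eq_zero_of_forall_setIntegral_eq_zero (ci.add iZ) fun s hs _ => ?_
    have h1 := hZ.tendsto (fun n => s.indicator (ξ n)) (s.indicator ξ₀) (fun n => (hξ n).indicator hs)
      (hξ₀.indicator hs) (hconv s hs)
    simp_rw [integral_inner_indicator hs] at h1
    have h2 := (clim s hs).mono_left Nat.hyperfilter_le_atTop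
    simp_rw [hkeq, integral_neg] at h2
    have h3 := tendsto_nhds_unique h2 h1.neg
    rw [integral_add ci.integrableOn iZ.integrableOn, h3, neg_add_cancel]
  filter_upwards [hzero] with t ht
  simp only [Pi.zero_apply, ξ₀] at ht
  rw [hin, inner_toL_right _ (mlim t)] at ht
  linarith

theorem IsLimit.exists_hessian (hv : a.IsLimit v) (hS : SobolevConst p C) (h : SmallData p C Λ K κ) (hT : 0 ≤ T) :
    ∃ H : ℝ → LΩ Ten3 (expHess p), MemLp H 2 vol[T] ∧ ∀ᵐ t ∂vol[T], IsWeakGradOfTensor (v t).2 (H t) := by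
  obtain ⟨Z, hZ⟩ := a.exists_isWgradLimit hS h hT
  refine ⟨fun t => hessLim p (v t).2 (Z t),
    memLp_hessLim (continuous_snd.comp_continuousOn (hv.continuousOn hS h hT)) hZ.memLp, ?_⟩
  haveI : Fact (expForce p ≠ ⊤) := ⟨ENNReal.ofReal_ne_top⟩
  haveI : Fact ((2 : ℝ≥0∞) ≠ ⊤) := ⟨by norm_num⟩
  haveI : SecondCountableTopology (LΩ ℝ (expForce p)) := Lp.SecondCountableTopology
  haveI : SecondCountableTopology (LΩ ℝ 2) := Lp.SecondCountableTopology
  have key : ∀ i j k, ∀ᵐ t ∂vol[T], ∀ u ∈ closure {u : LΩ ℝ (expForce p) × LΩ ℝ 2 |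
      ∃ η, SP η ∧ u = (toL _ η, toL 2 (dd k η))},
      (∫ x in cube, inner ℝ (u.2 x) ((v t).2 x (i, j))) + ∫ x in cube, inner ℝ (u.1 x) (hessLim p (v t).2 (Z t) x (i, j, k)) =
        (0 : ℝ) := by
    intro i j k
    refine ae_forall_mem_closure (ae_of_all _ fun t => ?_) ?_
    · have m1 : MemLp (fun x => (v t).2 x (i, j)) 2 volΩ :=
        (EuclideanSpace.proj (𝕜 := ℝ) (i, j) : Mat3 →L[ℝ] ℝ).comp_memLp' (Lp.memLp (v t).2)
      have m2 : MemLp (fun x => hessLim p (v t).2 (Z t) x (i, j, k)) (expHess p) volΩ :=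
        (EuclideanSpace.proj (𝕜 := ℝ) (i, j, k) : Ten3 →L[ℝ] ℝ).comp_memLp' (Lp.memLp (hessLim p (v t).2 (Z t)))
      exact isClosed_eq (((continuous_integral_inner (a := 2) m1).comp continuous_snd).add
        ((continuous_integral_inner (a := expForce p) m2).comp continuous_fst)) continuous_const
    · rintro _ ⟨η, hη, rfl⟩
      filter_upwards [hv.inner_grad_eq h hT hZ hη i j k] with t ht
      have e1 : (∫ x in cube, (inner ℝ (toL 2 (dd k η) x) ((v t).2 x (i, j)) : ℝ)) = ∫ x in cube, (v t).2 x (i, j) * dd k η x := by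
        refine integral_congr_ae ?_
        filter_upwards [coeFn_toL ((hη.dd k).memLp 2)] with x hx
        rw [hx]; simp [mul_comm]
      have e2 : (∫ x in cube, (inner ℝ (toL (expForce p) η x) (hessLim p (v t).2 (Z t) x (i, j, k)) : ℝ)) =
          ∫ x in cube, inner ℝ (Z t x) (ampTestLim p (v t).2 η (hessDual i j k) x) := by
        refine integral_congr_ae ?_
        filter_upwards [coeFn_toL (hη.memLp (expForce p)), coeFn_hessLim (p := p) (v t).2 (Z t)] with x hx hx2
        rw [hx, hx2, ampTestLim, inner_smul_right, inner_hessDual]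
        simp; ring
      rw [e1, e2, ht, neg_add_cancel]
  have := ae_all_iff.2 fun i => ae_all_iff.2 fun j => ae_all_iff.2 fun k => key i j k
  filter_upwards [this] with t ht η hη hηp i j k
  have hs : SP η := ⟨hη, hηp⟩
  have h1 := ht i j k (toL _ η, toL 2 (dd k η)) (subset_closure ⟨η, hs, rfl⟩)
  have e1 : (∫ x in cube, (inner ℝ (toL 2 (dd k η) x) ((v t).2 x (i, j)) : ℝ)) = ∫ x in cube, (v t).2 x (i, j) * pderiv k η x := by
    refine integral_congr_ae ?_
    filter_upwards [coeFn_toL ((hs.dd k).memLp 2)] with x hx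
    rw [hx, RCLike.inner_apply, conj_trivial]; rfl
  have e2 : (∫ x in cube, (inner ℝ (toL (expForce p) η x) (hessLim p (v t).2 (Z t) x (i, j, k)) : ℝ)) =
      ∫ x in cube, hessLim p (v t).2 (Z t) x (i, j, k) * η x := by
    refine integral_congr_ae ?_
    filter_upwards [coeFn_toL (hs.memLp (expForce p))] with x hx
    rw [hx]; simp [mul_comm]
  simp only [e1, e2] at h1
  linarith

end ApproxSeq

/-- The radial retraction onto a ball. -/
def retract {E : Type} [NormedAddCommGroup E] [NormedSpace ℝ E] (K : ℝ) (y : E) : E := (K / max K ‖y‖) • y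

section Retract

variable {E : Type} [NormedAddCommGroup E] [NormedSpace ℝ E] {K : ℝ}

theorem norm_retract_le (hK : 0 < K) (y : E) : ‖retract K y‖ ≤ K := by
  have h1 : 0 < max K ‖y‖ := lt_max_of_lt_left hK
  rw [retract, norm_smul, Real.norm_of_nonneg (by positivity), div_mul_eq_mul_div, div_le_iff₀ h1]
  exact mul_le_mul_of_nonneg_left (le_max_right _ _) hK.le

theorem continuous_retract (hK : 0 < K) : Continuous (retract K : E → E) := by
  unfold retract
  exact (continuous_const.div (by fun_prop) fun y => (lt_max_of_lt_left hK).ne').smul continuous_id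

theorem norm_retract_sub_le (hK : 0 < K) {x : E} (hx : ‖x‖ ≤ K) (y : E) : ‖retract K y - x‖ ≤ 2 * ‖y - x‖ := by
  have h1 : ‖retract K y - y‖ ≤ ‖y - x‖ := by
    rcases le_total ‖y‖ K with h | h
    · rw [retract, max_eq_left h, div_self hK.ne', one_smul, sub_self, norm_zero]; exact norm_nonneg _
    · have hy : 0 < ‖y‖ := hK.trans_le h
      have e : retract K y - y = (K / ‖y‖ - 1) • y := by rw [retract, max_eq_right h, sub_smul, one_smul]
      have h2 : K / ‖y‖ - 1 ≤ 0 := by rw [sub_nonpos, div_le_one hy]; exact h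
      rw [e, norm_smul, Real.norm_of_nonpos h2, neg_sub, sub_mul, one_mul, div_mul_cancel₀ _ hy.ne']
      linarith [norm_sub_norm_le y x]
  calc ‖retract K y - x‖ = ‖(retract K y - y) + (y - x)‖ := by congr 1; abel
    _ ≤ _ := (norm_add_le _ _).trans (by linarith)

theorem exists_continuous_integral_sub_le {μ : Measure ℝ} [IsFiniteMeasure μ] {f : ℝ → E} (hf : Integrable f μ)
    (hK : 0 ≤ K) (hfK : ∀ᵐ t ∂μ, ‖f t‖ ≤ K) {ε : ℝ} (hε : 0 < ε) :
    ∃ g : ℝ → E, Continuous g ∧ (∀ t, ‖g t‖ ≤ K) ∧ ∫ t, ‖g t - f t‖ ∂μ ≤ ε := by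
  rcases hK.eq_or_lt with rfl | hK
  · refine ⟨0, continuous_zero, fun t => by simp, ?_⟩
    have : ∫ t, ‖(0 : ℝ → E) t - f t‖ ∂μ = 0 := by
      refine integral_eq_zero_of_ae ?_
      filter_upwards [hfK] with t ht
      simpa using ht
    rw [this]; exact hε.le
  · obtain ⟨g, hg, hgi⟩ := hf.exists_boundedContinuous_integral_sub_le (half_pos hε)
    refine ⟨fun t => retract K (g t), (continuous_retract hK).comp g.continuous, fun t => norm_retract_le hK _, ?_⟩
    calc ∫ t, ‖retract K (g t) - f t‖ ∂μ ≤ ∫ t, 2 * ‖f t - g t‖ ∂μ := by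
          refine integral_mono_of_nonneg (ae_of_all _ fun t => norm_nonneg _) ((hf.sub hgi).norm.const_mul 2) ?_
          filter_upwards [hfK] with t ht
          rw [norm_sub_rev (f t)]
          exact norm_retract_sub_le hK ht _
      _ ≤ ε := by rw [integral_const_mul]; linarith

end Retract

section Data

variable {p : Ico (5 / 3 : ℝ) 2} {C Λ K κ : ℝ}

theorem SmallData.lt_one (h : SmallData p C Λ K κ) (hC : 1 ≤ C) : Λ < 1 := by
  by_contra! hΛ
  have h1 := p.2.1
  have h2 := p.2.2
  have hr : (2 * Λ) ^ (-((2 - (p : ℝ)) / 2)) ≤ 1 := Real.rpow_le_one_of_one_le_of_nonpos (by linarith) (by linarith)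
  have hκ : κ ≤ 1 / 8 := by
    rw [h.kappa]
    calc ((p : ℝ) - 1) / 8 * (2 * Λ) ^ (-((2 - (p : ℝ)) / 2)) ≤ ((p : ℝ) - 1) / 8 * 1 :=
          mul_le_mul_of_nonneg_left hr (by linarith)
      _ ≤ 1 / 8 := by linarith
  have h3 : 1 ≤ √Λ := Real.one_le_sqrt.2 hΛ
  have h4 : (1 : ℝ) ≤ C ^ 2 := one_le_pow₀ hC
  have h5 : 1 ≤ C ^ 2 * √Λ := one_le_mul_of_one_le_of_one_le h4 h3
  linarith [h.conv]

theorem exists_initial_seq (hΛ1 : Λ < 1) {v₀ : LΩ E3 2 × LΩ Mat3 2} (hv₀ : v₀ ∈ J1 2) (hv₀Λ : ‖v₀.2‖ ^ 2 < Λ) :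
    ∃ ψ : ℕ → E3 → E3, (∀ j, ψ j ∈ X (4096 ^ j)) ∧ (∀ j, nm 2 (grad (ψ j)) ^ 2 ≤ Λ) ∧
      ∀ j, ‖toL 2 (ψ j) - v₀.1‖ ≤ 5 / 4 * (1 / 4) ^ j := by
  obtain ⟨φ, hφ, hlim⟩ := exists_test_seq hv₀
  have h1 : ∀ᶠ n in atTop, ‖toL 2 (grad (φ n))‖ ^ 2 < Λ :=
    (((continuous_snd.tendsto v₀).comp hlim).norm.pow 2).eventually_lt_const hv₀Λ
  have h2 := tendsto_iff_norm_sub_tendsto_zero.1 ((continuous_fst.tendsto v₀).comp hlim)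
  have key : ∀ j : ℕ, ∃ ψ ∈ X (4096 ^ j), nm 2 (grad ψ) ^ 2 ≤ Λ ∧ ‖toL 2 ψ - v₀.1‖ ≤ 5 / 4 * (1 / 4 : ℝ) ^ j := by
    intro j
    obtain ⟨n, hn1, hn2⟩ := (h1.and (h2.eventually_lt_const (by positivity : (0 : ℝ) < 1 / 4 * (1 / 4) ^ j))).exists
    have hs := (hφ n).sp
    rw [norm_toL (hs.grad.memLp 2)] at hn1
    obtain ⟨ψ, hψ, -, d, e, -⟩ := exists_projection_nm (n := 4096 ^ j) (Nat.one_le_pow _ _ (by norm_num)) (hφ n)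
    have hψs := hψ.1.sp
    refine ⟨ψ, hψ, (pow_le_pow_left₀ (nm_nonneg _ _) e 2).trans hn1.le, ?_⟩
    have h3 : nm 2 (grad (φ n)) ≤ 1 := by
      by_contra! hc
      exact absurd (hn1.trans hΛ1) (not_lt.2 (one_le_pow₀ hc.le))
    have h4 : (((4096 ^ j : ℕ) : ℝ))⁻¹ ≤ (1 / 4) ^ j := by
      push_cast
      rw [← inv_pow]
      exact pow_le_pow_left₀ (by norm_num) (by norm_num) j
    have h5 : ‖toL 2 (φ n) - toL 2 ψ‖ ≤ (1 / 4) ^ j := by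
      rw [norm_toL_sub (hs.memLp 2) (hψs.memLp 2)]
      calc _ ≤ _ := d
        _ ≤ (1 / 4 : ℝ) ^ j * 1 := mul_le_mul h4 h3 (nm_nonneg _ _) (by positivity)
        _ = _ := mul_one _
    have h6 : ‖toL 2 (φ n) - v₀.1‖ < 1 / 4 * (1 / 4) ^ j := hn2
    calc ‖toL 2 ψ - v₀.1‖ = ‖(toL 2 (φ n) - v₀.1) - (toL 2 (φ n) - toL 2 ψ)‖ := by congr 1; abel
      _ ≤ _ := (norm_sub_le _ _).trans (by linarith)
  choose ψ hψ using key
  exact ⟨ψ, fun j => (hψ j).1, fun j => (hψ j).2.1, fun j => (hψ j).2.2⟩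

theorem exists_approxSeq (hS : SobolevConst p C) (h : SmallData p C Λ K κ) {f : ℝ → LΩ E3 (expForce p)}
    (hf : MemLp f ⊤ (volume.restrict (Ioi 0))) (hfK : ∀ᵐ t ∂volume.restrict (Ioi (0 : ℝ)), ‖f t‖ ≤ K)
    {v₀ : LΩ E3 2 × LΩ Mat3 2} (hv₀ : v₀ ∈ J1 2) (hv₀Λ : ‖v₀.2‖ ^ 2 < Λ) :
    ∃ a : ApproxSeq p Λ K, a.ForceLimit f ∧ Tendsto (fun j => toL 2 ((a.γ j).v 0)) atTop (𝓝 v₀.1) := by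
  have hΛ := h.pos
  have hsub : ∀ T : ℝ, vol[T] ≤ volume.restrict (Ioi (0 : ℝ)) := fun T =>
    Measure.restrict_mono (fun t ht => ht.1) le_rfl
  have hfi : ∀ T : ℝ, Integrable f vol[T] := fun T =>
    (hf.mono_measure (hsub T)).integrable (by simp)
  have key : ∀ j : ℕ, ∃ g : ℝ → LΩ E3 (expForce p), Continuous g ∧ (∀ t, ‖g t‖ ≤ K) ∧
      ∫ t in Ioo 0 ((j : ℝ) + 1), ‖g t - f t‖ ≤ (1 / 16) ^ j := fun j =>
    exists_continuous_integral_sub_le (hfi _) h.nonneg (ae_mono (hsub _) hfK) (by positivity)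
  choose g hgc hgK hgf using key
  obtain ⟨ψ, hψ, hψΛ, hψv⟩ := exists_initial_seq (h.lt_one hS.one_le) hv₀ hv₀Λ
  have hgal := fun j : ℕ => exists_galerkin hS h (visc_pos hΛ j) (visc_le hΛ j) (Nat.cast_nonneg j) (hgc j) (hgK j)
    (hψ j) (hψΛ j)
  choose γ hγ hγ0 using hgal
  have hint : ∀ (j : ℕ) (T : ℝ), Integrable (fun t => ‖g j t - f t‖) vol[T] := fun j T =>
    ((memLp_one_iff_integrable.1 (memLp_Ioo_of_continuous (hgc j) 1)).sub (hfi T)).norm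
  have hmono : ∀ (j : ℕ) (T : ℝ), T ≤ j + 1 → ∫ t in Ioo 0 T, ‖g j t - f t‖ ≤ (1 / 16) ^ j := fun j T hT =>
    (setIntegral_mono_set (hint j _) (ae_of_all _ fun t => norm_nonneg _)
      (Ioo_subset_Ioo_right hT).eventuallyLE).trans (hgf j)
  refine ⟨⟨g, hgc, hgK, fun j => ?_, γ, hγ, fun j => ?_⟩, ⟨hfi, fun T => ?_⟩, ?_⟩
  · rw [intervalIntegral.integral_of_le (Nat.cast_nonneg j), integral_Ioc_eq_integral_Ioo]
    calc ∫ t in Ioo 0 (j : ℝ), ‖g (j + 1) t - g j t‖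
        ≤ ∫ t in Ioo 0 (j : ℝ), (‖g (j + 1) t - f t‖ + ‖g j t - f t‖) := by
          refine integral_mono_of_nonneg (ae_of_all _ fun t => norm_nonneg _) ((hint _ _).add (hint _ _))
            (ae_of_all _ fun t => ?_)
          simp only
          rw [norm_sub_rev (g j t) (f t)]
          exact norm_sub_le_norm_sub_add_norm_sub _ _ _
      _ ≤ (1 / 16) ^ (j + 1) + (1 / 16) ^ j := by
          rw [integral_add (hint _ _) (hint _ _)]
          exact add_le_add (hmono _ _ (by push_cast; linarith)) (hmono _ _ (by linarith))
      _ ≤ 4 * (1 / 16) ^ j := by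
          rw [pow_succ]; linarith [pow_pos (by norm_num : (0 : ℝ) < 1 / 16) j]
  · simp only [hγ0]
    rw [← norm_toL_sub ((hψ _).1.sp.memLp 2) ((hψ _).1.sp.memLp 2)]
    have h1 : ‖toL 2 (ψ (j + 1)) - toL 2 (ψ j)‖ ≤ 2 * (1 / 4) ^ j := by
      calc ‖toL 2 (ψ (j + 1)) - toL 2 (ψ j)‖ = ‖(toL 2 (ψ (j + 1)) - v₀.1) - (toL 2 (ψ j) - v₀.1)‖ := by congr 1; abel
        _ ≤ 5 / 4 * (1 / 4) ^ (j + 1) + 5 / 4 * (1 / 4) ^ j := (norm_sub_le _ _).trans (add_le_add (hψv _) (hψv _))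
        _ ≤ _ := by rw [pow_succ]; linarith [pow_pos (by norm_num : (0 : ℝ) < 1 / 4) j]
    calc _ ≤ (2 * (1 / 4 : ℝ) ^ j) ^ 2 := pow_le_pow_left₀ (norm_nonneg _) h1 2
      _ = 4 * (1 / 16) ^ j := by rw [mul_pow, ← pow_mul, mul_comm j 2, pow_mul]; norm_num
  · obtain ⟨j₀, hj₀⟩ := exists_nat_ge T
    refine squeeze_zero' (Eventually.of_forall fun j => integral_nonneg fun t => norm_nonneg _) ?_
      (tendsto_pow_atTop_nhds_zero_of_lt_one (by norm_num : (0 : ℝ) ≤ 1 / 16) (by norm_num))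
    filter_upwards [eventually_ge_atTop j₀] with j hj
    have : (j₀ : ℝ) ≤ j := by exact_mod_cast hj
    exact hmono j T (by linarith)
  · simp only [hγ0]
    rw [tendsto_iff_norm_sub_tendsto_zero]
    have := (tendsto_pow_atTop_nhds_zero_of_lt_one (by norm_num : (0 : ℝ) ≤ 1 / 4) (by norm_num)).const_mul (5 / 4)
    rw [mul_zero] at this
    exact squeeze_zero (fun _ => norm_nonneg _) hψv this

end Data

section Main

variable {p : Ico (5 / 3 : ℝ) 2} {C C₀ Λ K κ : ℝ}

theorem SobolevConst.mono (hS : SobolevConst p C) {C' : ℝ} (h : C ≤ C') : SobolevConst p C' :=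
  ⟨hS.one_le.trans h, fun φ hφ h0 => (hS.vel φ hφ h0).trans (mul_le_mul_of_nonneg_right h (nm_nonneg _ _)),
    fun φ hφ => (hS.grad φ hφ).trans (mul_le_mul_of_nonneg_right h (nm_nonneg _ _))⟩

theorem kornConst_of_isKornConstant (hS : SobolevConst p C) (hK : IsKornConstant (expHess p) C₀) :
    KornConst p (C * (1 + C₀)) C₀ := by
  have hC := hS.one_le
  have h1 : ∀ φ : E3 → E3, IsSolenoidalTest φ → nm (expHess p) (grad φ) ≤ C₀ * nm (expHess p) (sg φ) := by
    intro φ hφ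
    have h := ENNReal.toReal_mono (ENNReal.mul_ne_top ENNReal.ofReal_ne_top (hφ.sp.sg.memLp (expHess p)).2.ne)
      (hK.2 φ hφ.smooth hφ.periodic)
    rwa [ENNReal.toReal_mul, ENNReal.toReal_ofReal hK.1.le] at h
  refine ⟨hK.1, h1, fun φ hφ => (hS.vel φ hφ.sp hφ.mean_zero).trans ?_⟩
  have h2 := nm_nonneg (expHess p) (sg φ)
  calc C * nm (expHess p) (grad φ) ≤ C * (C₀ * nm (expHess p) (sg φ)) :=
        mul_le_mul_of_nonneg_left (h1 φ hφ) (by linarith)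
    _ = C * C₀ * nm (expHess p) (sg φ) := by ring
    _ ≤ C * (1 + C₀) * nm (expHess p) (sg φ) := mul_le_mul_of_nonneg_right (by linarith) h2

theorem smallData_of_lt (hC : 1 ≤ C) (hΛ : 0 < Λ) (hK : 0 ≤ K)
    (h1 : Λ < ((p : ℝ) / (8 * (505 * C ^ 2))) ^ (2 / (3 - p : ℝ)))
    (h2 : 505 * C ^ 2 * K ^ 2 * (2 : ℝ) ^ (2 - p : ℝ) ≤ p * (p - 1 : ℝ) / 8 * Λ ^ (p - 1 : ℝ)) :
    SmallData p C Λ K (((p : ℝ) - 1) / 8 * (2 * Λ) ^ (-((2 - (p : ℝ)) / 2))) := by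
  have hp1 := p.2.1
  have hp2 := p.2.2
  refine ⟨hΛ, hK, rfl, ?_, ?_⟩ <;> generalize (p : ℝ) = r at *
  · have e1 : Λ ^ ((3 - r) / 2) ≤ r / (8 * (505 * C ^ 2)) := by
      have := Real.rpow_le_rpow hΛ.le h1.le (by linarith : 0 ≤ (3 - r) / 2)
      rwa [← Real.rpow_mul (by positivity), show 2 / (3 - r) * ((3 - r) / 2) = 1 by
        have : 3 - r ≠ 0 := by linarith
        field_simp, Real.rpow_one] at this
    have e2 : C ^ 2 * Λ ^ ((3 - r) / 2) ≤ 1 / 2020 := by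
      calc C ^ 2 * Λ ^ ((3 - r) / 2) ≤ C ^ 2 * (r / (8 * (505 * C ^ 2))) := mul_le_mul_of_nonneg_left e1 (by positivity)
        _ = r / 4040 := by field_simp; norm_num
        _ ≤ _ := by linarith
    have e3 : (2 : ℝ) ^ ((2 - r) / 2) ≤ 2 := by
      calc (2 : ℝ) ^ ((2 - r) / 2) ≤ 2 ^ (1 : ℝ) := Real.rpow_le_rpow_of_exponent_le (by norm_num) (by linarith)
        _ = 2 := Real.rpow_one 2
    have hm : 0 < (2 * Λ) ^ ((2 - r) / 2) := by positivity
    rw [Real.rpow_neg (by positivity), show 2 * ((r - 1) / 8 * ((2 * Λ) ^ ((2 - r) / 2))⁻¹) =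
      (r - 1) / 4 / (2 * Λ) ^ ((2 - r) / 2) by field_simp; ring, le_div_iff₀ hm]
    have e4 : C ^ 2 * √Λ * (2 * Λ) ^ ((2 - r) / 2) = C ^ 2 * Λ ^ ((3 - r) / 2) * 2 ^ ((2 - r) / 2) := by
      rw [Real.mul_rpow (by norm_num) hΛ.le, Real.sqrt_eq_rpow,
        show (3 - r) / 2 = 1 / 2 + (2 - r) / 2 by ring, Real.rpow_add hΛ]
      ring
    rw [e4]
    calc _ ≤ 1 / 2020 * (2 : ℝ) := mul_le_mul e2 e3 (by positivity) (by norm_num)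
      _ ≤ _ := by linarith
  · have e1 : ((r - 1) / 8 * (2 * Λ) ^ (-((2 - r) / 2))) ^ 2 * Λ = ((r - 1) / 8) ^ 2 * Λ ^ (r - 1) / 2 ^ (2 - r) := by
      rw [mul_pow, ← Real.rpow_mul_natCast (by positivity), Real.mul_rpow (by norm_num) hΛ.le,
        show -((2 - r) / 2) * ((2 : ℕ) : ℝ) = -(2 - r) by push_cast; ring,
        show r - 1 = -(2 - r) + 1 by ring, Real.rpow_add hΛ, Real.rpow_one, Real.rpow_neg (by norm_num : (0 : ℝ) ≤ 2)]
      ring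
    have hP : 0 < Λ ^ (r - 1) := by positivity
    have h2' : (0 : ℝ) < 2 ^ (2 - r) := by positivity
    rw [e1, lt_div_iff₀ h2']
    generalize Λ ^ (r - 1) = P at *
    generalize (2 : ℝ) ^ (2 - r) = m at *
    have h3 : 505 * (21 * C ^ 2 * K ^ 2 * m) ≤ 21 * (r * (r - 1) / 8 * P) := by linarith
    have h4 : 21 * (r / 8) < 505 * ((r - 1) / 64) := by linarith
    have h5 : 21 * (r / 8) * ((r - 1) * P) < 505 * ((r - 1) / 64) * ((r - 1) * P) :=
      mul_lt_mul_of_pos_right h4 (mul_pos (by linarith) hP)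
    linarith

theorem exists_regularSolution (hS : SobolevConst p C) (hKo : KornConst p C C₀) (h : SmallData p C Λ K κ)
    {f : ℝ → LΩ E3 (expForce p)} (hf : MemLp f ⊤ (volume.restrict (Ioi 0)))
    (hfK : ∀ᵐ t ∂volume.restrict (Ioi (0 : ℝ)), ‖f t‖ ≤ K)
    {v₀ : LΩ E3 2 × LΩ Mat3 2} (hv₀ : v₀ ∈ J1 2) (hv₀Λ : ‖v₀.2‖ ^ 2 < Λ) :
    ∃ v : ℝ → LΩ E3 2 × LΩ Mat3 2, ∀ T : ℝ, 0 < T →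
      IsRegularSolution p T f v₀.1 v ∧ ∀ t ∈ Icc 0 T, ‖(v t).2‖ ^ 2 ≤ Λ := by
  obtain ⟨a, haf, ha0⟩ := exists_approxSeq hS h hf hfK hv₀ hv₀Λ
  obtain ⟨v, hv⟩ := a.exists_limit hS h hKo
  refine ⟨v, fun T hT => ⟨?_, fun t ht => hv.bound t ht.1⟩⟩
  obtain ⟨vt, hvt⟩ := a.exists_isTimeDeriv hS h hT.le
  refine ⟨fun t ht => hv.mem t ht.1, hv.continuousOn hS h hT.le, hv.exists_hessian hS h hT.le,
    ⟨vt, hvt.memLp, hv.isWeakTimeDeriv hT.le hvt, ?_⟩, ?_⟩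
  · filter_upwards [hv.weak_form h hT.le hvt haf] with t ht W hW
    exact sub_eq_zero.1 (ht W hW)
  · have h0 : (v 0).1 = v₀.1 := tendsto_nhds_unique (hv.tendsto_fst le_rfl) ha0
    have h1 : ContinuousWithinAt (fun t => (v t).1) (Icc 0 T) 0 := hv.continuousOn_fst hT.le 0 ⟨le_rfl, hT.le⟩
    have h2 : Tendsto (fun t => (v t).1) (𝓝[>] 0) (𝓝 (v 0).1) :=
      h1.mono_left (nhdsWithin_le_of_mem (mem_of_superset (Ioo_mem_nhdsGT hT) Ioo_subset_Icc_self))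
    rw [h0] at h2
    exact tendsto_iff_norm_sub_tendsto_zero.1 h2

end Main

end

end PNavierStokes

open PNavierStokes in
theorem theorem1 (p : Set.Ico (5 / 3 : ℝ) 2) :
    ∃ CS : ℝ, 0 < CS ∧ ∀ CK : ℝ, IsKornConstant (expHess p) CK →
      ∀ Λ K : ℝ,
        Λ < min ((p / (8 * CS)) ^ (2 / (3 - p : ℝ)))
          (min (((3 : ℝ) ^ ((2 - p : ℝ) / 2) * CS * CK / 2) ^ (-(2 / (3 - p : ℝ))))
            ((CS⁻¹ * CK⁻¹ * (3 : ℝ) ^ ((p - 2 : ℝ) / 2) * (p - 1 : ℝ)) ^ (2 / (3 - p : ℝ)))) →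
        CS * K ^ 2 * (2 : ℝ) ^ (2 - p : ℝ) ≤ p * (p - 1 : ℝ) / 8 * Λ ^ (p - 1 : ℝ) →
        ∀ f : ℝ → LΩ E3 (expForce p),
          MemLp f ⊤ (volume.restrict (Ioi (0 : ℝ))) →
          (∀ᵐ t ∂volume.restrict (Ioi (0 : ℝ)), ‖f t‖ ≤ K) →
          ∀ v₀ ∈ J1 2, ‖v₀.2‖ ^ 2 < Λ →
            ∃ v : ℝ → LΩ E3 2 × LΩ Mat3 2, ∀ T : ℝ, 0 < T →
              IsRegularSolution p T f v₀.1 v ∧ ∀ t ∈ Icc 0 T, ‖(v t).2‖ ^ 2 ≤ Λ := by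
  obtain ⟨C, hS⟩ := exists_sobolevConst p
  by_cases hex : ∃ C₀, IsKornConstant (expHess p) C₀
  · obtain ⟨C₀, hC₀⟩ := hex
    have hC := hS.one_le
    have hle : C ≤ C * (1 + C₀) := le_mul_of_one_le_right (by linarith) (by linarith [hC₀.1])
    have hC' : 1 ≤ C * (1 + C₀) := hC.trans hle
    refine ⟨505 * (C * (1 + C₀)) ^ 2, by positivity, fun CK _ Λ K h1 h2 f hf hfK v₀ hv₀ hv₀Λ => ?_⟩
    have hΛ : 0 < Λ := (sq_nonneg _).trans_lt hv₀Λ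
    have hK : 0 ≤ K := by
      have : NeBot (ae (volume.restrict (Ioi (0 : ℝ)))) := ae_neBot.2 (by simp)
      obtain ⟨t, ht⟩ := hfK.exists
      exact (norm_nonneg _).trans ht
    exact exists_regularSolution (hS.mono hle) (kornConst_of_isKornConstant hS hC₀)
      (smallData_of_lt hC' hΛ hK (h1.trans_le (min_le_left _ _)) h2) hf hfK hv₀ hv₀Λ
  · exact ⟨1, one_pos, fun CK hCK => absurd ⟨CK, hCK⟩ hex⟩
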